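/- Let $G$ be a finitely generated torsion-free nilpotent group of class $2$ with $Z(G)=G'$, $G/G'\cong\mathbb Z^{2r}$ and $G'\cong\mathbb Z^{3}$. Let $x_1,\dots,x_{2r}\in G$ map to a basis of $G/G'$, let $y_1,y_2,y_3$ be a basis of $G'$, and write (additively in the $y_k$) $[x_i,x_j]=M(\mathbf y)_{ij}$, where $M(\mathbf y)$ is an antisymmetric $(2r\times 2r)$-matrix of $\mathbb Z$-linear forms in $\mathbf y=(y_1,y_2,y_3)$. Assume that $\sqrt{\det M(\mathbf y)}\in\mathbb Z[\mathbf y]$ is non-zero and square-free over $\mathbb Q$, that the irreducible components $E_1,\dots,E_l$ of the plane curve $\mathcal P_G=(\sqrt{\det M(\mathbf y)}=0)\subset\mathbb P^2$ over $\mathbb Q$ all have degree $>1$, and that all singular points of $\mathcal P_G$ (over $\overline{\mathbb Q}$) are rational ordinary double points with rational tangent slopes. For a prime $p$ let $c_{p,i}$ be the number of $\mathbb F_p$-points of the non-singular projective curve birationally equivalent to the reduction of $E_i$ modulo $p$, and for $j=1,2$ let $n_p^{(j)}$ be the number of $\mathbb F_p$-rational ordinary double points $\alpha$ of the reduction of $\mathcal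 P_G$ modulo $p$ with $\operatorname{rk} M(\alpha)=2(r-j)$. Let $\zeta^{\triangleleft}_{G,p}(s)=\sum_{n\ge 0}a^{\triangleleft}_{p^n}p^{-ns}$, where $a^\triangleleft_{k}$ is the number of normal subgroups of index $k$ in $G$. Put $$W_1(X,Y)=\frac{1+X^{2r}Y^{2r+1}+X^{2r+1}Y^{2r+1}+X^{4r}Y^{2r+2}+X^{4r+1}Y^{2r+2}+X^{6r+1}Y^{4r+3}}{(1-X^{4r+2}Y^{2r+2})(1-X^{2r+2}Y^{2r+1})},$$ $$W_2(X,Y)=\frac{(1-Y^2)X^{2r}Y^{2r-1}(1+X^{4r+1}Y^{2r+2})}{(1-X^{2r+1}Y^{2r-1})(1-X^{2r+2}Y^{2r+1})(1-X^{4r+2}Y^{2r+2})},$$ $$W_3(X,Y)=-\frac{(1-Y^2)X^{2r}Y^{2r-1}(1-X^{2r+2}Y^{2r-1})(1+X^{4r+1}Y^{2r+2})}{(1-X^{2r+1}Y^{2r-1})^2(1-X^{2r+2}Y^{2r+1})(1-X^{4r+2}Y^{2r+2})},$$ $$W_4(X,Y)=\frac{(1-Y^2)^2X^{2r}Y^{2r-3}(1+X^{2r+1}Y^{2r-1})(1+X^{4r+1}Y^{2r+2})}{(1-X^{2r+2}Y^{2r+1})(1-X^{2r}Y^{2r-3})(1-X^{2r+1}Y^{2r-1})(1-X^{4r+2}Y^{2r+2})},$$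 $$Z(X,Y;\mathbf c,n_1,n_2)=\frac{W_1(X,Y)+\bigl(\sum_{i=1}^l c_i\bigr)W_2(X,Y)+n_1W_3(X,Y)+n_2W_4(X,Y)}{(1-X^{6r}Y^{2r+3})\prod_{i=0}^{2r-1}(1-X^iY)}.$$ Then for all but finitely many primes $p$ the following holds. The series $\zeta^{\triangleleft}_{G,p}(s)$ converges in some right half-plane, where $$\zeta^{\triangleleft}_{G,p}(s)=Z\bigl(p,p^{-s};(c_{p,i})_i,n_p^{(1)},n_p^{(2)}\bigr).$$ Moreover, suppose that for each $i$ there are an integer $B^{(i)}\ge 0$ and non-zero complex numbers $\beta_{i,1},\dots,\beta_{i,B^{(i)}}$ with $c_{p,i}=1+p-\sum_{j}\beta_{i,j}$ such that the families $(p/\beta_{i,j})_j$ and $(\beta_{i,k})_k$ agree up to a permutation of the indices. Set $c_{p^{-1},i}:=1+p^{-1}-\sum_j\beta_{i,j}^{-1}$ and $n^{(j)}_{p^{-1}}:=n^{(j)}_p$. Then $c_{p^{-1},i}=p^{-1}c_{p,i}$, and with $$\zeta^{\triangleleft}_{G,p}(s)\big|_{p\to p^{-1}}:=Z\bigl(p^{-1},p^{s};(c_{p^{-1},i})_i,n_{p^{-1}}^{(1)},n_{p^{-1}}^{(2)}\bigr)$$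 the functional equation $$\zeta^{\triangleleft}_{G,p}(s)\big|_{p\to p^{-1}}=-p^{\binom{2r+3}{2}-(4r+3)s}\,\zeta^{\triangleleft}_{G,p}(s)$$ holds, where $\zeta^{\triangleleft}_{G,p}(s)$ on the right denotes the meromorphic continuation $Z(p,p^{-s};(c_{p,i})_i,n_p^{(1)},n_p^{(2)})$. -/

import Mathlib

open scoped LinearAlgebra.Projectivization

noncomputable section

namespace PfaffianZeta

/-! ### Groups and their local normal zeta functions -/

/-- A finitely generated torsion-free nilpotent group of nilpotency class `2`. -/
def IsT2Group (G : Type*) [Group G] : Prop :=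
  Group.FG G ∧ (∀ g : G, IsOfFinOrder g → g = 1) ∧
    ∃ _ : Group.IsNilpotent G, Group.nilpotencyClass G = 2

/-- The number of normal subgroups of index `n` (used for `n ≥ 1` only). -/
def normalSubgroupCount (G : Type*) [Group G] (n : ℕ) : ℕ :=
  Nat.card {N : Subgroup G // N.Normal ∧ N.index = n}

/-- The general term `a_{p^n} p^{-ns}` of the local normal zeta function at `p`. -/
def localNormalZetaTerm (G : Type*) [Group G] (p : ℕ) (s : ℂ) (n : ℕ) : ℂ :=
  (normalSubgroupCount G (p ^ n) : ℂ) * (p : ℂ) ^ (-(n : ℂ) * s)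

/-- The local normal zeta function at `p`, as the sum of its defining series. -/
def localNormalZeta (G : Type*) [Group G] (p : ℕ) (s : ℂ) : ℂ :=
  ∑' n : ℕ, localNormalZetaTerm G p s n

/-! ### The matrix of commutators -/

/-- The matrix `M(v) = v₁ m₁ + v₂ m₂ + v₃ m₃` of linear forms with integral coefficients,
evaluated at a vector `v` over an arbitrary commutative ring. -/
def commMatrix {n : ℕ} (m : Fin 3 → Matrix (Fin n) (Fin n) ℤ) {R : Type*} [CommRing R]
    (v : Fin 3 → R) : Matrix (Fin n) (Fin n) R :=
  fun i j => ∑ k, (m k i j : R) * v k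

/-- The generic matrix `M(y)`, with entries in `ℤ[y₁, y₂, y₃]`. -/
def genericCommMatrix {n : ℕ} (m : Fin 3 → Matrix (Fin n) (Fin n) ℤ) :
    Matrix (Fin n) (Fin n) (MvPolynomial (Fin 3) ℤ) :=
  commMatrix m MvPolynomial.X

/-- Change of coefficients of an integral polynomial: its extension to a field of
characteristic zero, or its reduction modulo `p`. -/
def baseChange (F : Type*) [CommRing F] (f : MvPolynomial (Fin 3) ℤ) : MvPolynomial (Fin 3) F :=
  MvPolynomial.map (Int.castRingHom F) f

/-! ### Singularities of plane projective curves -/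

/-- `v` (homogeneous coordinates, `v ≠ 0`) is a singular point of the plane curve `f = 0`. -/
def IsSingularAt {F : Type*} [Field F] (f : MvPolynomial (Fin 3) F) (v : Fin 3 → F) : Prop :=
  v ≠ 0 ∧ MvPolynomial.eval v f = 0 ∧ ∀ i, MvPolynomial.eval v (MvPolynomial.pderiv i f) = 0

/-- The Hessian matrix of the homogeneous equation `f` at `v`. -/
def hessian {F : Type*} [Field F] (f : MvPolynomial (Fin 3) F) (v : Fin 3 → F) :
    Matrix (Fin 3) (Fin 3) F :=
  fun i j => MvPolynomial.eval v (MvPolynomial.pderiv i (MvPolynomial.pderiv j f))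

/-- `v` is an ordinary double point of `f = 0` (characteristic different from `2`). At a singular
point, `v` itself lies in the radical of the Hessian form by Euler's relation, and the form induced
on `F³ / ⟨v⟩`, the tangent space of the plane up to a twist, is twice the quadratic term of a local
equation; it is non-degenerate, that is, the two tangent lines are distinct, iff the Hessian has
rank `2`. -/
def IsODP {F : Type*} [Field F] (f : MvPolynomial (Fin 3) F) (v : Fin 3 → F) : Prop :=
  IsSingularAt f v ∧ (hessian f v).rank = 2

/-- The tangent lines `a = 0` and `b = 0` of `f = 0` at the double point `v` are defined
over `F`. -/
def HasRationalSlopes {F : Type*} [Field F] (f : MvPolynomial (Fin 3) F) (v : Fin 3 → F) : Prop :=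
  ∃ a b : Fin 3 → F, ∀ w : Fin 3 → F,
    dotProduct w ((hessian f v).mulVec w) = dotProduct a w * dotProduct b w

/-- All singular points (over an algebraic closure) of the plane curve `f = 0` over `ℚ` are
rational, and they are ordinary double points with rational slopes. -/
def HasOnlyRationalODPs (f : MvPolynomial (Fin 3) ℤ) : Prop :=
  ∀ v : Fin 3 → AlgebraicClosure ℚ, IsSingularAt (baseChange (AlgebraicClosure ℚ) f) v →
    ∃ (c : AlgebraicClosure ℚ) (w : Fin 3 → ℚ),
      v = (fun i => c * algebraMap ℚ (AlgebraicClosure ℚ) (w i)) ∧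
      IsODP (baseChange ℚ f) w ∧ HasRationalSlopes (baseChange ℚ f) w

/-- The number of `F`-rational ordinary double points of the curve `f = 0` at which `M` has
rank deficit `2 * j`. -/
def odpCount {n : ℕ} (m : Fin 3 → Matrix (Fin n) (Fin n) ℤ) (F : Type*) [Field F]
    (f : MvPolynomial (Fin 3) F) (j : ℕ) : ℕ :=
  Nat.card {α : ℙ F (Fin 3 → F) // IsODP f α.rep ∧ (commMatrix m α.rep).rank + 2 * j = n}

/-! ### Points of the non-singular model of a plane curve -/

/-- The homogeneous coordinate ring of the plane curve `g = 0`. -/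
abbrev CoordRing {F : Type*} [Field F] (g : MvPolynomial (Fin 3) F) : Type _ :=
  MvPolynomial (Fin 3) F ⧸ Ideal.span {g}

/-- The function field of the integral plane curve `g = 0`: the field generated over `F` by the
quotients of the homogeneous coordinate functions. -/
abbrev FunctionField {F : Type*} [Field F] (g : MvPolynomial (Fin 3) F)
    [(Ideal.span {g}).IsPrime] : IntermediateField F (FractionRing (CoordRing g)) :=
  IntermediateField.adjoin F
    {q | ∃ i j : Fin 3, q =
      algebraMap (CoordRing g) (FractionRing (CoordRing g))
        (Ideal.Quotient.mk (Ideal.span {g}) (MvPolynomial.X i)) /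
      algebraMap (CoordRing g) (FractionRing (CoordRing g))
        (Ideal.Quotient.mk (Ideal.span {g}) (MvPolynomial.X j))}

/-- The `F`-rational points of the non-singular projective curve with the same function field as
the integral plane curve `g = 0`: the non-trivial valuation rings of the function field over `F`
with residue field `F`. -/
def ModelPoint {F : Type*} [Field F] (g : MvPolynomial (Fin 3) F)
    [(Ideal.span {g}).IsPrime] : Type _ :=
  {V : ValuationSubring (FunctionField g) //
    V ≠ ⊤ ∧ (∀ a : F, algebraMap F (FunctionField g) a ∈ V) ∧
    ∀ x ∈ V, ∃ a : F, V.valuation (x - algebraMap F (FunctionField g) a) < 1}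

open Classical in
/-- The number of `F`-rational points of the non-singular projective model of `g = 0`
(and `0` if `g = 0` is not an integral curve). -/
def modelPointCount {F : Type*} [Field F] (g : MvPolynomial (Fin 3) F) : ℕ :=
  if _h : (Ideal.span {g}).IsPrime then Nat.card (ModelPoint g) else 0

/-! ### The numbers attached to a prime -/

/-- The number `c_p` of points over `𝔽_p` of the non-singular model of the curve `g = 0`. -/
def modelCountAt (p : ℕ) [Fact p.Prime] (g : MvPolynomial (Fin 3) ℤ) : ℕ :=
  modelPointCount (baseChange (ZMod p) g)

/-- The number `n_p^{(j)}` of `𝔽_p`-rational ordinary double points of rank deficit `2 * j` of the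
reduction of the curve `f = 0` modulo `p`. -/
def odpCountAt {n : ℕ} (m : Fin 3 → Matrix (Fin n) (Fin n) ℤ) (p : ℕ) [Fact p.Prime]
    (f : MvPolynomial (Fin 3) ℤ) (j : ℕ) : ℕ :=
  odpCount m (ZMod p) (baseChange (ZMod p) f) j

/-- The number `c_{p⁻¹} = 1 + p⁻¹ - ∑ β_j⁻¹`. -/
def invertedCount (p : ℕ) {B : ℕ} (β : Fin B → ℂ) : ℂ :=
  1 + (p : ℂ)⁻¹ - ∑ j, (β j)⁻¹

/-! ### The explicit expression for the local normal zeta functions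

Below, `X` stands for `p` and `Y` for `p^{-s}`. The expressions are used for `r ≥ 2`, where no
subtraction of natural numbers is truncated. -/

def W1 (r : ℕ) (X Y : ℂ) : ℂ :=
  (1 + X ^ (2 * r) * Y ^ (2 * r + 1) + X ^ (2 * r + 1) * Y ^ (2 * r + 1)
      + X ^ (4 * r) * Y ^ (2 * r + 2) + X ^ (4 * r + 1) * Y ^ (2 * r + 2)
      + X ^ (6 * r + 1) * Y ^ (4 * r + 3)) /
    ((1 - X ^ (4 * r + 2) * Y ^ (2 * r + 2)) * (1 - X ^ (2 * r + 2) * Y ^ (2 * r + 1)))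

def W2 (r : ℕ) (X Y : ℂ) : ℂ :=
  ((1 - Y) * (1 + Y) * X ^ (2 * r) * Y ^ (2 * r - 1) * (1 + X ^ (4 * r + 1) * Y ^ (2 * r + 2))) /
    ((1 - X ^ (2 * r + 1) * Y ^ (2 * r - 1)) * (1 - X ^ (2 * r + 2) * Y ^ (2 * r + 1)) *
      (1 - X ^ (4 * r + 2) * Y ^ (2 * r + 2)))

/-- The contribution of an ordinary double point of rank deficit `2`. -/
def W3 (r : ℕ) (X Y : ℂ) : ℂ :=
  -((1 - Y) * (1 + Y) * X ^ (2 * r) * Y ^ (2 * r - 1) * (1 - X ^ (2 * r + 2) * Y ^ (2 * r - 1)) *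
      (1 + X ^ (4 * r + 1) * Y ^ (2 * r + 2))) /
    ((1 - X ^ (2 * r + 1) * Y ^ (2 * r - 1)) ^ 2 * (1 - X ^ (2 * r + 2) * Y ^ (2 * r + 1)) *
      (1 - X ^ (4 * r + 2) * Y ^ (2 * r + 2)))

/-- The contribution of an ordinary double point of rank deficit `4`. -/
def W4 (r : ℕ) (X Y : ℂ) : ℂ :=
  ((1 - Y) ^ 2 * (1 + Y) ^ 2 * X ^ (2 * r) * Y ^ (2 * r - 3) *
      (1 + X ^ (2 * r + 1) * Y ^ (2 * r - 1)) * (1 + X ^ (4 * r + 1) * Y ^ (2 * r + 2))) /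
    ((1 - X ^ (2 * r + 2) * Y ^ (2 * r + 1)) * (1 - X ^ (2 * r) * Y ^ (2 * r - 3)) *
      (1 - X ^ (2 * r + 1) * Y ^ (2 * r - 1)) * (1 - X ^ (4 * r + 2) * Y ^ (2 * r + 2)))

/-- The rational expression in `X`, `Y`, the numbers `c i` and the numbers `n₁, n₂`:
the zeta function `∏_{i < 2r} (1 - X^i Y)⁻¹` of `ℤ_p^{2r}`, times the local Riemann zeta
factor `(1 - X^{6r} Y^{2r+3})⁻¹`, times `W₁ + (∑ c i) W₂ + n₁ W₃ + n₂ W₄`. -/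
def zetaExpr (r : ℕ) {l : ℕ} (X Y : ℂ) (c : Fin l → ℂ) (n₁ n₂ : ℂ) : ℂ :=
  (∏ i ∈ Finset.range (2 * r), (1 - X ^ i * Y)⁻¹) * (1 - X ^ (6 * r) * Y ^ (2 * r + 3))⁻¹ *
    (W1 r X Y + (∑ i, c i) * W2 r X Y + n₁ * W3 r X Y + n₂ * W4 r X Y)

end PfaffianZeta

end

open scoped LinearAlgebra.Projectivization

noncomputable section

namespace PfaffianZeta

open Finset (sum_congr mul_sum sum_mul sum_add_distrib mem_univ sum_eq_single sum_comm
  prod_ne_zero_iff sum_const dvd_sum sum_const_zero sum_sub_distrib prod_pow_eq_pow_sum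
  dvd_prod_of_mem mem_image_of_mem sum_insert prod_congr prod_mul_distrib)
open Matrix (fromBlocks mulVec mulVec_mulVec transpose_mul det_mul det_transpose
  det_fromBlocks_zero₂₁ det_fromBlocks_zero₁₂ det_smul nonsing_inv_mul mul_nonsing_inv
  det_fin_three one_mulVec mulVec_zero det_one transpose_transpose transpose_submatrix
  submatrix_neg fromBlocks_toBlocks transpose_smul submatrix_map fromBlocks_map mulVec_smul
  transpose_map fromBlocks_mulVec fromBlocks_transpose fromBlocks_neg fromBlocks_inj
  rank_le_card_width submatrix_mulVec_equiv mulVec_sub submatrix_smul fromBlocks_smul)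
open PadicInt (toZMod toZModPow)

local notation "ℳ" => MvPolynomial (Fin 3)
local notation "ℚᵃ" => AlgebraicClosure ℚ

section

/-! ### The functional equation of the rational expression -/

lemma inv_one_sub_inv (t : ℂ) (ht : t ≠ 0) : (1 - t⁻¹)⁻¹ = -t * (1 - t)⁻¹ := by
  have : 1 - t⁻¹ = -(t⁻¹ * (1 - t)) := by field_simp; ring
  rw [this, inv_neg, mul_inv, inv_inv]; ring

lemma inv_one_sub_monomial (X Y : ℂ) (hX : X ≠ 0) (hY : Y ≠ 0) (a b : ℕ) :
    (1 - X⁻¹ ^ a * Y⁻¹ ^ b)⁻¹ = -(X ^ a * Y ^ b) * (1 - X ^ a * Y ^ b)⁻¹ := by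
  rw [← inv_one_sub_inv _ (mul_ne_zero (pow_ne_zero _ hX) (pow_ne_zero _ hY))]
  simp only [mul_inv, inv_pow]

lemma W1_inv (r : ℕ) (X Y : ℂ) (hX : X ≠ 0) (hY : Y ≠ 0) :
    W1 r X⁻¹ Y⁻¹ = X ^ 3 * W1 r X Y := by
  unfold W1
  simp only [div_eq_mul_inv, mul_inv, inv_one_sub_monomial X Y hX hY]
  generalize (1 - X ^ (4 * r + 2) * Y ^ (2 * r + 2))⁻¹ = d₁
  generalize (1 - X ^ (2 * r + 2) * Y ^ (2 * r + 1))⁻¹ = d₂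
  simp only [pow_add, show 6 * r = 2 * r + 2 * r + 2 * r by ring,
    show 4 * r = 2 * r + 2 * r by ring, inv_pow]
  have h1 : X ^ (2 * r) ≠ 0 := pow_ne_zero _ hX
  have h2 : Y ^ (2 * r) ≠ 0 := pow_ne_zero _ hY
  generalize X ^ (2 * r) = a at *
  generalize Y ^ (2 * r) = b at *
  field_simp
  ring

lemma W2_inv (k : ℕ) (X Y : ℂ) (hX : X ≠ 0) (hY : Y ≠ 0) :
    W2 (k + 2) X⁻¹ Y⁻¹ = X ^ 4 * W2 (k + 2) X Y := by
  unfold W2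
  rw [show 2 * (k + 2) - 1 = 2 * k + 3 by omega]
  simp only [div_eq_mul_inv, mul_inv, inv_one_sub_monomial X Y hX hY]
  generalize (1 - X ^ (4 * (k + 2) + 2) * Y ^ (2 * (k + 2) + 2))⁻¹ = d₁
  generalize (1 - X ^ (2 * (k + 2) + 2) * Y ^ (2 * (k + 2) + 1))⁻¹ = d₂
  generalize (1 - X ^ (2 * (k + 2) + 1) * Y ^ (2 * k + 3))⁻¹ = d₃
  simp only [mul_add, pow_add,
    show 4 * k = 2 * k + 2 * k by ring, inv_pow]
  have h1 : X ^ (2 * k) ≠ 0 := pow_ne_zero _ hX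
  have h2 : Y ^ (2 * k) ≠ 0 := pow_ne_zero _ hY
  generalize X ^ (2 * k) = a at *
  generalize Y ^ (2 * k) = b at *
  field_simp
  ring

lemma W3_inv (k : ℕ) (X Y : ℂ) (hX : X ≠ 0) (hY : Y ≠ 0) :
    W3 (k + 2) X⁻¹ Y⁻¹ = X ^ 3 * W3 (k + 2) X Y := by
  unfold W3
  rw [show 2 * (k + 2) - 1 = 2 * k + 3 by omega]
  simp only [div_eq_mul_inv, mul_inv, inv_one_sub_monomial X Y hX hY]
  generalize (1 - X ^ (4 * (k + 2) + 2) * Y ^ (2 * (k + 2) + 2))⁻¹ = d₁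
  generalize (1 - X ^ (2 * (k + 2) + 2) * Y ^ (2 * (k + 2) + 1))⁻¹ = d₂
  generalize (1 - X ^ (2 * (k + 2) + 1) * Y ^ (2 * k + 3))⁻¹ = d₃
  simp only [mul_add, pow_add,
    show 4 * k = 2 * k + 2 * k by ring, inv_pow]
  have h1 : X ^ (2 * k) ≠ 0 := pow_ne_zero _ hX
  have h2 : Y ^ (2 * k) ≠ 0 := pow_ne_zero _ hY
  generalize X ^ (2 * k) = a at *
  generalize Y ^ (2 * k) = b at *
  field_simp
  ring

lemma W4_inv (k : ℕ) (X Y : ℂ) (hX : X ≠ 0) (hY : Y ≠ 0) :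
    W4 (k + 2) X⁻¹ Y⁻¹ = X ^ 3 * W4 (k + 2) X Y := by
  unfold W4
  rw [show 2 * (k + 2) - 1 = 2 * k + 3 by omega, show 2 * (k + 2) - 3 = 2 * k + 1 by omega]
  simp only [div_eq_mul_inv, mul_inv, inv_one_sub_monomial X Y hX hY]
  generalize (1 - X ^ (4 * (k + 2) + 2) * Y ^ (2 * (k + 2) + 2))⁻¹ = d₁
  generalize (1 - X ^ (2 * (k + 2) + 2) * Y ^ (2 * (k + 2) + 1))⁻¹ = d₂
  generalize (1 - X ^ (2 * (k + 2) + 1) * Y ^ (2 * k + 3))⁻¹ = d₃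
  generalize (1 - X ^ (2 * (k + 2)) * Y ^ (2 * k + 1))⁻¹ = d₄
  simp only [mul_add, pow_add,
    show 4 * k = 2 * k + 2 * k by ring, inv_pow]
  have h1 : X ^ (2 * k) ≠ 0 := pow_ne_zero _ hX
  have h2 : Y ^ (2 * k) ≠ 0 := pow_ne_zero _ hY
  generalize X ^ (2 * k) = a at *
  generalize Y ^ (2 * k) = b at *
  field_simp
  ring

lemma prod_inv_one_sub_inv (n : ℕ) (X Y : ℂ) (hX : X ≠ 0) (hY : Y ≠ 0) :
    ∏ i ∈ Finset.range n, (1 - X⁻¹ ^ i * Y⁻¹)⁻¹ =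
      (-1) ^ n * X ^ (n.choose 2) * Y ^ n * ∏ i ∈ Finset.range n, (1 - X ^ i * Y)⁻¹ := by
  induction n with
  | zero => simp
  | succ n ih =>
    have h := inv_one_sub_monomial X Y hX hY n 1
    simp only [pow_one] at h
    rw [Finset.prod_range_succ, Finset.prod_range_succ, ih, h,
      Nat.choose_succ_succ' n 1, Nat.choose_one_right, pow_add X]
    ring

theorem zetaExpr_inv (r : ℕ) (hr : 2 ≤ r) {l : ℕ} (X Y : ℂ) (hX : X ≠ 0) (hY : Y ≠ 0)
    (c c' : Fin l → ℂ) (hc : ∀ i, c' i = X⁻¹ * c i) (n₁ n₂ : ℂ) :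
    zetaExpr r X⁻¹ Y⁻¹ c' n₁ n₂ =
      -(X ^ ((2 * r + 3).choose 2) * Y ^ (4 * r + 3)) * zetaExpr r X Y c n₁ n₂ := by
  obtain ⟨k, rfl⟩ := Nat.exists_eq_add_of_le' hr
  unfold zetaExpr
  rw [W1_inv _ X Y hX hY, W2_inv _ X Y hX hY, W3_inv _ X Y hX hY, W4_inv _ X Y hX hY,
    prod_inv_one_sub_inv _ X Y hX hY, inv_one_sub_monomial X Y hX hY,
    sum_congr rfl fun i _ => hc i, ← mul_sum]
  have h1 : (2 * (k + 2) + 3).choose 2 = (2 * (k + 2)).choose 2 + 6 * (k + 2) + 3 := by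
    simp only [Nat.choose_succ_succ' _ 1, Nat.choose_one_right]
    ring
  have h2 : ((-1 : ℂ)) ^ (2 * (k + 2)) = 1 := by simp
  rw [h1, h2, pow_add X, pow_add X, show 4 * (k + 2) + 3 = 2 * (k + 2) + (2 * (k + 2) + 3) by ring,
    pow_add Y (2 * (k + 2)) (2 * (k + 2) + 3)]
  generalize ∏ i ∈ Finset.range (2 * (k + 2)), (1 - X ^ i * Y)⁻¹ = d₁
  generalize (1 - X ^ (6 * (k + 2)) * Y ^ (2 * (k + 2) + 3))⁻¹ = d₂
  field_simp

end

section

/-! ### Generating functions of linearly recurrent sequences -/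

lemma hasSum_of_recurrence {a b : ℕ → ℂ} {α x B : ℂ} (k : ℕ)
    (hrec : ∀ n, a (n + k) = α * a n + b n) (hα : ‖α * x ^ k‖ < 1)
    (hb : HasSum (fun n => b n * x ^ n) B) :
    HasSum (fun n => a n * x ^ n)
      ((∑ n ∈ Finset.range k, a n * x ^ n + x ^ k * B) / (1 - α * x ^ k)) := by
  have hbs : Summable fun n => ‖b n * x ^ n‖ := hb.summable.norm
  have key : ∀ n, a (n + k) * x ^ (n + k) = α * x ^ k * (a n * x ^ n) + x ^ k * (b n * x ^ n) := by
    intro n; rw [hrec, pow_add]; ring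
  have hs : Summable fun n => a n * x ^ n := by
    refine Summable.of_norm ?_
    set K := ∑ n ∈ Finset.range k, ‖a n * x ^ n‖ with hK
    set β := ∑' n, ‖b n * x ^ n‖
    refine summable_of_sum_range_le (c := (K + ‖x ^ k‖ * β) / (1 - ‖α * x ^ k‖))
      (fun _ => norm_nonneg _) fun n => ?_
    rw [le_div_iff₀ (by linarith)]
    have h1 : ∑ i ∈ Finset.range n, ‖a i * x ^ i‖ ≤ ∑ i ∈ Finset.range (k + n), ‖a i * x ^ i‖ :=
      Finset.sum_le_sum_of_subset_of_nonneg (Finset.range_mono (by omega))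
        fun _ _ _ => norm_nonneg _
    have h2 : ∑ i ∈ Finset.range n, ‖a (k + i) * x ^ (k + i)‖ ≤
        ‖α * x ^ k‖ * ∑ i ∈ Finset.range n, ‖a i * x ^ i‖ + ‖x ^ k‖ * β := by
      calc ∑ i ∈ Finset.range n, ‖a (k + i) * x ^ (k + i)‖
          ≤ ∑ i ∈ Finset.range n,
            (‖α * x ^ k‖ * ‖a i * x ^ i‖ + ‖x ^ k‖ * ‖b i * x ^ i‖) := by
            refine Finset.sum_le_sum fun i _ => ?_
            rw [add_comm k i, key, ← norm_mul, ← norm_mul]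
            exact norm_add_le _ _
        _ ≤ _ := by
            rw [sum_add_distrib, ← mul_sum, ← mul_sum]
            gcongr
            exact hbs.sum_le_tsum _ fun _ _ => norm_nonneg _
    rw [Finset.sum_range_add] at h1
    linarith
  have h1 : (1 - α * x ^ k) ≠ 0 := by
    intro h
    rw [← sub_eq_zero.1 h, norm_one] at hα
    exact lt_irrefl _ hα
  have h2 := hs.sum_add_tsum_nat_add k
  simp only [key] at h2
  rw [Summable.tsum_add (hs.mul_left _) (hb.summable.mul_left _), tsum_mul_left, tsum_mul_left,
    hb.tsum_eq] at h2
  have h3 : ∑' n, a n * x ^ n =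
      (∑ n ∈ Finset.range k, a n * x ^ n + x ^ k * B) / (1 - α * x ^ k) := by
    rw [eq_div_iff h1]; linear_combination h2.symm
  rw [← h3]
  exact hs.hasSum

lemma hasSum_geom {z : ℂ} (hz : ‖z‖ < 1) : HasSum (fun n : ℕ => z ^ n) (1 - z)⁻¹ :=
  hasSum_geometric_of_norm_lt_one hz

lemma one_sub_ne_zero_of_norm_lt_one {z : ℂ} (hz : ‖z‖ < 1) : 1 - z ≠ 0 := by
  intro h
  rw [← sub_eq_zero.1 h, norm_one] at hz
  exact lt_irrefl _ hz

/-- The weighted number of lifts of a smooth point, in the transversal direction. -/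
def smoothSeq (p Q : ℂ) : ℕ → ℂ
  | 0 => Q
  | n + 1 => Q * ((p - 1) * p ^ n + smoothSeq p Q n)

/-- The weighted number of lifts of a double point of rank deficit two. -/
def nodeSeq (p Q : ℂ) : ℕ → ℂ
  | 0 => Q
  | 1 => Q ^ 2 * p ^ 2
  | n + 2 => Q ^ 2 * p ^ 2 *
      ((p - 1) ^ 2 * p ^ (2 * n) + 2 * (p - 1) * p ^ n * smoothSeq p Q n + nodeSeq p Q n)

/-- The weighted number of lifts of a double point of rank deficit four. -/
def degenerateNodeSeq (p Q : ℂ) : ℕ → ℂ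
  | 0 => Q ^ 2
  | n + 1 => Q ^ 2 * ((p - 1) ^ 2 * p ^ (2 * n) + 2 * (p - 1) * p ^ n * smoothSeq p Q n +
      degenerateNodeSeq p Q n)

section
variable {p Q U : ℂ}

lemma hasSum_smoothSeq {x : ℂ} (h1 : ‖p * x‖ < 1) (h2 : ‖Q * x‖ < 1) :
    HasSum (fun n => smoothSeq p Q n * x ^ n)
      ((Q + x * (Q * (p - 1) * (1 - p * x)⁻¹)) / (1 - Q * x)) := by
  have := hasSum_of_recurrence (a := smoothSeq p Q) (b := fun n => Q * (p - 1) * p ^ n) (α := Q)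
    (x := x) (B := Q * (p - 1) * (1 - p * x)⁻¹) 1
    (fun n => by rw [smoothSeq]; ring) (by simpa using h2) ?_
  · simpa [smoothSeq] using this
  · simp only [mul_assoc, ← mul_pow]
    simp only [← mul_assoc]
    exact (hasSum_geom h1).mul_left _

/-- The generating function of `p ^ n * smoothSeq p Q n`. -/
def smoothSum (p Q U : ℂ) : ℂ :=
  (Q + (p * U) * (Q * (p - 1) * (1 - p ^ 2 * U)⁻¹)) / (1 - Q * (p * U))

lemma hasSum_pow_mul_smoothSeq (h1 : ‖p ^ 2 * U‖ < 1) (h2 : ‖Q * (p * U)‖ < 1) :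
    HasSum (fun n => p ^ n * smoothSeq p Q n * U ^ n) (smoothSum p Q U) := by
  have := hasSum_smoothSeq (p := p) (Q := Q) (x := p * U)
    (by rwa [← mul_assoc, ← sq]) h2
  rw [← mul_assoc p p, ← sq] at this
  exact this.congr_fun fun n => by rw [mul_pow]; ring

lemma hasSum_branches (h1 : ‖p ^ 2 * U‖ < 1) (h2 : ‖Q * (p * U)‖ < 1) :
    HasSum (fun n => ((p - 1) ^ 2 * p ^ (2 * n) + 2 * (p - 1) * p ^ n * smoothSeq p Q n) * U ^ n)
      ((p - 1) ^ 2 * (1 - p ^ 2 * U)⁻¹ + 2 * (p - 1) * smoothSum p Q U) := by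
  exact (((hasSum_geom h1).mul_left ((p - 1) ^ 2)).add
    ((hasSum_pow_mul_smoothSeq h1 h2).mul_left (2 * (p - 1)))).congr_fun
      fun n => by rw [mul_pow, ← pow_mul]; ring

lemma hasSum_nodeSeq (h1 : ‖p ^ 2 * U‖ < 1) (h2 : ‖Q * (p * U)‖ < 1) :
    HasSum (fun n => nodeSeq p Q n * U ^ n)
      ((Q + Q ^ 2 * p ^ 2 * U + U ^ 2 * (Q ^ 2 * p ^ 2 *
        ((p - 1) ^ 2 * (1 - p ^ 2 * U)⁻¹ + 2 * (p - 1) * smoothSum p Q U))) /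
        (1 - Q ^ 2 * p ^ 2 * U ^ 2)) := by
  have := hasSum_of_recurrence (a := nodeSeq p Q) (α := Q ^ 2 * p ^ 2) (x := U)
    (b := fun n => Q ^ 2 * p ^ 2 *
      ((p - 1) ^ 2 * p ^ (2 * n) + 2 * (p - 1) * p ^ n * smoothSeq p Q n)) 2
    (fun n => by rw [nodeSeq]; ring) ?_ ((hasSum_branches h1 h2).mul_left (Q ^ 2 * p ^ 2) |>.congr_fun
      (fun n => mul_assoc _ _ _))
  · simpa [nodeSeq, Finset.sum_range_succ] using this
  · rw [show Q ^ 2 * p ^ 2 * U ^ 2 = (Q * (p * U)) ^ 2 by ring, norm_pow]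
    exact pow_lt_one₀ (norm_nonneg _) h2 (by norm_num)

lemma hasSum_degenerateNodeSeq (h1 : ‖p ^ 2 * U‖ < 1) (h2 : ‖Q * (p * U)‖ < 1)
    (h3 : ‖Q ^ 2 * U‖ < 1) :
    HasSum (fun n => degenerateNodeSeq p Q n * U ^ n)
      ((Q ^ 2 + U * (Q ^ 2 *
        ((p - 1) ^ 2 * (1 - p ^ 2 * U)⁻¹ + 2 * (p - 1) * smoothSum p Q U))) /
        (1 - Q ^ 2 * U)) := by
  have := hasSum_of_recurrence (a := degenerateNodeSeq p Q) (α := Q ^ 2) (x := U)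
    (b := fun n => Q ^ 2 *
      ((p - 1) ^ 2 * p ^ (2 * n) + 2 * (p - 1) * p ^ n * smoothSeq p Q n)) 1
    (fun n => by rw [degenerateNodeSeq]; ring) (by simpa using h3)
    ((hasSum_branches h1 h2).mul_left (Q ^ 2) |>.congr_fun
      (fun n => mul_assoc _ _ _))
  simpa [degenerateNodeSeq] using this

end

/-- The contributions of the cyclic quotients of the centre, with `N₀`, `N₁`, `N₂`, `N₃` points
off the curve, smooth points, and double points of rank deficit two and four. -/
def cyclicTerm (p Q U N₀ N₁ N₂ N₃ : ℂ) (n : ℕ) : ℂ :=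
  U ^ (n + 1) * (N₀ * p ^ (2 * n) + N₁ * (p ^ n * smoothSeq p Q n) + N₂ * nodeSeq p Q n +
    N₃ * degenerateNodeSeq p Q n)

theorem hasSum_cyclicTerm {r : ℕ} (hr : 2 ≤ r) {p Y : ℂ} (hp : p ≠ 0) (hY : Y ≠ 0)
    (N₀ N₁ N₂ N₃ : ℂ) (hN : N₀ + N₁ + N₂ + N₃ = p ^ 2 + p + 1)
    (h1 : ‖p ^ (2 * r + 2) * Y ^ (2 * r + 1)‖ < 1) (h2 : ‖p ^ (2 * r + 1) * Y ^ (2 * r - 1)‖ < 1)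
    (h3 : ‖p ^ (2 * r) * Y ^ (2 * r - 3)‖ < 1) (h4 : ‖p ^ (4 * r + 2) * Y ^ (2 * r + 2)‖ < 1) :
    ∃ Z₁ : ℂ, HasSum (cyclicTerm p (Y ^ 2)⁻¹ (p ^ (2 * r) * Y ^ (2 * r + 1)) N₀ N₁ N₂ N₃) Z₁ ∧
      ∀ Z₂ : ℂ, Z₂ = p ^ (4 * r) * Y ^ (2 * r + 2) *
          ((p ^ 2 + p + 1) + (p ^ 2 + p) * Z₁ + p ^ 2 * Z₂) →
        1 + Z₁ + Z₂ = W1 r p Y + (N₁ + 2 * N₂ + 2 * N₃) * W2 r p Y + N₂ * W3 r p Y +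
          N₃ * W4 r p Y := by
  obtain ⟨k, rfl⟩ := Nat.exists_eq_add_of_le' hr
  rw [show 2 * (k + 2) - 1 = 2 * k + 3 by omega] at h2
  rw [show 2 * (k + 2) - 3 = 2 * k + 1 by omega] at h3
  set U := p ^ (2 * (k + 2)) * Y ^ (2 * (k + 2) + 1) with hU
  set Q := (Y ^ 2)⁻¹ with hQ
  have e1 : p ^ (2 * (k + 2) + 2) * Y ^ (2 * (k + 2) + 1) = p ^ 2 * U := by rw [hU]; ring
  have e2 : p ^ (2 * (k + 2) + 1) * Y ^ (2 * k + 3) = Q * (p * U) := by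
    rw [hU, hQ, show 2 * (k + 2) + 1 = (2 * k + 3) + 2 by ring, pow_add Y _ 2]; field_simp; ring
  have e3 : p ^ (2 * (k + 2)) * Y ^ (2 * k + 1) = Q ^ 2 * U := by
    rw [hU, hQ, show 2 * (k + 2) + 1 = (2 * k + 1) + 4 by ring, pow_add Y _ 4]; field_simp
  rw [e1] at h1; rw [e2] at h2; rw [e3] at h3
  have d1 := one_sub_ne_zero_of_norm_lt_one h1
  have d2 := one_sub_ne_zero_of_norm_lt_one h2
  have d2' : 1 - Q * p * U ≠ 0 := by rwa [mul_assoc]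
  have d2'' : 1 - Q * U * p ≠ 0 := by rwa [mul_right_comm]
  have d1' : 1 - U * p ^ 2 ≠ 0 := by rwa [mul_comm]
  have d3 := one_sub_ne_zero_of_norm_lt_one h3
  have d4 := one_sub_ne_zero_of_norm_lt_one h4
  have d5 : 1 - Q ^ 2 * p ^ 2 * U ^ 2 ≠ 0 := by
    rw [show Q ^ 2 * p ^ 2 * U ^ 2 = (Q * (p * U)) ^ 2 by ring]
    exact one_sub_ne_zero_of_norm_lt_one
      (by rw [norm_pow]; exact pow_lt_one₀ (norm_nonneg _) h2 (by norm_num))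
  have hsum := (((((hasSum_geom h1).mul_left N₀).add
    ((hasSum_pow_mul_smoothSeq (p := p) (Q := Q) h1 h2).mul_left N₁)).add
    ((hasSum_nodeSeq h1 h2).mul_left N₂)).add
    ((hasSum_degenerateNodeSeq h1 h2 h3).mul_left N₃)).mul_left U
  refine ⟨_, hsum.congr_fun fun n => by rw [cyclicTerm, mul_pow, ← pow_mul]; ring,
    fun Z₂ hZ₂ => ?_⟩
  set T := p ^ (4 * (k + 2) + 2) * Y ^ (2 * (k + 2) + 2) with hT
  have a1 : smoothSum p Q U = (1 - p ^ 2 * U)⁻¹ +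
      (Q - 1) / ((1 - p ^ 2 * U) * (1 - Q * (p * U))) := by
    rw [smoothSum]; field_simp; ring
  have a2 : (Q + Q ^ 2 * p ^ 2 * U + U ^ 2 * (Q ^ 2 * p ^ 2 *
        ((p - 1) ^ 2 * (1 - p ^ 2 * U)⁻¹ + 2 * (p - 1) * smoothSum p Q U))) /
        (1 - Q ^ 2 * p ^ 2 * U ^ 2) = (1 - p ^ 2 * U)⁻¹ +
      2 * ((Q - 1) / ((1 - p ^ 2 * U) * (1 - Q * (p * U)))) -
      (Q - 1) * (1 - p * (Q * (p * U))) / ((1 - p ^ 2 * U) * (1 - Q * (p * U)) ^ 2) := by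
    rw [a1]; field_simp; ring
  have a3 : (Q ^ 2 + U * (Q ^ 2 *
        ((p - 1) ^ 2 * (1 - p ^ 2 * U)⁻¹ + 2 * (p - 1) * smoothSum p Q U))) /
        (1 - Q ^ 2 * U) = (1 - p ^ 2 * U)⁻¹ +
      2 * ((Q - 1) / ((1 - p ^ 2 * U) * (1 - Q * (p * U)))) +
      (Q - 1) ^ 2 * (1 + Q * (p * U)) /
        ((1 - p ^ 2 * U) * (1 - Q * (p * U)) * (1 - Q ^ 2 * U)) := by
    rw [a1]; field_simp; ring
  have hTp : p ^ (4 * (k + 2) + 1) * Y ^ (2 * (k + 2) + 2) = T / p := by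
    rw [hT]; field_simp; ring
  have hTp2 : p ^ (4 * (k + 2)) * Y ^ (2 * (k + 2) + 2) = T / p ^ 2 := by
    rw [hT]; field_simp; ring
  have hUQ : (1 - Y) * (1 + Y) * p ^ (2 * (k + 2)) * Y ^ (2 * k + 3) = (Q - 1) * U := by
    rw [hU, hQ, show 2 * (k + 2) + 1 = (2 * k + 3) + 2 by ring, pow_add Y _ 2]; field_simp; ring
  have hUQ2 : (1 - Y) ^ 2 * (1 + Y) ^ 2 * p ^ (2 * (k + 2)) * Y ^ (2 * k + 1) =
      (Q - 1) ^ 2 * U := by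
    rw [hU, hQ, show 2 * (k + 2) + 1 = (2 * k + 1) + 4 by ring, pow_add Y _ 4]; field_simp; ring
  have hpR : p ^ (2 * (k + 2) + 2) * Y ^ (2 * k + 3) = p * (Q * (p * U)) := by
    rw [← e2]; ring
  have w1 : W1 (k + 2) p Y = (1 + U + p * U + T / p ^ 2 + T / p + T * U / p) /
      ((1 - T) * (1 - p ^ 2 * U)) := by
    rw [W1, hTp, hTp2, e1, ← hT, ← hU]
    have u1 : p ^ (2 * (k + 2) + 1) * Y ^ (2 * (k + 2) + 1) = p * U := by rw [hU]; ring
    have u2 : p ^ (6 * (k + 2) + 1) * Y ^ (4 * (k + 2) + 3) = T * U / p := by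
      rw [hU, hT]; field_simp; ring
    rw [u1, u2]
  have w2 : W2 (k + 2) p Y = (Q - 1) * U * (1 + T / p) /
      ((1 - Q * (p * U)) * (1 - p ^ 2 * U) * (1 - T)) := by
    rw [W2, show 2 * (k + 2) - 1 = 2 * k + 3 by omega, hTp, e1, e2, ← hT, hUQ]
  have w3 : W3 (k + 2) p Y = -((Q - 1) * U * (1 - p * (Q * (p * U))) * (1 + T / p)) /
      ((1 - Q * (p * U)) ^ 2 * (1 - p ^ 2 * U) * (1 - T)) := by
    rw [W3, show 2 * (k + 2) - 1 = 2 * k + 3 by omega, hTp, e1, e2, ← hT, hUQ, hpR]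
  have w4 : W4 (k + 2) p Y = (Q - 1) ^ 2 * U * (1 + Q * (p * U)) * (1 + T / p) /
      ((1 - p ^ 2 * U) * (1 - Q ^ 2 * U) * (1 - Q * (p * U)) * (1 - T)) := by
    rw [W4, show 2 * (k + 2) - 1 = 2 * k + 3 by omega,
      show 2 * (k + 2) - 3 = 2 * k + 1 by omega, hTp, e1, e2, e3, ← hT, hUQ2]
  rw [hTp2] at hZ₂
  rw [a2, a3, a1] at hZ₂ ⊢
  rw [w1, w2, w3, w4]
  clear_value U Q T
  clear a1 a2 a3 w1 w2 w3 w4 hUQ hUQ2 hpR hTp hTp2 hsum e1 e2 e3 hU hQ hT h1 h2 h3 h4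
  have hZ : Z₂ = (T / p ^ 2 * ((p ^ 2 + p + 1) + (p ^ 2 + p) * (U *
      (N₀ * (1 - p ^ 2 * U)⁻¹ + N₁ * ((1 - p ^ 2 * U)⁻¹ +
        (Q - 1) / ((1 - p ^ 2 * U) * (1 - Q * (p * U)))) +
        N₂ * ((1 - p ^ 2 * U)⁻¹ + 2 * ((Q - 1) / ((1 - p ^ 2 * U) * (1 - Q * (p * U)))) -
      (Q - 1) * (1 - p * (Q * (p * U))) / ((1 - p ^ 2 * U) * (1 - Q * (p * U)) ^ 2)) +
        N₃ * ((1 - p ^ 2 * U)⁻¹ + 2 * ((Q - 1) / ((1 - p ^ 2 * U) * (1 - Q * (p * U)))) +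
      (Q - 1) ^ 2 * (1 + Q * (p * U)) /
        ((1 - p ^ 2 * U) * (1 - Q * (p * U)) * (1 - Q ^ 2 * U))))))) / (1 - T) := by
    rw [eq_div_iff d4]
    have : T = T / p ^ 2 * p ^ 2 := by field_simp
    linear_combination hZ₂ - Z₂ * this
  rw [hZ, show N₀ = p ^ 2 + p + 1 - N₁ - N₂ - N₃ by linear_combination hN]
  field_simp
  ring

end

section

/-! ### Subgroups of extensions -/

/-- Sections of a surjection onto a free abelian group of rank `k`. -/
lemma card_sections {Q C : Type*} [CommGroup Q] [CommGroup C] (ρ : Q →* C)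
    (hρ : Function.Surjective ρ) {k : ℕ} (b : Module.Basis (Fin k) ℤ (Additive C)) :
    Nat.card {s : C →* Q // ρ.comp s = MonoidHom.id C} = Nat.card ρ.ker ^ k := by
  classical
  have ext_basis : ∀ s t : C →* Q, (∀ i, s (b i).toMul = t (b i).toMul) → s = t := by
    intro s t h
    have : s.toAdditive.toIntLinearMap = t.toAdditive.toIntLinearMap :=
      b.ext fun i => congrArg Additive.ofMul (h i)
    ext c
    exact congrArg Additive.toMul (LinearMap.congr_fun this (Additive.ofMul c))
  have e : {s : C →* Q // ρ.comp s = MonoidHom.id C} ≃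
      ((i : Fin k) → {x : Q // ρ x = (b i).toMul}) := by
    refine Equiv.ofBijective (fun s i => ⟨s.1 (b i).toMul, DFunLike.congr_fun s.2 _⟩) ⟨?_, ?_⟩
    · intro s t h
      exact Subtype.ext (ext_basis _ _ fun i => congrArg Subtype.val (congrFun h i))
    · intro x
      let L : Additive C →ₗ[ℤ] Additive Q := b.constr ℤ fun i => Additive.ofMul (x i).1
      let s : C →* Q := AddMonoidHom.toMultiplicative L.toAddMonoidHom
      have hs : ∀ i, s (b i).toMul = (x i).1 := fun i =>
        congrArg Additive.toMul (b.constr_basis ℤ (fun i => Additive.ofMul (x i).1) i)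
      refine ⟨⟨s, ?_⟩, ?_⟩
      · have : (ρ.comp s).toAdditive.toIntLinearMap =
            (MonoidHom.id C).toAdditive.toIntLinearMap :=
          b.ext fun i => congrArg Additive.ofMul (by
            show ρ (s (b i).toMul) = _
            rw [hs, (x i).2]; rfl)
        ext c
        exact congrArg Additive.toMul (LinearMap.congr_fun this (Additive.ofMul c))
      · funext i
        exact Subtype.ext (hs i)
  have hfib : ∀ c : C, Nat.card {x : Q // ρ x = c} = Nat.card ρ.ker := by
    intro c
    obtain ⟨x₀, rfl⟩ := hρ c
    refine Nat.card_congr ⟨fun x => ⟨x₀⁻¹ * x.1, by simp [MonoidHom.mem_ker, x.2]⟩,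
      fun x => ⟨x₀ * x.1, by simp [MonoidHom.mem_ker.1 x.2]⟩, fun x => ?_, fun x => ?_⟩
    · ext; simp
    · ext; simp
  rw [Nat.card_congr e, Nat.card_pi, prod_congr rfl fun i _ => hfib _]
  simp

section Extension
variable {E A B : Type*} [Group E] [CommGroup A] [CommGroup B] (ι : A →* E) (π : E →* B)

/-- The number of subgroups of an extension `1 → A → E → B → 1` with given trace `Λ` on `A` and
given image `Γ` in `B`, if the preimage of `Γ` is abelian modulo `Λ`. -/
theorem card_subgroups_of_extension (hι : Function.Injective ι) (hπ : Function.Surjective π)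
    (hex : π.ker = ι.range) (hc : ∀ a g, Commute (ι a) g) (Λ : Subgroup A) (Γ : Subgroup B)
    {k : ℕ} (b : Module.Basis (Fin k) ℤ (Additive Γ))
    (hab : ∀ g h : E, π g ∈ Γ → π h ∈ Γ → g * h * g⁻¹ * h⁻¹ ∈ Λ.map ι) :
    Nat.card {N : Subgroup E // N.comap ι = Λ ∧ N.map π = Γ} = Λ.index ^ k := by
  classical
  have hπι : ∀ a, π (ι a) = 1 := fun a => by
    have : ι a ∈ π.ker := hex ▸ ⟨a, rfl⟩
    exact this
  set K : Subgroup E := Λ.map ι with hK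
  have hKmem : ∀ a, ι a ∈ K ↔ a ∈ Λ := fun a => by
    rw [hK, Subgroup.mem_map_iff_mem hι]
  set F : Subgroup E := Γ.comap π with hF
  have hKF : K ≤ F := by
    rintro _ ⟨a, -, rfl⟩
    rw [hF, Subgroup.mem_comap, hπι]; exact Γ.one_mem
  have hKn : K.Normal := ⟨by
    rintro _ ⟨a, ha, rfl⟩ g
    rw [← (hc a g).eq, mul_inv_cancel_right]; exact ⟨a, ha, rfl⟩⟩
  let K' : Subgroup F := K.subgroupOf F
  have : K'.Normal := inferInstanceAs (K.subgroupOf F).Normal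
  let _ : CommGroup (F ⧸ K') :=
    { (inferInstance : Group (F ⧸ K')) with
      mul_comm := by
        intro x y
        obtain ⟨g, rfl⟩ := QuotientGroup.mk'_surjective K' x
        obtain ⟨h, rfl⟩ := QuotientGroup.mk'_surjective K' y
        show ((g * h : F) : F ⧸ K') = ((h * g : F) : F ⧸ K')
        rw [QuotientGroup.eq, Subgroup.mem_subgroupOf]
        have := hab (h : E)⁻¹ (g : E)⁻¹ (by simpa using Γ.inv_mem h.2)
          (by simpa using Γ.inv_mem g.2)
        convert this using 1
        push_cast
        group }
  let πF : F →* Γ := (π.comp F.subtype).codRestrict Γ (fun g => g.2)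
  have hπF : ∀ g, ((πF g : Γ) : B) = π g := fun g => rfl
  let ρ : F ⧸ K' →* Γ := QuotientGroup.lift K' πF (by
    intro g hg
    rw [Subgroup.mem_subgroupOf] at hg
    obtain ⟨a, -, ha⟩ := hg
    apply Subtype.ext
    rw [hπF, ← ha, hπι]; rfl)
  have hρmk : ∀ g : F, ρ (g : F ⧸ K') = πF g := fun g => rfl
  have hρ : Function.Surjective ρ := by
    rintro ⟨c, hcΓ⟩
    obtain ⟨g, rfl⟩ := hπ c
    exact ⟨((⟨g, hcΓ⟩ : F) : F ⧸ K'), rfl⟩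
  -- the kernel of `ρ` is `A / Λ`
  let ιF : A →* F := ι.codRestrict F (fun a => by rw [hF, Subgroup.mem_comap, hπι]; exact Γ.one_mem)
  have hker : Nat.card ρ.ker = Λ.index := by
    let j : A →* F ⧸ K' := (QuotientGroup.mk' K').comp ιF
    have hj : j.ker = Λ := by
      ext a
      rw [MonoidHom.mem_ker]
      show ((ιF a : F) : F ⧸ K') = 1 ↔ _
      rw [QuotientGroup.eq_one_iff, Subgroup.mem_subgroupOf]
      exact hKmem a
    have hjr : j.range = ρ.ker := by
      ext x
      constructor
      · rintro ⟨a, rfl⟩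
        exact Subtype.ext (hπι a)
      · intro hx
        obtain ⟨g, rfl⟩ := QuotientGroup.mk'_surjective K' x
        have : (g : E) ∈ π.ker := congrArg Subtype.val (MonoidHom.mem_ker.1 hx)
        rw [hex] at this
        obtain ⟨a, ha⟩ := this
        exact ⟨a, congrArg (QuotientGroup.mk' K') (Subtype.ext ha)⟩
    rw [← hjr, ← Subgroup.index_ker, hj]
  rw [← hker, ← card_sections ρ hρ b]
  symm
  let N : (Γ →* F ⧸ K') → Subgroup E := fun s =>
    (s.range.comap (QuotientGroup.mk' K')).map F.subtype
  have hN : ∀ (s : Γ →* F ⧸ K') (g : E), g ∈ N s ↔ ∃ (h : g ∈ F) (c : Γ),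
      s c = ((⟨g, h⟩ : F) : F ⧸ K') := by
    intro s g
    constructor
    · rintro ⟨g, ⟨c, hc⟩, rfl⟩
      exact ⟨g.2, c, hc⟩
    · rintro ⟨h, c, hc⟩
      exact ⟨⟨g, h⟩, ⟨c, hc⟩, rfl⟩
  have hsec : ∀ (s : Γ →* F ⧸ K'), ρ.comp s = MonoidHom.id Γ → ∀ (g : E) (h : g ∈ F) (c : Γ),
      s c = ((⟨g, h⟩ : F) : F ⧸ K') → c = πF ⟨g, h⟩ := by
    intro s hs g h c hc
    rw [← hρmk, ← hc]
    exact (DFunLike.congr_fun hs c).symm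
  have hNπ : ∀ (s : Γ →* F ⧸ K'), ρ.comp s = MonoidHom.id Γ → (N s).map π = Γ := by
    intro s hs
    ext c
    constructor
    · rintro ⟨g, hg, rfl⟩
      obtain ⟨h, -⟩ := (hN s g).1 hg
      exact h
    · intro hcΓ
      obtain ⟨g, hg⟩ := QuotientGroup.mk'_surjective K' (s ⟨c, hcΓ⟩)
      refine ⟨g, (hN s g).2 ⟨g.2, _, hg.symm⟩, ?_⟩
      exact congrArg Subtype.val (hsec s hs g g.2 _ hg.symm).symm
  have hNι : ∀ (s : Γ →* F ⧸ K'), ρ.comp s = MonoidHom.id Γ → (N s).comap ι = Λ := by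
    intro s hs
    ext a
    rw [Subgroup.mem_comap, hN]
    constructor
    · rintro ⟨h, c, hca⟩
      have h1 : c = 1 := by rw [hsec s hs _ h c hca]; exact Subtype.ext (hπι a)
      rw [h1, map_one, eq_comm, QuotientGroup.eq_one_iff, Subgroup.mem_subgroupOf] at hca
      exact (hKmem a).1 hca
    · intro ha
      refine ⟨(ιF a).2, 1, ?_⟩
      rw [map_one, eq_comm, QuotientGroup.eq_one_iff, Subgroup.mem_subgroupOf]
      exact (hKmem a).2 ha
  refine Nat.card_eq_of_bijective
    (fun s : {s : Γ →* F ⧸ K' // ρ.comp s = MonoidHom.id Γ} =>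
      (⟨N s.1, hNι s.1 s.2, hNπ s.1 s.2⟩ :
        {N : Subgroup E // N.comap ι = Λ ∧ N.map π = Γ})) ⟨?_, ?_⟩
  · rintro ⟨s, hs⟩ ⟨t, ht⟩ hst
    have hst : N s = N t := congrArg Subtype.val hst
    refine Subtype.ext (MonoidHom.ext fun c => ?_)
    obtain ⟨g, hg⟩ := QuotientGroup.mk'_surjective K' (s c)
    have h1 : (g : E) ∈ N t := hst ▸ (hN s g).2 ⟨g.2, c, hg.symm⟩
    obtain ⟨h, c', hc'⟩ := (hN t g).1 h1
    have h2 : c' = c := by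
      rw [hsec t ht _ h c' hc', hsec s hs _ h c hg.symm]
    rw [← h2, hc', h2]
    exact hg.symm
  · rintro ⟨N', hN'ι, hN'π⟩
    have hlift : ∀ i, ∃ n ∈ N', π n = ((b i).toMul : Γ) := by
      intro i
      have : (((b i).toMul : Γ) : B) ∈ N'.map π := hN'π ▸ (b i).toMul.2
      exact this
    choose n hn hnπ using hlift
    have hnF : ∀ i, n i ∈ F := fun i => by
      rw [hF, Subgroup.mem_comap, hnπ]; exact Subtype.mem _
    let L : Additive Γ →ₗ[ℤ] Additive (F ⧸ K') :=
      b.constr ℤ fun i => Additive.ofMul ((⟨n i, hnF i⟩ : F) : F ⧸ K')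
    let s : Γ →* F ⧸ K' := AddMonoidHom.toMultiplicative L.toAddMonoidHom
    have hsb : ∀ i, s (b i).toMul = ((⟨n i, hnF i⟩ : F) : F ⧸ K') := fun i =>
      congrArg Additive.toMul (b.constr_basis ℤ _ i)
    have hs : ρ.comp s = MonoidHom.id Γ := by
      have : (ρ.comp s).toAdditive.toIntLinearMap =
          (MonoidHom.id Γ).toAdditive.toIntLinearMap :=
        b.ext fun i => congrArg Additive.ofMul (by
          show ρ (s (b i).toMul) = (b i).toMul
          rw [hsb]; exact Subtype.ext (hnπ i))
      ext c : 1
      exact congrArg Additive.toMul (LinearMap.congr_fun this (Additive.ofMul c))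
    refine ⟨⟨s, hs⟩, Subtype.ext ?_⟩
    show N s = N'
    have hKN : K ≤ N' := by
      rintro _ ⟨a, ha, rfl⟩
      have : a ∈ N'.comap ι := hN'ι ▸ ha
      exact this
    have hle : N s ≤ N' := by
      intro g hg
      obtain ⟨h, c, hcg⟩ := (hN s g).1 hg
      have hr : ∀ c : Γ, s c ∈ (N'.subgroupOf F).map (QuotientGroup.mk' K') := by
        intro c
        have : Submodule.span ℤ (Set.range b) ≤
            (AddSubgroup.toIntSubmodule (Subgroup.toAddSubgroup
              ((N'.subgroupOf F).map (QuotientGroup.mk' K')))).comap L := by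
          rw [Submodule.span_le]
          rintro _ ⟨i, rfl⟩
          show s (b i).toMul ∈ (N'.subgroupOf F).map (QuotientGroup.mk' K')
          rw [hsb]
          exact ⟨⟨n i, hnF i⟩, hn i, rfl⟩
        rw [b.span_eq] at this
        exact this (Submodule.mem_top (x := Additive.ofMul c))
      obtain ⟨g', hg', hgg'⟩ := hr c
      rw [hcg] at hgg'
      have := QuotientGroup.eq.1 hgg'
      rw [Subgroup.mem_subgroupOf] at this
      have h2 := N'.mul_mem (show (g' : E) ∈ N' from hg') (hKN this)
      simpa using h2
    refine le_antisymm hle fun g hg => ?_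
    have hgF : g ∈ F := by
      have : π g ∈ N'.map π := ⟨g, hg, rfl⟩
      rw [hN'π] at this; exact this
    have : π g ∈ (N s).map π := by rw [hNπ s hs]; exact hgF
    obtain ⟨g', hg', hgg'⟩ := this
    have h1 : g'⁻¹ * g ∈ π.ker := by simp [MonoidHom.mem_ker, hgg']
    rw [hex] at h1
    obtain ⟨a, ha⟩ := h1
    have h2 : a ∈ Λ := by
      rw [← hN'ι, Subgroup.mem_comap, ha]
      exact N'.mul_mem (N'.inv_mem (hle hg')) hg
    rw [← hNι s hs, Subgroup.mem_comap, ha] at h2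
    simpa using (N s).mul_mem hg' h2

lemma index_of_extension (hπ : Function.Surjective π) (hex : π.ker = ι.range)
    (N : Subgroup E) [N.Normal] : N.index = (N.comap ι).index * (N.map π).index := by
  rw [Subgroup.index_map, Subgroup.index_comap, ← hex, MonoidHom.range_eq_top.2 hπ,
    Subgroup.index_top, mul_one, ← Subgroup.relIndex_sup_left π.ker N,
    Subgroup.relIndex_mul_index le_sup_left]

end Extension

/-! ### Subgroups of `p`-power index -/

/-- The exponent of a prime power. -/
def plog (p n : ℕ) : ℕ := n.factorization p

lemma plog_pow {p : ℕ} (hp : p.Prime) (n : ℕ) : plog p (p ^ n) = n := by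
  simp [plog, hp.factorization]

lemma plog_mul {p m n : ℕ} (hm : m ≠ 0) (hn : n ≠ 0) : plog p (m * n) = plog p m + plog p n := by
  simp [plog, Nat.factorization_mul hm hn]

/-- The subgroups of `p`-power index. -/
abbrev PSub (p : ℕ) (C : Type*) [Group C] : Type _ := {Γ : Subgroup C // ∃ n, Γ.index = p ^ n}

lemma pow_plog {p m : ℕ} (hp : p.Prime) (h : ∃ n, m = p ^ n) : p ^ plog p m = m := by
  obtain ⟨n, rfl⟩ := h
  rw [plog_pow hp]

lemma exists_pow_of_dvd {p m n : ℕ} (hp : p.Prime) (h : ∃ k, m = p ^ k) (hd : n ∣ m) :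
    ∃ k, n = p ^ k := by
  obtain ⟨k, rfl⟩ := h
  obtain ⟨j, -, h⟩ := (Nat.dvd_prime_pow hp).1 hd
  exact ⟨j, h⟩

lemma ne_zero_of_exists_pow {p m : ℕ} (hp : p.Prime) (h : ∃ k, m = p ^ k) : m ≠ 0 := by
  obtain ⟨k, rfl⟩ := h
  exact pow_ne_zero _ hp.ne_zero

lemma hasSum_comp_of_card_fiber {α β : Type*} (f : α → β) (w : β → ℂ) (n : β → ℕ)
    (hn : ∀ b, Nat.card {a // f a = b} = n b) (hn0 : ∀ b, n b ≠ 0) {S : ℂ}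
    (h : HasSum (fun b => (n b : ℂ) * w b) S) : HasSum (fun a => w (f a)) S := by
  classical
  have hfin : ∀ b, Finite {a // f a = b} := fun b =>
    (Nat.card_ne_zero.1 (by rw [hn]; exact hn0 b)).2
  have hsum : ∀ b, HasSum (fun a : {a // f a = b} => w (f a.1)) ((n b : ℂ) * w b) := by
    intro b
    have := Fintype.ofFinite {a // f a = b}
    have h1 := hasSum_fintype (fun a : {a // f a = b} => w (f a.1))
    have h2 : ∑ a : {a // f a = b}, w (f a.1) = (n b : ℂ) * w b := by
      rw [sum_congr rfl fun a _ => by rw [a.2], sum_const, Finset.card_univ,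
        ← Nat.card_eq_fintype_card, hn, nsmul_eq_mul]
    rwa [h2] at h1
  have hs : Summable (fun x : Σ b, {a // f a = b} => w (f x.2.1)) := by
    refine Summable.of_norm ((summable_sigma_of_nonneg fun _ => norm_nonneg _).2 ⟨fun b => ?_, ?_⟩)
    · have := Fintype.ofFinite {a // f a = b}
      exact (hasSum_fintype _).summable
    · refine h.summable.norm.congr fun b => ?_
      have := Fintype.ofFinite {a // f a = b}
      rw [tsum_fintype, sum_congr rfl fun a _ => by rw [a.2], sum_const,
        Finset.card_univ, ← Nat.card_eq_fintype_card, hn, nsmul_eq_mul, norm_mul]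
      simp
  have := (h.sigma_of_hasSum (g := fun b => (n b : ℂ) * w b)
    (f := fun x : Σ b, {a // f a = b} => w (f x.2.1)) hsum hs)
  exact (Equiv.sigmaFiberEquiv f).hasSum_iff.1 this

lemma hasSum_sigma_mul {α : Type*} {β : α → Type*} {a : α → ℂ} {b : (x : α) → β x → ℂ} {ζ S : ℂ}
    {ζ' : ℝ} (hζ : ∀ x, HasSum (b x) ζ) (hζ' : ∀ x, HasSum (fun y => ‖b x y‖) ζ')
    (hS : HasSum a S) : HasSum (fun x : Σ x, β x => a x.1 * b x.1 x.2) (S * ζ) := by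
  have h1 : ∀ x, HasSum (fun y => a x * b x y) (a x * ζ) := fun x => (hζ x).mul_left _
  refine (hS.mul_right ζ).sigma_of_hasSum h1 ?_
  refine Summable.of_norm ((summable_sigma_of_nonneg fun _ => norm_nonneg _).2 ⟨fun x => ?_, ?_⟩)
  · exact (h1 x).summable.norm
  · simp only [norm_mul, tsum_mul_left, (hζ' _).tsum_eq]
    exact hS.summable.norm.mul_right _

theorem hasSum_normal_subgroups {p k : ℕ} (hp : p.Prime) {E A B : Type*} [Group E] [CommGroup A]
    [CommGroup B] (ι : A →* E) (π : E →* B) (hι : Function.Injective ι)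
    (hπ : Function.Surjective π) (hex : π.ker = ι.range) (hc : ∀ a g, Commute (ι a) g)
    (c : B → B → A) (hcomm : ∀ g h, g * h * g⁻¹ * h⁻¹ = ι (c (π g) (π h)))
    (hB : ∀ Γ : Subgroup B, Γ.index ≠ 0 → Nonempty (Module.Basis (Fin k) ℤ (Additive Γ)))
    (X : Subgroup A → Subgroup B) (hX : ∀ Λ γ, γ ∈ X Λ ↔ ∀ b, c b γ ∈ Λ)
    (hXp : ∀ Λ, (∃ n, Λ.index = p ^ n) → ∃ n, (X Λ).index = p ^ n)
    {Y ζ S : ℂ} {ζ' : ℝ}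
    (hζ : ∀ Λ : PSub p A, HasSum (fun Γ : PSub p (X Λ.1) => Y ^ plog p Γ.1.index) ζ)
    (hζ' : ∀ Λ : PSub p A, HasSum (fun Γ : PSub p (X Λ.1) => ‖Y‖ ^ plog p Γ.1.index) ζ')
    (hS : HasSum (fun Λ : PSub p A => (Λ.1.index : ℂ) ^ k *
      Y ^ (plog p Λ.1.index + plog p (X Λ.1).index)) S) :
    HasSum (fun N : {N : Subgroup E // N.Normal ∧ ∃ n, N.index = p ^ n} =>
      Y ^ plog p N.1.index) (ζ * S) := by
  classical
  let P := {q : Subgroup A × Subgroup B // (∃ n, q.1.index = p ^ n) ∧ (∃ n, q.2.index = p ^ n) ∧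
    q.2 ≤ X q.1}
  have hmap : ∀ N : Subgroup E, N.Normal ↔ N.map π ≤ X (N.comap ι) := by
    intro N
    constructor
    · rintro hN _ ⟨n, hn, rfl⟩
      rw [hX]
      intro b
      obtain ⟨g, rfl⟩ := hπ b
      rw [Subgroup.mem_comap, ← hcomm]
      exact N.mul_mem (hN.conj_mem n hn g) (N.inv_mem hn)
    · intro h
      refine ⟨fun n hn g => ?_⟩
      have := (hX _ _).1 (h ⟨n, hn, rfl⟩) (π g)
      rw [Subgroup.mem_comap, ← hcomm] at this
      simpa using N.mul_mem this hn
  let f : {N : Subgroup E // N.Normal ∧ ∃ n, N.index = p ^ n} → P := fun N =>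
    ⟨(N.1.comap ι, N.1.map π), by
      have := N.2.1
      have h := index_of_extension ι π hπ hex N.1
      exact ⟨exists_pow_of_dvd hp N.2.2 ⟨_, h⟩,
        exists_pow_of_dvd hp N.2.2 ⟨_, h.trans (mul_comm _ _)⟩, (hmap _).1 N.2.1⟩⟩
  have hcard : ∀ q : P, Nat.card {N // f N = q} = q.1.1.index ^ k := by
    rintro ⟨⟨Λ, Γ⟩, h1, h2, h3⟩
    obtain ⟨b⟩ := hB Γ (ne_zero_of_exists_pow hp h2)
    rw [← card_subgroups_of_extension ι π hι hπ hex hc Λ Γ b ?_]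
    · refine Nat.card_congr ⟨fun N => ⟨N.1.1, by
          have := congrArg Subtype.val N.2
          exact ⟨congrArg Prod.fst this, congrArg Prod.snd this⟩⟩,
        fun N => ⟨⟨N.1, ?_, ?_⟩, ?_⟩, fun _ => rfl, fun _ => rfl⟩
      · rw [hmap, N.2.1, N.2.2]; exact h3
      · have : N.1.Normal := by rw [hmap, N.2.1, N.2.2]; exact h3
        rw [index_of_extension ι π hπ hex N.1, N.2.1, N.2.2]
        obtain ⟨m, hm⟩ := h1
        obtain ⟨m', hm'⟩ := h2
        exact ⟨m + m', by rw [pow_add, ← hm, ← hm']⟩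
      · exact Subtype.ext (Prod.ext N.2.1 N.2.2)
    · intro g h hg hh
      rw [hcomm]
      exact ⟨_, (hX _ _).1 (h3 hh) _, rfl⟩
  -- the sum over pairs
  let e : (Σ Λ : PSub p A, PSub p (X Λ.1)) ≃ P :=
    { toFun := fun x => ⟨(x.1.1, x.2.1.map (X x.1.1).subtype), x.1.2, by
        obtain ⟨m, hm⟩ := x.2.2
        obtain ⟨m', hm'⟩ := hXp _ x.1.2
        exact ⟨m + m', by rw [Subgroup.index_map_subtype, hm, hm', pow_add]⟩,
        Subgroup.map_subtype_le _⟩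
      invFun := fun q => ⟨⟨q.1.1, q.2.1⟩, q.1.2.subgroupOf (X q.1.1), by
        refine exists_pow_of_dvd hp q.2.2.1 ?_
        exact Subgroup.relIndex_dvd_index_of_le q.2.2.2⟩
      left_inv := by
        rintro ⟨⟨Λ, h⟩, ⟨Γ, h'⟩⟩
        simp only [Sigma.mk.injEq, heq_eq_eq, true_and]
        exact Subtype.ext (Subgroup.comap_map_eq_self_of_injective (Subgroup.subtype_injective _) _)
      right_inv := by
        rintro ⟨⟨Λ, Γ⟩, h⟩
        refine Subtype.ext (Prod.ext rfl ?_)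
        exact Subgroup.map_subgroupOf_eq_of_le h.2.2 }
  have hlog : ∀ x : Σ Λ : PSub p A, PSub p (X Λ.1), plog p (e x).1.2.index =
      plog p x.2.1.index + plog p (X x.1.1).index := by
    intro x
    show plog p (x.2.1.map (X x.1.1).subtype).index = _
    rw [Subgroup.index_map_subtype, plog_mul (ne_zero_of_exists_pow hp x.2.2)
      (ne_zero_of_exists_pow hp (hXp _ x.1.2))]
  have hfst : ∀ x, (e x).1.1 = x.1.1 := fun _ => rfl
  clear_value e
  have hpairs : HasSum (fun q : P => ((q.1.1.index ^ k : ℕ) : ℂ) *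
      Y ^ (plog p q.1.1.index + plog p q.1.2.index)) (ζ * S) := by
    have hz : ∀ Λ : PSub p A, HasSum (fun Γ : PSub p (X Λ.1) => ‖Y ^ plog p Γ.1.index‖) ζ' := by
      simpa only [norm_pow] using hζ'
    have h3 := hasSum_sigma_mul
      (b := fun (Λ : PSub p A) (Γ : PSub p (X Λ.1)) => Y ^ plog p Γ.1.index) hζ hz hS
    rw [← e.hasSum_iff, mul_comm ζ S]
    convert h3 using 2 with x
    simp only [Function.comp]
    rw [hlog, hfst]
    push_cast
    ring
  have key := hasSum_comp_of_card_fiber f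
    (fun q : P => Y ^ (plog p q.1.1.index + plog p q.1.2.index))
    (fun q : P => q.1.1.index ^ k) hcard
    (fun q => pow_ne_zero _ (ne_zero_of_exists_pow hp q.2.1)) hpairs
  have hf : ∀ N, plog p N.1.index = plog p (f N).1.1.index + plog p (f N).1.2.index := by
    intro N
    have := N.2.1
    rw [index_of_extension ι π hπ hex N.1]
    exact plog_mul (ne_zero_of_exists_pow hp (f N).2.1) (ne_zero_of_exists_pow hp (f N).2.2.1)
  simp only [hf]
  exact key

end

section

/-! ### The zeta function of a free abelian group -/

lemma exists_basis_of_index_ne_zero {C : Type*} [CommGroup C] {k : ℕ}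
    (b : Module.Basis (Fin k) ℤ (Additive C)) (Γ : Subgroup C) (h : Γ.index ≠ 0) :
    Nonempty (Module.Basis (Fin k) ℤ (Additive Γ)) := by
  have := Module.Free.of_basis b
  have := Module.Finite.of_basis b
  let N : Submodule ℤ (Additive C) := AddSubgroup.toIntSubmodule (Subgroup.toAddSubgroup Γ)
  have hfin : Finite (Additive C ⧸ N) := by
    have h1 := Subgroup.index_ne_zero_iff_finite.1 h
    exact h1
  have h2 := (Submodule.finiteQuotient_iff N).1 hfin
  rw [Module.finrank_eq_card_basis b, Fintype.card_fin] at h2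
  exact ⟨(Module.finBasisOfFinrankEq ℤ N h2 : Module.Basis (Fin k) ℤ N)⟩

lemma hasSum_psub_congr {p : ℕ} {C D : Type*} [Group C] [Group D] (e : C ≃* D) {R : Type*}
    [NormedRing R] (Y : R) {S : R} (h : HasSum (fun Γ : PSub p D => Y ^ plog p Γ.1.index) S) :
    HasSum (fun Γ : PSub p C => Y ^ plog p Γ.1.index) S := by
  have hidx : ∀ Γ : Subgroup C, (e.mapSubgroup Γ).index = Γ.index := fun Γ =>
    Subgroup.index_map_equiv Γ e
  let E : PSub p C ≃ PSub p D := e.mapSubgroup.toEquiv.subtypeEquiv fun Γ => by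
    show _ ↔ ∃ n, (e.mapSubgroup Γ).index = p ^ n
    rw [hidx]
  refine (E.hasSum_iff.2 h).congr_fun fun Γ => ?_
  show _ = Y ^ plog p (e.mapSubgroup Γ.1).index
  rw [hidx]

lemma hasSum_psub_int {p : ℕ} (hp : p.Prime) {Y : ℂ} (hY : ‖Y‖ < 1) :
    HasSum (fun Γ : PSub p (Multiplicative ℤ) => Y ^ plog p Γ.1.index) (1 - Y)⁻¹ := by
  have hidx : ∀ n : ℕ, (AddSubgroup.toSubgroup (AddSubgroup.zmultiples ((p : ℤ) ^ n))).index =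
      p ^ n := by
    intro n
    rw [AddSubgroup.index_toSubgroup, Int.index_zmultiples, Int.natAbs_pow, Int.natAbs_natCast]
  let f : ℕ → PSub p (Multiplicative ℤ) := fun n =>
    ⟨AddSubgroup.toSubgroup (AddSubgroup.zmultiples ((p : ℤ) ^ n)), n, hidx n⟩
  have hf : Function.Bijective f := by
    constructor
    · intro m n h
      have h1 := congrArg (fun Γ => Subgroup.index Γ.1) h
      simp only [f, hidx] at h1
      exact Nat.pow_right_injective hp.two_le h1
    · rintro ⟨Γ, n, hn⟩
      refine ⟨n, Subtype.ext ?_⟩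
      obtain ⟨a, ha⟩ := Int.subgroup_cyclic (AddSubgroup.toSubgroup.symm Γ)
      rw [← AddSubgroup.zmultiples_eq_closure] at ha
      have hΓ : Γ = AddSubgroup.toSubgroup (AddSubgroup.zmultiples a) := by
        rw [← ha, OrderIso.apply_symm_apply]
      rw [hΓ, AddSubgroup.index_toSubgroup, Int.index_zmultiples] at hn
      show AddSubgroup.toSubgroup (AddSubgroup.zmultiples ((p : ℤ) ^ n)) = Γ
      rw [hΓ]
      congr 1
      rw [← Int.zmultiples_natAbs a, hn]
      push_cast; rfl
  refine ((Equiv.ofBijective f hf).hasSum_iff).1 ((hasSum_geom hY).congr_fun fun n => ?_)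
  show Y ^ plog p (AddSubgroup.toSubgroup (AddSubgroup.zmultiples ((p : ℤ) ^ n))).index = Y ^ n
  rw [hidx, plog_pow hp]

lemma hasSum_norm_of_hasSum {α : Type*} {f : α → ℕ} {Y : ℂ} {S : ℂ}
    (h : HasSum (fun a => ((‖Y‖ : ℝ) : ℂ) ^ f a) S) : HasSum (fun a => ‖Y‖ ^ f a) S.re := by
  have := Complex.hasSum_re h
  refine this.congr_fun fun a => ?_
  rw [← Complex.ofReal_pow, Complex.ofReal_re]

lemma hasSum_psub_of_extension {p : ℕ} (hp : p.Prime) {E A : Type*} [CommGroup E] [CommGroup A]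
    (ι : A →* E) (π : E →* Multiplicative ℤ) (hι : Function.Injective ι)
    (hπ : Function.Surjective π) (hex : π.ker = ι.range) {Y S : ℂ} (hY : ‖Y‖ < 1)
    (hS : HasSum (fun Γ : PSub p A => ((p : ℂ) * Y) ^ plog p Γ.1.index) S) :
    HasSum (fun Γ : PSub p E => Y ^ plog p Γ.1.index) ((1 - Y)⁻¹ * S) := by
  have bZ : Module.Basis (Fin 1) ℤ (Additive (Multiplicative ℤ)) :=
    (Module.Basis.singleton (Fin 1) ℤ : Module.Basis (Fin 1) ℤ ℤ)
  have topcase : ∀ Y : ℂ, ‖Y‖ < 1 → HasSum (fun Γ : PSub p (⊤ : Subgroup (Multiplicative ℤ)) =>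
      Y ^ plog p Γ.1.index) (1 - Y)⁻¹ := fun Y hY =>
    hasSum_psub_congr Subgroup.topEquiv _ (hasSum_psub_int hp hY)
  have key := hasSum_normal_subgroups hp (k := 1) ι π hι hπ hex (fun a g => mul_comm _ _)
    (fun _ _ => 1) (fun g h => by rw [map_one, mul_comm g h]; group)
    (fun Γ hΓ => exists_basis_of_index_ne_zero bZ Γ hΓ) (fun _ => ⊤)
    (fun Λ γ => by simp [Λ.one_mem]) (fun Λ _ => ⟨0, by simp⟩)
    (fun Λ => topcase Y hY)
    (fun Λ => hasSum_norm_of_hasSum (topcase _ (by simpa using hY)))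
    (S := S) ?_
  · let e' : PSub p E ≃ {N : Subgroup E // N.Normal ∧ ∃ n, N.index = p ^ n} :=
      Equiv.subtypeEquivRight fun N => ⟨fun h => ⟨inferInstance, h⟩, fun h => h.2⟩
    have h2 := e'.hasSum_iff.2 key
    exact h2
  · convert hS using 2 with Λ
    rw [Subgroup.index_top, show plog p 1 = 0 by simp [plog], add_zero, mul_pow, pow_one]
    congr 1
    conv_lhs => rw [← pow_plog hp Λ.2]
    push_cast
    rfl

lemma hasSum_psub_pi {p : ℕ} (hp : p.Prime) (d : ℕ) :
    ∀ {Y : ℂ} (_ : (p : ℝ) ^ d * ‖Y‖ < 1),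
    HasSum (fun Γ : PSub p (Multiplicative (Fin d → ℤ)) => Y ^ plog p Γ.1.index)
      (∏ i ∈ Finset.range d, (1 - (p : ℂ) ^ i * Y)⁻¹) := by
  induction d with
  | zero =>
    intro Y _
    set C := Multiplicative (Fin 0 → ℤ)
    have : Subsingleton C := inferInstanceAs (Subsingleton (Fin 0 → ℤ))
    have h : ∀ Γ : PSub p C, Γ = ⟨⊤, 0, by simp⟩ := fun Γ => Subtype.ext (Subsingleton.elim _ _)
    have := hasSum_single (f := fun Γ : PSub p C => Y ^ plog p Γ.1.index) ⟨⊤, 0, by simp⟩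
      fun Γ hΓ => (hΓ (h Γ)).elim
    simpa [plog] using this
  | succ d ih =>
    intro Y hY
    have hp1 : (1 : ℝ) ≤ p := by exact_mod_cast hp.one_le
    have hY1 : ‖Y‖ < 1 := by
      refine lt_of_le_of_lt ?_ hY
      exact le_mul_of_one_le_left (norm_nonneg _) (one_le_pow₀ hp1)
    let L : (Fin d → ℤ) →ₗ[ℤ] (Fin (d + 1) → ℤ) :=
      LinearMap.pi (Fin.cons 0 fun i => LinearMap.proj i)
    have hL0 : ∀ a, L a 0 = 0 := fun a => rfl
    have hLs : ∀ a i, L a (Fin.succ i) = a i := fun a i => rfl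
    let ι : Multiplicative (Fin d → ℤ) →* Multiplicative (Fin (d + 1) → ℤ) :=
      AddMonoidHom.toMultiplicative L.toAddMonoidHom
    let π : Multiplicative (Fin (d + 1) → ℤ) →* Multiplicative ℤ :=
      AddMonoidHom.toMultiplicative (LinearMap.proj (R := ℤ) (0 : Fin (d + 1))).toAddMonoidHom
    have hι : Function.Injective ι := by
      intro a a' h
      funext i
      exact congrFun (show L a = L a' from h) (Fin.succ i)
    have hπ : Function.Surjective π := fun z => ⟨(fun _ => z : Fin (d + 1) → ℤ), rfl⟩
    have hex : π.ker = ι.range := by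
      ext x
      constructor
      · intro hx
        refine ⟨(fun i => (x : Fin (d + 1) → ℤ) (Fin.succ i) : Fin d → ℤ), ?_⟩
        have hx0 : (x : Fin (d + 1) → ℤ) 0 = 0 := hx
        show L _ = (x : Fin (d + 1) → ℤ)
        funext i
        refine Fin.cases ?_ (fun i => ?_) i
        · rw [hL0]; exact hx0.symm
        · rw [hLs]; rfl
      · rintro ⟨a, rfl⟩
        exact hL0 a
    have hpY : (p : ℝ) ^ d * ‖(p : ℂ) * Y‖ < 1 := by
      rw [norm_mul, Complex.norm_natCast, ← mul_assoc, ← pow_succ]; exact hY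
    rw [Finset.prod_range_succ', mul_comm]
    simp only [pow_zero, one_mul]
    have hval : ∏ i ∈ Finset.range d, (1 - (p : ℂ) ^ (i + 1) * Y)⁻¹ =
        ∏ i ∈ Finset.range d, (1 - (p : ℂ) ^ i * (p * Y))⁻¹ :=
      prod_congr rfl fun i _ => by rw [pow_succ, mul_assoc]
    rw [hval]
    exact hasSum_psub_of_extension hp ι π hι hπ hex hY1 (ih hpY)

theorem hasSum_psub_free {p : ℕ} (hp : p.Prime) {d : ℕ} {C : Type*} [CommGroup C]
    (b : Module.Basis (Fin d) ℤ (Additive C)) {Y : ℂ} (hY : (p : ℝ) ^ d * ‖Y‖ < 1) :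
    HasSum (fun Γ : PSub p C => Y ^ plog p Γ.1.index)
      (∏ i ∈ Finset.range d, (1 - (p : ℂ) ^ i * Y)⁻¹) :=
  hasSum_psub_congr (MulEquiv.mk' (show C ≃ Multiplicative (Fin d → ℤ) from b.equivFun.toEquiv)
    (fun x y => map_add b.equivFun (Additive.ofMul x) (Additive.ofMul y))) Y (hasSum_psub_pi hp d hY)

end

section

/-! ### From subgroups to the Dirichlet series -/

theorem localNormalZeta_of_hasSum (G : Type*) [Group G] {p : ℕ} (hp : p.Prime) (s : ℂ) {S : ℂ}
    (h : HasSum (fun N : {N : Subgroup G // N.Normal ∧ ∃ n, N.index = p ^ n} =>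
      ((p : ℂ) ^ (-s)) ^ plog p N.1.index) S) :
    Summable (localNormalZetaTerm G p s) ∧ localNormalZeta G p s = S := by
  set Y : ℂ := (p : ℂ) ^ (-s) with hYdef
  have hp0 : (p : ℂ) ≠ 0 := by exact_mod_cast hp.ne_zero
  have hY : Y ≠ 0 := by rw [hYdef, Complex.cpow_def_of_ne_zero hp0]; exact Complex.exp_ne_zero _
  let e : (Σ n : ℕ, {N : Subgroup G // N.Normal ∧ N.index = p ^ n}) ≃
      {N : Subgroup G // N.Normal ∧ ∃ n, N.index = p ^ n} :=
    { toFun := fun x => ⟨x.2.1, x.2.2.1, x.1, x.2.2.2⟩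
      invFun := fun N => ⟨plog p N.1.index, N.1, N.2.1, (pow_plog hp N.2.2).symm⟩
      left_inv := by
        rintro ⟨n, N, hN, hn⟩
        have : plog p N.index = n := by rw [hn, plog_pow hp]
        subst this
        rfl
      right_inv := fun _ => rfl }
  have h1 : HasSum (fun x : Σ n : ℕ, {N : Subgroup G // N.Normal ∧ N.index = p ^ n} =>
      Y ^ x.1) S := by
    refine (e.hasSum_iff.2 h).congr_fun fun x => ?_
    show _ = Y ^ plog p x.2.1.index
    rw [x.2.2.2, plog_pow hp]
  have hterm : ∀ n, localNormalZetaTerm G p s n =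
      (Nat.card {N : Subgroup G // N.Normal ∧ N.index = p ^ n} : ℂ) * Y ^ n := by
    intro n
    rw [localNormalZetaTerm, normalSubgroupCount, hYdef, ← Complex.cpow_nat_mul]
    congr 2
    ring
  have h2 : ∀ n, HasSum (fun _ : {N : Subgroup G // N.Normal ∧ N.index = p ^ n} => Y ^ n)
      (localNormalZetaTerm G p s n) := by
    intro n
    have hs : Summable (fun _ : {N : Subgroup G // N.Normal ∧ N.index = p ^ n} => Y ^ n) :=
      h1.summable.sigma_factor n
    have hfin : Finite {N : Subgroup G // N.Normal ∧ N.index = p ^ n} := by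
      by_contra hinf
      rw [not_finite_iff_infinite] at hinf
      exact pow_ne_zero n hY ((summable_const_iff _).1 hs)
    have := Fintype.ofFinite {N : Subgroup G // N.Normal ∧ N.index = p ^ n}
    have h3 := hasSum_fintype
      (fun _ : {N : Subgroup G // N.Normal ∧ N.index = p ^ n} => Y ^ n)
    rw [sum_const, Finset.card_univ, ← Nat.card_eq_fintype_card, nsmul_eq_mul] at h3
    rwa [hterm]
  have h3 := h1.sigma h2
  exact ⟨h3.summable, h3.tsum_eq⟩

/-! ### The commutator pairing -/

/-- The commutator pairing `(u, v) ↦ (uᵗ m₁ v, uᵗ m₂ v, uᵗ m₃ v)`. -/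
def bracket {n : ℕ} (m : Fin 3 → Matrix (Fin n) (Fin n) ℤ) (u v : Fin n → ℤ) : Fin 3 → ℤ :=
  fun k => ∑ i, ∑ j, u i * m k i j * v j

section
variable {n : ℕ} (m : Fin 3 → Matrix (Fin n) (Fin n) ℤ)

lemma bracket_add_right (u v w : Fin n → ℤ) :
    bracket m u (v + w) = bracket m u v + bracket m u w := by
  funext k
  simp only [bracket, Pi.add_apply, mul_add, sum_add_distrib]

lemma bracket_add_left (u v w : Fin n → ℤ) :
    bracket m (u + v) w = bracket m u w + bracket m v w := by
  funext k
  simp only [bracket, Pi.add_apply, add_mul, sum_add_distrib]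

lemma bracket_smul_right (c : ℤ) (u v : Fin n → ℤ) :
    bracket m u (c • v) = c • bracket m u v := by
  funext k
  simp only [bracket, Pi.smul_apply, smul_eq_mul, mul_sum]
  exact sum_congr rfl fun i _ => sum_congr rfl fun j _ => by ring

lemma bracket_single (i j : Fin n) :
    bracket m (Pi.single i 1) (Pi.single j 1) = fun k => m k i j := by
  funext k
  rw [bracket, sum_eq_single i, sum_eq_single j]
  · simp
  · intro j' _ h; simp [h]
  · simp
  · intro i' _ h; simp [h]
  · simp

/-- The largest subgroup `X(Λ)` of `ℤⁿ` with `[ℤⁿ, X(Λ)] ⊆ Λ`. -/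
def centralizerMod (Λ : AddSubgroup (Fin 3 → ℤ)) : AddSubgroup (Fin n → ℤ) where
  carrier := {v | ∀ u, bracket m u v ∈ Λ}
  zero_mem' u := by
    have := bracket_smul_right m 0 u 0
    rw [zero_smul, zero_smul] at this
    rw [this]; exact Λ.zero_mem
  add_mem' hv hw u := by rw [bracket_add_right]; exact Λ.add_mem (hv u) (hw u)
  neg_mem' {v} hv u := by
    have := bracket_smul_right m (-1) u v
    rw [neg_one_smul, neg_one_smul] at this
    rw [this]; exact Λ.neg_mem (hv u)

lemma mem_centralizerMod {Λ : AddSubgroup (Fin 3 → ℤ)} {v : Fin n → ℤ} :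
    v ∈ centralizerMod m Λ ↔ ∀ u, bracket m u v ∈ Λ := Iff.rfl

end

lemma index_range_smul_pi (n : ℕ) (N : ℕ) :
    (zsmulAddGroupHom (N : ℤ) : (Fin n → ℤ) →+ (Fin n → ℤ)).range.index = N ^ n := by
  have h : (zsmulAddGroupHom (N : ℤ) : (Fin n → ℤ) →+ (Fin n → ℤ)).range =
      AddSubgroup.pi Set.univ (fun _ : Fin n => AddSubgroup.zmultiples (N : ℤ)) := by
    ext v
    simp only [AddMonoidHom.mem_range, AddSubgroup.mem_pi, Set.mem_univ, forall_true_left,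
      AddSubgroup.mem_zmultiples_iff]
    constructor
    · rintro ⟨w, rfl⟩ i
      exact ⟨w i, by simp [mul_comm]⟩
    · intro h
      choose w hw using h
      refine ⟨w, funext fun i => ?_⟩
      rw [← hw i]
      simp [mul_comm]
  rw [h, AddSubgroup.index_pi]
  simp [Int.index_zmultiples]

lemma index_centralizerMod {n p : ℕ} (hp : p.Prime) (m : Fin 3 → Matrix (Fin n) (Fin n) ℤ)
    (Λ : AddSubgroup (Fin 3 → ℤ)) (h : ∃ k, Λ.index = p ^ k) :
    ∃ k, (centralizerMod m Λ).index = p ^ k := by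
  refine exists_pow_of_dvd hp (m := (Λ.index) ^ n) ?_ ?_
  · obtain ⟨k, hk⟩ := h
    exact ⟨k * n, by rw [hk, pow_mul]⟩
  · rw [← index_range_smul_pi n Λ.index]
    refine AddSubgroup.index_dvd_of_le ?_
    rintro _ ⟨v, rfl⟩
    rw [mem_centralizerMod]
    intro u
    show bracket m u ((Λ.index : ℤ) • v) ∈ Λ
    rw [bracket_smul_right, natCast_zsmul]
    exact Λ.nsmul_index_mem _

/-! ### Torsion-free groups of class two -/

section Group
variable {G : Type*} [Group G]

lemma hom_ext_of_basis {Z : Type*} [Group Z] (hZ : ∀ a b : Z, a * b = b * a) {n : ℕ} {x : Fin n → G}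
    (bx : Module.Basis (Fin n) ℤ (Additive (Abelianization G)))
    (hx : ∀ i, bx i = Additive.ofMul (Abelianization.of (x i))) {φ ψ : G →* Z}
    (h : ∀ i, φ (x i) = ψ (x i)) : φ = ψ := by
  let _ : CommGroup Z := { ‹Group Z› with mul_comm := hZ }
  have h1 : Abelianization.lift φ = Abelianization.lift ψ := by
    have : (Abelianization.lift φ).toAdditive.toIntLinearMap =
        (Abelianization.lift ψ).toAdditive.toIntLinearMap := by
      refine bx.ext fun i => ?_
      rw [hx]
      exact congrArg Additive.ofMul (by simpa using h i)
    ext g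
    exact congrArg Additive.toMul (LinearMap.congr_fun this (Additive.ofMul (Abelianization.of g)))
  ext g
  simpa using DFunLike.congr_fun h1 (Abelianization.of g)

lemma commute_of_mem_center {z : G} (hz : z ∈ Subgroup.center G) (g : G) : Commute z g :=
  ((Subgroup.mem_center_iff.1 hz) g).symm

/-- In a group of class two the commutator is multiplicative in its first argument. -/
def commLeft (hc : commutator G ≤ Subgroup.center G) (h : G) : G →* Subgroup.center G where
  toFun g := ⟨g * h * g⁻¹ * h⁻¹, hc (Subgroup.commutator_mem_commutator (Subgroup.mem_top g)
    (Subgroup.mem_top h))⟩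
  map_one' := by ext; simp
  map_mul' g g' := by
    ext
    have h1 : g' * h * g'⁻¹ * h⁻¹ ∈ Subgroup.center G :=
      hc (Subgroup.commutator_mem_commutator (Subgroup.mem_top g') (Subgroup.mem_top h))
    have h2 := (commute_of_mem_center h1 (g * h * g⁻¹ * h⁻¹)).eq
    have h3 := (commute_of_mem_center h1 g).eq
    simp only [Subgroup.coe_mul]
    rw [← h2]
    calc g * g' * h * (g * g')⁻¹ * h⁻¹ = g * (g' * h * g'⁻¹ * h⁻¹) * h * g⁻¹ * h⁻¹ := by group
      _ = (g' * h * g'⁻¹ * h⁻¹) * g * h * g⁻¹ * h⁻¹ := by rw [h3]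
      _ = _ := by group

end Group

end

section

/-- The lattices of `p`-power index in `ℤⁿ`. -/
abbrev PLattice (p n : ℕ) : Type := {Λ : AddSubgroup (Fin n → ℤ) // ∃ k, Λ.index = p ^ k}

section Group
variable {G : Type*} [Group G] {n : ℕ}

/-- The parametrization of the centre by its basis. -/
def centreHom (y : Fin 3 → G) (hy : ∀ k, y k ∈ Subgroup.center G) :
    Multiplicative (Fin 3 → ℤ) →* G where
  toFun a := y 0 ^ a.toAdd 0 * y 1 ^ a.toAdd 1 * y 2 ^ a.toAdd 2
  map_one' := by simp
  map_mul' a b := by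
    have h : ∀ (k : Fin 3) (e : ℤ) (g : G), Commute (y k ^ e) g := fun k e g =>
      commute_of_mem_center (Subgroup.zpow_mem _ (hy k) e) g
    simp only [toAdd_mul, Pi.add_apply, zpow_add]
    have h1 := (h 1 (a.toAdd 1) (y 0 ^ b.toAdd 0)).eq
    have h2 := (h 2 (a.toAdd 2) (y 0 ^ b.toAdd 0 * y 1 ^ b.toAdd 1)).eq
    calc _ = y 0 ^ a.toAdd 0 * (y 0 ^ b.toAdd 0 * y 1 ^ a.toAdd 1) * y 1 ^ b.toAdd 1 *
          y 2 ^ a.toAdd 2 * y 2 ^ b.toAdd 2 := by group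
      _ = y 0 ^ a.toAdd 0 * y 1 ^ a.toAdd 1 * ((y 0 ^ b.toAdd 0 * y 1 ^ b.toAdd 1) *
          y 2 ^ a.toAdd 2) * y 2 ^ b.toAdd 2 := by rw [← h1]; group
      _ = _ := by rw [← h2]; group

lemma centreHom_apply (y : Fin 3 → G) (hy : ∀ k, y k ∈ Subgroup.center G) (a : Fin 3 → ℤ) :
    centreHom y hy (Multiplicative.ofAdd a) = y 0 ^ a 0 * y 1 ^ a 1 * y 2 ^ a 2 := rfl

lemma centreHom_mem (y : Fin 3 → G) (hy : ∀ k, y k ∈ Subgroup.center G)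
    (a : Multiplicative (Fin 3 → ℤ)) : centreHom y hy a ∈ Subgroup.center G :=
  Subgroup.mul_mem _ (Subgroup.mul_mem _ (Subgroup.zpow_mem _ (hy 0) _)
    (Subgroup.zpow_mem _ (hy 1) _)) (Subgroup.zpow_mem _ (hy 2) _)

/-- The coordinates of the image in the abelianization. -/
def abHom (bx : Module.Basis (Fin n) ℤ (Additive (Abelianization G))) :
    G →* Multiplicative (Fin n → ℤ) :=
  (AddMonoidHom.toMultiplicative bx.equivFun.toLinearMap.toAddMonoidHom :
    Multiplicative (Additive (Abelianization G)) →* Multiplicative (Fin n → ℤ)).comp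
    (Abelianization.of : G →* Abelianization G)

lemma abHom_apply (bx : Module.Basis (Fin n) ℤ (Additive (Abelianization G))) (g : G) :
    (abHom bx g).toAdd = bx.equivFun (Additive.ofMul (Abelianization.of g)) := rfl

theorem commutator_eq_centreHom (hZ : Subgroup.center G = commutator G) {x : Fin n → G}
    (bx : Module.Basis (Fin n) ℤ (Additive (Abelianization G)))
    (hx : ∀ i, bx i = Additive.ofMul (Abelianization.of (x i)))
    (y : Fin 3 → G) (hy : ∀ k, y k ∈ Subgroup.center G)
    (m : Fin 3 → Matrix (Fin n) (Fin n) ℤ)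
    (hm : ∀ i j, x i * x j * (x i)⁻¹ * (x j)⁻¹ =
      y 0 ^ m 0 i j * y 1 ^ m 1 i j * y 2 ^ m 2 i j) (g h : G) :
    g * h * g⁻¹ * h⁻¹ = centreHom y hy
      (Multiplicative.ofAdd (bracket m (abHom bx g).toAdd (abHom bx h).toAdd)) := by
  have hc : commutator G ≤ Subgroup.center G := hZ.ge
  have hxi : ∀ i, (abHom bx (x i)).toAdd = Pi.single i 1 := by
    intro i
    rw [abHom_apply, ← hx]
    funext j
    rw [Module.Basis.equivFun_self]
    simp [Pi.single_apply, eq_comm]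
  have hcc : ∀ a b : Subgroup.center G, a * b = b * a := fun a b =>
    Subtype.ext (commute_of_mem_center a.2 b.1).eq
  let L : G → G →* Subgroup.center G := fun h =>
    { toFun := fun g => ⟨centreHom y hy
        (Multiplicative.ofAdd (bracket m (abHom bx g).toAdd (abHom bx h).toAdd)),
        centreHom_mem y hy _⟩
      map_one' := by
        ext
        have : bracket m 0 (abHom bx h).toAdd = 0 := by
          have := bracket_add_left m 0 0 (abHom bx h).toAdd
          simpa using this
        simp [this]
      map_mul' := fun g g' => by
        ext
        simp only [map_mul, toAdd_mul, bracket_add_left, ofAdd_add, Subgroup.coe_mul] }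
  let R : G → G →* Subgroup.center G := fun g =>
    { toFun := fun h => ⟨centreHom y hy
        (Multiplicative.ofAdd (-bracket m (abHom bx g).toAdd (abHom bx h).toAdd)),
        centreHom_mem y hy _⟩
      map_one' := by
        ext
        have : bracket m (abHom bx g).toAdd 0 = 0 := by
          have := bracket_add_right m (abHom bx g).toAdd 0 0
          simpa using this
        simp [this]
      map_mul' := fun h h' => by
        ext
        simp only [map_mul, toAdd_mul, bracket_add_right, neg_add, ofAdd_add, Subgroup.coe_mul] }
  have hbase : ∀ i j, x i * x j * (x i)⁻¹ * (x j)⁻¹ = centreHom y hy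
      (Multiplicative.ofAdd (bracket m (abHom bx (x i)).toAdd (abHom bx (x j)).toAdd)) := by
    intro i j
    rw [hm, hxi, hxi, bracket_single, centreHom_apply]
  have h1 : ∀ (g : G) (j : Fin n), g * x j * g⁻¹ * (x j)⁻¹ = centreHom y hy
      (Multiplicative.ofAdd (bracket m (abHom bx g).toAdd (abHom bx (x j)).toAdd)) := by
    intro g j
    have : commLeft hc (x j) = L (x j) := hom_ext_of_basis hcc bx hx fun i => Subtype.ext (hbase i j)
    exact congrArg Subtype.val (DFunLike.congr_fun this g)
  have h2 : commLeft hc g = R g := by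
    refine hom_ext_of_basis hcc bx hx fun j => Subtype.ext ?_
    show x j * g * (x j)⁻¹ * g⁻¹ = centreHom y hy
      (Multiplicative.ofAdd (-bracket m (abHom bx g).toAdd (abHom bx (x j)).toAdd))
    rw [ofAdd_neg, map_inv, ← h1]
    group
  have h4 : h * g * h⁻¹ * g⁻¹ = centreHom y hy
      (Multiplicative.ofAdd (-bracket m (abHom bx g).toAdd (abHom bx h).toAdd)) :=
    congrArg Subtype.val (DFunLike.congr_fun h2 h)
  rw [ofAdd_neg, map_inv] at h4
  rw [← inv_inj, ← h4]
  group

theorem hasSum_normal_of_class_two (hZ : Subgroup.center G = commutator G) {x : Fin n → G}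
    (bx : Module.Basis (Fin n) ℤ (Additive (Abelianization G)))
    (hx : ∀ i, bx i = Additive.ofMul (Abelianization.of (x i)))
    (y : Fin 3 → G) (hy : ∀ k, y k ∈ Subgroup.center G)
    (hyb : ∀ z ∈ Subgroup.center G, ∃! a : Fin 3 → ℤ, z = y 0 ^ a 0 * y 1 ^ a 1 * y 2 ^ a 2)
    (m : Fin 3 → Matrix (Fin n) (Fin n) ℤ)
    (hm : ∀ i j, x i * x j * (x i)⁻¹ * (x j)⁻¹ =
      y 0 ^ m 0 i j * y 1 ^ m 1 i j * y 2 ^ m 2 i j) {p : ℕ} (hp : p.Prime) {Y S : ℂ}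
    (hY : (p : ℝ) ^ n * ‖Y‖ < 1)
    (hS : HasSum (fun Λ : PLattice p 3 => (Λ.1.index : ℂ) ^ n *
      Y ^ (plog p Λ.1.index + plog p (centralizerMod m Λ.1).index)) S) :
    HasSum (fun N : {N : Subgroup G // N.Normal ∧ ∃ n, N.index = p ^ n} =>
      Y ^ plog p N.1.index) ((∏ i ∈ Finset.range n, (1 - (p : ℂ) ^ i * Y)⁻¹) * S) := by
  have hι : Function.Injective (centreHom y hy) := by
    intro a b hab
    obtain ⟨c, -, hc⟩ := hyb _ (centreHom_mem y hy a)
    have h1 : a.toAdd = c := hc _ rfl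
    have h2 : b.toAdd = c := hc _ hab
    exact h1.trans h2.symm
  have hπ : Function.Surjective (abHom bx) := by
    intro v
    obtain ⟨w, hw⟩ := bx.equivFun.surjective v.toAdd
    obtain ⟨g, hg⟩ := (QuotientGroup.mk'_surjective (commutator G)) w.toMul
    refine ⟨g, ?_⟩
    rw [← ofAdd_toAdd v, ← hw, ← ofMul_toMul w, ← hg]
    rfl
  have hex : (abHom bx).ker = (centreHom y hy).range := by
    have h1 : (abHom bx).ker = commutator G := by
      ext g
      rw [MonoidHom.mem_ker, ← Abelianization.ker_of G, MonoidHom.mem_ker]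
      constructor
      · intro h
        exact bx.equivFun.injective (h.trans (map_zero bx.equivFun).symm)
      · intro h
        show bx.equivFun (Additive.ofMul (Abelianization.of g)) = 0
        rw [h]
        exact map_zero bx.equivFun
    rw [h1, ← hZ]
    ext g
    constructor
    · intro hg
      obtain ⟨a, ha, -⟩ := hyb g hg
      exact ⟨Multiplicative.ofAdd a, ha.symm⟩
    · rintro ⟨a, rfl⟩
      exact centreHom_mem y hy a
  let bN : Module.Basis (Fin n) ℤ (Additive (Multiplicative (Fin n → ℤ))) := Pi.basisFun ℤ (Fin n)
  let X : Subgroup (Multiplicative (Fin 3 → ℤ)) → Subgroup (Multiplicative (Fin n → ℤ)) :=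
    fun Λ => AddSubgroup.toSubgroup (centralizerMod m (AddSubgroup.toSubgroup.symm Λ))
  have hidx : ∀ Λ : Subgroup (Multiplicative (Fin 3 → ℤ)),
      (AddSubgroup.toSubgroup.symm Λ).index = Λ.index := fun Λ => by
    rw [← AddSubgroup.index_toSubgroup, OrderIso.apply_symm_apply]
  have hXi : ∀ Λ, (X Λ).index = (centralizerMod m (AddSubgroup.toSubgroup.symm Λ)).index :=
    fun Λ => AddSubgroup.index_toSubgroup _
  have hXp : ∀ Λ, (∃ k, Λ.index = p ^ k) → ∃ k, (X Λ).index = p ^ k := by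
    intro Λ h
    rw [hXi]
    exact index_centralizerMod hp m _ (by rwa [hidx])
  have hζ : ∀ Y : ℂ, (p : ℝ) ^ n * ‖Y‖ < 1 → ∀ Λ : PSub p (Multiplicative (Fin 3 → ℤ)),
      HasSum (fun Γ : PSub p (X Λ.1) => Y ^ plog p Γ.1.index)
        (∏ i ∈ Finset.range n, (1 - (p : ℂ) ^ i * Y)⁻¹) := by
    intro Y hY Λ
    obtain ⟨b⟩ := exists_basis_of_index_ne_zero bN (X Λ.1) (ne_zero_of_exists_pow hp (hXp _ Λ.2))
    exact hasSum_psub_free hp b hY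
  refine hasSum_normal_subgroups hp (centreHom y hy) (abHom bx) hι hπ hex
    (fun a g => commute_of_mem_center (centreHom_mem y hy a) g)
    (fun u v => Multiplicative.ofAdd (bracket m u.toAdd v.toAdd))
    (commutator_eq_centreHom hZ bx hx y hy m hm)
    (fun Γ hΓ => exists_basis_of_index_ne_zero bN Γ hΓ) X (fun Λ γ => ?_) hXp (hζ Y hY)
    (fun Λ => hasSum_norm_of_hasSum (hζ _ (by simpa using hY) Λ)) ?_
  · rfl
  · let e : PSub p (Multiplicative (Fin 3 → ℤ)) ≃ PLattice p 3 :=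
      (AddSubgroup.toSubgroup (A := Fin 3 → ℤ)).symm.toEquiv.subtypeEquiv fun Λ => by
        show _ ↔ ∃ n, (AddSubgroup.toSubgroup.symm Λ).index = p ^ n
        rw [hidx]
    have h2 := e.hasSum_iff.2 hS
    convert h2 using 2 with Λ
    show _ = ((AddSubgroup.toSubgroup.symm Λ.1).index : ℂ) ^ n *
      Y ^ (plog p (AddSubgroup.toSubgroup.symm Λ.1).index +
        plog p (centralizerMod m (AddSubgroup.toSubgroup.symm Λ.1)).index)
    rw [hidx, hXi]

end Group

/-- The generating series of lattices in `ℤⁿ` converges near zero. -/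
lemma summable_lattices {p n : ℕ} (hp : p.Prime) {Y : ℂ} (hY : (p : ℝ) ^ n * ‖Y‖ < 1) :
    Summable (fun Λ : PLattice p n => ‖Y‖ ^ plog p Λ.1.index) := by
  have h := (hasSum_psub_pi hp n hY).summable.norm
  let e : PLattice p n ≃ PSub p (Multiplicative (Fin n → ℤ)) :=
    (AddSubgroup.toSubgroup (A := Fin n → ℤ)).toEquiv.subtypeEquiv fun Λ => by
      show _ ↔ ∃ n, (AddSubgroup.toSubgroup Λ).index = p ^ n
      rw [AddSubgroup.index_toSubgroup]
  convert e.summable_iff.2 h using 2 with Λ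
  show _ = ‖Y ^ plog p (AddSubgroup.toSubgroup Λ.1).index‖
  rw [AddSubgroup.index_toSubgroup, norm_pow]

end

section

/-! ### Lattices in `ℤ³` -/

/-- Multiplication by `p` on `ℤⁿ`. -/
def mulp (p n : ℕ) : (Fin n → ℤ) →+ (Fin n → ℤ) := zsmulAddGroupHom (p : ℤ)

lemma mulp_apply (p n : ℕ) (v : Fin n → ℤ) : mulp p n v = (p : ℤ) • v := rfl

lemma mulp_injective {p n : ℕ} (hp : p.Prime) : Function.Injective (mulp p n) := by
  intro v w h
  funext i
  have := congrFun h i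
  simp only [mulp_apply, Pi.smul_apply, smul_eq_mul] at this
  exact mul_left_cancel₀ (by exact_mod_cast hp.ne_zero) this

/-- The lattice `{z | p z ∈ Λ}`. -/
def colon (p : ℕ) {n : ℕ} (Λ : AddSubgroup (Fin n → ℤ)) : AddSubgroup (Fin n → ℤ) :=
  Λ.comap (mulp p n)

/-- The order of `ℤⁿ / (Λ + p ℤⁿ)`. -/
def topIndex (p : ℕ) {n : ℕ} (Λ : AddSubgroup (Fin n → ℤ)) : ℕ := ((mulp p n).range ⊔ Λ).index

lemma map_colon (p : ℕ) {n : ℕ} (Λ : AddSubgroup (Fin n → ℤ)) :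
    (colon p Λ).map (mulp p n) = (mulp p n).range ⊓ Λ := by
  rw [colon, AddSubgroup.map_comap_eq]

lemma relIndex_mul_topIndex (p : ℕ) {n : ℕ} (Λ : AddSubgroup (Fin n → ℤ)) :
    (mulp p n).range.relIndex Λ * topIndex p Λ = p ^ n := by
  rw [topIndex, ← AddSubgroup.relIndex_sup_left, AddSubgroup.relIndex_mul_index le_sup_left]
  exact index_range_smul_pi n p

lemma index_map_mulp {p n : ℕ} (hp : p.Prime) (Λ : AddSubgroup (Fin n → ℤ)) :
    (Λ.map (mulp p n)).index = p ^ n * Λ.index := by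
  rw [AddSubgroup.index_map_of_injective _ (mulp_injective hp), mul_comm]
  congr 1
  exact index_range_smul_pi n p

lemma index_eq_topIndex_mul {p n : ℕ} (hp : p.Prime) (Λ : AddSubgroup (Fin n → ℤ)) :
    Λ.index = topIndex p Λ * (colon p Λ).index := by
  have h1 := index_map_mulp hp (colon p Λ)
  have h2 : ((colon p Λ).map (mulp p n)).relIndex Λ * Λ.index =
      ((colon p Λ).map (mulp p n)).index := by
    rw [map_colon p]; exact AddSubgroup.relIndex_mul_index inf_le_right
  rw [h1, map_colon p, AddSubgroup.inf_relIndex_right, ← relIndex_mul_topIndex p Λ,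
    mul_assoc] at h2
  refine Nat.eq_of_mul_eq_mul_left ?_ h2
  refine Nat.pos_of_ne_zero fun h => ?_
  have := relIndex_mul_topIndex p Λ
  rw [h, zero_mul] at this
  exact pow_ne_zero _ hp.ne_zero this.symm

lemma index_colon {p n : ℕ} (hp : p.Prime) {Λ : AddSubgroup (Fin n → ℤ)} (h : ∃ k, Λ.index = p ^ k) :
    ∃ k, (colon p Λ).index = p ^ k :=
  exists_pow_of_dvd hp h ⟨_, (index_eq_topIndex_mul hp Λ).trans (mul_comm _ _)⟩

lemma exists_topIndex {p n : ℕ} (hp : p.Prime) (Λ : AddSubgroup (Fin n → ℤ)) : ∃ i ≤ n, topIndex p Λ = p ^ i :=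
  (Nat.dvd_prime_pow hp).1 ⟨_, (relIndex_mul_topIndex p Λ).symm.trans (mul_comm _ _)⟩

lemma le_colon (p : ℕ) {n : ℕ} (Λ : AddSubgroup (Fin n → ℤ)) : Λ ≤ colon p Λ := by
  intro v hv
  show (p : ℤ) • v ∈ Λ
  exact Λ.zsmul_mem hv _

/-- Nakayama's lemma for lattices of `p`-power index. -/
lemma eq_top_of_topIndex_eq_one {p n : ℕ} (hp : p.Prime) {Λ : AddSubgroup (Fin n → ℤ)} (hΛ : ∃ k, Λ.index = p ^ k)
    (h : topIndex p Λ = 1) : Λ = ⊤ := by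
  have h1 := index_eq_topIndex_mul hp Λ
  rw [h, one_mul] at h1
  have h2 := AddSubgroup.relIndex_mul_index (le_colon p Λ)
  rw [h1] at h2
  have h3 : colon p Λ ≤ Λ := by
    rw [← AddSubgroup.relIndex_eq_one]
    have h0 : (colon p Λ).index ≠ 0 := ne_zero_of_exists_pow hp (index_colon hp hΛ)
    exact Nat.eq_of_mul_eq_mul_right (Nat.pos_of_ne_zero h0) (by rw [h2, one_mul])
  have h4 : ∀ (k : ℕ) (v : Fin n → ℤ), ((p : ℤ) ^ k) • v ∈ Λ → v ∈ Λ := by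
    intro k
    induction k with
    | zero => intro v hv; simpa using hv
    | succ k ih =>
      intro v hv
      refine ih v (h3 ?_)
      show (p : ℤ) • ((p : ℤ) ^ k) • v ∈ Λ
      rwa [smul_smul, ← pow_succ']
  obtain ⟨k, hk⟩ := hΛ
  refine eq_top_iff.2 fun v _ => h4 k v ?_
  have := Λ.nsmul_index_mem v
  rw [hk] at this
  rw [← Nat.cast_pow, natCast_zsmul]
  exact this

/-- The lattices `Λ` with `Λ ⊄ p ℤⁿ`-index `p` in `Λ` and given `colon`. -/
lemma card_fiber_colon {p n : ℕ} (hp : p.Prime) (Λ' : AddSubgroup (Fin n → ℤ)) (hΛ' : ∃ k, Λ'.index = p ^ k) (hn : 0 < n) :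
    (p - 1) * Nat.card {Λ : PLattice p n // topIndex p Λ.1 = p ^ (n - 1) ∧ colon p Λ.1 = Λ'} +
      topIndex p Λ' = p ^ n := by
  classical
  have hΛ'0 : Λ'.index ≠ 0 := ne_zero_of_exists_pow hp hΛ'
  set P := Λ'.map (mulp p n) with hP
  have hPΛ : P ≤ Λ' := by
    rintro _ ⟨v, hv, rfl⟩
    exact Λ'.zsmul_mem hv _
  set K : AddSubgroup Λ' := P.addSubgroupOf Λ' with hK
  let V := Λ' ⧸ K
  let q : Λ' →+ V := QuotientAddGroup.mk' K
  have hqker : q.ker = K := QuotientAddGroup.ker_mk' K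
  have hq : Function.Surjective q := QuotientAddGroup.mk'_surjective K
  have hPrel : P.relIndex Λ' = p ^ n := by
    have h1 := AddSubgroup.relIndex_mul_index hPΛ
    rw [hP, index_map_mulp hp] at h1
    exact Nat.eq_of_mul_eq_mul_right (Nat.pos_of_ne_zero hΛ'0) h1
  have hVcard : Nat.card V = p ^ n := by rw [← hPrel]; rfl
  have hVfin : Finite V := (Nat.card_ne_zero.1 (by rw [hVcard]; exact pow_ne_zero _ hp.ne_zero)).2
  have hpV : ∀ x : V, p • x = 0 := by
    intro x
    obtain ⟨v, rfl⟩ := hq x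
    rw [← map_nsmul, ← AddMonoidHom.mem_ker, hqker, hK, AddSubgroup.mem_addSubgroupOf]
    exact ⟨v.1, v.2, by rw [mulp_apply, natCast_zsmul]; rfl⟩
  set U : AddSubgroup V := ((mulp p n).range.addSubgroupOf Λ').map q with hU
  have hPle : P ≤ (mulp p n).range := by
    rintro _ ⟨v, -, rfl⟩
    exact ⟨v, rfl⟩
  have hmemU : ∀ v : Λ', q v ∈ U ↔ v.1 ∈ (mulp p n).range := by
    intro v
    constructor
    · rintro ⟨w, hw, hwv⟩
      have : -w + v ∈ K := by
        rw [← hqker, AddMonoidHom.mem_ker, map_add, map_neg, hwv, neg_add_cancel]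
      have h2 := hPle (AddSubgroup.mem_addSubgroupOf.1 this)
      have h3 : (w : Fin n → ℤ) ∈ (mulp p n).range := hw
      simpa using (mulp p n).range.add_mem h3 h2
    · intro h
      exact ⟨v, h, rfl⟩
  have hUcard : Nat.card U = topIndex p Λ' := by
    have h1 : Nat.card U = K.relIndex ((mulp p n).range.addSubgroupOf Λ') := by
      rw [hU, ← AddSubgroup.relIndex_ker, hqker]
    have hKle : K ≤ (mulp p n).range.addSubgroupOf Λ' :=
      fun v hv => hPle hv
    have h2 := AddSubgroup.relIndex_mul_index hKle
    have h3 : ((mulp p n).range.addSubgroupOf Λ').index = (mulp p n).range.relIndex Λ' := rfl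
    have h4 : K.index = p ^ n := hPrel
    have h5 := relIndex_mul_topIndex p Λ'
    rw [h3, h4, ← h5, mul_comm] at h2
    rw [h1]
    refine Nat.eq_of_mul_eq_mul_left (Nat.pos_of_ne_zero fun h => ?_) h2
    rw [h, zero_mul] at h5
    exact pow_ne_zero _ hp.ne_zero h5.symm
  let F := {Λ : PLattice p n // topIndex p Λ.1 = p ^ (n - 1) ∧ colon p Λ.1 = Λ'}
  let im : AddSubgroup (Fin n → ℤ) → AddSubgroup V := fun Λ => (Λ.addSubgroupOf Λ').map q
  have hFle : ∀ Λ : F, Λ.1.1 ≤ Λ' := fun Λ => by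
    have := le_colon p Λ.1.1
    rwa [Λ.2.2] at this
  have hFP : ∀ Λ : F, P = (mulp p n).range ⊓ Λ.1.1 := fun Λ => by
    rw [← map_colon p, Λ.2.2]
  have hmem : ∀ Λ : F, ∀ v : Λ', q v ∈ im Λ.1.1 ↔ v.1 ∈ Λ.1.1 := by
    intro Λ v
    constructor
    · rintro ⟨w, hw, hwv⟩
      have : -w + v ∈ K := by
        rw [← hqker, AddMonoidHom.mem_ker, map_add, map_neg, hwv, neg_add_cancel]
      have h2 := AddSubgroup.mem_addSubgroupOf.1 this
      rw [hFP Λ] at h2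
      have h3 : (w : Fin n → ℤ) ∈ Λ.1.1 := hw
      simpa using Λ.1.1.add_mem h3 h2.2
    · intro h
      exact ⟨v, h, rfl⟩
  have hpn : p ^ n = p * p ^ (n - 1) := by rw [← pow_succ']; congr 1; omega
  have himcard : ∀ Λ : F, Nat.card (im Λ.1.1) = p := by
    intro Λ
    have h1 : Nat.card (im Λ.1.1) = K.relIndex (Λ.1.1.addSubgroupOf Λ') := by
      rw [← AddSubgroup.relIndex_ker, hqker]
    rw [h1, hK, AddSubgroup.relIndex_addSubgroupOf (hFle Λ), hFP Λ, AddSubgroup.inf_relIndex_right]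
    have h5 := relIndex_mul_topIndex p Λ.1.1
    rw [Λ.2.1, hpn] at h5
    exact Nat.eq_of_mul_eq_mul_right (pow_pos hp.pos _) h5
  have hgen : ∀ (W : AddSubgroup V), Nat.card W = p → ∀ x ∈ W, x ≠ 0 →
      W = AddSubgroup.zmultiples x := by
    intro W hW x hx hx0
    have hfp := Fact.mk hp
    refine le_antisymm (fun y hy => ?_) ((AddSubgroup.zmultiples_le_of_mem hx))
    have h2 := mem_zmultiples_of_prime_card (p := p) hW (g := (⟨x, hx⟩ : W)) (g' := ⟨y, hy⟩)
      (fun h => hx0 (congrArg Subtype.val h))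
    obtain ⟨k, hk⟩ := h2
    exact ⟨k, congrArg Subtype.val hk⟩
  have hzcard : ∀ x : V, x ≠ 0 → Nat.card (AddSubgroup.zmultiples x) = p := by
    intro x hx
    rw [Nat.card_zmultiples]
    have hfp := Fact.mk hp
    exact addOrderOf_eq_prime (hpV x) hx
  have hinj : ∀ Λ₁ Λ₂ : F, im Λ₁.1.1 = im Λ₂.1.1 → Λ₁ = Λ₂ := by
    intro Λ₁ Λ₂ h3
    apply Subtype.ext
    apply Subtype.ext
    ext v
    constructor
    · intro hv
      have := (hmem Λ₁ ⟨v, hFle Λ₁ hv⟩).2 hv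
      rw [h3, hmem] at this
      exact this
    · intro hv
      have := (hmem Λ₂ ⟨v, hFle Λ₂ hv⟩).2 hv
      rw [← h3, hmem] at this
      exact this
  have hFfin : Finite F := Finite.of_injective (fun Λ : F => im Λ.1.1) fun _ _ h => hinj _ _ h
  let g : (Σ Λ : F, {x : V // x ∈ im Λ.1.1 ∧ x ≠ 0}) → {x : V // x ∉ U} := fun s => ⟨s.2.1, by
    obtain ⟨Λ, x, hx, hx0⟩ := s
    obtain ⟨v, rfl⟩ := hq x
    intro hxU
    rw [hmemU] at hxU
    rw [hmem] at hx
    apply hx0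
    rw [← AddMonoidHom.mem_ker, hqker, hK, AddSubgroup.mem_addSubgroupOf, hFP Λ]
    exact ⟨hxU, hx⟩⟩
  have hg : Function.Bijective g := by
    constructor
    · rintro ⟨Λ₁, x, hx₁, hx0⟩ ⟨Λ₂, x', hx₂, _⟩ h
      have hxx : x = x' := congrArg Subtype.val h
      subst hxx
      have : Λ₁ = Λ₂ := hinj _ _ (by
        rw [hgen _ (himcard Λ₁) x hx₁ hx0, hgen _ (himcard Λ₂) x hx₂ hx0])
      subst this
      rfl
    · rintro ⟨x, hxU⟩
      have hx0 : x ≠ 0 := fun h => hxU (h ▸ U.zero_mem)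
      let Λ : AddSubgroup (Fin n → ℤ) := ((AddSubgroup.zmultiples x).comap q).map Λ'.subtype
      have hΛle : Λ ≤ Λ' := by
        rintro _ ⟨v, -, rfl⟩
        exact v.2
      have hΛmem : ∀ v : Λ', v.1 ∈ Λ ↔ q v ∈ AddSubgroup.zmultiples x := by
        intro v
        constructor
        · rintro ⟨w, hw, hwv⟩
          rw [← Subtype.ext hwv]; exact hw
        · intro h
          exact ⟨v, h, rfl⟩
      have hPΛ2 : P ≤ Λ := by
        intro v hv
        rw [hΛmem ⟨v, hPΛ hv⟩]
        have : (⟨v, hPΛ hv⟩ : Λ') ∈ K := hv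
        rw [← hqker, AddMonoidHom.mem_ker] at this
        rw [this]; exact AddSubgroup.zero_mem _
      have hinf : (mulp p n).range ⊓ Λ = P := by
        refine le_antisymm ?_ (le_inf hPle hPΛ2)
        rintro v ⟨hv1, hv2⟩
        have h1 := (hmemU ⟨v, hΛle hv2⟩).2 hv1
        have h2 := (hΛmem ⟨v, hΛle hv2⟩).1 hv2
        by_contra hvP
        have h3 : q ⟨v, hΛle hv2⟩ ≠ 0 := by
          intro h
          rw [← AddMonoidHom.mem_ker, hqker] at h
          exact hvP h
        have h4 := hgen _ (hzcard x hx0) _ h2 h3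
        apply hxU
        have h5 : x ∈ AddSubgroup.zmultiples (q ⟨v, hΛle hv2⟩) :=
          h4 ▸ AddSubgroup.mem_zmultiples x
        exact AddSubgroup.zmultiples_le_of_mem h1 h5
      have hcol : colon p Λ = Λ' := by
        have := map_colon p Λ
        rw [hinf, hP] at this
        exact AddSubgroup.map_injective (mulp_injective hp) this
      have hidx : ∃ k, Λ.index = p ^ k := by
        refine exists_pow_of_dvd hp ?_ (AddSubgroup.index_dvd_of_le hPΛ2)
        obtain ⟨k, hk⟩ := hΛ'
        exact ⟨n + k, by rw [hP, index_map_mulp hp, hk, pow_add]⟩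
      have him : im Λ = AddSubgroup.zmultiples x := by
        ext y
        constructor
        · rintro ⟨v, hv, rfl⟩
          exact (hΛmem v).1 hv
        · intro hy
          obtain ⟨v, rfl⟩ := hq y
          exact ⟨v, (hΛmem v).2 hy, rfl⟩
      have htop : topIndex p Λ = p ^ (n - 1) := by
        have h1 : Nat.card (im Λ) = K.relIndex (Λ.addSubgroupOf Λ') := by
          rw [← AddSubgroup.relIndex_ker, hqker]
        rw [him, hzcard x hx0, hK, AddSubgroup.relIndex_addSubgroupOf hΛle, ← hinf,
          AddSubgroup.inf_relIndex_right] at h1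
        have h5 := relIndex_mul_topIndex p Λ
        rw [← h1, hpn] at h5
        exact Nat.eq_of_mul_eq_mul_left hp.pos h5
      refine ⟨⟨⟨⟨Λ, hidx⟩, htop, hcol⟩, x, ?_, hx0⟩, rfl⟩
      show x ∈ im Λ
      rw [him]; exact AddSubgroup.mem_zmultiples x
  have hfinx : ∀ Λ : F, Nat.card {x : V // x ∈ im Λ.1.1 ∧ x ≠ 0} = p - 1 := by
    intro Λ
    have h1 := himcard Λ
    have : Nat.card {x : V // x ∈ im Λ.1.1 ∧ x ≠ 0} = ((im Λ.1.1 : Set V) \ {0}).ncard := rfl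
    rw [this, Set.ncard_sdiff_singleton_of_mem (im Λ.1.1).zero_mem]
    exact congrArg (· - 1) h1
  have hcount : Nat.card (Σ Λ : F, {x : V // x ∈ im Λ.1.1 ∧ x ≠ 0}) = (p - 1) * Nat.card F := by
    have := Fintype.ofFinite F
    rw [Nat.card_sigma, sum_congr rfl fun Λ _ => hfinx Λ, sum_const, smul_eq_mul,
      Finset.card_univ, Nat.card_eq_fintype_card, mul_comm]
  have hcompl : Nat.card {x : V // x ∉ U} + Nat.card U = Nat.card V := by
    have := Set.ncard_add_ncard_compl (U : Set V)
    rw [add_comm]; exact this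
  rw [← hcount, Nat.card_eq_of_bijective g hg, ← hUcard, hcompl, hVcard]

end

section

/-- The contribution of a lattice `Λ` of the centre to the local zeta function. -/
def latticeTerm {n : ℕ} (m : Fin 3 → Matrix (Fin n) (Fin n) ℤ) (p : ℕ) (Y : ℂ)
    (Λ : AddSubgroup (Fin 3 → ℤ)) : ℂ :=
  (Λ.index : ℂ) ^ n * Y ^ (plog p Λ.index + plog p (centralizerMod m Λ).index)

lemma summable_latticeTerm {n : ℕ} (m : Fin 3 → Matrix (Fin n) (Fin n) ℤ) {p : ℕ} (hp : p.Prime)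
    {Y : ℂ} (hY : (p : ℝ) ^ (n + 3) * ‖Y‖ < 1) :
    Summable (fun Λ : PLattice p 3 => latticeTerm m p Y Λ.1) := by
  have hp1 : (1 : ℝ) ≤ p := by exact_mod_cast hp.one_lt.le
  have hY1 : ‖Y‖ ≤ 1 := by
    refine le_trans ?_ hY.le
    exact le_mul_of_one_le_left (norm_nonneg _) (one_le_pow₀ hp1)
  have h := summable_lattices (p := p) (n := 3) hp (Y := (p : ℂ) ^ n * Y) (by
    rw [norm_mul, norm_pow, Complex.norm_natCast, ← mul_assoc, ← pow_add, add_comm 3 n]; exact hY)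
  refine Summable.of_norm_bounded h fun Λ => ?_
  have hpow := pow_plog hp Λ.2
  rw [latticeTerm, norm_mul, norm_pow, norm_pow, Complex.norm_natCast, norm_mul, norm_pow,
    Complex.norm_natCast, mul_pow, pow_add]
  have e : ((Λ.1.index : ℕ) : ℝ) ^ n = ((p : ℝ) ^ n) ^ plog p Λ.1.index := by
    conv_lhs => rw [← hpow]
    push_cast
    rw [← pow_mul, ← pow_mul, mul_comm]
  rw [e]
  refine mul_le_mul_of_nonneg_left ?_ (by positivity)
  exact mul_le_of_le_one_right (by positivity) (pow_le_one₀ (norm_nonneg _) hY1)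

lemma tsum_eq_tsum_fiber {α β : Type*} (κ : α → β) {w : α → ℂ} (hw : Summable w) :
    ∑' a, w a = ∑' b, ∑' a : {a // κ a = b}, w a.1 := by
  rw [← (Equiv.sigmaFiberEquiv κ).tsum_eq]
  exact Summable.tsum_sigma ((Equiv.sigmaFiberEquiv κ).summable_iff.2 hw)

lemma tsum_mul_comp_of_finite {T ι : Type*} [Fintype ι] (cls : T → ι) {w : T → ℂ} (hw : Summable w)
    (a : ι → ℂ) :
    ∑' t, a (cls t) * w t = ∑ i, a i * ∑' t : {t // cls t = i}, w t.1 := by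
  obtain ⟨C, hC⟩ : ∃ C : ℝ, ∀ i, ‖a i‖ ≤ C :=
    ⟨∑ i, ‖a i‖, fun i => Finset.single_le_sum (f := fun i => ‖a i‖)
      (fun _ _ => norm_nonneg _) (mem_univ i)⟩
  have hs : Summable fun t => a (cls t) * w t :=
    Summable.of_norm_bounded (hw.norm.mul_left C) fun t => by
      rw [norm_mul]; exact mul_le_mul_of_nonneg_right (hC _) (norm_nonneg _)
  rw [tsum_eq_tsum_fiber cls hs, tsum_fintype]
  refine sum_congr rfl fun i _ => ?_
  rw [← tsum_mul_left]
  refine tsum_congr fun t => ?_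
  show a (cls t.1) * w t.1 = _
  rw [t.2]

section

variable {n : ℕ} {m : Fin 3 → Matrix (Fin n) (Fin n) ℤ} {p : ℕ}

lemma centralizerMod_eq_map {Λ : AddSubgroup (Fin 3 → ℤ)}
    (h : ∀ v ∈ centralizerMod m Λ, ∃ w, v = (p : ℤ) • w) :
    centralizerMod m Λ = (centralizerMod m (colon p Λ)).map (mulp p n) := by
  ext v
  constructor
  · intro hv
    obtain ⟨w, rfl⟩ := h v hv
    refine ⟨w, ?_, rfl⟩
    rw [SetLike.mem_coe, mem_centralizerMod]
    intro u
    have := (mem_centralizerMod m).1 hv u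
    rw [bracket_smul_right] at this
    exact this
  · rintro ⟨w, hw, rfl⟩
    rw [mem_centralizerMod]
    intro u
    rw [mulp_apply, bracket_smul_right]
    exact (mem_centralizerMod m).1 hw u

lemma latticeTerm_eq_colon (hp : p.Prime) (Y : ℂ) {Λ : AddSubgroup (Fin 3 → ℤ)} {i : ℕ}
    (hΛ : ∃ k, Λ.index = p ^ k) (hi : topIndex p Λ = p ^ i)
    (h : ∀ v ∈ centralizerMod m Λ, ∃ w, v = (p : ℤ) • w) :
    latticeTerm m p Y Λ = (p : ℂ) ^ (i * n) * Y ^ (n + i) * latticeTerm m p Y (colon p Λ) := by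
  have hc := index_colon hp hΛ
  have hc0 := ne_zero_of_exists_pow hp hc
  have hx0 : (centralizerMod m (colon p Λ)).index ≠ 0 :=
    ne_zero_of_exists_pow hp (index_centralizerMod hp m _ hc)
  have hpi : p ^ i ≠ 0 := pow_ne_zero _ hp.ne_zero
  have hpn : p ^ n ≠ 0 := pow_ne_zero _ hp.ne_zero
  rw [latticeTerm, latticeTerm, centralizerMod_eq_map h, index_map_mulp hp,
    index_eq_topIndex_mul hp Λ, hi, plog_mul hpi hc0, plog_mul hpn hx0, plog_pow hp, plog_pow hp]
  push_cast
  rw [pow_mul]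
  ring

theorem hasSum_lattices_of_cyclic (hp : p.Prime) {Y : ℂ} (hY : (p : ℝ) ^ (n + 3) * ‖Y‖ < 1)
    (hY' : (p : ℂ) ^ (3 * n) * Y ^ (n + 3) ≠ 1)
    (hX : ∀ Λ : AddSubgroup (Fin 3 → ℤ), (∃ k, Λ.index = p ^ k) → p ^ 2 ∣ topIndex p Λ →
      ∀ v ∈ centralizerMod m Λ, ∃ w, v = (p : ℤ) • w) {Z₁ : ℂ}
    (h₁ : HasSum (fun Λ : {Λ : PLattice p 3 // topIndex p Λ.1 = p} => latticeTerm m p Y Λ.1.1) Z₁) :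
    ∃ Z₂ : ℂ, Z₂ = (p : ℂ) ^ (2 * n) * Y ^ (n + 2) *
        (((p : ℂ) ^ 2 + p + 1) + ((p : ℂ) ^ 2 + p) * Z₁ + (p : ℂ) ^ 2 * Z₂) ∧
      HasSum (fun Λ : PLattice p 3 => latticeTerm m p Y Λ.1)
        ((1 - (p : ℂ) ^ (3 * n) * Y ^ (n + 3))⁻¹ * (1 + Z₁ + Z₂)) := by
  classical
  set w : PLattice p 3 → ℂ := fun Λ => latticeTerm m p Y Λ.1 with hw
  have hs : Summable w := summable_latticeTerm m hp hY
  have hp1 : (p : ℂ) - 1 ≠ 0 := by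
    rw [sub_ne_zero]; exact_mod_cast hp.one_lt.ne'
  have hclsex : ∀ Λ : PLattice p 3, ∃ i : Fin 4, topIndex p Λ.1 = p ^ (i : ℕ) := fun Λ => by
    obtain ⟨i, hi, h⟩ := exists_topIndex hp Λ.1
    exact ⟨⟨i, by omega⟩, h⟩
  choose cls hcls using hclsex
  have hcls_iff : ∀ (Λ : PLattice p 3) (i : Fin 4), cls Λ = i ↔ topIndex p Λ.1 = p ^ (i : ℕ) := by
    intro Λ i
    constructor
    · rintro rfl; exact hcls Λ
    · intro h
      rw [hcls] at h
      exact Fin.ext (Nat.pow_right_injective hp.two_le h)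
  let Z : Fin 4 → ℂ := fun i => ∑' Λ : {Λ // cls Λ = i}, w Λ.1
  have htot : ∑' Λ, w Λ = Z 0 + Z 1 + Z 2 + Z 3 := by
    have := tsum_mul_comp_of_finite cls hs (fun _ => 1)
    simpa [Fin.sum_univ_four, Z] using this
  have hpl : ∀ Λ : PLattice p 3, ∃ Λ' : PLattice p 3, Λ'.1 = colon p Λ.1 := fun Λ =>
    ⟨⟨_, index_colon hp Λ.2⟩, rfl⟩
  choose col hcol using hpl
  have hZ0 : Z 0 = 1 := by
    let e : PLattice p 3 := ⟨⊤, 0, by simp⟩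
    have he : cls e = 0 := by
      rw [hcls_iff]
      simp [topIndex, e]
    have h1 : ∀ Λ : {Λ // cls Λ = 0}, Λ ≠ ⟨e, he⟩ → w Λ.1 = 0 := by
      intro Λ hΛ
      exfalso
      apply hΛ
      apply Subtype.ext
      apply Subtype.ext
      exact eq_top_of_topIndex_eq_one hp Λ.1.2 (by simpa using (hcls_iff _ _).1 Λ.2)
    show ∑' Λ : {Λ // cls Λ = 0}, w Λ.1 = 1
    rw [tsum_eq_single (⟨e, he⟩ : {Λ // cls Λ = 0}) h1]
    have htop : centralizerMod m (⊤ : AddSubgroup (Fin 3 → ℤ)) = ⊤ := by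
      refine eq_top_iff.2 fun v _ => ?_
      rw [mem_centralizerMod]
      exact fun _ => AddSubgroup.mem_top _
    simp [w, e, latticeTerm, htop, plog]
  have hZ1 : Z 1 = Z₁ := by
    let e : {Λ : PLattice p 3 // topIndex p Λ.1 = p} ≃ {Λ // cls Λ = 1} :=
      Equiv.subtypeEquivRight fun Λ => by rw [hcls_iff]; simp
    show ∑' Λ : {Λ // cls Λ = 1}, w Λ.1 = Z₁
    rw [← e.tsum_eq]
    exact h₁.tsum_eq
  have hZ3 : Z 3 = (p : ℂ) ^ (3 * n) * Y ^ (n + 3) * ∑' Λ, w Λ := by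
    have hcolmap : ∀ Λ : AddSubgroup (Fin 3 → ℤ), colon p (Λ.map (mulp p 3)) = Λ := fun Λ =>
      AddSubgroup.comap_map_eq_self_of_injective (mulp_injective hp) Λ
    let d : PLattice p 3 → PLattice p 3 := fun Λ => ⟨Λ.1.map (mulp p 3), by
      obtain ⟨k, hk⟩ := Λ.2
      exact ⟨3 + k, by rw [index_map_mulp hp, hk, pow_add]⟩⟩
    have hd : ∀ Λ, cls (d Λ) = 3 := fun Λ => by
      rw [hcls_iff]
      show ((mulp p 3).range ⊔ Λ.1.map (mulp p 3)).index = p ^ 3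
      rw [sup_eq_left.2]
      · exact index_range_smul_pi 3 p
      · rintro _ ⟨v, -, rfl⟩
        exact ⟨v, rfl⟩
    let e : PLattice p 3 ≃ {Λ // cls Λ = 3} := Equiv.ofBijective (fun Λ => ⟨d Λ, hd Λ⟩) (by
      constructor
      · intro Λ₁ Λ₂ h
        have h2 : Λ₁.1.map (mulp p 3) = Λ₂.1.map (mulp p 3) :=
          congrArg (fun x : {Λ // cls Λ = 3} => x.1.1) h
        exact Subtype.ext (AddSubgroup.map_injective (mulp_injective hp) h2)
      · rintro ⟨Λ, hΛ⟩
        refine ⟨col Λ, Subtype.ext (Subtype.ext ?_)⟩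
        show (col Λ).1.map (mulp p 3) = Λ.1
        rw [hcol, map_colon]
        have h3 : topIndex p Λ.1 = p ^ 3 := (hcls_iff _ _).1 hΛ
        have h4 := relIndex_mul_topIndex p Λ.1
        rw [h3] at h4
        have h5 : (mulp p 3).range.relIndex Λ.1 = 1 :=
          Nat.eq_of_mul_eq_mul_right (pow_pos hp.pos 3) (by rw [h4, one_mul])
        rw [AddSubgroup.relIndex_eq_one] at h5
        exact inf_eq_right.2 h5)
    show ∑' Λ : {Λ // cls Λ = 3}, w Λ.1 = _
    rw [← e.tsum_eq, ← tsum_mul_left]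
    refine tsum_congr fun Λ => ?_
    show latticeTerm m p Y (d Λ).1 = _
    have h3 := (hcls_iff _ _).1 (hd Λ)
    have := latticeTerm_eq_colon (m := m) hp Y (d Λ).2 h3 (hX _ (d Λ).2 (by
      rw [h3]; exact pow_dvd_pow p (by decide)))
    rw [this, hcolmap]
    rfl
  have hZ2 : Z 2 = (p : ℂ) ^ (2 * n) * Y ^ (n + 2) *
      (((p : ℂ) ^ 2 + p + 1) * Z 0 + ((p : ℂ) ^ 2 + p) * Z 1 + (p : ℂ) ^ 2 * Z 2) := by
    let κ : {Λ // cls Λ = 2} → PLattice p 3 := fun Λ => col Λ.1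
    have hs2 : Summable fun Λ : {Λ // cls Λ = 2} => w Λ.1 := hs.subtype _
    have e0 : Z 2 = ∑' Λ' : PLattice p 3, ∑' Λ : {Λ // κ Λ = Λ'}, w Λ.1.1 :=
      tsum_eq_tsum_fiber κ hs2
    let a : Fin 4 → ℂ := fun i => (p : ℂ) ^ (2 * n) * Y ^ (n + 2) *
      (((p : ℂ) ^ 3 - (p : ℂ) ^ (i : ℕ)) / ((p : ℂ) - 1))
    have e1 : ∀ Λ' : PLattice p 3, ∑' Λ : {Λ // κ Λ = Λ'}, w Λ.1.1 = a (cls Λ') * w Λ' := by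
      intro Λ'
      have h1 : ∀ Λ : {Λ // κ Λ = Λ'}, w Λ.1.1 = (p : ℂ) ^ (2 * n) * Y ^ (n + 2) * w Λ' := by
        rintro ⟨⟨Λ, hΛ⟩, hΛ'⟩
        have h3 : topIndex p Λ.1 = p ^ 2 := (hcls_iff _ _).1 hΛ
        have := latticeTerm_eq_colon (m := m) hp Y Λ.2 h3 (hX _ Λ.2 (by rw [h3]))
        show latticeTerm m p Y Λ.1 = _
        rw [this, ← hcol]
        have h4 : col Λ = Λ' := hΛ'
        rw [h4]
      rw [tsum_congr h1, tsum_const]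
      have hcard : Nat.card {Λ // κ Λ = Λ'} =
          Nat.card {Λ : PLattice p 3 // topIndex p Λ.1 = p ^ (3 - 1) ∧ colon p Λ.1 = Λ'.1} := by
        refine Nat.card_congr ((Equiv.subtypeSubtypeEquivSubtypeInter (fun Λ => cls Λ = 2)
          (fun Λ => col Λ = Λ')).trans (Equiv.subtypeEquivRight fun Λ => ?_))
        rw [hcls_iff, ← hcol, Subtype.ext_iff]
        rfl
      have hf := card_fiber_colon hp Λ'.1 Λ'.2 (by decide)
      rw [← hcard, hcls] at hf
      have hf' : ((p : ℂ) - 1) * (Nat.card {Λ // κ Λ = Λ'} : ℂ) + (p : ℂ) ^ (cls Λ' : ℕ) =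
          (p : ℂ) ^ 3 := by
        have := congrArg (Nat.cast (R := ℂ)) hf
        push_cast [Nat.cast_sub hp.one_lt.le] at this
        exact this
      have : (Nat.card {Λ // κ Λ = Λ'} : ℂ) =
          ((p : ℂ) ^ 3 - (p : ℂ) ^ (cls Λ' : ℕ)) / ((p : ℂ) - 1) := by
        rw [eq_div_iff hp1, ← hf']; ring
      rw [nsmul_eq_mul, this]
      ring
    rw [tsum_congr e1, tsum_mul_comp_of_finite cls hs a, Fin.sum_univ_four] at e0
    have b0 : ((p : ℂ) ^ 3 - (p : ℂ) ^ 0) / ((p : ℂ) - 1) = (p : ℂ) ^ 2 + p + 1 := by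
      rw [div_eq_iff hp1]; ring
    have b1 : ((p : ℂ) ^ 3 - (p : ℂ) ^ 1) / ((p : ℂ) - 1) = (p : ℂ) ^ 2 + p := by
      rw [div_eq_iff hp1]; ring
    have b2 : ((p : ℂ) ^ 3 - (p : ℂ) ^ 2) / ((p : ℂ) - 1) = (p : ℂ) ^ 2 := by
      rw [div_eq_iff hp1]; ring
    have a0 : a 0 = (p : ℂ) ^ (2 * n) * Y ^ (n + 2) * ((p : ℂ) ^ 2 + p + 1) := by rw [← b0]; rfl
    have a1 : a 1 = (p : ℂ) ^ (2 * n) * Y ^ (n + 2) * ((p : ℂ) ^ 2 + p) := by rw [← b1]; rfl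
    have a2 : a 2 = (p : ℂ) ^ (2 * n) * Y ^ (n + 2) * (p : ℂ) ^ 2 := by rw [← b2]; rfl
    have a3 : a 3 = 0 := by
      show _ * (((p : ℂ) ^ 3 - (p : ℂ) ^ 3) / _) = 0
      simp
    rw [a0, a1, a2, a3] at e0
    refine e0.trans ?_
    show _ * Z 0 + _ * Z 1 + _ * Z 2 + 0 * Z 3 = _
    ring
  refine ⟨Z 2, ?_, ?_⟩
  · rw [hZ0, hZ1] at hZ2
    rw [mul_one] at hZ2
    exact hZ2
  · have h := hs.hasSum
    have hne : 1 - (p : ℂ) ^ (3 * n) * Y ^ (n + 3) ≠ 0 := sub_ne_zero.2 (Ne.symm hY')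
    have : ∑' Λ, w Λ = (1 - (p : ℂ) ^ (3 * n) * Y ^ (n + 3))⁻¹ * (1 + Z₁ + Z 2) := by
      rw [eq_inv_mul_iff_mul_eq₀ hne, sub_mul, one_mul, ← hZ3, htot, hZ0, hZ1]; ring
    rwa [this] at h

end

end

section

/-! ### Lattices with cyclic quotient -/

/-- The number of elements of the kernel of a square matrix. -/
def kerCard {ι R : Type*} [Fintype ι] [CommRing R] (M : Matrix ι ι R) : ℕ :=
  Nat.card {x : ι → R // M.mulVec x = 0}

/-- The homomorphism `ℤ³ → ℤ / N` with given values on the basis. -/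
def evalHom {N : ℕ} (φ : Fin 3 → ZMod N) : (Fin 3 → ℤ) →+ ZMod N where
  toFun z := ∑ k, (z k : ZMod N) * φ k
  map_zero' := by simp
  map_add' z w := by simp [add_mul, sum_add_distrib]

lemma evalHom_apply {N : ℕ} (φ : Fin 3 → ZMod N) (z : Fin 3 → ℤ) :
    evalHom φ z = ∑ k, (z k : ZMod N) * φ k := rfl

lemma evalHom_single {N : ℕ} (φ : Fin 3 → ZMod N) (k : Fin 3) (a : ℤ) :
    evalHom φ (Pi.single k a) = a * φ k := by
  rw [evalHom_apply, sum_eq_single k]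
  · simp
  · intro j _ hj; simp [hj]
  · simp

lemma evalHom_surjective {N : ℕ} {φ : Fin 3 → ZMod N} (h : ∃ k, IsUnit (φ k)) :
    Function.Surjective (evalHom φ) := by
  obtain ⟨k, u, hu⟩ := h
  intro t
  obtain ⟨a, ha⟩ := ZMod.intCast_surjective (t * ((u⁻¹ : (ZMod N)ˣ) : ZMod N))
  exact ⟨Pi.single k a, by rw [evalHom_single, ha, ← hu]; simp⟩

lemma index_ker_evalHom {N : ℕ} {φ : Fin 3 → ZMod N} (h : ∃ k, IsUnit (φ k)) :
    (evalHom φ).ker.index = N := by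
  rw [AddSubgroup.index_ker, AddMonoidHom.range_eq_top.2 (evalHom_surjective h)]
  simp

lemma isUnit_zmod_prime_pow_iff {p n : ℕ} (hp : p.Prime) (x : ZMod (p ^ (n + 1))) :
    IsUnit x ↔ ¬ (p : ZMod (p ^ (n + 1))) ∣ x := by
  have := Fact.mk hp
  obtain ⟨a, rfl⟩ := ZMod.natCast_zmod_surjective x
  rw [ZMod.isUnit_iff_coprime, Nat.coprime_comm, Nat.coprime_pow_left_iff n.succ_pos,
    hp.coprime_iff_not_dvd, not_iff_not]
  constructor
  · rintro ⟨b, rfl⟩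
    exact ⟨b, by push_cast; rfl⟩
  · rintro ⟨b, hb⟩
    obtain ⟨b, rfl⟩ := ZMod.natCast_zmod_surjective b
    rw [← Nat.cast_mul, ZMod.natCast_eq_natCast_iff] at hb
    exact ((hb.dvd_iff (dvd_pow_self p n.succ_ne_zero)).2 ⟨b, rfl⟩)

lemma topIndex_ker_evalHom {p n : ℕ} (hp : p.Prime) {φ : Fin 3 → ZMod (p ^ (n + 1))}
    (h : ∃ k, IsUnit (φ k)) : topIndex p (evalHom φ).ker = p := by
  have hfp := Fact.mk hp
  set c : ZMod (p ^ (n + 1)) →+ ZMod p :=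
    (ZMod.castHom (dvd_pow_self p n.succ_ne_zero) (ZMod p)).toAddMonoidHom with hc
  have hcs : Function.Surjective c := ZMod.ringHom_surjective _
  have hker : (mulp p 3).range ⊔ (evalHom φ).ker = (c.comp (evalHom φ)).ker := by
    apply le_antisymm
    · refine sup_le ?_ ?_
      · rintro _ ⟨z, rfl⟩
        rw [AddMonoidHom.mem_ker, AddMonoidHom.comp_apply, mulp_apply, map_zsmul, map_zsmul]
        simp
      · intro z hz
        rw [AddMonoidHom.mem_ker] at hz ⊢
        rw [AddMonoidHom.comp_apply, hz, map_zero]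
    · intro z hz
      rw [AddMonoidHom.mem_ker, AddMonoidHom.comp_apply] at hz
      have hd : (p : ZMod (p ^ (n + 1))) ∣ evalHom φ z := by
        by_contra hcon
        rw [← isUnit_zmod_prime_pow_iff hp] at hcon
        have := hcon.map (ZMod.castHom (dvd_pow_self p n.succ_ne_zero) (ZMod p))
        have h0 : (ZMod.castHom (dvd_pow_self p n.succ_ne_zero) (ZMod p)) (evalHom φ z) = 0 := hz
        rw [h0] at this
        exact not_isUnit_zero this
      obtain ⟨t, ht⟩ := hd
      obtain ⟨z', rfl⟩ := evalHom_surjective h t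
      have h1 : z = mulp p 3 z' + (z - mulp p 3 z') := by abel
      rw [h1]
      refine AddSubgroup.add_mem_sup ⟨z', rfl⟩ ?_
      rw [AddMonoidHom.mem_ker, map_sub, ht, mulp_apply, map_zsmul]
      simp
  rw [topIndex, hker, AddSubgroup.index_ker,
    AddMonoidHom.range_eq_top.2 (by exact hcs.comp (evalHom_surjective h))]
  simp

/-- A lattice of index `p ^ (n + 1)` with cyclic quotient is the kernel of a primitive form. -/
lemma exists_ker_evalHom {p n : ℕ} (hp : p.Prime) {Λ : AddSubgroup (Fin 3 → ℤ)}
    (hΛ : Λ.index = p ^ (n + 1)) (ht : topIndex p Λ = p) :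
    ∃ φ : Fin 3 → ZMod (p ^ (n + 1)), (∃ k, IsUnit (φ k)) ∧ (evalHom φ).ker = Λ := by
  obtain ⟨z₀, hz₀⟩ : ∃ z, z ∉ (mulp p 3).range ⊔ Λ := by
    by_contra! hcon
    have : (mulp p 3).range ⊔ Λ = ⊤ := eq_top_iff.2 fun z _ => hcon z
    rw [topIndex, this, AddSubgroup.index_top] at ht
    exact hp.one_lt.ne ht
  have htop : Λ ⊔ AddSubgroup.zmultiples z₀ = ⊤ := by
    apply eq_top_of_topIndex_eq_one hp
    · refine exists_pow_of_dvd hp ⟨_, hΛ⟩ (AddSubgroup.index_dvd_of_le le_sup_left)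
    · have h1 : (mulp p 3).range ⊔ Λ ≤ (mulp p 3).range ⊔ (Λ ⊔ AddSubgroup.zmultiples z₀) :=
        sup_le_sup_left le_sup_left _
      have h2 := AddSubgroup.index_dvd_of_le h1
      rw [show ((mulp p 3).range ⊔ Λ).index = p from ht, Nat.dvd_prime hp] at h2
      refine h2.resolve_right fun h3 => hz₀ ?_
      have h4 := AddSubgroup.relIndex_mul_index h1
      rw [h3, show ((mulp p 3).range ⊔ Λ).index = p from ht] at h4
      have h5 : ((mulp p 3).range ⊔ Λ).relIndex
          ((mulp p 3).range ⊔ (Λ ⊔ AddSubgroup.zmultiples z₀)) = 1 :=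
        Nat.eq_of_mul_eq_mul_right hp.pos (by rw [h4, one_mul])
      rw [AddSubgroup.relIndex_eq_one] at h5
      exact h5 (le_sup_right (α := AddSubgroup (Fin 3 → ℤ))
        (le_sup_right (α := AddSubgroup (Fin 3 → ℤ)) (AddSubgroup.mem_zmultiples z₀)))
  have hcyc : IsAddCyclic ((Fin 3 → ℤ) ⧸ Λ) := by
    refine ⟨QuotientAddGroup.mk z₀, fun t => ?_⟩
    obtain ⟨z, rfl⟩ := QuotientAddGroup.mk_surjective t
    have hz : z ∈ Λ ⊔ AddSubgroup.zmultiples z₀ := htop ▸ AddSubgroup.mem_top z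
    obtain ⟨a, ha, b, ⟨k, rfl⟩, rfl⟩ := AddSubgroup.mem_sup.1 hz
    refine ⟨k, ?_⟩
    have h0 : ((a : Fin 3 → ℤ) : (Fin 3 → ℤ) ⧸ Λ) = 0 := (QuotientAddGroup.eq_zero_iff a).2 ha
    rw [QuotientAddGroup.mk_add, h0, zero_add]
    rfl
  have hcard : Nat.card ((Fin 3 → ℤ) ⧸ Λ) = p ^ (n + 1) := hΛ
  obtain ⟨e⟩ : Nonempty ((Fin 3 → ℤ) ⧸ Λ ≃+ ZMod (p ^ (n + 1))) := by
    have := (zmodAddCyclicAddEquiv hcyc).symm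
    rw [hcard] at this
    exact ⟨this⟩
  let ψ : (Fin 3 → ℤ) →+ ZMod (p ^ (n + 1)) := e.toAddMonoidHom.comp (QuotientAddGroup.mk' Λ)
  have hψ : ψ = evalHom (fun k => ψ (Pi.single k 1)) := by
    refine AddMonoidHom.functions_ext' _ _ _ fun k => ?_
    ext
    simp only [AddMonoidHom.comp_apply, AddMonoidHom.single_apply]
    rw [evalHom_single]
    simp
  have hψs : Function.Surjective ψ := e.surjective.comp (QuotientAddGroup.mk'_surjective Λ)
  refine ⟨fun k => ψ (Pi.single k 1), ?_, ?_⟩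
  · by_contra! hcon
    simp only [isUnit_zmod_prime_pow_iff hp, not_not] at hcon
    obtain ⟨z, hz⟩ := hψs 1
    have : (p : ZMod (p ^ (n + 1))) ∣ 1 := by
      rw [← hz, hψ, evalHom_apply]
      exact dvd_sum fun k _ => (hcon k).mul_left _
    exact (isUnit_zmod_prime_pow_iff hp 1).1 isUnit_one this
  · rw [← hψ]
    ext z
    rw [AddMonoidHom.mem_ker]
    show e (QuotientAddGroup.mk' Λ z) = 0 ↔ _
    rw [map_eq_zero_iff e e.injective, ← AddMonoidHom.mem_ker, QuotientAddGroup.ker_mk']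

lemma ker_evalHom_eq_iff {N : ℕ} {φ φ' : Fin 3 → ZMod N} (h : ∃ k, IsUnit (φ k))
    (h' : ∃ k, IsUnit (φ' k)) :
    (evalHom φ').ker = (evalHom φ).ker ↔ ∃ u : (ZMod N)ˣ, φ' = fun k => u * φ k := by
  constructor
  · intro hk
    obtain ⟨k, c, hc⟩ := h
    have hj : ∀ j, φ' j = φ' k * ((c⁻¹ : (ZMod N)ˣ) * φ j) := by
      intro j
      obtain ⟨a, ha⟩ := ZMod.intCast_surjective (((c⁻¹ : (ZMod N)ˣ) : ZMod N) * φ j)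
      have hmem : (Pi.single j 1 - Pi.single k a : Fin 3 → ℤ) ∈ (evalHom φ).ker := by
        rw [AddMonoidHom.mem_ker, map_sub, evalHom_single, evalHom_single, ha, ← hc]
        push_cast
        rw [mul_right_comm, Units.inv_mul, sub_self]
      rw [← hk, AddMonoidHom.mem_ker, map_sub, evalHom_single, evalHom_single, ha] at hmem
      push_cast at hmem
      rw [one_mul, sub_eq_zero] at hmem
      rw [hmem, mul_comm]
    have hu : IsUnit (φ' k) := by
      obtain ⟨j, hj'⟩ := h'
      rw [hj j] at hj'
      exact isUnit_of_mul_isUnit_left hj'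
    obtain ⟨d, hd⟩ := hu
    refine ⟨d * c⁻¹, funext fun j => ?_⟩
    rw [hj j, ← hd, Units.val_mul, mul_assoc]
  · rintro ⟨u, rfl⟩
    ext z
    rw [AddMonoidHom.mem_ker, AddMonoidHom.mem_ker, evalHom_apply, evalHom_apply]
    have : ∑ k, (z k : ZMod N) * (u * φ k) = u * ∑ k, (z k : ZMod N) * φ k := by
      rw [mul_sum]
      exact sum_congr rfl fun k _ => by ring
    rw [this, Units.mul_right_eq_zero]

lemma index_centralizerMod_mul_kerCard {n N : ℕ} [NeZero N] (m : Fin 3 → Matrix (Fin n) (Fin n) ℤ)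
    (φ : Fin 3 → ZMod N) :
    (centralizerMod m (evalHom φ).ker).index * kerCard (commMatrix m φ) = N ^ n := by
  set M := commMatrix m φ
  let red : (Fin n → ℤ) →+ (Fin n → ZMod N) :=
    (RingHom.pi fun i => (Int.castRingHom (ZMod N)).comp (Pi.evalRingHom _ i)).toAddMonoidHom
  have hred : ∀ v i, red v i = (v i : ZMod N) := fun v i => rfl
  have hreds : Function.Surjective red := by
    intro x
    choose v hv using fun i => ZMod.intCast_surjective (x i)
    exact ⟨v, funext hv⟩
  let μ : (Fin n → ZMod N) →+ (Fin n → ZMod N) := M.mulVecLin.toAddMonoidHom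
  have hμ : ∀ x, μ x = M.mulVec x := fun x => rfl
  have hX : centralizerMod m (evalHom φ).ker = (μ.comp red).ker := by
    ext v
    rw [mem_centralizerMod, AddMonoidHom.mem_ker, AddMonoidHom.comp_apply, hμ]
    have key : ∀ u, evalHom φ (bracket m u v) = ∑ i, (u i : ZMod N) * M.mulVec (red v) i := by
      intro u
      rw [evalHom_apply]
      simp only [bracket, mulVec, dotProduct, M, commMatrix, hred]
      push_cast
      simp only [sum_mul, mul_sum]
      rw [sum_comm]
      refine sum_congr rfl fun i _ => ?_
      rw [sum_comm]
      refine sum_congr rfl fun j _ => sum_congr rfl fun k _ => ?_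
      ring
    constructor
    · intro h
      funext i
      have := h (Pi.single i 1)
      rw [AddMonoidHom.mem_ker, key, sum_eq_single i] at this
      · simpa using this
      · intro j _ hj; simp [hj]
      · simp
    · intro h u
      rw [AddMonoidHom.mem_ker, key, h]
      simp
  have hk : kerCard M = Nat.card μ.ker := rfl
  rw [hX, AddSubgroup.index_ker, hk]
  have hr : (μ.comp red).range = μ.range := by
    rw [AddMonoidHom.range_comp, AddMonoidHom.range_eq_top.2 hreds, ← AddMonoidHom.range_eq_map]
  rw [hr, ← AddSubgroup.index_ker, mul_comm, AddSubgroup.card_mul_index]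
  simp

lemma latticeTerm_ker_evalHom {n p a : ℕ} (hp : p.Prime) (m : Fin 3 → Matrix (Fin n) (Fin n) ℤ)
    {Y : ℂ} (hY : Y ≠ 0) {φ : Fin 3 → ZMod (p ^ (a + 1))} (h : ∃ k, IsUnit (φ k)) :
    latticeTerm m p Y (evalHom φ).ker =
      ((p : ℂ) ^ n * Y ^ (n + 1)) ^ (a + 1) * Y⁻¹ ^ plog p (kerCard (commMatrix m φ)) := by
  have := Fact.mk hp
  have h1 := index_centralizerMod_mul_kerCard m φ
  have h0 : (p ^ (a + 1)) ^ n ≠ 0 := pow_ne_zero _ (pow_ne_zero _ hp.ne_zero)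
  have hc : (centralizerMod m (evalHom φ).ker).index ≠ 0 := fun h => h0 (by rw [← h1, h, zero_mul])
  have hk : kerCard (commMatrix m φ) ≠ 0 := fun h => h0 (by rw [← h1, h, mul_zero])
  have h2 := congrArg (plog p) h1
  rw [plog_mul hc hk, ← pow_mul, plog_pow hp] at h2
  rw [latticeTerm, index_ker_evalHom h, plog_pow hp, inv_pow, eq_mul_inv_iff_mul_eq₀ (pow_ne_zero _ hY),
    mul_assoc, ← pow_add, add_assoc, h2]
  push_cast
  ring

/-- The sum over primitive forms modulo `p ^ (a + 1)` of `q` to the corank. -/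
def primSum {n : ℕ} (m : Fin 3 → Matrix (Fin n) (Fin n) ℤ) (p a : ℕ) [Fact p.Prime] (q : ℂ) : ℂ :=
  ∑' φ : {φ : Fin 3 → ZMod (p ^ (a + 1)) // ∃ k, IsUnit (φ k)},
    q ^ plog p (kerCard (commMatrix m φ.1))

theorem hasSum_cyclic_lattices {n p : ℕ} [hfp : Fact p.Prime] (m : Fin 3 → Matrix (Fin n) (Fin n) ℤ)
    {Y : ℂ} (hY0 : Y ≠ 0) (hY : (p : ℝ) ^ (n + 3) * ‖Y‖ < 1) {Z₁ : ℂ}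
    (h : HasSum (fun a : ℕ => ((p : ℂ) ^ n * Y ^ (n + 1)) ^ (a + 1) *
      (((p : ℂ) ^ a * ((p : ℂ) - 1))⁻¹ * primSum m p a Y⁻¹)) Z₁) :
    HasSum (fun Λ : {Λ : PLattice p 3 // topIndex p Λ.1 = p} => latticeTerm m p Y Λ.1.1) Z₁ := by
  classical
  have hp := hfp.out
  let C := {Λ : PLattice p 3 // topIndex p Λ.1 = p}
  have hs : Summable fun Λ : C => latticeTerm m p Y Λ.1.1 :=
    (summable_latticeTerm m hp hY).subtype _
  have hidx : ∀ Λ : C, ∃ a, Λ.1.1.index = p ^ (a + 1) := by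
    intro Λ
    obtain ⟨k, hk⟩ := Λ.1.2
    cases k with
    | succ a => exact ⟨a, hk⟩
    | zero =>
      exfalso
      have h1 := index_eq_topIndex_mul hp Λ.1.1
      rw [hk, Λ.2, pow_zero] at h1
      exact hp.one_lt.ne' (Nat.eq_one_of_mul_eq_one_right h1.symm)
  choose lev hlev using hidx
  have hsum := hs.hasSum
  have hfib : ∀ a : ℕ, ∑' Λ : {Λ : C // lev Λ = a}, latticeTerm m p Y Λ.1.1.1 =
      ((p : ℂ) ^ n * Y ^ (n + 1)) ^ (a + 1) *
        (((p : ℂ) ^ a * ((p : ℂ) - 1))⁻¹ * primSum m p a Y⁻¹) := by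
    intro a
    let Φ := {φ : Fin 3 → ZMod (p ^ (a + 1)) // ∃ k, IsUnit (φ k)}
    let ker : Φ → {Λ : C // lev Λ = a} := fun φ =>
      ⟨⟨⟨(evalHom φ.1).ker, a + 1, index_ker_evalHom φ.2⟩, topIndex_ker_evalHom hp φ.2⟩, by
        have h1 := hlev ⟨⟨(evalHom φ.1).ker, a + 1, index_ker_evalHom φ.2⟩,
          topIndex_ker_evalHom hp φ.2⟩
        have h2 := (index_ker_evalHom φ.2).symm.trans h1
        exact (Nat.succ_injective (Nat.pow_right_injective hp.two_le h2)).symm⟩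
    have hkers : Function.Surjective ker := by
      rintro ⟨Λ, hΛ⟩
      have h1 := hlev Λ
      rw [hΛ] at h1
      obtain ⟨φ, hφ, hφΛ⟩ := exists_ker_evalHom hp h1 Λ.2
      exact ⟨⟨φ, hφ⟩, Subtype.ext (Subtype.ext (Subtype.ext hφΛ))⟩
    have hcard : ∀ Λ, Nat.card {φ : Φ // ker φ = Λ} = p ^ a * (p - 1) := by
      intro Λ
      obtain ⟨φ, rfl⟩ := hkers Λ
      have hval : ∀ φ' : Φ, ker φ' = ker φ ↔ (evalHom φ'.1).ker = (evalHom φ.1).ker := by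
        intro φ'
        constructor
        · intro h; exact congrArg (fun x : {Λ : C // lev Λ = a} => x.1.1.1) h
        · intro h; exact Subtype.ext (Subtype.ext (Subtype.ext h))
      have hprim : ∀ u : (ZMod (p ^ (a + 1)))ˣ, ∃ k, IsUnit ((u : ZMod (p ^ (a + 1))) * φ.1 k) := by
        intro u
        obtain ⟨k, hk⟩ := φ.2
        exact ⟨k, u.isUnit.mul hk⟩
      let g : (ZMod (p ^ (a + 1)))ˣ → {φ' : Φ // ker φ' = ker φ} := fun u =>
        ⟨⟨fun k => u * φ.1 k, hprim u⟩, (hval _).2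
          ((ker_evalHom_eq_iff φ.2 (hprim u)).2 ⟨u, rfl⟩)⟩
      have hg : Function.Bijective g := by
        constructor
        · intro u u' huu
          obtain ⟨k, hk⟩ := φ.2
          have := congrArg (fun x : {φ' : Φ // ker φ' = ker φ} => x.1.1 k) huu
          exact Units.ext (hk.mul_right_cancel this)
        · rintro ⟨φ', hφ'⟩
          obtain ⟨u, hu⟩ := (ker_evalHom_eq_iff φ.2 φ'.2).1 ((hval _).1 hφ')
          exact ⟨u, Subtype.ext (Subtype.ext hu.symm)⟩
      rw [← Nat.card_eq_of_bijective g hg, Nat.card_eq_fintype_card, ZMod.card_units_eq_totient,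
        Nat.totient_prime_pow_succ hp]
    have hΦs : Summable fun φ : Φ => latticeTerm m p Y (ker φ).1.1.1 := Summable.of_finite
    have e1 := tsum_eq_tsum_fiber ker hΦs
    have e2 : ∀ Λ, ∑' φ : {φ : Φ // ker φ = Λ}, latticeTerm m p Y (ker φ.1).1.1.1 =
        ((p : ℂ) ^ a * ((p : ℂ) - 1)) * latticeTerm m p Y Λ.1.1.1 := by
      intro Λ
      have : ∀ φ : {φ : Φ // ker φ = Λ}, latticeTerm m p Y (ker φ.1).1.1.1 =
        latticeTerm m p Y Λ.1.1.1 := fun φ => by rw [φ.2]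
      rw [tsum_congr this, tsum_const, hcard, nsmul_eq_mul]
      push_cast [Nat.cast_sub hp.one_lt.le]
      rfl
    rw [tsum_congr e2, tsum_mul_left] at e1
    have e3 : ∑' φ : Φ, latticeTerm m p Y (ker φ).1.1.1 =
        ((p : ℂ) ^ n * Y ^ (n + 1)) ^ (a + 1) * primSum m p a Y⁻¹ := by
      rw [primSum, ← tsum_mul_left]
      exact tsum_congr fun φ => latticeTerm_ker_evalHom hp m hY0 φ.2
    have hp1 : (p : ℂ) - 1 ≠ 0 := by
      rw [sub_ne_zero]; exact_mod_cast hp.one_lt.ne'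
    have hp0 : (p : ℂ) ≠ 0 := by exact_mod_cast hp.ne_zero
    have hne : (p : ℂ) ^ a * ((p : ℂ) - 1) ≠ 0 := mul_ne_zero (pow_ne_zero _ hp0) hp1
    rw [e3] at e1
    rw [mul_left_comm, e1, inv_mul_cancel_left₀ hne]
  rw [tsum_eq_tsum_fiber lev hs, tsum_congr hfib, h.tsum_eq] at hsum
  exact hsum

end

section

/-! ### Sums over residue classes -/

section Residue
variable {p : ℕ} [hfp : Fact p.Prime]

lemma pow_dvd_sub_iff {n : ℕ} {x y : ℤ_[p]} :
    (p : ℤ_[p]) ^ n ∣ x - y ↔ toZModPow n x = toZModPow n y := by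
  rw [← sub_eq_zero, ← map_sub, ← RingHom.mem_ker, PadicInt.ker_toZModPow,
    Ideal.mem_span_singleton]

lemma toZModPow_val {n : ℕ} (z : ZMod (p ^ n)) : toZModPow n ((z.val : ℕ) : ℤ_[p]) = z := by
  rw [map_natCast, ZMod.natCast_zmod_val]

lemma isUnit_iff_not_dvd {x : ℤ_[p]} : IsUnit x ↔ ¬ (p : ℤ_[p]) ∣ x := by
  rw [← not_iff_not, not_not, ← mem_nonunits_iff, ← IsLocalRing.mem_maximalIdeal,
    PadicInt.maximalIdeal_eq_span_p, Ideal.mem_span_singleton]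

lemma padic_p_ne_zero : (p : ℤ_[p]) ≠ 0 := by exact_mod_cast hfp.out.ne_zero

open Classical in
/-- The valuation of `x`, truncated at `n`. -/
def truncVal (n : ℕ) (x : ℤ_[p]) : ℕ := Nat.findGreatest (fun k => (p : ℤ_[p]) ^ k ∣ x) n

lemma truncVal_le (n : ℕ) (x : ℤ_[p]) : truncVal n x ≤ n := by
  classical
  rw [truncVal]; exact Nat.findGreatest_le n

lemma le_truncVal_iff {n k : ℕ} (hk : k ≤ n) {x : ℤ_[p]} :
    k ≤ truncVal n x ↔ (p : ℤ_[p]) ^ k ∣ x := by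
  classical
  constructor
  · intro h
    refine (pow_dvd_pow _ h).trans ?_
    rw [truncVal]
    exact Nat.findGreatest_spec (P := fun k => (p : ℤ_[p]) ^ k ∣ x) (Nat.zero_le n) (by simp)
  · intro h
    rw [truncVal]
    exact Nat.le_findGreatest hk h

lemma truncVal_eq_of_dvd_iff {n n' : ℕ} {x y : ℤ_[p]} (hn : n = n')
    (h : ∀ k ≤ n, (p : ℤ_[p]) ^ k ∣ x ↔ (p : ℤ_[p]) ^ k ∣ y) : truncVal n x = truncVal n' y := by
  subst hn
  apply le_antisymm
  · exact (le_truncVal_iff (truncVal_le _ _)).2 ((h _ (truncVal_le _ _)).1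
      ((le_truncVal_iff (truncVal_le _ _)).1 le_rfl))
  · exact (le_truncVal_iff (truncVal_le _ _)).2 ((h _ (truncVal_le _ _)).2
      ((le_truncVal_iff (truncVal_le _ _)).1 le_rfl))

lemma truncVal_congr {n : ℕ} {x y : ℤ_[p]} (h : (p : ℤ_[p]) ^ n ∣ x - y) :
    truncVal n x = truncVal n y := by
  refine truncVal_eq_of_dvd_iff rfl fun k hk => ?_
  have := (pow_dvd_pow (p : ℤ_[p]) hk).trans h
  rw [show x = y + (x - y) by ring]
  exact (dvd_add_left this)

lemma truncVal_eq_zero {n : ℕ} {x : ℤ_[p]} (h : ¬ (p : ℤ_[p]) ∣ x) : truncVal n x = 0 := by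
  by_contra hne
  have h1 : 1 ≤ truncVal n x := Nat.one_le_iff_ne_zero.2 hne
  rw [le_truncVal_iff (h1.trans (truncVal_le _ _)), pow_one] at h1
  exact h h1

lemma truncVal_succ_mul {n : ℕ} (x : ℤ_[p]) :
    truncVal (n + 1) ((p : ℤ_[p]) * x) = truncVal n x + 1 := by
  have key : ∀ k, (p : ℤ_[p]) ^ (k + 1) ∣ p * x ↔ (p : ℤ_[p]) ^ k ∣ x := fun k => by
    rw [pow_succ', mul_dvd_mul_iff_left padic_p_ne_zero]
  apply le_antisymm
  · obtain ⟨k, hk⟩ : ∃ k, truncVal (n + 1) ((p : ℤ_[p]) * x) = k + 1 := by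
      refine Nat.exists_eq_succ_of_ne_zero fun h => ?_
      have : 1 ≤ truncVal (n + 1) ((p : ℤ_[p]) * x) := by
        rw [le_truncVal_iff (by omega), pow_one]; exact dvd_mul_right _ _
      omega
    have h1 := truncVal_le (n + 1) ((p : ℤ_[p]) * x)
    have h2 := (le_truncVal_iff (h1)).1 (le_refl (truncVal (n + 1) ((p : ℤ_[p]) * x)))
    rw [hk] at h1 h2 ⊢
    rw [key] at h2
    exact Nat.succ_le_succ ((le_truncVal_iff (by omega)).2 h2)
  · rw [le_truncVal_iff (Nat.succ_le_succ (truncVal_le _ _)), key]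
    exact (le_truncVal_iff (truncVal_le _ _)).1 le_rfl

lemma truncVal_zero (x : ℤ_[p]) : truncVal 0 x = 0 := Nat.le_zero.1 (truncVal_le 0 x)

/-- `h` depends on its argument modulo `p ^ n` only. -/
def InvMod (n : ℕ) (h : ℤ_[p] → ℂ) : Prop := ∀ x y, (p : ℤ_[p]) ^ n ∣ x - y → h x = h y

/-- The sum of `h` over the standard representatives of the residue classes modulo `p ^ n`. -/
def rsum (n : ℕ) (h : ℤ_[p] → ℂ) : ℂ := ∑ z : ZMod (p ^ n), h ((z.val : ℕ) : ℤ_[p])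

lemma rsum_eq_of_complete {n : ℕ} {h : ℤ_[p] → ℂ} (hh : InvMod n h) {J : Type*} [Fintype J]
    (c : J → ℤ_[p]) (hc : ∀ i j, (p : ℤ_[p]) ^ n ∣ c i - c j → i = j)
    (hcard : Fintype.card J = p ^ n) : ∑ j, h (c j) = rsum n h := by
  classical
  have hbij : Function.Bijective fun j => toZModPow n (c j) := by
    rw [Fintype.bijective_iff_injective_and_card]
    exact ⟨fun i j hij => hc i j (pow_dvd_sub_iff.2 hij), by rw [hcard, ZMod.card]⟩
  rw [rsum, ← hbij.sum_comp]
  refine sum_congr rfl fun j _ => hh _ _ ?_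
  rw [pow_dvd_sub_iff, toZModPow_val]

lemma rsum_comp {n : ℕ} {h : ℤ_[p] → ℂ} (hh : InvMod n h) (T : ℤ_[p] → ℤ_[p])
    (hT : ∀ x y, (p : ℤ_[p]) ^ n ∣ T x - T y → (p : ℤ_[p]) ^ n ∣ x - y) :
    rsum n (fun x => h (T x)) = rsum n h := by
  refine rsum_eq_of_complete hh (fun z : ZMod (p ^ n) => T ((z.val : ℕ) : ℤ_[p])) ?_
    (by rw [ZMod.card])
  intro i j hij
  have := hT _ _ hij
  rwa [pow_dvd_sub_iff, toZModPow_val, toZModPow_val] at this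

lemma rsum_congr {n : ℕ} {h h' : ℤ_[p] → ℂ} (hh : ∀ x, h x = h' x) : rsum n h = rsum n h' :=
  sum_congr rfl fun _ _ => hh _

lemma rsum_const (n : ℕ) (c : ℂ) : rsum (p := p) n (fun _ => c) = (p : ℂ) ^ n * c := by
  simp [rsum, ZMod.card]

lemma rsum_mul_left (n : ℕ) (c : ℂ) (h : ℤ_[p] → ℂ) :
    rsum n (fun x => c * h x) = c * rsum n h := by
  rw [rsum, rsum, mul_sum]

lemma rsum_zero (h : ℤ_[p] → ℂ) : rsum 0 h = h 0 := by
  have : Subsingleton (ZMod (p ^ 0)) := by rw [pow_zero]; infer_instance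
  rw [rsum, Fintype.sum_subsingleton _ 0, ZMod.val_zero, Nat.cast_zero]

/-- Decomposition by the lowest digit. -/
lemma rsum_succ {n : ℕ} {h : ℤ_[p] → ℂ} (hh : InvMod (n + 1) h) :
    rsum (n + 1) h = ∑ a : Fin p, rsum n (fun x => h (((a : ℕ) : ℤ_[p]) + (p : ℤ_[p]) * x)) := by
  classical
  have hp := hfp.out
  rw [← rsum_eq_of_complete hh
    (fun j : Fin p × ZMod (p ^ n) => (((j.1 : ℕ) : ℤ_[p]) + p * ((j.2.val : ℕ) : ℤ_[p]))) ?_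
    (by simp [ZMod.card, pow_succ']), Fintype.sum_prod_type]
  · rfl
  · rintro ⟨a, z⟩ ⟨b, w⟩ h1
    have hab : a = b := by
      have h2 : (p : ℤ_[p]) ^ 1 ∣ ((a : ℕ) : ℤ_[p]) - ((b : ℕ) : ℤ_[p]) := by
        have h3 := (pow_dvd_pow (p : ℤ_[p]) (Nat.succ_le_succ (Nat.zero_le n))).trans h1
        rw [show ((a : ℕ) : ℤ_[p]) - ((b : ℕ) : ℤ_[p]) = ((((a : ℕ) : ℤ_[p]) +
          p * ((z.val : ℕ) : ℤ_[p])) - (((b : ℕ) : ℤ_[p]) + p * ((w.val : ℕ) : ℤ_[p]))) -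
          (p : ℤ_[p]) ^ 1 * (((z.val : ℕ) : ℤ_[p]) - ((w.val : ℕ) : ℤ_[p])) by ring]
        exact dvd_sub h3 (dvd_mul_right _ _)
      rw [pow_dvd_sub_iff, map_natCast, map_natCast, ZMod.natCast_eq_natCast_iff, pow_one] at h2
      exact Fin.ext (Nat.ModEq.eq_of_lt_of_lt h2 a.2 b.2)
    subst hab
    have h2 : (p : ℤ_[p]) ^ n ∣ ((z.val : ℕ) : ℤ_[p]) - ((w.val : ℕ) : ℤ_[p]) := by
      rw [← mul_dvd_mul_iff_left (padic_p_ne_zero (p := p)), ← pow_succ']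
      convert h1 using 1
      ring
    rw [pow_dvd_sub_iff, toZModPow_val, toZModPow_val] at h2
    rw [h2]

/-- Decomposition by the highest digit. -/
lemma rsum_succ_of_invMod {n : ℕ} {h : ℤ_[p] → ℂ} (hh : InvMod n h) :
    rsum (n + 1) h = p * rsum n h := by
  classical
  have hp := hfp.out
  have hh' : InvMod (n + 1) h := fun x y hxy => hh x y ((pow_dvd_pow _ n.le_succ).trans hxy)
  rw [← rsum_eq_of_complete hh'
    (fun j : Fin p × ZMod (p ^ n) => (((j.2.val : ℕ) : ℤ_[p]) + p ^ n * ((j.1 : ℕ) : ℤ_[p]))) ?_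
    (by simp [ZMod.card, pow_succ']), Fintype.sum_prod_type]
  · have : ∀ a : Fin p, ∑ z : ZMod (p ^ n),
        h (((z.val : ℕ) : ℤ_[p]) + p ^ n * ((a : ℕ) : ℤ_[p])) = rsum n h := fun a =>
      sum_congr rfl fun z _ => hh _ _ (by rw [add_sub_cancel_left]; exact dvd_mul_right _ _)
    rw [sum_congr rfl fun a _ => this a]
    simp
  · rintro ⟨a, z⟩ ⟨b, w⟩ h1
    have hzw : z = w := by
      have h2 : (p : ℤ_[p]) ^ n ∣ ((z.val : ℕ) : ℤ_[p]) - ((w.val : ℕ) : ℤ_[p]) := by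
        have h3 := (pow_dvd_pow (p : ℤ_[p]) n.le_succ).trans h1
        rw [show ((z.val : ℕ) : ℤ_[p]) - ((w.val : ℕ) : ℤ_[p]) = ((((z.val : ℕ) : ℤ_[p]) +
          p ^ n * ((a : ℕ) : ℤ_[p])) - (((w.val : ℕ) : ℤ_[p]) + p ^ n * ((b : ℕ) : ℤ_[p]))) -
          (p : ℤ_[p]) ^ n * (((a : ℕ) : ℤ_[p]) - ((b : ℕ) : ℤ_[p])) by ring]
        exact dvd_sub h3 (dvd_mul_right _ _)
      rwa [pow_dvd_sub_iff, toZModPow_val, toZModPow_val] at h2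
    subst hzw
    have h2 : (p : ℤ_[p]) ^ 1 ∣ ((a : ℕ) : ℤ_[p]) - ((b : ℕ) : ℤ_[p]) := by
      rw [← mul_dvd_mul_iff_left (pow_ne_zero n (padic_p_ne_zero (p := p))), ← pow_add]
      convert h1 using 1
      ring
    rw [pow_dvd_sub_iff, map_natCast, map_natCast, ZMod.natCast_eq_natCast_iff, pow_one] at h2
    rw [Fin.ext (Nat.ModEq.eq_of_lt_of_lt h2 a.2 b.2)]

/-- Separate the digit `0`. -/
lemma sum_fin_prime (F : Fin p → ℂ) (A B : ℂ) (h0 : ∀ a : Fin p, (a : ℕ) = 0 → F a = A)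
    (h1 : ∀ a : Fin p, ¬ (p : ℤ_[p]) ∣ ((a : ℕ) : ℤ_[p]) → F a = B) :
    ∑ a, F a = A + ((p : ℂ) - 1) * B := by
  have hp := hfp.out
  let z : Fin p := ⟨0, hp.pos⟩
  rw [← Finset.add_sum_erase _ _ (mem_univ z), h0 z rfl]
  congr 1
  rw [sum_congr rfl (g := fun _ => B), sum_const, Finset.card_erase_of_mem (mem_univ z)]
  · simp [Nat.cast_sub hp.one_lt.le]
  · intro a ha
    apply h1
    intro hd
    have ha0 : (a : ℕ) ≠ 0 := fun h => (Finset.mem_erase.1 ha).1 (Fin.ext h)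
    have h2 : (p : ℤ_[p]) ^ 1 ∣ ((a : ℕ) : ℤ_[p]) - ((0 : ℕ) : ℤ_[p]) := by simpa using hd
    rw [pow_dvd_sub_iff, map_natCast, map_natCast, ZMod.natCast_eq_natCast_iff, pow_one] at h2
    exact ha0 (Nat.ModEq.eq_of_lt_of_lt h2 a.2 hp.pos)

lemma invMod_truncVal (n : ℕ) (Q : ℂ) :
    InvMod (p := p) n fun x => Q ^ truncVal (n + 1) ((p : ℤ_[p]) * x) := by
  intro x y h
  beta_reduce
  rw [truncVal_succ_mul, truncVal_succ_mul, truncVal_congr h]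

lemma rsum_truncVal (Q : ℂ) (n : ℕ) :
    rsum (p := p) n (fun x => Q ^ truncVal (n + 1) ((p : ℤ_[p]) * x)) = smoothSeq p Q n := by
  induction n with
  | zero => rw [rsum_zero, truncVal_succ_mul, truncVal_zero]; simp [smoothSeq]
  | succ n ih =>
    rw [rsum_succ (invMod_truncVal _ _),
      sum_fin_prime _ (Q * smoothSeq p Q n) (Q * (p : ℂ) ^ n)]
    · rw [smoothSeq]; ring
    · intro a ha
      rw [← ih, ← rsum_mul_left]
      refine rsum_congr fun x => ?_
      rw [ha, truncVal_succ_mul, pow_succ']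
      simp
    · intro a ha
      rw [rsum_congr (h' := fun _ => Q) fun x => ?_, rsum_const, mul_comm]
      rw [truncVal_succ_mul, truncVal_eq_zero, zero_add, pow_one]
      intro hd
      exact ha ((dvd_add_left (dvd_mul_right _ _)).1 hd)

/-- The sum over a line transversal to a smooth curve. -/
lemma rsum_truncVal_of_isometry (Q : ℂ) (n : ℕ) (H : ℤ_[p] → ℤ_[p])
    (h0 : ∀ x, (p : ℤ_[p]) ∣ H x)
    (hH : ∀ x y, (p : ℤ_[p]) ^ (n + 1) ∣ H x - H y → (p : ℤ_[p]) ^ n ∣ x - y) :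
    rsum n (fun x => Q ^ truncVal (n + 1) (H x)) = smoothSeq p Q n := by
  choose T hT using h0
  rw [← rsum_truncVal, ← rsum_comp (invMod_truncVal n Q) T]
  · exact rsum_congr fun x => by rw [hT x]
  · intro x y h
    apply hH
    rw [hT, hT, ← mul_sub, pow_succ']
    exact mul_dvd_mul_left _ h

lemma rsum_sum {ι : Type*} (n : ℕ) (s : Finset ι) (h : ι → ℤ_[p] → ℂ) :
    rsum n (fun x => ∑ i ∈ s, h i x) = ∑ i ∈ s, rsum n (h i) := by
  simp only [rsum]
  rw [sum_comm]

lemma rsum_comm (n k : ℕ) (h : ℤ_[p] → ℤ_[p] → ℂ) :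
    rsum n (fun x => rsum k fun y => h x y) = rsum k (fun y => rsum n fun x => h x y) := by
  simp only [rsum]
  rw [sum_comm]

/-- `h` depends on its arguments modulo `p ^ n` only. -/
def InvMod₂ (n : ℕ) (h : ℤ_[p] → ℤ_[p] → ℂ) : Prop :=
  ∀ x y x' y', (p : ℤ_[p]) ^ n ∣ x - x' → (p : ℤ_[p]) ^ n ∣ y - y' → h x y = h x' y'

lemma InvMod₂.right {n : ℕ} {h : ℤ_[p] → ℤ_[p] → ℂ} (hh : InvMod₂ n h) (x : ℤ_[p]) :
    InvMod n (h x) := fun y y' hy => hh _ _ _ _ (by simp) hy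

lemma InvMod₂.left {n k : ℕ} {h : ℤ_[p] → ℤ_[p] → ℂ} (hh : InvMod₂ n h) :
    InvMod n (fun x => rsum k fun y => h x y) :=
  fun x x' hx => rsum_congr fun y => hh _ _ _ _ hx (by simp)

lemma rsum₂_succ_of_invMod {n : ℕ} {h : ℤ_[p] → ℤ_[p] → ℂ} (hh : InvMod₂ n h) :
    rsum (n + 1) (fun x => rsum (n + 1) fun y => h x y) =
      (p : ℂ) ^ 2 * rsum n (fun x => rsum n fun y => h x y) := by
  rw [rsum_succ_of_invMod hh.left, rsum_congr fun x => rsum_succ_of_invMod (hh.right x),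
    rsum_mul_left]
  ring

lemma rsum₂_digits {n : ℕ} {h : ℤ_[p] → ℤ_[p] → ℂ} (hh : InvMod₂ (n + 1) h) {A B : ℂ}
    (h00 : rsum n (fun x => rsum n fun y => h ((p : ℤ_[p]) * x) ((p : ℤ_[p]) * y)) = A)
    (h10 : ∀ x, ¬ (p : ℤ_[p]) ∣ x → rsum n (fun y => h x ((p : ℤ_[p]) * y)) = B)
    (h01 : ∀ y, ¬ (p : ℤ_[p]) ∣ y → rsum n (fun x => h ((p : ℤ_[p]) * x) y) = B)
    (h11 : ∀ x y, ¬ (p : ℤ_[p]) ∣ x → ¬ (p : ℤ_[p]) ∣ y → h x y = 1) :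
    rsum (n + 1) (fun x => rsum (n + 1) fun y => h x y) =
      ((p : ℂ) - 1) ^ 2 * (p : ℂ) ^ (2 * n) + 2 * ((p : ℂ) - 1) * (p : ℂ) ^ n * B + A := by
  have hnd : ∀ {a x : ℤ_[p]}, ¬ (p : ℤ_[p]) ∣ a → ¬ (p : ℤ_[p]) ∣ a + p * x := fun ha hd =>
    ha ((dvd_add_left (dvd_mul_right _ _)).1 hd)
  have e1 : ∀ x, rsum (n + 1) (fun y => h x y) = ∑ b : Fin p, rsum n (fun y =>
      h x (((b : ℕ) : ℤ_[p]) + (p : ℤ_[p]) * y)) := fun x => rsum_succ (hh.right x)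
  have hu : ∀ a x : ℤ_[p], ¬ (p : ℤ_[p]) ∣ a → ∑ b : Fin p, rsum n (fun y =>
      h (a + p * x) (((b : ℕ) : ℤ_[p]) + (p : ℤ_[p]) * y)) = B + ((p : ℂ) - 1) * (p : ℂ) ^ n := by
    intro a x ha
    rw [sum_fin_prime _ B ((p : ℂ) ^ n)]
    · intro b hb
      rw [← h10 _ (hnd (x := x) ha)]
      exact rsum_congr fun y => by rw [hb]; simp
    · intro b hb
      rw [rsum_congr (h' := fun _ => 1) fun y => h11 _ _ (hnd ha) (hnd hb), rsum_const, mul_one]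
  rw [rsum_succ hh.left, sum_fin_prime _ (A + ((p : ℂ) - 1) * (p : ℂ) ^ n * B)
    ((p : ℂ) ^ n * (B + ((p : ℂ) - 1) * (p : ℂ) ^ n))]
  · ring
  · intro a ha
    rw [rsum_congr fun x => e1 _, rsum_sum, sum_fin_prime _ A ((p : ℂ) ^ n * B)]
    · ring
    · intro b hb
      rw [← h00]
      exact rsum_congr fun x => rsum_congr fun y => by rw [ha, hb]; simp
    · intro b hb
      rw [rsum_comm, rsum_congr (h' := fun _ => B) fun y => ?_, rsum_const]
      rw [← h01 _ (hnd (x := y) hb)]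
      exact rsum_congr fun x => by rw [ha]; simp
  · intro a ha
    rw [rsum_congr fun x => e1 _, rsum_congr fun x => hu _ x ha, rsum_const]

/-- A remainder term which is negligible with respect to `x y` near the origin. -/
def NodalRemainder (C : ℤ_[p] → ℤ_[p] → ℤ_[p]) : Prop :=
  C 0 0 = 0 ∧ ∀ (k l : ℕ) (x y x' y' : ℤ_[p]), (p : ℤ_[p]) ^ k ∣ x → (p : ℤ_[p]) ^ k ∣ y →
    (p : ℤ_[p]) ^ k ∣ x' → (p : ℤ_[p]) ^ k ∣ y' → (p : ℤ_[p]) ^ l ∣ x - x' →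
    (p : ℤ_[p]) ^ l ∣ y - y' → (p : ℤ_[p]) ^ (l + 2 * k + 1) ∣ C x y - C x' y'

lemma NodalRemainder.swap {C : ℤ_[p] → ℤ_[p] → ℤ_[p]} (hC : NodalRemainder C) :
    NodalRemainder fun x y => C y x :=
  ⟨hC.1, fun k l _ _ _ _ h1 h2 h3 h4 h5 h6 => hC.2 k l _ _ _ _ h2 h1 h4 h3 h6 h5⟩

lemma NodalRemainder.rescale {C : ℤ_[p] → ℤ_[p] → ℤ_[p]} (hC : NodalRemainder C) :
    ∃ C', NodalRemainder C' ∧ ∀ x y, C (p * x) (p * y) = (p : ℤ_[p]) ^ 2 * C' x y := by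
  have h : ∀ x y, (p : ℤ_[p]) ^ 2 ∣ C (p * x) (p * y) := by
    intro x y
    have := hC.2 1 1 (p * x) (p * y) 0 0 (by simp) (by simp) (by simp) (by simp) (by simp) (by simp)
    rw [hC.1, sub_zero] at this
    exact (pow_dvd_pow _ (by norm_num)).trans this
  choose C' hC' using h
  have hp2 : (p : ℤ_[p]) ^ 2 ≠ 0 := pow_ne_zero _ padic_p_ne_zero
  refine ⟨C', ⟨?_, ?_⟩, hC'⟩
  · have := hC' 0 0
    rw [mul_zero, hC.1] at this
    exact (mul_eq_zero.1 this.symm).resolve_left hp2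
  · intro k l x y x' y' h1 h2 h3 h4 h5 h6
    have h7 := hC.2 (k + 1) (l + 1) (p * x) (p * y) (p * x') (p * y')
      (by rw [pow_succ']; exact mul_dvd_mul_left _ h1)
      (by rw [pow_succ']; exact mul_dvd_mul_left _ h2)
      (by rw [pow_succ']; exact mul_dvd_mul_left _ h3)
      (by rw [pow_succ']; exact mul_dvd_mul_left _ h4)
      (by rw [pow_succ', ← mul_sub]; exact mul_dvd_mul_left _ h5)
      (by rw [pow_succ', ← mul_sub]; exact mul_dvd_mul_left _ h6)
    rw [hC', hC', ← mul_sub] at h7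
    rw [← mul_dvd_mul_iff_left hp2, ← pow_add]
    exact (pow_dvd_pow _ (by omega)).trans h7

section Nodal

variable {c : ℤ_[p]} {C : ℤ_[p] → ℤ_[p] → ℤ_[p]}

lemma NodalRemainder.dvd (hC : NodalRemainder C) (x y : ℤ_[p]) : (p : ℤ_[p]) ∣ C x y := by
  have := hC.2 0 0 x y 0 0 (by simp) (by simp) (by simp) (by simp) (by simp) (by simp)
  rwa [hC.1, sub_zero, zero_add, mul_zero, zero_add, pow_one] at this

lemma padic_prime : Prime (p : ℤ_[p]) := PadicInt.prime_p

lemma NodalRemainder.not_dvd (hC : NodalRemainder C) (hc : ¬ (p : ℤ_[p]) ∣ c) {x y : ℤ_[p]}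
    (hx : ¬ (p : ℤ_[p]) ∣ x) (hy : ¬ (p : ℤ_[p]) ∣ y) : ¬ (p : ℤ_[p]) ∣ c * x * y + C x y := by
  rw [dvd_add_left (hC.dvd x y)]
  intro h
  rcases padic_prime.dvd_or_dvd h with h | h
  · rcases padic_prime.dvd_or_dvd h with h | h
    · exact hc h
    · exact hx h
  · exact hy h

lemma NodalRemainder.dvd_left (hC : NodalRemainder C) (x y : ℤ_[p]) :
    (p : ℤ_[p]) ∣ c * x * (p * y) + C x (p * y) :=
  dvd_add (Dvd.intro (c * x * y) (by ring)) (hC.dvd _ _)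

lemma NodalRemainder.isometry (hC : NodalRemainder C) (hc : ¬ (p : ℤ_[p]) ∣ c) {x : ℤ_[p]}
    (hx : ¬ (p : ℤ_[p]) ∣ x) (n : ℕ) (y y' : ℤ_[p])
    (h : (p : ℤ_[p]) ^ (n + 1) ∣ (c * x * (p * y) + C x (p * y)) -
      (c * x * (p * y') + C x (p * y'))) : (p : ℤ_[p]) ^ n ∣ y - y' := by
  induction n with
  | zero => simp
  | succ n ih =>
    have h1 := ih ((pow_dvd_pow _ (by omega)).trans h)
    have h2 := hC.2 0 (n + 1) x (p * y) x (p * y') (by simp) (by simp) (by simp) (by simp) (by simp)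
      (by rw [pow_succ', ← mul_sub]; exact mul_dvd_mul_left _ h1)
    rw [mul_zero, add_zero] at h2
    have h3 := dvd_sub h h2
    rw [show (c * x * (p * y) + C x (p * y)) - (c * x * (p * y') + C x (p * y')) -
      (C x (p * y) - C x (p * y')) = p * ((c * x) * (y - y')) by ring, pow_succ',
      mul_dvd_mul_iff_left padic_p_ne_zero] at h3
    have hcx : ¬ (p : ℤ_[p]) ∣ c * x := fun h => (padic_prime.dvd_or_dvd h).elim hc hx
    exact padic_prime.pow_dvd_of_dvd_mul_left _ hcx h3

lemma NodalRemainder.invMod (hC : NodalRemainder C) (n : ℕ) {x y x' y' : ℤ_[p]}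
    (hx : (p : ℤ_[p]) ^ n ∣ x - x') (hy : (p : ℤ_[p]) ^ n ∣ y - y') :
    (p : ℤ_[p]) ^ n ∣ (c * x * y + C x y) - (c * x' * y' + C x' y') := by
  have h2 := hC.2 0 n x y x' y' (by simp) (by simp) (by simp) (by simp) hx hy
  rw [show (c * x * y + C x y) - (c * x' * y' + C x' y') = c * y * (x - x') + c * x' * (y - y') +
    (C x y - C x' y') by ring]
  exact dvd_add (dvd_add (hx.mul_left _) (hy.mul_left _)) ((pow_dvd_pow _ (by omega)).trans h2)

theorem rsum_node (hc : ¬ (p : ℤ_[p]) ∣ c) (Q : ℂ) (n : ℕ) (hC : NodalRemainder C) :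
    rsum n (fun x => rsum n fun y => Q ^ truncVal (n + 1) ((p : ℤ_[p]) ^ 2 * (c * x * y + C x y))) =
      nodeSeq p Q n := by
  induction n using Nat.twoStepInduction generalizing C with
  | zero =>
    rw [rsum_zero, rsum_zero, pow_two, mul_assoc, truncVal_succ_mul, truncVal_zero]
    simp [nodeSeq]
  | one =>
    have : ∀ x y, Q ^ truncVal (1 + 1) ((p : ℤ_[p]) ^ 2 * (c * x * y + C x y)) = Q ^ 2 := fun x y => by
      rw [pow_two, mul_assoc, truncVal_succ_mul, truncVal_succ_mul, truncVal_zero]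
    rw [rsum_congr fun x => rsum_congr fun y => this x y]
    simp only [rsum_const, nodeSeq]
    ring
  | more n ih _ =>
    have hs : ∀ x y, Q ^ truncVal (n + 2 + 1) ((p : ℤ_[p]) ^ 2 * (c * x * y + C x y)) =
        Q ^ 2 * Q ^ truncVal (n + 1) (c * x * y + C x y) := fun x y => by
      rw [pow_two, mul_assoc, truncVal_succ_mul, truncVal_succ_mul, ← pow_add]
      congr 1
      omega
    rw [rsum_congr fun x => rsum_congr fun y => hs x y]
    simp only [rsum_mul_left]
    have hinv : InvMod₂ (n + 1) fun x y => Q ^ truncVal (n + 1) (c * x * y + C x y) :=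
      fun x y x' y' hx hy => by
        beta_reduce
        rw [truncVal_congr (hC.invMod (n + 1) hx hy)]
    rw [rsum₂_succ_of_invMod hinv, rsum₂_digits hinv (A := nodeSeq p Q n) (B := smoothSeq p Q n)]
    · rw [nodeSeq]; ring
    · obtain ⟨C', hC', hCC'⟩ := hC.rescale
      rw [← ih hC']
      refine rsum_congr fun x => rsum_congr fun y => ?_
      rw [hCC']
      congr 2
      ring
    · intro x hx
      exact rsum_truncVal_of_isometry Q n (fun y => c * x * ((p : ℤ_[p]) * y) + C x ((p : ℤ_[p]) * y))
        (fun y => hC.dvd_left x y) (fun y y' h => hC.isometry hc hx n y y' h)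
    · intro y hy
      rw [← rsum_truncVal_of_isometry Q n (fun x => c * y * ((p : ℤ_[p]) * x) + C ((p : ℤ_[p]) * x) y)
        (fun x => hC.swap.dvd_left y x) (fun x x' h => hC.swap.isometry hc hy n x x' h)]
      refine rsum_congr fun x => ?_
      congr 2
      ring
    · intro x y hx hy
      rw [truncVal_eq_zero (hC.not_dvd hc hx hy), pow_zero]

end Nodal

end Residue

end

section

/-! ### Kernels of matrices modulo prime powers -/

section Kernels

variable {ι κ R : Type*} [Fintype ι] [Fintype κ] [DecidableEq ι] [DecidableEq κ] [CommRing R]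

lemma kerCard_mul_left {U : Matrix ι ι R} (hU : IsUnit U.det) (M : Matrix ι ι R) :
    kerCard (U * M) = kerCard M := by
  refine Nat.card_congr (Equiv.subtypeEquivRight fun x => ?_)
  rw [← mulVec_mulVec]
  constructor
  · intro h
    have := congrArg (U⁻¹.mulVec) h
    rwa [mulVec_mulVec, nonsing_inv_mul _ hU, one_mulVec,
      mulVec_zero] at this
  · intro h; rw [h, mulVec_zero]

lemma kerCard_mul_right {V : Matrix ι ι R} (hV : IsUnit V.det) (M : Matrix ι ι R) :
    kerCard (M * V) = kerCard M := by
  let e : (ι → R) ≃ (ι → R) :=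
    { toFun := V.mulVec
      invFun := V⁻¹.mulVec
      left_inv := fun x => by rw [mulVec_mulVec, nonsing_inv_mul _ hV, one_mulVec]
      right_inv := fun x => by
        rw [mulVec_mulVec, mul_nonsing_inv _ hV, one_mulVec] }
  refine Nat.card_congr (e.subtypeEquiv fun x => ?_)
  rw [← mulVec_mulVec]
  rfl

omit [DecidableEq ι] [DecidableEq κ] in
lemma kerCard_submatrix (e : κ ≃ ι) (M : Matrix ι ι R) :
    kerCard (M.submatrix e e) = kerCard M := by
  refine Nat.card_congr ((e.arrowCongr (Equiv.refl R)).subtypeEquiv fun x => ?_)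
  rw [submatrix_mulVec_equiv]
  constructor
  · intro h
    funext i
    have := congrFun h (e.symm i)
    rw [Function.comp_apply, e.apply_symm_apply] at this
    exact this
  · intro h
    funext i
    exact congrFun h (e i)

omit [DecidableEq ι] [DecidableEq κ] in
lemma kerCard_fromBlocks_diag (A : Matrix ι ι R) (D : Matrix κ κ R) :
    kerCard (fromBlocks A 0 0 D) = kerCard A * kerCard D := by
  rw [kerCard, kerCard, kerCard, ← Nat.card_prod]
  refine Nat.card_congr (((Equiv.sumArrowEquivProdArrow ι κ R).subtypeEquiv (q := fun x =>
    A.mulVec x.1 = 0 ∧ D.mulVec x.2 = 0) fun x => ?_).trans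
    (Equiv.subtypeProdEquivProd (p := fun x => A.mulVec x = 0) (q := fun x => D.mulVec x = 0)))
  rw [fromBlocks_mulVec]
  simp only [Matrix.zero_mulVec, add_zero, zero_add]
  constructor
  · intro h
    exact ⟨funext fun i => congrFun h (Sum.inl i), funext fun i => congrFun h (Sum.inr i)⟩
  · rintro ⟨h1, h2⟩
    funext i
    rcases i with i | i
    · exact congrFun h1 i
    · exact congrFun h2 i

lemma kerCard_eq_one {A : Matrix ι ι R} (hA : IsUnit A.det) : kerCard A = 1 := by
  have := kerCard_mul_left hA (1 : Matrix ι ι R)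
  rw [mul_one] at this
  rw [this, kerCard]
  simp

lemma schur_factorization {A : Matrix ι ι R} (hA : IsUnit A.det) (B : Matrix ι κ R)
    (C : Matrix κ ι R) (D : Matrix κ κ R) :
    fromBlocks A B C D = fromBlocks 1 0 (C * A⁻¹) 1 *
      fromBlocks A 0 0 (D - C * A⁻¹ * B) * fromBlocks 1 (A⁻¹ * B) 0 1 := by
  have h1 : C * A⁻¹ * A = C := by rw [Matrix.mul_assoc, nonsing_inv_mul _ hA, Matrix.mul_one]
  have h2 : A * (A⁻¹ * B) = B := by rw [← Matrix.mul_assoc, mul_nonsing_inv _ hA, Matrix.one_mul]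
  simp only [Matrix.fromBlocks_multiply, Matrix.one_mul, Matrix.zero_mul, Matrix.mul_zero, add_zero,
    zero_add, Matrix.mul_one, h1, h2]
  congr 1
  rw [← Matrix.mul_assoc, add_sub_cancel]

end Kernels

section Padic

variable {p : ℕ} [hfp : Fact p.Prime] {ι κ : Type*} [Fintype ι] [Fintype κ] [DecidableEq ι]
  [DecidableEq κ]

/-- The number of elements of the kernel of `M` modulo `p ^ n`. -/
def padicKer (n : ℕ) (M : Matrix ι ι ℤ_[p]) : ℕ := kerCard (M.map (toZModPow n))

lemma isUnit_det_map {n : ℕ} {M : Matrix ι ι ℤ_[p]} (hM : IsUnit M.det) :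
    IsUnit (M.map (toZModPow n)).det := by
  have := hM.map (toZModPow (p := p) n)
  rwa [RingHom.map_det] at this

lemma padicKer_mul_mul (n : ℕ) {U V : Matrix ι ι ℤ_[p]} (hU : IsUnit U.det) (hV : IsUnit V.det)
    (M : Matrix ι ι ℤ_[p]) : padicKer n (U * M * V) = padicKer n M := by
  rw [padicKer, Matrix.map_mul, Matrix.map_mul, kerCard_mul_right (isUnit_det_map hV),
    kerCard_mul_left (isUnit_det_map hU), padicKer]

omit [DecidableEq ι] [DecidableEq κ] in
lemma padicKer_submatrix (n : ℕ) (e : κ ≃ ι) (M : Matrix ι ι ℤ_[p]) :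
    padicKer n (M.submatrix e e) = padicKer n M := by
  rw [padicKer, ← submatrix_map, kerCard_submatrix, padicKer]

lemma padicKer_eq_one (n : ℕ) {M : Matrix ι ι ℤ_[p]} (hM : IsUnit M.det) : padicKer n M = 1 :=
  kerCard_eq_one (isUnit_det_map hM)

lemma padicKer_fromBlocks (n : ℕ) {A : Matrix ι ι ℤ_[p]} (hA : IsUnit A.det) (B : Matrix ι κ ℤ_[p])
    (C : Matrix κ ι ℤ_[p]) (D : Matrix κ κ ℤ_[p]) :
    padicKer n (fromBlocks A B C D) = padicKer n (D - C * A⁻¹ * B) := by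
  rw [schur_factorization hA, padicKer_mul_mul _ (by simp) (by simp), padicKer,
    fromBlocks_map]
  rw [Matrix.map_zero _ (map_zero _), Matrix.map_zero _ (map_zero _), kerCard_fromBlocks_diag, kerCard_eq_one (isUnit_det_map hA), one_mul, padicKer]

omit [DecidableEq ι] in
lemma padicKer_ne_zero (n : ℕ) (M : Matrix ι ι ℤ_[p]) : padicKer n M ≠ 0 := by
  have : Nonempty {x : ι → ZMod (p ^ n) // (M.map (toZModPow n)).mulVec x = 0} :=
    ⟨⟨0, mulVec_zero _⟩⟩
  exact Nat.card_pos.ne'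

omit [DecidableEq ι] in
lemma padicKer_zero (M : Matrix ι ι ℤ_[p]) : padicKer 0 M = 1 := by
  have : Subsingleton (ZMod (p ^ 0)) := by rw [pow_zero]; infer_instance
  have : Subsingleton {x : ι → ZMod (p ^ 0) // (M.map (toZModPow 0)).mulVec x = 0} :=
    inferInstance
  have h := Finite.card_le_one_iff_subsingleton.2 this
  have := padicKer_ne_zero 0 M
  unfold padicKer kerCard at *
  omega

omit [DecidableEq ι] in
lemma padicKer_congr {n : ℕ} {M M' : Matrix ι ι ℤ_[p]}
    (h : ∀ i j, (p : ℤ_[p]) ^ n ∣ M i j - M' i j) : padicKer n M = padicKer n M' := by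
  rw [padicKer, padicKer]
  congr 1
  ext i j
  exact pow_dvd_sub_iff.1 (h i j)

omit [DecidableEq ι] in
lemma padicKer_smul (n : ℕ) (M : Matrix ι ι ℤ_[p]) :
    padicKer (n + 1) ((p : ℤ_[p]) • M) = p ^ Fintype.card ι * padicKer n M := by
  have hp := hfp.out
  have hdvd : p ^ n ∣ p ^ (n + 1) := pow_dvd_pow p n.le_succ
  let π := ZMod.castHom hdvd (ZMod (p ^ n))
  have hπ : ∀ x : ℤ_[p], π (toZModPow (n + 1) x) = toZModPow n x := fun x => by
    rw [← PadicInt.zmod_cast_comp_toZModPow n (n + 1) n.le_succ]; rfl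
  have hpz : ∀ t : ZMod (p ^ (n + 1)), (p : ZMod (p ^ (n + 1))) * t = 0 ↔ π t = 0 := by
    intro t
    obtain ⟨a, rfl⟩ := ZMod.natCast_zmod_surjective t
    rw [map_natCast, ← Nat.cast_mul, ZMod.natCast_eq_zero_iff, ZMod.natCast_eq_zero_iff, pow_succ',
      Nat.mul_dvd_mul_iff_left hp.pos]
  let red : (ι → ZMod (p ^ (n + 1))) →+ (ι → ZMod (p ^ n)) :=
    (RingHom.pi fun i => π.comp (Pi.evalRingHom _ i)).toAddMonoidHom
  have hred : ∀ x i, red x i = π (x i) := fun x i => rfl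
  have hreds : Function.Surjective red := by
    intro y
    choose x hx using fun i => ZMod.ringHom_surjective π (y i)
    exact ⟨x, funext hx⟩
  let K : AddSubgroup (ι → ZMod (p ^ n)) :=
    (M.map (toZModPow n)).mulVecLin.toAddMonoidHom.ker
  have hK : padicKer n M = Nat.card K := rfl
  have hK' : padicKer (n + 1) ((p : ℤ_[p]) • M) = Nat.card (K.comap red) := by
    refine Nat.card_congr (Equiv.subtypeEquivRight fun x => ?_)
    show _ ↔ (M.map (toZModPow n)).mulVec (red x) = 0
    rw [funext_iff, funext_iff]
    refine forall_congr' fun i => ?_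
    have e1 : (((p : ℤ_[p]) • M).map (toZModPow (n + 1))).mulVec x i =
        (p : ZMod (p ^ (n + 1))) * (M.map (toZModPow (n + 1))).mulVec x i := by
      simp only [mulVec, dotProduct, mul_sum, Matrix.map_apply, Matrix.smul_apply,
        smul_eq_mul, map_mul, map_natCast, mul_assoc]
    have e2 : π ((M.map (toZModPow (n + 1))).mulVec x i) =
        (M.map (toZModPow n)).mulVec (red x) i := by
      simp only [mulVec, dotProduct, Matrix.map_apply, map_sum, map_mul, hπ, hred]
    rw [e1, Pi.zero_apply, hpz, e2]
    rfl
  have h1 := AddSubgroup.card_mul_index (K.comap red)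
  rw [AddSubgroup.index_comap_of_surjective _ hreds] at h1
  have h2 := AddSubgroup.card_mul_index K
  have h3 : Nat.card (ι → ZMod (p ^ (n + 1))) = p ^ Fintype.card ι * Nat.card (ι → ZMod (p ^ n)) := by
    rw [Nat.card_fun, Nat.card_fun, Nat.card_zmod, Nat.card_zmod, Nat.card_eq_fintype_card, ← mul_pow,
      ← pow_succ']
  rw [h3, ← h2, ← mul_assoc] at h1
  rw [hK', hK]
  refine Nat.eq_of_mul_eq_mul_right (Nat.pos_of_ne_zero ?_) h1
  exact AddSubgroup.index_ne_zero_of_finite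

lemma alternating_fin_two {R : Type*} [CommRing R] [IsDomain R] [CharZero R]
    {D : Matrix (Fin 2) (Fin 2) R} (hD : D.transpose = -D) : D = D 0 1 • !![0, 1; -1, 0] := by
  have h : ∀ i j, D j i = - D i j := fun i j => congrFun (congrFun hD i) j
  have h0 : ∀ i, D i i = 0 := fun i => self_eq_neg.1 (h i i)
  ext i j
  fin_cases i <;> fin_cases j
  · simpa using h0 0
  · simp
  · simpa using h 0 1
  · simpa using h0 1

lemma padicKer_fin_two (n : ℕ) (d : ℤ_[p]) :
    padicKer n (d • !![0, 1; -1, 0] : Matrix (Fin 2) (Fin 2) ℤ_[p]) = p ^ (2 * truncVal n d) := by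
  induction n generalizing d with
  | zero => rw [padicKer_zero, truncVal_zero]; simp
  | succ n ih =>
    by_cases hd : (p : ℤ_[p]) ∣ d
    · obtain ⟨d, rfl⟩ := hd
      rw [mul_smul, padicKer_smul, ih, truncVal_succ_mul, Fintype.card_fin, ← pow_add]
      congr 1
      ring
    · rw [truncVal_eq_zero hd, padicKer_eq_one, mul_zero, pow_zero]
      rw [Matrix.det_fin_two]
      simpa using (isUnit_iff_not_dvd.2 hd).mul (isUnit_iff_not_dvd.2 hd)

omit [Fintype κ] [DecidableEq κ] in
lemma transpose_schur {A : Matrix ι ι ℤ_[p]} {B : Matrix ι κ ℤ_[p]} {C : Matrix κ ι ℤ_[p]}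
    {D : Matrix κ κ ℤ_[p]} (hA' : IsUnit A.det)
    (h : (fromBlocks A B C D).transpose = -fromBlocks A B C D) :
    (D - C * A⁻¹ * B).transpose = -(D - C * A⁻¹ * B) := by
  rw [fromBlocks_transpose, fromBlocks_neg, fromBlocks_inj] at h
  obtain ⟨hA, hC, hB, hD⟩ := h
  have hinv : A⁻¹.transpose = -A⁻¹ := by
    rw [Matrix.transpose_nonsing_inv, hA]
    exact Matrix.inv_eq_right_inv (by rw [neg_mul_neg, mul_nonsing_inv _ hA'])
  rw [Matrix.transpose_sub, transpose_mul, transpose_mul, hD, hC, hB, hinv]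
  simp only [Matrix.neg_mul, Matrix.mul_neg, neg_neg, Matrix.mul_assoc]
  abel

lemma padic_dvd_of_sq_eq {a b u : ℤ_[p]} (hu : IsUnit u) (h : a ^ 2 = u * b ^ 2) (k : ℕ) :
    (p : ℤ_[p]) ^ k ∣ a ↔ (p : ℤ_[p]) ^ k ∣ b := by
  rw [← IsIntegrallyClosed.pow_dvd_pow_iff two_ne_zero, h, hu.dvd_mul_left,
    IsIntegrallyClosed.pow_dvd_pow_iff two_ne_zero]

lemma padicKer_schur_two (n : ℕ) {A : Matrix ι ι ℤ_[p]} (hA : IsUnit A.det)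
    {B : Matrix ι (Fin 2) ℤ_[p]} {C : Matrix (Fin 2) ι ℤ_[p]} {D : Matrix (Fin 2) (Fin 2) ℤ_[p]}
    (h : (fromBlocks A B C D).transpose = -fromBlocks A B C D) {a u : ℤ_[p]}
    (hu : IsUnit u) (ha : a ^ 2 = u * (fromBlocks A B C D).det) :
    padicKer n (fromBlocks A B C D) = p ^ (2 * truncVal n a) := by
  have hS := transpose_schur hA h
  rw [schur_factorization hA, det_mul, det_mul] at ha
  simp only [det_fromBlocks_zero₁₂, det_fromBlocks_zero₂₁, det_one, mul_one,
    one_mul] at ha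
  rw [padicKer_fromBlocks n hA]
  set S := D - C * A⁻¹ * B
  have hd : S.det = S 0 1 ^ 2 := by
    conv_lhs => rw [alternating_fin_two hS]
    rw [Matrix.det_fin_two]; simp; ring
  rw [alternating_fin_two hS, padicKer_fin_two]
  congr 2
  refine truncVal_eq_of_dvd_iff rfl fun k _ => ?_
  rw [padic_dvd_of_sq_eq (hu.mul hA) (a := a) (b := S 0 1) (by rw [ha, hd]; ring)]

end Padic

/-! ### Alternating matrices over fields -/

lemma exists_adapted_basis {F : Type*} [Field F] {n : ℕ} (M : Matrix (Fin n) (Fin n) F)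
    (hM : M.transpose = -M) :
    ∃ (k d : ℕ) (e : Fin k ⊕ Fin d ≃ Fin n) (P : Matrix (Fin k ⊕ Fin d) (Fin k ⊕ Fin d) F)
      (A : Matrix (Fin k) (Fin k) F), P.det ≠ 0 ∧ A.det ≠ 0 ∧
      P.transpose * M.submatrix e e * P = fromBlocks A 0 0 0 ∧ M.rank + d = n := by
  classical
  let W := LinearMap.ker M.mulVecLin
  obtain ⟨W', hW'⟩ := Submodule.exists_isCompl W
  let b : Module.Basis (Fin (Module.finrank F W') ⊕ Fin (Module.finrank F W)) F (Fin n → F) :=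
    ((Module.finBasis F W').prod (Module.finBasis F W)).map
      (Submodule.prodEquivOfIsCompl W' W hW'.symm)
  have hbl : ∀ i, b (Sum.inl i) = (Module.finBasis F W' i : Fin n → F) := fun i => by simp [b]
  have hbr : ∀ i, b (Sum.inr i) = (Module.finBasis F W i : Fin n → F) := fun i => by simp [b]
  have hcard : Fintype.card (Fin (Module.finrank F W') ⊕ Fin (Module.finrank F W)) =
      Fintype.card (Fin n) := by
    rw [← Module.finrank_eq_card_basis b, Module.finrank_fintype_fun_eq_card]
  let e := Fintype.equivOfCardEq hcard
  let P : Matrix _ _ F := fun i j => b j (e i)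
  have hPmul : ∀ x, P.mulVec x = (∑ j, x j • b j) ∘ e := by
    intro x
    funext i
    simp only [mulVec, dotProduct, P, Function.comp_apply, Finset.sum_apply, Pi.smul_apply,
      smul_eq_mul]
    exact sum_congr rfl fun j _ => mul_comm _ _
  have hPinj : ∀ x, P.mulVec x = 0 → x = 0 := by
    intro x hx
    rw [hPmul] at hx
    have h1 : ∑ j, x j • b j = 0 := by
      funext i
      have := congrFun hx (e.symm i)
      simpa using this
    exact funext (Fintype.linearIndependent_iff.1 b.linearIndependent x h1)
  have hdet : P.det ≠ 0 := fun h0 => by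
    obtain ⟨x, hx0, hx⟩ := Matrix.exists_mulVec_eq_zero_iff.2 h0
    exact hx0 (hPinj x hx)
  have hMmul : ∀ x : (Fin (Module.finrank F W') ⊕ Fin (Module.finrank F W)) → F,
      (M.submatrix e e * P).mulVec x = (M.mulVec (∑ j, x j • b j)) ∘ e := by
    intro x
    rw [← mulVec_mulVec, hPmul, submatrix_mulVec_equiv]
    congr 2
    funext i
    simp
  set N := P.transpose * M.submatrix e e * P with hN
  have hNT : N.transpose = -N := by
    rw [hN, transpose_mul, transpose_mul, transpose_transpose,
      transpose_submatrix, hM]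
    simp [Matrix.mul_assoc, submatrix_neg]
  have hNcol : ∀ i j, N i (Sum.inr j) = 0 := by
    intro i j
    have h1 : (M.submatrix e e * P).mulVec (Pi.single (Sum.inr j) 1) = 0 := by
      rw [hMmul]
      have : ∑ j', (Pi.single (Sum.inr j) (1 : F) : _ → F) j' • b j' = b (Sum.inr j) := by
        rw [sum_eq_single (Sum.inr j)]
        · simp
        · intro j' _ hj'; simp [hj']
        · simp
      rw [this, hbr]
      have h2 : M.mulVec (Module.finBasis F W j : Fin n → F) = 0 := (Module.finBasis F W j).2
      rw [h2]
      rfl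
    have h2 : N.mulVec (Pi.single (Sum.inr j) 1) = 0 := by
      rw [hN, Matrix.mul_assoc, ← mulVec_mulVec, h1, mulVec_zero]
    rw [Matrix.mulVec_single_one] at h2
    exact congrFun h2 i
  have hNrow : ∀ i j, N (Sum.inr i) j = 0 := by
    intro i j
    have := congrFun (congrFun hNT j) (Sum.inr i)
    rw [Matrix.transpose_apply, Matrix.neg_apply, hNcol, neg_zero] at this
    exact this
  have hblocks : N = fromBlocks N.toBlocks₁₁ 0 0 0 := by
    ext i j
    rcases i with i | i <;> rcases j with j | j
    · rfl
    · exact hNcol _ _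
    · exact hNrow _ _
    · exact hNcol _ _
  refine ⟨_, _, e, P, N.toBlocks₁₁, hdet, ?_, hblocks, ?_⟩
  · intro h0
    obtain ⟨x, hx0, hx⟩ := Matrix.exists_mulVec_eq_zero_iff.2 h0
    have h1 : N.mulVec (Sum.elim x 0) = 0 := by
      rw [hblocks, fromBlocks_mulVec]
      funext i
      rcases i with i | i
      · simpa using congrFun hx i
      · simp
    have hPT : ∀ y, P.transpose.mulVec y = 0 → y = 0 := by
      intro y hy
      by_contra hy0
      have := Matrix.exists_mulVec_eq_zero_iff.1 ⟨y, hy0, hy⟩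
      rw [det_transpose] at this
      exact hdet this
    rw [hN, Matrix.mul_assoc, ← mulVec_mulVec] at h1
    have h2 := hPT _ h1
    rw [hMmul] at h2
    have h3 : M.mulVec (∑ j, (Sum.elim x 0 : _ → F) j • b j) = 0 := by
      funext i
      have := congrFun h2 (e.symm i)
      simpa using this
    have h4 : ∑ j, (Sum.elim x 0 : _ → F) j • b j ∈ W := h3
    have h5 : ∑ j, (Sum.elim x 0 : _ → F) j • b j ∈ W' := by
      rw [Fintype.sum_sum_type]
      simp only [Sum.elim_inl, Sum.elim_inr, Pi.zero_apply, zero_smul, sum_const_zero,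
        add_zero, hbl]
      exact W'.sum_mem fun i _ => W'.smul_mem _ (Module.finBasis F W' i).2
    have h6 : ∑ j, (Sum.elim x 0 : _ → F) j • b j = 0 := by
      have : ∑ j, (Sum.elim x 0 : _ → F) j • b j ∈ W ⊓ W' := ⟨h4, h5⟩
      rwa [hW'.inf_eq_bot, Submodule.mem_bot] at this
    have h7 := Fintype.linearIndependent_iff.1 b.linearIndependent _ h6
    exact hx0 (funext fun i => h7 (Sum.inl i))
  · have := LinearMap.finrank_range_add_finrank_ker M.mulVecLin
    rw [Module.finrank_fintype_fun_eq_card, Fintype.card_fin] at this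
    exact this

lemma even_of_alternating {F : Type*} [Field F] (h2 : (2 : F) ≠ 0) {k : ℕ}
    {A : Matrix (Fin k) (Fin k) F} (hA : A.transpose = -A) (hdet : A.det ≠ 0) : Even k := by
  by_contra hk
  rw [Nat.not_even_iff_odd] at hk
  have h := congrArg Matrix.det hA
  rw [det_transpose, Matrix.det_neg, Fintype.card_fin, hk.neg_one_pow] at h
  have : (2 : F) * A.det = 0 := by linear_combination h
  exact (mul_ne_zero h2 hdet) this

end

section

section Corank

variable {p : ℕ} [hfp : Fact p.Prime]

/-- Reduction of a matrix modulo `p`. -/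
def redMod {ι κ : Type*} (M : Matrix ι κ ℤ_[p]) : Matrix ι κ (ZMod p) := M.map toZMod

lemma toZMod_eq_zero_iff {x : ℤ_[p]} : toZMod x = 0 ↔ (p : ℤ_[p]) ∣ x := by
  rw [← RingHom.mem_ker, PadicInt.ker_toZMod, PadicInt.maximalIdeal_eq_span_p,
    Ideal.mem_span_singleton]

lemma toZMod_surjective : Function.Surjective (toZMod (p := p)) :=
  ZMod.ringHom_surjective _

lemma isUnit_iff_toZMod_ne_zero {x : ℤ_[p]} : IsUnit x ↔ toZMod x ≠ 0 := by
  rw [isUnit_iff_not_dvd, Ne, toZMod_eq_zero_iff]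

lemma det_redMod {ι : Type*} [Fintype ι] [DecidableEq ι] (M : Matrix ι ι ℤ_[p]) :
    (redMod M).det = toZMod M.det := by
  rw [RingHom.map_det]; rfl

/-- A matrix over `ℤ_p` in block form adapted to the kernel of its reduction. -/
lemma exists_adapted_padic {n : ℕ} (M : Matrix (Fin n) (Fin n) ℤ_[p]) (hM : M.transpose = -M) :
    ∃ (k d : ℕ) (e : Fin k ⊕ Fin d ≃ Fin n) (P : Matrix (Fin k ⊕ Fin d) (Fin k ⊕ Fin d) ℤ_[p])
      (A : Matrix (Fin k) (Fin k) ℤ_[p]) (B : Matrix (Fin k) (Fin d) ℤ_[p])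
      (C : Matrix (Fin d) (Fin k) ℤ_[p]) (D : Matrix (Fin d) (Fin d) ℤ_[p]),
      IsUnit P.det ∧ IsUnit A.det ∧
      P.transpose * M.submatrix e e * P = fromBlocks A B C D ∧
      (fromBlocks A B C D).transpose = -fromBlocks A B C D ∧
      (∀ i j, (p : ℤ_[p]) ∣ C i j) ∧ (∀ i j, (p : ℤ_[p]) ∣ D i j) ∧ (redMod M).rank + d = n := by
  have hM' : (redMod M).transpose = -redMod M := by
    ext i j
    have := congrArg toZMod (congrFun (congrFun hM i) j)
    simpa [redMod] using this
  obtain ⟨k, d, e, P₀, A₀, hP₀, hA₀, hblock, hrank⟩ := exists_adapted_basis _ hM'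
  choose P hP using fun i j => toZMod_surjective (p := p) (P₀ i j)
  have hPr : redMod (Matrix.of P) = P₀ := by ext i j; exact hP i j
  set N := (Matrix.of P).transpose * M.submatrix e e * Matrix.of P with hN
  have hNr : redMod N = fromBlocks A₀ 0 0 0 := by
    rw [← hblock, ← hPr, hN, redMod, Matrix.map_mul, Matrix.map_mul]
    rfl
  have hNT : N.transpose = -N := by
    rw [hN, transpose_mul, transpose_mul, transpose_transpose,
      transpose_submatrix, hM]
    simp [Matrix.mul_assoc, submatrix_neg]
  have hNb := (fromBlocks_toBlocks N).symm
  refine ⟨k, d, e, Matrix.of P, N.toBlocks₁₁, N.toBlocks₁₂, N.toBlocks₂₁, N.toBlocks₂₂, ?_, ?_, hNb,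
    ?_, ?_, ?_, hrank⟩
  · rw [isUnit_iff_toZMod_ne_zero, ← det_redMod, hPr]; exact hP₀
  · rw [isUnit_iff_toZMod_ne_zero, ← det_redMod]
    have : redMod N.toBlocks₁₁ = A₀ := by
      ext i j
      exact congrFun (congrFun hNr (Sum.inl i)) (Sum.inl j)
    rw [this]
    exact hA₀
  · rw [← hNb]; exact hNT
  · intro i j
    rw [← toZMod_eq_zero_iff]
    exact congrFun (congrFun hNr (Sum.inr i)) (Sum.inl j)
  · intro i j
    rw [← toZMod_eq_zero_iff]
    exact congrFun (congrFun hNr (Sum.inr i)) (Sum.inr j)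

lemma det_conj_submatrix {n : ℕ} {ι R : Type*} [Fintype ι] [DecidableEq ι] [CommRing R] (e : ι ≃ Fin n)
    (P : Matrix ι ι R) (M : Matrix (Fin n) (Fin n) R) :
    (P.transpose * M.submatrix e e * P).det = P.det ^ 2 * M.det := by
  rw [det_mul, det_mul, det_transpose, Matrix.det_submatrix_equiv_self]
  ring

/-- If `M` modulo `p` has corank `2`, the kernels of `M` modulo prime powers are determined by the
Pfaffian. -/
lemma padicKer_of_corank_two {n : ℕ} (a : ℕ) {M : Matrix (Fin n) (Fin n) ℤ_[p]}
    (hM : M.transpose = -M) (hrank : (redMod M).rank + 2 = n) {f u : ℤ_[p]} (hu : IsUnit u)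
    (hf : f ^ 2 = u * M.det) : padicKer a M = p ^ (2 * truncVal a f) := by
  obtain ⟨k, d, e, P, A, B, C, D, hP, hA, hblock, hT, hC, hD, hr⟩ := exists_adapted_padic M hM
  obtain rfl : d = 2 := by omega
  have h1 := padicKer_mul_mul a (U := P.transpose) (by rwa [det_transpose]) hP
    (M.submatrix e e)
  rw [padicKer_submatrix, hblock] at h1
  rw [← h1]
  obtain ⟨v, hv⟩ := hP
  refine padicKer_schur_two a hA hT (u := u * ((v⁻¹ ^ 2 : ℤ_[p]ˣ) : ℤ_[p])) (hu.mul (Units.isUnit _)) ?_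
  rw [← hblock, det_conj_submatrix, hf, ← hv, mul_assoc, ← mul_assoc _ _ M.det]
  congr 1
  rw [← Units.val_pow_eq_pow_val, ← Units.val_mul, ← mul_pow, inv_mul_cancel, one_pow, Units.val_one,
    one_mul]

lemma pow_corank_dvd_det {n d : ℕ} {M : Matrix (Fin n) (Fin n) ℤ_[p]}
    (hM : M.transpose = -M) (hrank : (redMod M).rank + d = n) : (p : ℤ_[p]) ^ d ∣ M.det := by
  obtain ⟨k, d', e, P, A, B, C, D, hP, hA, hblock, hT, hC, hD, hr⟩ := exists_adapted_padic M hM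
  obtain rfl : d' = d := by omega
  have h1 := det_conj_submatrix e P M
  rw [hblock, schur_factorization hA, det_mul, det_mul] at h1
  simp only [det_fromBlocks_zero₁₂, det_fromBlocks_zero₂₁, det_one, mul_one,
    one_mul] at h1
  rw [← (hP.pow 2).dvd_mul_left, ← h1, hA.dvd_mul_left]
  choose S hS using fun i j => show (p : ℤ_[p]) ∣ (D - C * A⁻¹ * B) i j by
    rw [Matrix.sub_apply, Matrix.mul_assoc, Matrix.mul_apply]
    exact dvd_sub (hD i j) (dvd_sum fun l _ => (hC i l).mul_right _)
  have : D - C * A⁻¹ * B = (p : ℤ_[p]) • Matrix.of S := by ext i j; exact hS i j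
  rw [this, det_smul, Fintype.card_fin]
  exact dvd_mul_right _ _

/-- The corank of an alternating matrix of even size is even. -/
lemma even_corank {F : Type*} [Field F] (h2 : (2 : F) ≠ 0) {n : ℕ} {M : Matrix (Fin n) (Fin n) F}
    (hM : M.transpose = -M) : Even M.rank := by
  obtain ⟨k, d, e, P, A, hP, hA, hblock, hr⟩ := exists_adapted_basis M hM
  have hk : M.rank = k := by
    have := Fintype.card_congr e
    simp only [Fintype.card_sum, Fintype.card_fin] at this
    omega
  rw [hk]
  refine even_of_alternating h2 ?_ hA
  have h1 : (P.transpose * M.submatrix e e * P).transpose = -(P.transpose * M.submatrix e e * P) := by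
    rw [transpose_mul, transpose_mul, transpose_transpose,
      transpose_submatrix, hM]
    simp [Matrix.mul_assoc, submatrix_neg]
  rw [hblock, fromBlocks_transpose, fromBlocks_neg, fromBlocks_inj] at h1
  exact h1.1

/-! ### Degenerate nodes -/

/-- A matrix-valued remainder term of higher order at the origin. -/
def MatrixRemainder {ι : Type*} (E : ℤ_[p] → ℤ_[p] → Matrix ι ι ℤ_[p]) : Prop :=
  E 0 0 = 0 ∧ ∀ (k l : ℕ) (x y x' y' : ℤ_[p]), (p : ℤ_[p]) ^ k ∣ x → (p : ℤ_[p]) ^ k ∣ y →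
    (p : ℤ_[p]) ^ k ∣ x' → (p : ℤ_[p]) ^ k ∣ y' → (p : ℤ_[p]) ^ l ∣ x - x' →
    (p : ℤ_[p]) ^ l ∣ y - y' → ∀ i j, (p : ℤ_[p]) ^ (l + k + 1) ∣ E x y i j - E x' y' i j

lemma MatrixRemainder.dvd {ι : Type*} {E : ℤ_[p] → ℤ_[p] → Matrix ι ι ℤ_[p]}
    (hE : MatrixRemainder E) (x y : ℤ_[p]) (i j : ι) : (p : ℤ_[p]) ∣ E x y i j := by
  have := hE.2 0 0 x y 0 0 (by simp) (by simp) (by simp) (by simp) (by simp) (by simp) i j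
  rwa [hE.1, Matrix.zero_apply, sub_zero, zero_add, zero_add, pow_one] at this

lemma MatrixRemainder.rescale {ι : Type*} {E : ℤ_[p] → ℤ_[p] → Matrix ι ι ℤ_[p]}
    (hE : MatrixRemainder E) :
    ∃ E', MatrixRemainder E' ∧ ∀ x y, E (p * x) (p * y) = (p : ℤ_[p]) • E' x y := by
  choose E' hE' using fun x y i j => hE.dvd (p * x) (p * y) i j
  refine ⟨fun x y => Matrix.of (E' x y), ⟨?_, ?_⟩, fun x y => by ext i j; exact hE' x y i j⟩
  · ext i j
    have := hE' 0 0 i j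
    rw [mul_zero, hE.1] at this
    exact (mul_eq_zero.1 this.symm).resolve_left padic_p_ne_zero
  · intro k l x y x' y' h1 h2 h3 h4 h5 h6 i j
    have h7 := hE.2 (k + 1) (l + 1) (p * x) (p * y) (p * x') (p * y')
      (by rw [pow_succ']; exact mul_dvd_mul_left _ h1)
      (by rw [pow_succ']; exact mul_dvd_mul_left _ h2)
      (by rw [pow_succ']; exact mul_dvd_mul_left _ h3)
      (by rw [pow_succ']; exact mul_dvd_mul_left _ h4)
      (by rw [pow_succ', ← mul_sub]; exact mul_dvd_mul_left _ h5)
      (by rw [pow_succ', ← mul_sub]; exact mul_dvd_mul_left _ h6) i j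
    rw [hE', hE', ← mul_sub] at h7
    rw [← mul_dvd_mul_iff_left padic_p_ne_zero, ← pow_succ']
    exact (pow_dvd_pow _ (by omega)).trans h7

lemma eq_zero_of_rank_eq_zero {F : Type*} [Field F] {n : ℕ} {M : Matrix (Fin n) (Fin n) F}
    (h : M.rank = 0) : M = 0 := by
  have h1 : LinearMap.range M.mulVecLin = ⊥ := Submodule.finrank_eq_zero.1 h
  have h2 := LinearMap.range_eq_bot.1 h1
  ext i j
  have := congrFun (LinearMap.congr_fun h2 (Pi.single j 1)) i
  simpa using this

lemma det_ne_zero_of_rank_eq {F : Type*} [Field F] {n : ℕ} {M : Matrix (Fin n) (Fin n) F}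
    (hM : M.transpose = -M) (h : M.rank = n) : M.det ≠ 0 := by
  obtain ⟨k, d, e, P, A, hP, hA, hblock, hr⟩ := exists_adapted_basis M hM
  obtain rfl : d = 0 := by omega
  have h1 := det_conj_submatrix e P M
  rw [hblock, det_fromBlocks_zero₂₁, Matrix.det_fin_zero, mul_one] at h1
  intro h0
  rw [h0, mul_zero] at h1
  exact hA h1

lemma redMod_rank_fin_four {N : Matrix (Fin 4) (Fin 4) ℤ_[p]} (hp2 : p ≠ 2)
    (hN : N.transpose = -N) (h1 : (p : ℤ_[p]) ∣ N.det) (h2 : redMod N ≠ 0) :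
    (redMod N).rank + 2 = 4 := by
  have h2' : (2 : ZMod p) ≠ 0 := by
    intro h
    have : ((2 : ℕ) : ZMod p) = 0 := by exact_mod_cast h
    rw [ZMod.natCast_eq_zero_iff] at this
    exact hp2 ((Nat.prime_dvd_prime_iff_eq hfp.out Nat.prime_two).1 this)
  have hT : (redMod N).transpose = -redMod N := by
    ext i j
    have := congrArg toZMod (congrFun (congrFun hN i) j)
    simpa [redMod] using this
  obtain ⟨a, ha⟩ := even_corank h2' hT
  have h4 : (redMod N).rank ≤ 4 := (rank_le_card_width _).trans (by simp)
  have h0 : (redMod N).rank ≠ 0 := fun h => h2 (eq_zero_of_rank_eq_zero h)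
  have h5 : (redMod N).rank ≠ 4 := by
    intro h
    apply det_ne_zero_of_rank_eq hT h
    rw [det_redMod, toZMod_eq_zero_iff.2 h1]
  omega

variable {c : ℤ_[p]} {C : ℤ_[p] → ℤ_[p] → ℤ_[p]} {N₁ N₂ : Matrix (Fin 4) (Fin 4) ℤ_[p]}
  {E : ℤ_[p] → ℤ_[p] → Matrix (Fin 4) (Fin 4) ℤ_[p]}

theorem rsum_degenerate_node (hp2 : p ≠ 2) (hc : ¬ (p : ℤ_[p]) ∣ c) (q : ℂ) (n : ℕ)
    (hC : NodalRemainder C) (hE : MatrixRemainder E)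
    (hT : ∀ x y, (x • N₁ + y • N₂ + E x y).transpose = -(x • N₁ + y • N₂ + E x y))
    (hdet : ∀ x y, ∃ u, IsUnit u ∧
      (c * x * y + C x y) ^ 2 = u * (x • N₁ + y • N₂ + E x y).det) :
    rsum n (fun x => rsum n fun y =>
      q ^ plog p (padicKer (n + 1) ((p : ℤ_[p]) • (x • N₁ + y • N₂ + E x y)))) =
      degenerateNodeSeq p (q ^ 2) n := by
  have hp := hfp.out
  have hplog : ∀ (n : ℕ) (M : Matrix (Fin 4) (Fin 4) ℤ_[p]),
      q ^ plog p (padicKer (n + 1) ((p : ℤ_[p]) • M)) = (q ^ 2) ^ 2 * q ^ plog p (padicKer n M) := by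
    intro n M
    rw [padicKer_smul, plog_mul (pow_ne_zero _ hp.ne_zero) (padicKer_ne_zero _ _), plog_pow hp,
      pow_add, Fintype.card_fin]
    ring
  induction n generalizing C E with
  | zero =>
    rw [rsum_zero, rsum_zero, hplog, padicKer_zero]
    simp [degenerateNodeSeq, plog]
  | succ n ih =>
    have hsq : ∀ x y, (p : ℤ_[p]) ∣ c * x * y + C x y ↔
        (p : ℤ_[p]) ∣ (x • N₁ + y • N₂ + E x y).det := by
      intro x y
      obtain ⟨u, hu, h⟩ := hdet x y
      rw [← hu.dvd_mul_left (b := (x • N₁ + y • N₂ + E x y).det), ← h,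
        padic_prime.dvd_pow_iff_dvd two_ne_zero]
    have hunit : ∀ x y, ¬ (p : ℤ_[p]) ∣ x → ¬ (p : ℤ_[p]) ∣ y →
        IsUnit (x • N₁ + y • N₂ + E x y).det := by
      intro x y hx hy
      rw [isUnit_iff_not_dvd, ← hsq]
      exact hC.not_dvd hc hx hy
    have hred : ∀ x y, redMod (x • N₁ + y • N₂ + E x y) =
        toZMod x • redMod N₁ + toZMod y • redMod N₂ := by
      intro x y
      ext i j
      have := toZMod_eq_zero_iff.2 (hE.dvd x y i j)
      simp [redMod, this]
    have h1nd : ¬ (p : ℤ_[p]) ∣ 1 := fun h => padic_prime.not_isUnit (isUnit_of_dvd_one h)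
    -- neither of the linear terms vanishes modulo `p`
    have hN₁ : redMod N₁ ≠ 0 := by
      intro h0
      have h1 := hunit 1 1 h1nd h1nd
      have h2 : (p : ℤ_[p]) ∣ ((0 : ℤ_[p]) • N₁ + (1 : ℤ_[p]) • N₂ + E 0 1).det := by
        rw [← hsq]
        simpa using hC.dvd 0 1
      rw [isUnit_iff_toZMod_ne_zero, ← det_redMod, hred, h0] at h1
      rw [← toZMod_eq_zero_iff, ← det_redMod, hred, h0] at h2
      simp only [smul_zero, zero_add] at h1 h2
      exact h1 h2
    have hN₂ : redMod N₂ ≠ 0 := by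
      intro h0
      have h1 := hunit 1 1 h1nd h1nd
      have h2 : (p : ℤ_[p]) ∣ ((1 : ℤ_[p]) • N₁ + (0 : ℤ_[p]) • N₂ + E 1 0).det := by
        rw [← hsq]
        simpa using hC.dvd 1 0
      rw [isUnit_iff_toZMod_ne_zero, ← det_redMod, hred, h0] at h1
      rw [← toZMod_eq_zero_iff, ← det_redMod, hred, h0] at h2
      simp only [smul_zero, add_zero] at h1 h2
      exact h1 h2
    have hker : ∀ x y, (p : ℤ_[p]) ∣ c * x * y + C x y → redMod (x • N₁ + y • N₂ + E x y) ≠ 0 →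
        q ^ plog p (padicKer (n + 1) (x • N₁ + y • N₂ + E x y)) =
          (q ^ 2) ^ truncVal (n + 1) (c * x * y + C x y) := by
      intro x y hxy h0
      obtain ⟨u, hu, h⟩ := hdet x y
      rw [padicKer_of_corank_two (n + 1) (hT x y)
        (redMod_rank_fin_four hp2 (hT x y) ((hsq x y).1 hxy) h0) hu h, plog_pow hp, pow_mul]
    rw [rsum_congr fun x => rsum_congr fun y => hplog _ _]
    simp only [rsum_mul_left]
    have hinv : InvMod₂ (n + 1) fun x y =>
        q ^ plog p (padicKer (n + 1) (x • N₁ + y • N₂ + E x y)) := by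
      intro x y x' y' hx hy
      beta_reduce
      rw [padicKer_congr]
      intro i j
      have h1 := hE.2 0 (n + 1) x y x' y' (by simp) (by simp) (by simp) (by simp) hx hy i j
      simp only [Matrix.add_apply, Matrix.smul_apply, smul_eq_mul]
      rw [show x * N₁ i j + y * N₂ i j + E x y i j - (x' * N₁ i j + y' * N₂ i j + E x' y' i j) =
        (x - x') * N₁ i j + (y - y') * N₂ i j + (E x y i j - E x' y' i j) by ring]
      exact dvd_add (dvd_add (hx.mul_right _) (hy.mul_right _)) ((pow_dvd_pow _ (by omega)).trans h1)
    rw [rsum₂_digits hinv (A := degenerateNodeSeq p (q ^ 2) n) (B := smoothSeq p (q ^ 2) n)]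
    · rw [degenerateNodeSeq]
    · obtain ⟨C', hC', hCC'⟩ := hC.rescale
      obtain ⟨E', hE', hEE'⟩ := hE.rescale
      have hscale : ∀ x y : ℤ_[p], ((p : ℤ_[p]) * x) • N₁ + ((p : ℤ_[p]) * y) • N₂ +
          E (p * x) (p * y) = (p : ℤ_[p]) • (x • N₁ + y • N₂ + E' x y) := by
        intro x y
        rw [hEE', mul_smul, mul_smul, smul_add, smul_add]
      rw [← ih hC' hE']
      · exact rsum_congr fun x => rsum_congr fun y => by rw [hscale]
      · intro x y
        have := hT (p * x) (p * y)
        rw [hscale, transpose_smul, ← smul_neg] at this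
        exact smul_right_injective _ (padic_p_ne_zero (p := p)) this
      · intro x y
        obtain ⟨u, hu, h⟩ := hdet (p * x) (p * y)
        refine ⟨u, hu, ?_⟩
        rw [hscale, det_smul, Fintype.card_fin, hCC'] at h
        have h4 : (p : ℤ_[p]) ^ 4 ≠ 0 := pow_ne_zero _ padic_p_ne_zero
        apply mul_left_cancel₀ h4
        linear_combination h
    · intro x hx
      rw [← rsum_truncVal_of_isometry (q ^ 2) n
        (fun y => c * x * ((p : ℤ_[p]) * y) + C x ((p : ℤ_[p]) * y))
        (fun y => hC.dvd_left x y) (fun y y' h => hC.isometry hc hx n y y' h)]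
      refine rsum_congr fun y => hker _ _ (hC.dvd_left x y) ?_
      rw [hred, toZMod_eq_zero_iff.2 (dvd_mul_right _ _), zero_smul, add_zero]
      exact smul_ne_zero (by rwa [Ne, toZMod_eq_zero_iff]) hN₁
    · intro y hy
      rw [← rsum_truncVal_of_isometry (q ^ 2) n
        (fun x => c * y * ((p : ℤ_[p]) * x) + C ((p : ℤ_[p]) * x) y)
        (fun x => hC.swap.dvd_left y x) (fun x x' h => hC.swap.isometry hc hy n x x' h)]
      have hcomm : ∀ x : ℤ_[p], c * y * ((p : ℤ_[p]) * x) = c * ((p : ℤ_[p]) * x) * y := fun x => by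
        ring
      refine rsum_congr fun x => ?_
      rw [hcomm]
      refine hker _ _ ?_ ?_
      · rw [← hcomm]; exact hC.swap.dvd_left y x
      · rw [hred, toZMod_eq_zero_iff.2 (dvd_mul_right _ _), zero_smul, zero_add]
        exact smul_ne_zero (by rwa [Ne, toZMod_eq_zero_iff]) hN₂
    · intro x y hx hy
      rw [padicKer_eq_one _ (hunit x y hx hy)]
      simp [plog]

end Corank

end

section

/-! ### Taylor expansions -/

section Taylor

open MvPolynomial

variable {R : Type*} [CommRing R]

lemma pderiv_comm (i j : Fin 3) (F : ℳ R) :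
    pderiv i (pderiv j F) = pderiv j (pderiv i F) := by
  have h : ⁅(pderiv i : Derivation R (ℳ R) (ℳ R)),
      (pderiv j : Derivation R (ℳ R) (ℳ R))⁆ = 0 := by
    refine MvPolynomial.derivation_ext fun k => ?_
    rw [Derivation.commutator_apply, pderiv_X, pderiv_X]
    by_cases hi : i = k <;> by_cases hj : j = k <;>
      simp [hi, hj]
  have := congrArg (fun D => D F) h
  rw [Derivation.commutator_apply] at this
  exact sub_eq_zero.1 this

lemma dvd_eval_sub_eval (F : ℳ R) {x y : Fin 3 → R} {b : R}
    (h : ∀ i, b ∣ x i - y i) : b ∣ eval x F - eval y F := by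
  induction F using MvPolynomial.induction_on with
  | C a => simp
  | add F G hF hG =>
    rw [map_add, map_add, add_sub_add_comm]; exact dvd_add hF hG
  | mul_X F j hF =>
    rw [map_mul, map_mul, eval_X, eval_X,
      show eval x F * x j - eval y F * y j =
        (eval x F - eval y F) * x j + eval y F * (x j - y j) by ring]
    exact dvd_add (hF.mul_right _) ((h j).mul_left _)

lemma taylor_first_order (F : ℳ R) (c : Fin 3 → R) {x y : Fin 3 → R} {a b : R}
    (hx : ∀ i, a ∣ x i) (hy : ∀ i, a ∣ y i) (h : ∀ i, b ∣ x i - y i) :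
    a * b ∣ eval (c + x) F - eval (c + y) F - ∑ i, eval c (pderiv i F) * (x i - y i) := by
  induction F using MvPolynomial.induction_on with
  | C a => simp
  | add F G hF hG =>
    convert dvd_add hF hG using 1
    simp only [map_add, add_mul, sum_add_distrib]
    ring
  | mul_X F j hF =>
    have h1 : a ∣ eval (c + x) F - eval c F := dvd_eval_sub_eval F fun i => by simpa using hx i
    have h2 : b ∣ eval (c + x) F - eval (c + y) F := dvd_eval_sub_eval F fun i => by simpa using h i
    have e : eval (c + x) (F * X j) - eval (c + y) (F * X j) -
        ∑ i, eval c (pderiv i (F * X j)) * (x i - y i) =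
        (eval (c + x) F - eval (c + y) F - ∑ i, eval c (pderiv i F) * (x i - y i)) * c j +
        (eval (c + x) F - eval c F) * (x j - y j) + y j * (eval (c + x) F - eval (c + y) F) := by
      have hs : ∑ i, eval c (pderiv i (F * X j)) * (x i - y i) =
          (∑ i, eval c (pderiv i F) * (x i - y i)) * c j + eval c F * (x j - y j) := by
        have : ∀ i, eval c (pderiv i (F * X j)) * (x i - y i) =
            eval c (pderiv i F) * (x i - y i) * c j +
              if i = j then eval c F * (x j - y j) else 0 := by
          intro i
          rw [Derivation.leibniz, pderiv_X]
          by_cases hij : i = j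
          · subst hij; simp; ring
          · simp [hij, Ne.symm hij]; ring
        rw [sum_congr rfl fun i _ => this i, sum_add_distrib, sum_mul]
        simp
      rw [hs]
      simp only [map_mul, eval_X, Pi.add_apply]
      ring
    rw [e]
    exact dvd_add (dvd_add (hF.mul_right _) (mul_dvd_mul h1 (h j))) (mul_dvd_mul (hy j) h2)

/-- Twice the remainder of the second order Taylor expansion. -/
def taylorRem (F : ℳ R) (c x : Fin 3 → R) : R :=
  2 * eval (c + x) F - 2 * eval c F - 2 * ∑ i, eval c (pderiv i F) * x i -
    ∑ i, ∑ j, eval c (pderiv i (pderiv j F)) * x i * x j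

lemma taylorRem_mul_X (F : ℳ R) (c x : Fin 3 → R) (k : Fin 3) :
    taylorRem (F * X k) c x = (∑ i, ∑ j, eval c (pderiv i (pderiv j F)) * x i * x j) * x k +
      taylorRem F c x * (c k + x k) := by
  have h1 : ∀ i (G : ℳ R), pderiv i (G * X k) =
      pderiv i G * X k + if i = k then G else 0 := by
    intro i G
    rw [Derivation.leibniz, pderiv_X]
    by_cases hik : i = k
    · subst hik; simp; ring
    · simp [hik, Ne.symm hik]; ring
  have hs : ∑ i, eval c (pderiv i (F * X k)) * x i =
      (∑ i, eval c (pderiv i F) * x i) * c k + eval c F * x k := by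
    have : ∀ i, eval c (pderiv i (F * X k)) * x i =
        eval c (pderiv i F) * x i * c k + if i = k then eval c F * x k else 0 := by
      intro i
      rw [h1]
      by_cases hik : i = k
      · subst hik; simp; ring
      · simp [hik]; ring
    rw [sum_congr rfl fun i _ => this i, sum_add_distrib, sum_mul]
    simp
  have hq : ∑ i, ∑ j, eval c (pderiv i (pderiv j (F * X k))) * x i * x j =
      (∑ i, ∑ j, eval c (pderiv i (pderiv j F)) * x i * x j) * c k +
      2 * (∑ i, eval c (pderiv i F) * x i) * x k := by
    have : ∀ i j, eval c (pderiv i (pderiv j (F * X k))) * x i * x j =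
        eval c (pderiv i (pderiv j F)) * x i * x j * c k +
        (if i = k then eval c (pderiv j F) * x j * x k else 0) +
        (if j = k then eval c (pderiv i F) * x i * x k else 0) := by
      intro i j
      rw [h1 j F, map_add, h1 i]
      by_cases hik : i = k <;> by_cases hjk : j = k
      · subst hik; subst hjk; simp; ring
      · subst hik; simp [hjk]; ring
      · subst hjk; simp [hik]; ring
      · simp [hik, hjk]; ring
    simp only [this, sum_add_distrib, sum_mul]
    simp
    simp only [mul_sum, sum_mul]
    rw [add_assoc, ← sum_add_distrib]
    congr 1
    exact sum_congr rfl fun i _ => by ring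
  rw [taylorRem, taylorRem, hs, hq]
  simp only [map_mul, eval_X, Pi.add_apply]
  ring

lemma taylorRem_zero (F : ℳ R) (c : Fin 3 → R) : taylorRem F c 0 = 0 := by
  simp [taylorRem]

lemma taylor_second_order (F : ℳ R) (c : Fin 3 → R) {x y : Fin 3 → R} {a b : R}
    (hx : ∀ i, a ∣ x i) (hy : ∀ i, a ∣ y i) (h : ∀ i, b ∣ x i - y i) :
    a ^ 2 * b ∣ taylorRem F c x - taylorRem F c y := by
  induction F using MvPolynomial.induction_on generalizing x y b with
  | C a => simp [taylorRem]
  | add F G hF hG =>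
    convert dvd_add (hF hx hy h) (hG hx hy h) using 1
    simp only [taylorRem, map_add, add_mul, sum_add_distrib]
    ring
  | mul_X F k hF =>
    have h1 : a ^ 2 ∣ taylorRem F c y := by
      have := hF (y := 0) (b := a) hy (fun _ => dvd_zero _) (fun i => by simpa using hy i)
      rw [taylorRem_zero, sub_zero] at this
      exact (dvd_mul_right _ _).trans this
    have h2 : ∀ i j : Fin 3, a ^ 2 * b ∣ x i * x j * x k - y i * y j * y k := by
      intro i j
      rw [show x i * x j * x k - y i * y j * y k = x j * x k * (x i - y i) +
        y i * x k * (x j - y j) + y i * y j * (x k - y k) by ring, pow_two]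
      exact dvd_add (dvd_add (mul_dvd_mul (mul_dvd_mul (hx j) (hx k)) (h i))
        (mul_dvd_mul (mul_dvd_mul (hy i) (hx k)) (h j)))
        (mul_dvd_mul (mul_dvd_mul (hy i) (hy j)) (h k))
    have e : taylorRem (F * X k) c x - taylorRem (F * X k) c y =
        (∑ i, ∑ j, eval c (pderiv i (pderiv j F)) * (x i * x j * x k - y i * y j * y k)) +
        (taylorRem F c x - taylorRem F c y) * (c k + x k) + taylorRem F c y * (x k - y k) := by
      rw [taylorRem_mul_X, taylorRem_mul_X]
      have : ∑ i, ∑ j, eval c (pderiv i (pderiv j F)) * (x i * x j * x k - y i * y j * y k) =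
          (∑ i, ∑ j, eval c (pderiv i (pderiv j F)) * x i * x j) * x k -
          (∑ i, ∑ j, eval c (pderiv i (pderiv j F)) * y i * y j) * y k := by
        simp only [sum_mul, ← sum_sub_distrib]
        exact sum_congr rfl fun i _ => sum_congr rfl fun j _ => by ring
      rw [this]
      ring
    rw [e]
    exact dvd_add (dvd_add (dvd_sum fun i _ => dvd_sum fun j _ => (h2 i j).mul_left _)
      ((hF hx hy h).mul_right _)) (mul_dvd_mul h1 (h k))

end Taylor

section LocalExpansion

open MvPolynomial

variable {p : ℕ} [hfp : Fact p.Prime]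

lemma isUnit_two (hp2 : p ≠ 2) : IsUnit (2 : ℤ_[p]) := by
  rw [isUnit_iff_not_dvd, ← toZMod_eq_zero_iff]
  intro h
  have : ((2 : ℕ) : ZMod p) = 0 := by
    rw [← map_natCast (toZMod (p := p))]; exact_mod_cast h
  rw [ZMod.natCast_eq_zero_iff] at this
  exact hp2 ((Nat.prime_dvd_prime_iff_eq hfp.out Nat.prime_two).1 this)

/-- The expansion of an equation at a node. -/
lemma exists_nodal_expansion (hp2 : p ≠ 2) (F : ℳ ℤ_[p]) (c ψ₁ ψ₂ : Fin 3 → ℤ_[p])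
    (h0 : eval c F = 0) (h1 : ∀ i, eval c (pderiv i F) = 0)
    (h11 : ∑ i, ∑ j, eval c (pderiv i (pderiv j F)) * ψ₁ i * ψ₁ j = 0)
    (h22 : ∑ i, ∑ j, eval c (pderiv i (pderiv j F)) * ψ₂ i * ψ₂ j = 0) :
    ∃ C, NodalRemainder C ∧ ∀ x y : ℤ_[p], eval (c + (p : ℤ_[p]) • (x • ψ₁ + y • ψ₂)) F =
      (p : ℤ_[p]) ^ 2 * ((∑ i, ∑ j, eval c (pderiv i (pderiv j F)) * ψ₁ i * ψ₂ j) * x * y + C x y) := by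
  set c₀ := ∑ i, ∑ j, eval c (pderiv i (pderiv j F)) * ψ₁ i * ψ₂ j with hc₀
  let X : ℤ_[p] → ℤ_[p] → Fin 3 → ℤ_[p] := fun x y => (p : ℤ_[p]) • (x • ψ₁ + y • ψ₂)
  have hX : ∀ x y i, X x y i = p * (x * ψ₁ i + y * ψ₂ i) := fun x y i => rfl
  have hXd : ∀ k x y, (p : ℤ_[p]) ^ k ∣ x → (p : ℤ_[p]) ^ k ∣ y →
      ∀ i, (p : ℤ_[p]) ^ (k + 1) ∣ X x y i := by
    intro k x y hx hy i
    rw [hX, pow_succ']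
    exact mul_dvd_mul_left _ (dvd_add (hx.mul_right _) (hy.mul_right _))
  have hXs : ∀ l x y x' y', (p : ℤ_[p]) ^ l ∣ x - x' → (p : ℤ_[p]) ^ l ∣ y - y' →
      ∀ i, (p : ℤ_[p]) ^ (l + 1) ∣ X x y i - X x' y' i := by
    intro l x y x' y' hx hy i
    rw [hX, hX, show (p : ℤ_[p]) * (x * ψ₁ i + y * ψ₂ i) - p * (x' * ψ₁ i + y' * ψ₂ i) =
      p * ((x - x') * ψ₁ i + (y - y') * ψ₂ i) by ring, pow_succ']
    exact mul_dvd_mul_left _ (dvd_add (hx.mul_right _) (hy.mul_right _))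
  have hp2' : (p : ℤ_[p]) ^ 2 ≠ 0 := pow_ne_zero _ padic_p_ne_zero
  have h20 : (2 : ℤ_[p]) ≠ 0 := two_ne_zero
  have hrem : ∀ x y, (p : ℤ_[p]) ^ 2 * 2 ∣ taylorRem F c (X x y) := by
    intro x y
    rw [mul_comm, (isUnit_two hp2).mul_left_dvd]
    have := taylor_second_order F c (x := X x y) (y := 0) (a := p) (b := 1)
      (by simpa using hXd 0 x y (by simp) (by simp)) (by simp) (by simp)
    rwa [taylorRem_zero, sub_zero, mul_one] at this
  choose C hC using hrem
  have hXX : X 0 0 = 0 := by funext i; rw [hX]; simp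
  refine ⟨C, ⟨?_, ?_⟩, ?_⟩
  · have := hC 0 0
    rw [hXX, taylorRem_zero] at this
    exact (mul_eq_zero.1 this.symm).resolve_left (mul_ne_zero hp2' h20)
  · intro k l x y x' y' hx hy hx' hy' hxx hyy
    have h := taylor_second_order F c (hXd k x y hx hy) (hXd k x' y' hx' hy') (hXs l x y x' y' hxx hyy)
    rw [hC, hC, ← mul_sub, mul_assoc, ← pow_mul, ← pow_add] at h
    have h3 : (p : ℤ_[p]) ^ 2 * (p : ℤ_[p]) ^ (l + 2 * k + 1) ∣
        (p : ℤ_[p]) ^ 2 * (2 * (C x y - C x' y')) := by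
      rw [← pow_add]
      convert h using 2
      ring
    rw [mul_dvd_mul_iff_left hp2', (isUnit_two hp2).dvd_mul_left] at h3
    exact h3
  · intro x y
    have h := hC x y
    have hq : ∑ i, ∑ j, eval c (pderiv i (pderiv j F)) * X x y i * X x y j =
        (p : ℤ_[p]) ^ 2 * (2 * c₀ * x * y) := by
      have hsymm : ∑ i, ∑ j, eval c (pderiv i (pderiv j F)) * ψ₂ i * ψ₁ j = c₀ := by
        rw [hc₀, sum_comm]
        refine sum_congr rfl fun i _ => sum_congr rfl fun j _ => ?_
        rw [pderiv_comm j i]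
        ring
      have : ∀ i j, eval c (pderiv i (pderiv j F)) * X x y i * X x y j =
          (p : ℤ_[p]) ^ 2 * (x ^ 2 * (eval c (pderiv i (pderiv j F)) * ψ₁ i * ψ₁ j) +
          y ^ 2 * (eval c (pderiv i (pderiv j F)) * ψ₂ i * ψ₂ j) +
          x * y * (eval c (pderiv i (pderiv j F)) * ψ₁ i * ψ₂ j) +
          x * y * (eval c (pderiv i (pderiv j F)) * ψ₂ i * ψ₁ j)) := by
        intro i j
        rw [hX, hX]; ring
      simp only [this, ← mul_sum, sum_add_distrib, h11, h22, hsymm, ← hc₀]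
      ring
    rw [taylorRem, h0, hq] at h
    simp only [h1, zero_mul, sum_const_zero, mul_zero, sub_zero] at h
    apply mul_left_cancel₀ h20
    linear_combination h

end LocalExpansion

end

section

/-! ### Specialization of the commutator matrix -/

section Specialize

open MvPolynomial

variable {n : ℕ} (m : Fin 3 → Matrix (Fin n) (Fin n) ℤ)

lemma eval_baseChange {R : Type*} [CommRing R] (f : ℳ ℤ) (φ : Fin 3 → R) :
    eval φ (baseChange R f) = eval₂Hom (Int.castRingHom R) φ f := by
  rw [baseChange, eval_map]; rfl

lemma map_eval_baseChange {R S : Type*} [CommRing R] [CommRing S] (g : R →+* S)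
    (f : ℳ ℤ) (φ : Fin 3 → R) :
    g (eval φ (baseChange R f)) = eval (fun i => g (φ i)) (baseChange S f) := by
  rw [eval_baseChange, eval_baseChange, coe_eval₂Hom, coe_eval₂Hom, hom_eval₂]
  congr 1
  exact RingHom.ext_int _ _

lemma pderiv_baseChange {R : Type*} [CommRing R] (f : ℳ ℤ) (i : Fin 3) :
    pderiv i (baseChange R f) = baseChange R (pderiv i f) := pderiv_map

lemma map_commMatrix {R S : Type*} [CommRing R] [CommRing S] (g : R →+* S) (φ : Fin 3 → R) :
    (commMatrix m φ).map g = commMatrix m (fun i => g (φ i)) := by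
  ext i j
  simp [commMatrix]

variable {m} in
lemma det_commMatrix {f : ℳ ℤ} (hf : f ^ 2 = (genericCommMatrix m).det)
    {R : Type*} [CommRing R] (φ : Fin 3 → R) :
    (commMatrix m φ).det = eval φ (baseChange R f) ^ 2 := by
  rw [eval_baseChange, ← map_pow, hf, RingHom.map_det]
  congr 1
  rw [RingHom.mapMatrix_apply, genericCommMatrix, map_commMatrix]
  simp

variable {m} in
lemma transpose_commMatrix (hm : ∀ k, (m k).transpose = -m k) {R : Type*} [CommRing R]
    (φ : Fin 3 → R) : (commMatrix m φ).transpose = -commMatrix m φ := by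
  ext i j
  have : ∀ k, m k j i = - m k i j := fun k => congrFun (congrFun (hm k) i) j
  simp [commMatrix, this]

lemma commMatrix_add {R : Type*} [CommRing R] (φ ψ : Fin 3 → R) :
    commMatrix m (φ + ψ) = commMatrix m φ + commMatrix m ψ := by
  ext i j
  simp [commMatrix, mul_add, sum_add_distrib]

lemma commMatrix_smul {R : Type*} [CommRing R] (c : R) (φ : Fin 3 → R) :
    commMatrix m (c • φ) = c • commMatrix m φ := by
  ext i j
  simp only [commMatrix, Pi.smul_apply, smul_eq_mul, Matrix.smul_apply, mul_sum]
  exact sum_congr rfl fun k _ => by ring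

end Specialize

lemma dvd_mulVec {ι κ R : Type*} [Fintype κ] [CommRing R] (M : Matrix ι κ R) {x : κ → R} {b : R}
    (h : ∀ j, b ∣ x j) (i : ι) : b ∣ M.mulVec x i := by
  rw [mulVec, dotProduct]
  exact dvd_sum fun j _ => (h j).mul_left _

section ClassSum

variable {p : ℕ} [hfp : Fact p.Prime]

lemma castHom_toZModPow (a : ℕ) (x : ℤ_[p]) :
    ZMod.castHom (dvd_pow_self p a.succ_ne_zero) (ZMod p) (toZModPow (a + 1) x) =
      toZMod x := by
  set N := (toZMod x).val
  have h1 : (p : ℤ_[p]) ∣ x - (N : ℤ_[p]) := by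
    rw [← toZMod_eq_zero_iff, map_sub, map_natCast, ZMod.natCast_zmod_val, sub_self]
  obtain ⟨t, ht⟩ := h1
  have hx : x = (N : ℤ_[p]) + p * t := by rw [← ht]; ring
  conv_lhs => rw [hx]
  conv_rhs => rw [hx]
  simp

variable {n : ℕ} (m : Fin 3 → Matrix (Fin n) (Fin n) ℤ)

/-- The part of `primSum` with given reduction modulo `p`. -/
def classSum (a : ℕ) (q : ℂ) (v : Fin 3 → ZMod p) : ℂ :=
  ∑' φ : {φ : Fin 3 → ZMod (p ^ (a + 1)) //
    ∀ k, ZMod.castHom (dvd_pow_self p a.succ_ne_zero) (ZMod p) (φ k) = v k},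
    q ^ plog p (kerCard (commMatrix m φ.1))

lemma primSum_eq_sum_classSum (a : ℕ) (q : ℂ) :
    primSum m p a q = ∑ v : {v : Fin 3 → ZMod p // v ≠ 0}, classSum m a q v.1 := by
  classical
  have hp := hfp.out
  let c := ZMod.castHom (dvd_pow_self p a.succ_ne_zero) (ZMod p)
  have hc : ∀ x : ZMod (p ^ (a + 1)), IsUnit x ↔ c x ≠ 0 := by
    intro x
    rw [isUnit_zmod_prime_pow_iff hp, not_iff_not]
    constructor
    · rintro ⟨t, rfl⟩; simp
    · intro h
      obtain ⟨t, rfl⟩ := ZMod.natCast_zmod_surjective x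
      rw [map_natCast, ZMod.natCast_eq_zero_iff] at h
      obtain ⟨b, rfl⟩ := h
      exact ⟨b, by push_cast; rfl⟩
  let r : {φ : Fin 3 → ZMod (p ^ (a + 1)) // ∃ k, IsUnit (φ k)} → {v : Fin 3 → ZMod p // v ≠ 0} :=
    fun φ => ⟨fun k => c (φ.1 k), by
      obtain ⟨k, hk⟩ := φ.2
      intro h
      exact (hc _).1 hk (congrFun h k)⟩
  rw [primSum, tsum_eq_tsum_fiber r Summable.of_finite, tsum_fintype]
  refine sum_congr rfl fun v _ => ?_
  let e : {φ : {φ : Fin 3 → ZMod (p ^ (a + 1)) // ∃ k, IsUnit (φ k)} // r φ = v} ≃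
      {φ : Fin 3 → ZMod (p ^ (a + 1)) // ∀ k, c (φ k) = v.1 k} :=
    { toFun := fun φ => ⟨φ.1.1, fun k => congrFun (congrArg Subtype.val φ.2) k⟩
      invFun := fun φ => ⟨⟨φ.1, by
        by_contra! hcon
        apply v.2
        funext k
        have := hcon k
        rw [hc, not_not, φ.2] at this
        exact this⟩, Subtype.ext (funext φ.2)⟩
      left_inv := fun φ => rfl
      right_inv := fun φ => rfl }
  rw [classSum, ← e.tsum_eq]
  rfl

lemma classSum_eq_rsum (a : ℕ) (q : ℂ) (v : Fin 3 → ZMod p) (c : Fin 3 → ℤ_[p])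
    (hc : ∀ k, toZMod (c k) = v k) (W : Matrix (Fin 3) (Fin 3) ℤ_[p]) (hW : IsUnit W.det) :
    classSum m a q v = rsum a fun u => rsum a fun x => rsum a fun y =>
      q ^ plog p (padicKer (a + 1) (commMatrix m (c + (p : ℤ_[p]) • W.mulVec ![u, x, y]))) := by
  classical
  have hp := hfp.out
  let S := {φ : Fin 3 → ZMod (p ^ (a + 1)) //
    ∀ k, ZMod.castHom (dvd_pow_self p a.succ_ne_zero) (ZMod p) (φ k) = v k}
  let Z := ZMod (p ^ a)
  let vec : Z × Z × Z → Fin 3 → ℤ_[p] := fun z =>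
    ![((z.1.val : ℕ) : ℤ_[p]), ((z.2.1.val : ℕ) : ℤ_[p]), ((z.2.2.val : ℕ) : ℤ_[p])]
  let pt : Z × Z × Z → Fin 3 → ℤ_[p] := fun z => c + (p : ℤ_[p]) • W.mulVec (vec z)
  let g : Z × Z × Z → S := fun z => ⟨fun k => toZModPow (a + 1) (pt z k), fun k => by
    rw [castHom_toZModPow, ← hc k]
    simp [pt]⟩
  have hdvdW : ∀ (k : ℕ) (x : Fin 3 → ℤ_[p]), (∀ i, (p : ℤ_[p]) ^ k ∣ W.mulVec x i) →
      ∀ i, (p : ℤ_[p]) ^ k ∣ x i := by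
    intro k x h i
    have : x = W⁻¹.mulVec (W.mulVec x) := by
      rw [mulVec_mulVec, nonsing_inv_mul _ hW, one_mulVec]
    rw [this]
    exact dvd_mulVec _ h i
  have hg : Function.Bijective g := by
    constructor
    · intro z z' h
      have h1 : ∀ k, (p : ℤ_[p]) ^ (a + 1) ∣ pt z k - pt z' k := fun k =>
        pow_dvd_sub_iff.2 (congrFun (congrArg Subtype.val h) k)
      have h2 : ∀ k, (p : ℤ_[p]) ^ a ∣ W.mulVec (vec z - vec z') k := by
        intro k
        rw [← mul_dvd_mul_iff_left (padic_p_ne_zero (p := p)), ← pow_succ']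
        convert h1 k using 1
        simp only [pt, Pi.add_apply, Pi.smul_apply, smul_eq_mul, mulVec_sub, Pi.sub_apply]
        ring
      have h3 := hdvdW a _ h2
      have e0 := h3 0
      have e1 := h3 1
      have e2 := h3 2
      simp only [vec, Pi.sub_apply, Matrix.cons_val_zero, Matrix.cons_val_one, Matrix.cons_val,
        pow_dvd_sub_iff, toZModPow_val] at e0 e1 e2
      exact Prod.ext e0 (Prod.ext e1 e2)
    · rintro ⟨φ, hφ⟩
      have h1 : ∀ k, ∃ t : ℤ_[p], (((φ k).val : ℕ) : ℤ_[p]) - c k = p * t := by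
        intro k
        have : (p : ℤ_[p]) ∣ (((φ k).val : ℕ) : ℤ_[p]) - c k := by
          rw [← toZMod_eq_zero_iff, map_sub, hc, ← hφ k, ← castHom_toZModPow a, toZModPow_val, sub_self]
        exact this
      choose t ht using h1
      let s := W⁻¹.mulVec t
      have hs : W.mulVec s = t := by
        rw [mulVec_mulVec, mul_nonsing_inv _ hW, one_mulVec]
      let z : Z × Z × Z := (toZModPow a (s 0), toZModPow a (s 1),
        toZModPow a (s 2))
      have hz : ∀ i, (p : ℤ_[p]) ^ a ∣ vec z i - s i := by
        intro i
        fin_cases i <;>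
        · rw [pow_dvd_sub_iff]
          exact toZModPow_val _
      refine ⟨z, Subtype.ext (funext fun k => ?_)⟩
      show toZModPow (a + 1) (pt z k) = φ k
      rw [← toZModPow_val (φ k), ← pow_dvd_sub_iff]
      have h2 : pt z k - (((φ k).val : ℕ) : ℤ_[p]) = p * W.mulVec (vec z - s) k := by
        have h3 := ht k
        rw [mulVec_sub, hs]
        simp only [pt, Pi.add_apply, Pi.smul_apply, smul_eq_mul, Pi.sub_apply]
        linear_combination -h3
      rw [h2, pow_succ']
      exact mul_dvd_mul_left _ (dvd_mulVec _ hz k)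
  have hS : Fintype S := Fintype.ofFinite S
  show ∑' φ : S, q ^ plog p (kerCard (commMatrix m φ.1)) = _
  rw [tsum_fintype, ← hg.sum_comp, Fintype.sum_prod_type]
  refine sum_congr rfl fun u _ => ?_
  rw [Fintype.sum_prod_type]
  refine sum_congr rfl fun x _ => sum_congr rfl fun y _ => ?_
  show q ^ plog p (kerCard (commMatrix m fun k => toZModPow (a + 1) (pt (u, x, y) k))) = _
  rw [← map_commMatrix]
  rfl

end ClassSum

section LocalEvaluation

open MvPolynomial

variable {p : ℕ} [hfp : Fact p.Prime] {n : ℕ} {m : Fin 3 → Matrix (Fin n) (Fin n) ℤ}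
  {f : ℳ ℤ}

lemma redMod_commMatrix (φ : Fin 3 → ℤ_[p]) :
    redMod (commMatrix m φ) = commMatrix m (fun k => toZMod (φ k)) :=
  map_commMatrix m _ φ

lemma toZMod_add_p_smul (c x : Fin 3 → ℤ_[p]) :
    (fun k => toZMod ((c + (p : ℤ_[p]) • x) k)) = fun k => toZMod (c k) := by
  funext k
  simp

lemma exists_lift (v : Fin 3 → ZMod p) : ∃ c : Fin 3 → ℤ_[p], ∀ k, toZMod (c k) = v k := by
  choose c hc using fun k => toZMod_surjective (p := p) (v k)
  exact ⟨c, hc⟩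

lemma plog_one (p : ℕ) : plog p 1 = 0 := by simp [plog]

lemma two_ne_zero_zmod (hp2 : p ≠ 2) : (2 : ZMod p) ≠ 0 := by
  have := (isUnit_two hp2).map (toZMod (p := p))
  rw [map_ofNat] at this
  exact this.ne_zero

theorem classSum_of_eval_ne_zero (hf : f ^ 2 = (genericCommMatrix m).det) (a : ℕ) (q : ℂ)
    {v : Fin 3 → ZMod p} (hv : eval v (baseChange (ZMod p) f) ≠ 0) :
    classSum m a q v = (p : ℂ) ^ (3 * a) := by
  obtain ⟨c, hc⟩ := exists_lift v
  rw [classSum_eq_rsum m a q v c hc 1 (by simp)]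
  have : ∀ u x y : ℤ_[p], q ^ plog p (padicKer (a + 1) (commMatrix m
      (c + (p : ℤ_[p]) • (1 : Matrix (Fin 3) (Fin 3) ℤ_[p]).mulVec ![u, x, y]))) = 1 := by
    intro u x y
    rw [padicKer_eq_one, plog_one, pow_zero]
    rw [isUnit_iff_toZMod_ne_zero, det_commMatrix hf, map_pow, map_eval_baseChange,
      toZMod_add_p_smul, funext hc]
    exact pow_ne_zero _ hv
  simp only [this, rsum_const]
  ring

lemma even_corank_commMatrix (hp2 : p ≠ 2) (hn : Even n) (hm : ∀ k, (m k).transpose = -m k)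
    (v : Fin 3 → ZMod p) : ∃ d, Even d ∧ (commMatrix m v).rank + d = n := by
  have h1 := even_corank (two_ne_zero_zmod hp2) (transpose_commMatrix hm v)
  have h2 : (commMatrix m v).rank ≤ n := (rank_le_card_width _).trans (by simp)
  refine ⟨n - (commMatrix m v).rank, ?_, by omega⟩
  rw [Nat.even_sub h2]
  exact ⟨fun _ => h1, fun _ => hn⟩

lemma pow_corank_dvd (hm : ∀ k, (m k).transpose = -m k) (hf : f ^ 2 = (genericCommMatrix m).det)
    {v : Fin 3 → ZMod p} {d : ℕ} (hd : (commMatrix m v).rank + d = n) {φ : Fin 3 → ℤ_[p]}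
    (hφ : ∀ k, toZMod (φ k) = v k) :
    (p : ℤ_[p]) ^ d ∣ eval φ (baseChange ℤ_[p] f) ^ 2 := by
  rw [← det_commMatrix hf]
  refine pow_corank_dvd_det (transpose_commMatrix hm φ) ?_
  rw [redMod_commMatrix, funext hφ]
  exact hd

lemma corank_ne_zero (hm : ∀ k, (m k).transpose = -m k) (hf : f ^ 2 = (genericCommMatrix m).det)
    {v : Fin 3 → ZMod p} (hv : eval v (baseChange (ZMod p) f) = 0) {d : ℕ}
    (hd : (commMatrix m v).rank + d = n) : d ≠ 0 := by
  rintro rfl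
  apply det_ne_zero_of_rank_eq (transpose_commMatrix hm v) hd
  rw [det_commMatrix hf, hv, zero_pow two_ne_zero]

/-- Near a smooth point, on a line in the direction of the `k`-th coordinate. -/
lemma smooth_isometry {F : ℳ ℤ_[p]} {c : Fin 3 → ℤ_[p]} {k : Fin 3}
    (hk : IsUnit (eval c (pderiv k F))) {X : ℤ_[p] → Fin 3 → ℤ_[p]}
    (hX : ∀ y i, (p : ℤ_[p]) ∣ X y i) (hXk : ∀ y y', X y k - X y' k = p * (y - y'))
    (hXi : ∀ y y' i, i ≠ k → X y i = X y' i) (l : ℕ) (y y' : ℤ_[p])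
    (h : (p : ℤ_[p]) ^ (l + 1) ∣ eval (c + X y) F - eval (c + X y') F) :
    (p : ℤ_[p]) ^ l ∣ y - y' := by
  induction l with
  | zero => simp
  | succ l ih =>
    have h1 := ih ((pow_dvd_pow _ (by omega)).trans h)
    have h2 : ∀ i, (p : ℤ_[p]) ^ (l + 1) ∣ X y i - X y' i := by
      intro i
      by_cases hi : i = k
      · subst hi
        rw [hXk, pow_succ']
        exact mul_dvd_mul_left _ h1
      · rw [hXi y y' i hi, sub_self]; exact dvd_zero _
    have h3 := taylor_first_order F c (hX y) (hX y') h2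
    rw [← pow_succ', sum_eq_single k] at h3
    · have h4 := dvd_sub h h3
      rw [sub_sub_cancel, hXk, hk.dvd_mul_left, pow_succ', mul_dvd_mul_iff_left padic_p_ne_zero] at h4
      exact h4
    · intro i _ hi
      rw [hXi y y' i hi, sub_self, mul_zero]
    · simp

lemma corank_eq_two_of_smooth (hp2 : p ≠ 2) (hn : Even n) (hm : ∀ k, (m k).transpose = -m k)
    (hf : f ^ 2 = (genericCommMatrix m).det)
    {v : Fin 3 → ZMod p} (hv : eval v (baseChange (ZMod p) f) = 0) {k : Fin 3}
    (hk : eval v (pderiv k (baseChange (ZMod p) f)) ≠ 0) : (commMatrix m v).rank + 2 = n := by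
  obtain ⟨d, hde, hd⟩ := even_corank_commMatrix hp2 hn hm v
  have hd0 := corank_ne_zero hm hf hv hd
  obtain ⟨c, hc⟩ := exists_lift v
  suffices h : ¬ 4 ≤ d by
    obtain ⟨b, rfl⟩ := hde
    obtain rfl : b = 1 := by omega
    exact hd
  intro h4
  let X : ℤ_[p] → Fin 3 → ℤ_[p] := fun y => (p : ℤ_[p]) • Pi.single k y
  have hdvd : ∀ y, (p : ℤ_[p]) ^ 2 ∣ eval (c + X y) (baseChange ℤ_[p] f) := by
    intro y
    have h1 := pow_corank_dvd hm hf hd (φ := c + X y) (fun i => by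
      rw [← hc i]; exact congrFun (toZMod_add_p_smul c _) i)
    have h2 := (pow_dvd_pow (p : ℤ_[p]) h4).trans h1
    rw [show (4 : ℕ) = 2 * 2 by norm_num, pow_mul] at h2
    exact (IsIntegrallyClosed.pow_dvd_pow_iff two_ne_zero).1 h2
  have hku : IsUnit (eval c (pderiv k (baseChange ℤ_[p] f))) := by
    rw [isUnit_iff_toZMod_ne_zero, pderiv_baseChange, map_eval_baseChange, funext hc,
      ← pderiv_baseChange]
    exact hk
  have := smooth_isometry hku (X := X) (fun y i => by simp [X]) (fun y y' => by simp [X, mul_sub])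
    (fun y y' i hi => by simp [X, hi]) 1 1 0 (dvd_sub (hdvd 1) (hdvd 0))
  rw [pow_one, sub_zero] at this
  exact padic_prime.not_isUnit (isUnit_of_dvd_one this)

theorem classSum_of_smooth (hp2 : p ≠ 2) (hn : Even n) (hm : ∀ k, (m k).transpose = -m k)
    (hf : f ^ 2 = (genericCommMatrix m).det) (a : ℕ) (q : ℂ)
    {v : Fin 3 → ZMod p} (hv : eval v (baseChange (ZMod p) f) = 0) {k : Fin 3}
    (hk : eval v (pderiv k (baseChange (ZMod p) f)) ≠ 0) :
    classSum m a q v = (p : ℂ) ^ (2 * a) * smoothSeq p (q ^ 2) a := by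
  obtain ⟨c, hc⟩ := exists_lift v
  have hrank := corank_eq_two_of_smooth hp2 hn hm hf hv hk
  let σ : Equiv.Perm (Fin 3) := Equiv.swap k 2
  have hW : ∀ z : Fin 3 → ℤ_[p], (Equiv.Perm.permMatrix ℤ_[p] σ).mulVec z = fun i => z (σ i) :=
    fun z => by rw [Matrix.permMatrix_mulVec]; rfl
  rw [classSum_eq_rsum m a q v c hc (Equiv.Perm.permMatrix ℤ_[p] σ)
    (by rw [Matrix.det_permutation]; rcases Int.units_eq_one_or (Equiv.Perm.sign σ) with h | h <;> simp [h])]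
  have hline : ∀ u x : ℤ_[p], rsum a (fun y => q ^ plog p (padicKer (a + 1) (commMatrix m
      (c + (p : ℤ_[p]) • (Equiv.Perm.permMatrix ℤ_[p] σ).mulVec ![u, x, y])))) =
      smoothSeq p (q ^ 2) a := by
    intro u x
    let X : ℤ_[p] → Fin 3 → ℤ_[p] := fun y =>
      (p : ℤ_[p]) • (Equiv.Perm.permMatrix ℤ_[p] σ).mulVec ![u, x, y]
    have hX : ∀ y i, X y i = p * ![u, x, y] (σ i) := fun y i => by
      simp only [X, hW, Pi.smul_apply, smul_eq_mul]
    have hker : ∀ y, q ^ plog p (padicKer (a + 1) (commMatrix m (c + X y))) =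
        (q ^ 2) ^ truncVal (a + 1) (eval (c + X y) (baseChange ℤ_[p] f)) := by
      intro y
      rw [padicKer_of_corank_two (a + 1) (transpose_commMatrix hm _) (f := eval (c + X y)
        (baseChange ℤ_[p] f)) (u := 1) ?_ isUnit_one (by rw [det_commMatrix hf, one_mul]),
        plog_pow hfp.out, pow_mul]
      rw [redMod_commMatrix, toZMod_add_p_smul, funext hc]
      exact hrank
    rw [rsum_congr hker]
    refine rsum_truncVal_of_isometry (q ^ 2) a (fun y => eval (c + X y) (baseChange ℤ_[p] f)) ?_ ?_
    · intro y
      rw [← toZMod_eq_zero_iff, map_eval_baseChange, toZMod_add_p_smul, funext hc, hv]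
    · intro y y'
      refine smooth_isometry (k := k) ?_ ?_ ?_ ?_ a y y'
      · rw [isUnit_iff_toZMod_ne_zero, pderiv_baseChange, map_eval_baseChange, funext hc,
          ← pderiv_baseChange]
        exact hk
      · intro y i; rw [hX]; exact dvd_mul_right _ _
      · intro y y'
        rw [hX, hX]
        simp [σ, mul_sub]
      · intro y y' i hi
        have : σ i ≠ 2 := fun h => hi (by rw [← σ.symm_apply_apply i, h]; simp [σ])
        rw [hX, hX]
        generalize σ i = j at this
        fin_cases j <;> simp_all
  simp only [hline, rsum_const]
  ring

end LocalEvaluation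

end

section

section Nodes

open MvPolynomial

variable {p : ℕ} [hfp : Fact p.Prime] {n : ℕ}

/-- A lift to `ℤ_p` of a double point `v` modulo `p` of the Pfaffian curve, with rational tangents
and with a basis adapted to the kernel of `M` at this point. -/
structure NodeData (m : Fin 3 → Matrix (Fin n) (Fin n) ℤ) (f : ℳ ℤ)
    (v : Fin 3 → ZMod p) where
  (w ψ₁ ψ₂ : Fin 3 → ℤ_[p])
  red : ∀ k, toZMod (w k) = v k
  unit_det : IsUnit (Matrix.of ![w, ψ₁, ψ₂]).det
  eval_eq : ∀ u : ℤ_[p], eval (u • w) (baseChange ℤ_[p] f) = 0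
  pderiv_eq : ∀ (u : ℤ_[p]) (i), eval (u • w) (pderiv i (baseChange ℤ_[p] f)) = 0
  h11 : ∀ u : ℤ_[p],
    ∑ i, ∑ j, eval (u • w) (pderiv i (pderiv j (baseChange ℤ_[p] f))) * ψ₁ i * ψ₁ j = 0
  h22 : ∀ u : ℤ_[p],
    ∑ i, ∑ j, eval (u • w) (pderiv i (pderiv j (baseChange ℤ_[p] f))) * ψ₂ i * ψ₂ j = 0
  h12 : ∀ u : ℤ_[p], IsUnit u →
    IsUnit (∑ i, ∑ j, eval (u • w) (pderiv i (pderiv j (baseChange ℤ_[p] f))) * ψ₁ i * ψ₂ j)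
  (k d : ℕ)
  e : Fin k ⊕ Fin d ≃ Fin n
  P : Matrix (Fin k ⊕ Fin d) (Fin k ⊕ Fin d) ℤ_[p]
  A : Matrix (Fin k) (Fin k) ℤ_[p]
  unit_P : IsUnit P.det
  unit_A : IsUnit A.det
  block : P.transpose * (commMatrix m w).submatrix e e * P = fromBlocks A 0 0 0

lemma dvd_matrix_mul {ι κ μ R : Type*} [Fintype κ] [CommRing R] {M : Matrix ι κ R} {N : Matrix κ μ R}
    {a b : R} (hM : ∀ i j, a ∣ M i j) (hN : ∀ i j, b ∣ N i j) (i : ι) (j : μ) :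
    a * b ∣ (M * N) i j := by
  rw [Matrix.mul_apply]
  exact dvd_sum fun l _ => mul_dvd_mul (hM i l) (hN l j)

lemma isUnit_det_smul_add {k : ℕ} {u : ℤ_[p]} (hu : IsUnit u) {A : Matrix (Fin k) (Fin k) ℤ_[p]}
    (hA : IsUnit A.det) (Z : Matrix (Fin k) (Fin k) ℤ_[p]) :
    IsUnit (u • A + (p : ℤ_[p]) • Z).det := by
  rw [isUnit_iff_toZMod_ne_zero] at *
  rw [← det_redMod] at *
  have : redMod (u • A + (p : ℤ_[p]) • Z) = toZMod u • redMod A := by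
    ext i j
    simp [redMod]
  rw [this, det_smul]
  exact mul_ne_zero (pow_ne_zero _ hu) hA

lemma inv_sub_inv_matrix {k : ℕ} {A A' : Matrix (Fin k) (Fin k) ℤ_[p]} (hA : IsUnit A.det)
    (hA' : IsUnit A'.det) : A⁻¹ - A'⁻¹ = A⁻¹ * (A' - A) * A'⁻¹ := by
  rw [Matrix.mul_sub, Matrix.sub_mul, nonsing_inv_mul _ hA, Matrix.one_mul, Matrix.mul_assoc,
    mul_nonsing_inv _ hA', Matrix.mul_one]

/-- The correction term of the Schur complement. -/
lemma matrixRemainder_schur {k d : ℕ} {u : ℤ_[p]} (hu : IsUnit u) {A : Matrix (Fin k) (Fin k) ℤ_[p]}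
    (hA : IsUnit A.det) (A₁ A₂ : Matrix (Fin k) (Fin k) ℤ_[p]) (B₁ B₂ : Matrix (Fin k) (Fin d) ℤ_[p])
    (C₁ C₂ : Matrix (Fin d) (Fin k) ℤ_[p]) :
    MatrixRemainder fun x y => -((p : ℤ_[p]) • ((x • C₁ + y • C₂ : Matrix (Fin d) (Fin k) ℤ_[p]) *
      (u • A + (p : ℤ_[p]) • (x • A₁ + y • A₂) : Matrix (Fin k) (Fin k) ℤ_[p])⁻¹ *
      (x • B₁ + y • B₂ : Matrix (Fin k) (Fin d) ℤ_[p]))) := by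
  refine ⟨by simp, ?_⟩
  intro κ l x y x' y' hx hy hx' hy' hxx hyy i j
  have hlin : ∀ {α β : Type} (Z₁ Z₂ : Matrix α β ℤ_[p]) (b s t : ℤ_[p]), b ∣ s → b ∣ t → ∀ i j,
      b ∣ (s • Z₁ + t • Z₂) i j := by
    intro α β Z₁ Z₂ b s t hs ht i j
    exact dvd_add (hs.mul_right _) (ht.mul_right _)
  have hdiff : ∀ {α β : Type} (Z₁ Z₂ : Matrix α β ℤ_[p]),
      (x • Z₁ + y • Z₂) - (x' • Z₁ + y' • Z₂) = (x - x') • Z₁ + (y - y') • Z₂ := by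
    intro α β Z₁ Z₂
    rw [sub_smul, sub_smul]; abel
  set X := x • C₁ + y • C₂
  set X' := x' • C₁ + y' • C₂
  set Y := x • B₁ + y • B₂
  set Y' := x' • B₁ + y' • B₂
  set V := u • A + (p : ℤ_[p]) • (x • A₁ + y • A₂) with hV
  set V' := u • A + (p : ℤ_[p]) • (x' • A₁ + y' • A₂) with hV'
  have hVu : IsUnit V.det := isUnit_det_smul_add hu hA _
  have hVu' : IsUnit V'.det := isUnit_det_smul_add hu hA _
  have hVV : ∀ i j, (p : ℤ_[p]) ^ l ∣ (V' - V) i j := by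
    intro i j
    have : V' - V = -((p : ℤ_[p]) • ((x - x') • A₁ + (y - y') • A₂)) := by
      rw [← hdiff, hV, hV', smul_sub]; abel
    rw [this, Matrix.neg_apply, dvd_neg, Matrix.smul_apply, smul_eq_mul]
    exact (hlin _ _ _ _ _ hxx hyy i j).mul_left _
  have hXX : ∀ i j, (p : ℤ_[p]) ^ l ∣ (X - X') i j := by
    intro i j; rw [hdiff]; exact hlin _ _ _ _ _ hxx hyy i j
  have hYY : ∀ i j, (p : ℤ_[p]) ^ l ∣ (Y - Y') i j := by
    intro i j; rw [hdiff]; exact hlin _ _ _ _ _ hxx hyy i j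
  have hX' : ∀ i j, (p : ℤ_[p]) ^ κ ∣ X' i j := hlin _ _ _ _ _ hx' hy'
  have hY : ∀ i j, (p : ℤ_[p]) ^ κ ∣ Y i j := hlin _ _ _ _ _ hx hy
  have hone : ∀ {α β : Type} (Z : Matrix α β ℤ_[p]) i j, (1 : ℤ_[p]) ∣ Z i j := fun _ _ _ =>
    one_dvd _
  have e : X * V⁻¹ * Y - X' * V'⁻¹ * Y' =
      (X - X') * V⁻¹ * Y + X' * (V⁻¹ * (V' - V) * V'⁻¹) * Y + X' * V'⁻¹ * (Y - Y') := by
    rw [← inv_sub_inv_matrix hVu hVu']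
    simp only [Matrix.sub_mul, Matrix.mul_sub]
    abel
  have h1 := dvd_matrix_mul (dvd_matrix_mul hXX (hone V⁻¹)) hY i j
  have h2 := dvd_matrix_mul (dvd_matrix_mul hX' (dvd_matrix_mul (dvd_matrix_mul (hone V⁻¹) hVV)
    (hone V'⁻¹))) (hone Y) i j
  have h3 := dvd_matrix_mul (dvd_matrix_mul hX' (hone V'⁻¹)) hYY i j
  have h4 : (p : ℤ_[p]) ^ (l + κ) ∣ (X * V⁻¹ * Y - X' * V'⁻¹ * Y') i j := by
    rw [e, Matrix.add_apply, Matrix.add_apply]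
    refine dvd_add (dvd_add ?_ ?_) ?_
    · convert h1 using 1; ring
    · convert h2 using 1; ring
    · convert h3 using 1; ring
  change (p : ℤ_[p]) ^ (l + κ + 1) ∣ (-((p : ℤ_[p]) • (X * V⁻¹ * Y))) i j -
    (-((p : ℤ_[p]) • (X' * V'⁻¹ * Y'))) i j
  rw [Matrix.neg_apply, Matrix.neg_apply, Matrix.smul_apply, Matrix.smul_apply, smul_eq_mul,
    smul_eq_mul, pow_succ']
  rw [Matrix.sub_apply] at h4
  have := mul_dvd_mul_left (p : ℤ_[p]) h4
  rw [← dvd_neg] at this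
  convert this using 1
  ring

variable {m : Fin 3 → Matrix (Fin n) (Fin n) ℤ} {f : ℳ ℤ} {v : Fin 3 → ZMod p}

lemma kerCard_zmod (M : Matrix (Fin n) (Fin n) (ZMod p)) {d : ℕ} (h : kerCard M = p ^ d) :
    M.rank + d = n := by
  have h1 := LinearMap.finrank_range_add_finrank_ker M.mulVecLin
  rw [Module.finrank_fintype_fun_eq_card, Fintype.card_fin] at h1
  have h2 : kerCard M = Nat.card (LinearMap.ker M.mulVecLin) := rfl
  have h3 := Module.natCard_eq_pow_finrank (K := ZMod p) (V := LinearMap.ker M.mulVecLin)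
  rw [← h2, h, Nat.card_zmod] at h3
  rw [Nat.pow_right_injective hfp.out.two_le h3]
  exact h1

lemma NodeData.rank_add (D : NodeData m f v) : (commMatrix m v).rank + D.d = n := by
  have hred : commMatrix m v = redMod (commMatrix m D.w) := by
    rw [redMod_commMatrix, funext D.red]
  rw [hred]
  apply kerCard_zmod
  have hP : IsUnit (redMod D.P).det := by
    rw [det_redMod]; exact D.unit_P.map _
  have hA : IsUnit (redMod D.A).det := by
    rw [det_redMod]; exact D.unit_A.map _
  have h1 : (redMod D.P).transpose * (redMod (commMatrix m D.w)).submatrix D.e D.e * redMod D.P =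
      fromBlocks (redMod D.A) 0 0 0 := by
    have := congrArg redMod D.block
    rw [redMod, Matrix.map_mul, Matrix.map_mul] at this
    refine this.trans ?_
    rw [redMod, fromBlocks_map]
    simp [redMod]
  have h2 : kerCard (fromBlocks (redMod D.A) 0 0
      (0 : Matrix (Fin D.d) (Fin D.d) (ZMod p))) = p ^ D.d := by
    rw [kerCard_fromBlocks_diag, kerCard_eq_one hA, one_mul, kerCard]
    simp
  rw [← h2, ← h1, kerCard_mul_right hP, kerCard_mul_left (by rwa [det_transpose]),
    kerCard_submatrix]

lemma NodeData.point (D : NodeData m f v) (u x y : ℤ_[p]) :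
    D.w + (p : ℤ_[p]) • (Matrix.of ![D.w, D.ψ₁, D.ψ₂]).transpose.mulVec ![u, x, y] =
      (1 + p * u) • D.w + (p : ℤ_[p]) • (x • D.ψ₁ + y • D.ψ₂) := by
  funext i
  simp [mulVec, dotProduct, Fin.sum_univ_three]
  ring

lemma isUnit_one_add (u : ℤ_[p]) : IsUnit (1 + p * u) := by
  rw [isUnit_iff_toZMod_ne_zero]
  simp

lemma NodeData.exists_expansion (D : NodeData m f v) (hp2 : p ≠ 2) (u : ℤ_[p]) :
    ∃ (c : ℤ_[p]) (C : ℤ_[p] → ℤ_[p] → ℤ_[p]), ¬ (p : ℤ_[p]) ∣ c ∧ NodalRemainder C ∧ ∀ x y : ℤ_[p],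
      eval ((1 + p * u) • D.w + (p : ℤ_[p]) • (x • D.ψ₁ + y • D.ψ₂)) (baseChange ℤ_[p] f) =
      (p : ℤ_[p]) ^ 2 * (c * x * y + C x y) := by
  obtain ⟨C, hC, h⟩ := exists_nodal_expansion hp2 (baseChange ℤ_[p] f) ((1 + p * u) • D.w) D.ψ₁ D.ψ₂
    (D.eval_eq _) (D.pderiv_eq _) (D.h11 _) (D.h22 _)
  exact ⟨_, C, isUnit_iff_not_dvd.1 (D.h12 _ (isUnit_one_add u)), hC, h⟩

lemma NodeData.eval_zmod (D : NodeData m f v) : eval v (baseChange (ZMod p) f) = 0 := by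
  have := congrArg toZMod (D.eval_eq 1)
  rwa [one_smul, map_eval_baseChange, funext D.red, map_zero] at this

lemma NodeData.d_eq (D : NodeData m f v) (hp2 : p ≠ 2) (hn : Even n)
    (hm : ∀ k, (m k).transpose = -m k) (hf : f ^ 2 = (genericCommMatrix m).det) :
    D.d = 2 ∨ D.d = 4 := by
  obtain ⟨d, hde, hd⟩ := even_corank_commMatrix hp2 hn hm v
  have hD := D.rank_add
  obtain rfl : d = D.d := by omega
  have hd0 := corank_ne_zero hm hf D.eval_zmod hd
  suffices h : ¬ 6 ≤ D.d by
    obtain ⟨b, hb⟩ := hde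
    omega
  intro h6
  obtain ⟨c, C, hc, hC, h⟩ := D.exists_expansion hp2 0
  have h1nd : ¬ (p : ℤ_[p]) ∣ 1 := fun h => padic_prime.not_isUnit (isUnit_of_dvd_one h)
  have h1 := pow_corank_dvd hm hf hD
    (φ := (1 + (p : ℤ_[p]) * 0) • D.w + (p : ℤ_[p]) • ((1 : ℤ_[p]) • D.ψ₁ + (1 : ℤ_[p]) • D.ψ₂)) (by
      intro i
      rw [← D.red i]
      simp)
  rw [h 1 1] at h1
  have h2 := (pow_dvd_pow (p : ℤ_[p]) h6).trans h1
  rw [show (6 : ℕ) = 3 * 2 by norm_num, pow_mul, IsIntegrallyClosed.pow_dvd_pow_iff two_ne_zero,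
    show (3 : ℕ) = 2 + 1 by norm_num, pow_succ,
    mul_dvd_mul_iff_left (pow_ne_zero 2 (padic_p_ne_zero (p := p)))] at h2
  exact hC.not_dvd hc h1nd h1nd h2

theorem NodeData.classSum_two (D : NodeData m f v) (hp2 : p ≠ 2)
    (hm : ∀ k, (m k).transpose = -m k) (hf : f ^ 2 = (genericCommMatrix m).det) (hd : D.d = 2)
    (a : ℕ) (q : ℂ) : classSum m a q v = (p : ℂ) ^ a * nodeSeq p (q ^ 2) a := by
  have hrank := D.rank_add
  rw [hd] at hrank
  rw [classSum_eq_rsum m a q v D.w D.red (Matrix.of ![D.w, D.ψ₁, D.ψ₂]).transpose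
    (by rw [det_transpose]; exact D.unit_det)]
  rw [rsum_congr (h' := fun _ => nodeSeq p (q ^ 2) a), rsum_const]
  intro u
  obtain ⟨c, C, hc, hC, h⟩ := D.exists_expansion hp2 u
  rw [← rsum_node hc (q ^ 2) a hC]
  refine rsum_congr fun x => rsum_congr fun y => ?_
  rw [D.point, padicKer_of_corank_two (a + 1) (transpose_commMatrix hm _) (u := 1) ?_ isUnit_one
    (by rw [det_commMatrix hf, one_mul]), plog_pow hfp.out, pow_mul, h]
  rw [redMod_commMatrix, ← D.point, toZMod_add_p_smul, funext D.red]
  exact hrank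

theorem NodeData.classSum_four (D : NodeData m f v) (hp2 : p ≠ 2)
    (hm : ∀ k, (m k).transpose = -m k) (hf : f ^ 2 = (genericCommMatrix m).det) (hd : D.d = 4)
    (a : ℕ) (q : ℂ) : classSum m a q v = (p : ℂ) ^ a * degenerateNodeSeq p (q ^ 2) a := by
  rw [classSum_eq_rsum m a q v D.w D.red (Matrix.of ![D.w, D.ψ₁, D.ψ₂]).transpose
    (by rw [det_transpose]; exact D.unit_det)]
  rw [rsum_congr (h' := fun _ => degenerateNodeSeq p (q ^ 2) a), rsum_const]
  intro u
  obtain ⟨c, C, hc, hC, h⟩ := D.exists_expansion hp2 u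
  have hu := isUnit_one_add u
  have hpoint := D.point u
  obtain ⟨w, ψ₁, ψ₂, _, _, _, _, _, _, _, k, d, e, P, A, hP, hA, hblock⟩ := D
  obtain rfl : d = 4 := hd
  dsimp only at h hpoint ⊢
  let conj : (Fin 3 → ℤ_[p]) → Matrix (Fin k ⊕ Fin 4) (Fin k ⊕ Fin 4) ℤ_[p] := fun φ =>
    P.transpose * (commMatrix m φ).submatrix e e * P
  have hconj_add : ∀ φ φ', conj (φ + φ') = conj φ + conj φ' := fun φ φ' => by
    simp only [conj, commMatrix_add]
    rw [Matrix.submatrix_add, Pi.add_apply, Pi.add_apply, Matrix.mul_add, Matrix.add_mul]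
  have hconj_smul : ∀ (t : ℤ_[p]) φ, conj (t • φ) = t • conj φ := fun t φ => by
    simp only [conj, commMatrix_smul]
    rw [submatrix_smul, Pi.smul_apply, Pi.smul_apply, Matrix.mul_smul, Matrix.smul_mul]
  let A₁ := (conj ψ₁).toBlocks₁₁
  let A₂ := (conj ψ₂).toBlocks₁₁
  let B₁ := (conj ψ₁).toBlocks₁₂
  let B₂ := (conj ψ₂).toBlocks₁₂
  let C₁ := (conj ψ₁).toBlocks₂₁
  let C₂ := (conj ψ₂).toBlocks₂₁
  let N₁ := (conj ψ₁).toBlocks₂₂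
  let N₂ := (conj ψ₂).toBlocks₂₂
  let V : ℤ_[p] → ℤ_[p] → Matrix (Fin k) (Fin k) ℤ_[p] := fun x y =>
    (1 + p * u) • A + (p : ℤ_[p]) • (x • A₁ + y • A₂)
  let E : ℤ_[p] → ℤ_[p] → Matrix (Fin 4) (Fin 4) ℤ_[p] := fun x y =>
    -((p : ℤ_[p]) • ((x • C₁ + y • C₂ : Matrix (Fin 4) (Fin k) ℤ_[p]) * (V x y)⁻¹ *
      (x • B₁ + y • B₂ : Matrix (Fin k) (Fin 4) ℤ_[p])))
  have hE : MatrixRemainder E := matrixRemainder_schur hu hA A₁ A₂ B₁ B₂ C₁ C₂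
  have hV : ∀ x y, IsUnit (V x y).det := fun x y => isUnit_det_smul_add hu hA _
  let φ : ℤ_[p] → ℤ_[p] → Fin 3 → ℤ_[p] := fun x y =>
    (1 + p * u) • w + (p : ℤ_[p]) • (x • ψ₁ + y • ψ₂)
  have hφ : ∀ x y, conj (φ x y) = fromBlocks (V x y) ((p : ℤ_[p]) • (x • B₁ + y • B₂))
      ((p : ℤ_[p]) • (x • C₁ + y • C₂)) ((p : ℤ_[p]) • (x • N₁ + y • N₂)) := by
    intro x y
    have hb : conj w = fromBlocks A 0 0 0 := hblock
    have h1 : conj ψ₁ = fromBlocks A₁ B₁ C₁ N₁ := (fromBlocks_toBlocks _).symm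
    have h2 : conj ψ₂ = fromBlocks A₂ B₂ C₂ N₂ := (fromBlocks_toBlocks _).symm
    rw [hconj_add, hconj_smul, hconj_smul, hconj_add, hconj_smul, hconj_smul, hb, h1, h2]
    simp only [fromBlocks_smul, Matrix.fromBlocks_add, smul_zero, zero_add]
    rfl
  have hschur : ∀ x y, (p : ℤ_[p]) • (x • N₁ + y • N₂) -
      ((p : ℤ_[p]) • (x • C₁ + y • C₂) : Matrix (Fin 4) (Fin k) ℤ_[p]) * (V x y)⁻¹ *
      ((p : ℤ_[p]) • (x • B₁ + y • B₂) : Matrix (Fin k) (Fin 4) ℤ_[p]) =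
      (p : ℤ_[p]) • (x • N₁ + y • N₂ + E x y) := by
    intro x y
    simp only [E]
    generalize x • N₁ + y • N₂ = N
    generalize x • C₁ + y • C₂ = X
    generalize x • B₁ + y • B₂ = Y
    rw [smul_add, Matrix.smul_mul, Matrix.smul_mul, Matrix.mul_smul, smul_neg, sub_eq_add_neg]
  have hconjT : ∀ x y, (conj (φ x y)).transpose = -conj (φ x y) := by
    intro x y
    simp only [conj]
    rw [transpose_mul, transpose_mul, transpose_transpose,
      transpose_submatrix, transpose_commMatrix hm]
    simp [Matrix.mul_assoc, submatrix_neg]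
  rw [← rsum_degenerate_node hp2 hc q a hC hE (N₁ := N₁) (N₂ := N₂)]
  · refine rsum_congr fun x => rsum_congr fun y => ?_
    rw [hpoint]
    congr 2
    have h1 := padicKer_mul_mul (a + 1) (U := P.transpose) (by rwa [det_transpose]) hP
      ((commMatrix m (φ x y)).submatrix e e)
    rw [padicKer_submatrix] at h1
    have h2 : padicKer (a + 1) (conj (φ x y)) = padicKer (a + 1) (commMatrix m (φ x y)) := h1
    rw [hφ, padicKer_fromBlocks _ (hV x y), hschur] at h2
    exact h2.symm
  · intro x y
    have h1 := hconjT x y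
    rw [hφ] at h1
    have h2 := transpose_schur (hV x y) h1
    rw [hschur, transpose_smul, ← smul_neg] at h2
    exact smul_right_injective _ (padic_p_ne_zero (p := p)) h2
  · intro x y
    have h1 : (conj (φ x y)).det = P.det ^ 2 * (commMatrix m (φ x y)).det := det_conj_submatrix e P _
    rw [det_commMatrix hf, h, hφ, schur_factorization (hV x y), det_mul, det_mul,
      hschur] at h1
    simp only [det_fromBlocks_zero₁₂, det_fromBlocks_zero₂₁, det_one, mul_one,
      one_mul, det_smul, Fintype.card_fin] at h1
    obtain ⟨t, ht⟩ := hP.pow 2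
    refine ⟨((t⁻¹ : ℤ_[p]ˣ) : ℤ_[p]) * (V x y).det, (Units.isUnit _).mul (hV x y), ?_⟩
    have h4 : (p : ℤ_[p]) ^ 4 ≠ 0 := pow_ne_zero _ padic_p_ne_zero
    apply mul_left_cancel₀ h4
    rw [← ht] at h1
    have h5 := congrArg (fun z => ((t⁻¹ : ℤ_[p]ˣ) : ℤ_[p]) * z) h1
    simp only [Units.inv_mul_cancel_left] at h5
    linear_combination -h5

end Nodes

end

section

open MvPolynomial

/-! ### Homogeneous polynomials -/

/-- The homomorphism `h(x) ↦ h(T x)`. -/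
def scaleHom (R : Type*) [CommRing R] (σ : Type*) :
    MvPolynomial σ R →ₐ[R] Polynomial (MvPolynomial σ R) :=
  aeval fun i => Polynomial.C (X i) * Polynomial.X

lemma coeff_scaleHom {R : Type*} [CommRing R] {σ : Type*} (a : MvPolynomial σ R) (k : ℕ) :
    (scaleHom R σ a).coeff k = homogeneousComponent k a := by
  classical
  induction a using MvPolynomial.induction_on' with
  | add a b ha hb => rw [map_add, Polynomial.coeff_add, ha, hb, map_add]
  | monomial d c =>
    have h : scaleHom R σ (monomial d c) =
        Polynomial.C (monomial d c) * Polynomial.X ^ d.degree := by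
      rw [scaleHom, aeval_monomial, monomial_eq (a := c), Finsupp.prod, Finsupp.prod,
        Finsupp.degree_apply, ← prod_pow_eq_pow_sum, Polynomial.C_mul, map_prod, mul_assoc,
        ← prod_mul_distrib]
      congr 1
      refine prod_congr rfl fun i _ => ?_
      rw [mul_pow, Polynomial.C_pow]
    rw [h, Polynomial.coeff_C_mul_X_pow]
    have hd : (monomial d c).IsHomogeneous d.degree := isHomogeneous_monomial c rfl
    rw [homogeneousComponent_of_mem hd]

lemma scaleHom_of_isHomogeneous {R : Type*} [CommRing R] {σ : Type*} {a : MvPolynomial σ R} {k : ℕ}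
    (h : a.IsHomogeneous k) : scaleHom R σ a = Polynomial.C a * Polynomial.X ^ k := by
  ext1 j
  rw [coeff_scaleHom, Polynomial.coeff_C_mul_X_pow, homogeneousComponent_of_mem h]

/-- A factor of a non-zero homogeneous polynomial over a domain is homogeneous. -/
lemma isHomogeneous_of_mul {R : Type*} [CommRing R] [IsDomain R] {σ : Type*}
    {a b : MvPolynomial σ R} {k : ℕ} (h : (a * b).IsHomogeneous k) (h0 : a * b ≠ 0) :
    a.IsHomogeneous a.totalDegree := by
  have hab : scaleHom R σ a * scaleHom R σ b = Polynomial.C (a * b) * Polynomial.X ^ k := by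
    rw [← map_mul, scaleHom_of_isHomogeneous h]
  have hne : scaleHom R σ a * scaleHom R σ b ≠ 0 := by
    rw [hab]
    exact mul_ne_zero (Polynomial.C_ne_zero.2 h0) (pow_ne_zero _ Polynomial.X_ne_zero)
  have ha0 := left_ne_zero_of_mul hne
  have hb0 := right_ne_zero_of_mul hne
  have h1 := congrArg Polynomial.natDegree hab
  have h2 := congrArg Polynomial.natTrailingDegree hab
  rw [Polynomial.natDegree_mul ha0 hb0, Polynomial.natDegree_C_mul_X_pow _ _ h0] at h1
  rw [Polynomial.natTrailingDegree_mul ha0 hb0, Polynomial.C_mul_X_pow_eq_monomial,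
    Polynomial.natTrailingDegree_monomial h0] at h2
  have h3 := Polynomial.natTrailingDegree_le_natDegree (scaleHom R σ a)
  have h4 := Polynomial.natTrailingDegree_le_natDegree (scaleHom R σ b)
  have hcoeff : ∀ j, j ≠ (scaleHom R σ a).natDegree → homogeneousComponent j a = 0 := by
    intro j hj
    rw [← coeff_scaleHom]
    rcases lt_or_gt_of_ne hj with hj | hj
    · exact Polynomial.coeff_eq_zero_of_lt_natTrailingDegree (by omega)
    · exact Polynomial.coeff_eq_zero_of_natDegree_lt hj
  have hhom : a.IsHomogeneous (scaleHom R σ a).natDegree := by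
    have hs := sum_homogeneousComponent a
    have : a = homogeneousComponent (scaleHom R σ a).natDegree a := by
      conv_lhs => rw [← hs]
      rw [sum_eq_single (scaleHom R σ a).natDegree (fun j _ hj => hcoeff j hj)]
      intro hn
      apply homogeneousComponent_eq_zero
      simpa using hn
    have h5 := homogeneousComponent_isHomogeneous (scaleHom R σ a).natDegree a
    rwa [← this] at h5
  rwa [hhom.totalDegree (left_ne_zero_of_mul h0)]

lemma isHomogeneous_of_dvd {R : Type*} [CommRing R] [IsDomain R] {σ : Type*}
    {a b : MvPolynomial σ R} {k : ℕ} (h : b.IsHomogeneous k) (h0 : b ≠ 0) (hab : a ∣ b) :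
    a.IsHomogeneous a.totalDegree := by
  obtain ⟨c, rfl⟩ := hab
  exact isHomogeneous_of_mul h h0

lemma eval_smul_of_isHomogeneous {R : Type*} [CommRing R] {σ : Type*} {a : MvPolynomial σ R} {k : ℕ}
    (h : a.IsHomogeneous k) (c : R) (v : σ → R) : eval (c • v) a = c ^ k * eval v a := by
  rw [eval_eq, eval_eq, mul_sum]
  refine sum_congr rfl fun d hd => ?_
  have : d.degree = k := by
    have := h (mem_support_iff.1 hd)
    rw [← this, Finsupp.degree_eq_weight_one]
    rfl
  simp only [Pi.smul_apply, smul_eq_mul, mul_pow, prod_mul_distrib,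
    prod_pow_eq_pow_sum]
  rw [← Finsupp.degree_apply, this]
  ring

lemma genericCommMatrix_det_isHomogeneous {n : ℕ} (m : Fin 3 → Matrix (Fin n) (Fin n) ℤ) :
    (genericCommMatrix m).det.IsHomogeneous n := by
  rw [Matrix.det_apply]
  refine IsHomogeneous.sum _ _ _ fun σ _ => ?_
  have h : (∏ i, genericCommMatrix m (σ i) i).IsHomogeneous (∑ _i : Fin n, 1) := by
    refine IsHomogeneous.prod _ _ _ fun i _ => ?_
    refine IsHomogeneous.sum _ _ _ fun k _ => ?_
    have := (isHomogeneous_C (Fin 3) (m k (σ i) i)).mul (isHomogeneous_X ℤ k)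
    simpa using this
  simp only [sum_const, Finset.card_univ, Fintype.card_fin, smul_eq_mul, mul_one] at h
  rcases Int.units_eq_one_or (Equiv.Perm.sign σ) with h1 | h1 <;> rw [h1]
  · simpa using h
  · rw [Units.neg_smul, one_smul]; exact h.neg

lemma isHomogeneous_of_sq_eq_det {r : ℕ} {m : Fin 3 → Matrix (Fin (2 * r)) (Fin (2 * r)) ℤ}
    {f : ℳ ℤ} (hf : f ^ 2 = (genericCommMatrix m).det) (hf0 : f ≠ 0) :
    f.IsHomogeneous r := by
  have h1 : (f * f).IsHomogeneous (2 * r) := by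
    rw [← pow_two, hf]; exact genericCommMatrix_det_isHomogeneous m
  have h2 := isHomogeneous_of_mul h1 (mul_ne_zero hf0 hf0)
  have h3 := h1.totalDegree (mul_ne_zero hf0 hf0)
  rw [totalDegree_mul_of_isDomain hf0 hf0] at h3
  rwa [show f.totalDegree = r by omega] at h2

/-! ### Systems of integral polynomial equations modulo almost all primes -/

attribute [local instance] MvPolynomial.algebraMvPolynomial

instance : Algebra.IsAlgebraic ℚ ℚᵃ := by
  convert AlgebraicClosure.isAlgebraic ℚ
  · rfl
  · exact Subsingleton.elim _ _

/-- A system of integral polynomial equations without solution over the algebraic closure of `ℚ` has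
no solution in characteristic `p` for almost all `p`. -/
theorem exists_no_solution {σ : Type*} [Finite σ] (P : Set (MvPolynomial σ ℤ))
    (h : ∀ v : σ → ℚᵃ, ∃ q ∈ P, eval₂Hom (Int.castRingHom _) v q ≠ 0) :
    ∃ N : ℕ, N ≠ 0 ∧ ∀ (K : Type) [CommRing K], (N : K) ≠ 0 → ∀ v : σ → K,
      ∃ q ∈ P, eval₂Hom (Int.castRingHom K) v q ≠ 0 := by
  have htop : (Ideal.span P).map (algebraMap (MvPolynomial σ ℤ) (MvPolynomial σ ℚ)) = ⊤ := by
    by_contra hne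
    obtain ⟨M, hM, hle⟩ := Ideal.exists_le_maximal _ hne
    let _ : Field (MvPolynomial σ ℚ ⧸ M) := Ideal.Quotient.field M
    have : Module.Finite ℚ (MvPolynomial σ ℚ ⧸ M) := finite_of_finite_type_of_isJacobsonRing _ _
    let ι : (MvPolynomial σ ℚ ⧸ M) →ₐ[ℚ] ℚᵃ := IsAlgClosed.lift
    obtain ⟨q, hq, hne⟩ := h fun i => ι (Ideal.Quotient.mk M (X i))
    apply hne
    have h1 : algebraMap (MvPolynomial σ ℤ) (MvPolynomial σ ℚ) q ∈ M :=
      hle (Ideal.mem_map_of_mem _ (Ideal.subset_span hq))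
    have h2 : ((ι : (MvPolynomial σ ℚ ⧸ M) →+* ℚᵃ).comp ((Ideal.Quotient.mk M).comp
        (algebraMap (MvPolynomial σ ℤ) (MvPolynomial σ ℚ)))) q = 0 := by
      simp only [RingHom.comp_apply]
      rw [Ideal.Quotient.eq_zero_iff_mem.2 h1, map_zero]
    rw [← h2]
    congr 1
    apply MvPolynomial.ringHom_ext
    · intro a; simp
    · intro i
      have : algebraMap (MvPolynomial σ ℤ) (MvPolynomial σ ℚ) (X i) = X i := map_X _ i
      rw [RingHom.comp_apply, RingHom.comp_apply, this]
      exact eval₂Hom_X' _ _ i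
  have h1 : (1 : MvPolynomial σ ℚ) ∈
      (Ideal.span P).map (algebraMap (MvPolynomial σ ℤ) (MvPolynomial σ ℚ)) := by
    rw [htop]; trivial
  rw [IsLocalization.mem_map_algebraMap_iff ((nonZeroDivisors ℤ).map (C (σ := σ)))] at h1
  obtain ⟨⟨⟨a, ha⟩, ⟨s, hs⟩⟩, h1⟩ := h1
  obtain ⟨N, hN, rfl⟩ := hs
  simp only [one_mul] at h1
  have hinj : Function.Injective (algebraMap (MvPolynomial σ ℤ) (MvPolynomial σ ℚ)) := by
    rw [algebraMap_def]
    exact map_injective _ (algebraMap ℤ ℚ).injective_int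
  have h2 := hinj h1
  refine ⟨N.natAbs, by simpa using nonZeroDivisors.ne_zero hN, fun K _ hK v => ?_⟩
  by_contra! hc
  have h3 : Ideal.span P ≤ RingHom.ker (eval₂Hom (Int.castRingHom K) v) := by
    rw [Ideal.span_le]; exact fun q hq => hc q hq
  have h4 := h3 ha
  rw [RingHom.mem_ker, ← h2] at h4
  have h5 : ((N : ℤ) : K) = 0 := by simpa using h4
  apply hK
  rcases Int.natAbs_eq N with h6 | h6 <;> rw [h6] at h5 <;> simpa using h5

/-- A finitely generated algebra over `ℚ` is integral if all its points over the algebraic closure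
are rational. -/
theorem isIntegral_of_rational_points {A : Type*} [CommRing A] [Algebra ℚ A] [Algebra.FiniteType ℚ A]
    (h : ∀ (φ : A →ₐ[ℚ] ℚᵃ) (a : A), ∃ c : ℚ, φ a = algebraMap ℚ _ c) :
    Algebra.IsIntegral ℚ A := by
  rcases subsingleton_or_nontrivial A with hA | hA
  · exact ⟨fun x => ⟨1, Polynomial.monic_one, Subsingleton.elim _ _⟩⟩
  obtain ⟨s, g, hg, hI⟩ := exists_integral_inj_algHom_of_fg ℚ A
  rcases Nat.eq_zero_or_pos s with rfl | hs
  · refine ⟨fun x => ?_⟩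
    have h1 : (algebraMap ℚ A).IsIntegral := by
      have : algebraMap ℚ A = (g : MvPolynomial (Fin 0) ℚ →+* A).comp (C (σ := Fin 0)) := by
        ext a
        exact (g.commutes a).symm
      rw [this]
      refine RingHom.IsIntegral.trans _ _ (RingHom.isIntegral_of_surjective _ ?_) hI
      exact C_surjective (Fin 0)
    exact h1 x
  · exfalso
    let _ := g.toRingHom.toAlgebra
    have : Algebra.IsIntegral (MvPolynomial (Fin s) ℚ) A := ⟨hI⟩
    obtain ⟨α, hα⟩ := IsAlgClosed.exists_pow_nat_eq (2 : ℚᵃ) two_pos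
    let ψ : MvPolynomial (Fin s) ℚ →ₐ[ℚ] ℚᵃ := aeval fun _ => α
    have : (RingHom.ker ψ).IsMaximal := by
      apply Ideal.Quotient.maximal_of_isField
      have : (RingHom.ker ψ).IsPrime := RingHom.ker_isPrime ψ
      have hI : Algebra.IsIntegral ℚ (MvPolynomial (Fin s) ℚ ⧸ RingHom.ker ψ) := by
        refine ⟨fun x => ?_⟩
        rw [← isIntegral_algHom_iff (Ideal.kerLiftAlg ψ) (Ideal.kerLiftAlg_injective ψ)]
        exact Algebra.IsIntegral.isIntegral _
      exact isField_of_isIntegral_of_isField' (Field.toIsField ℚ)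
    obtain ⟨M, hM, hcomap⟩ := Ideal.exists_ideal_over_maximal_of_isIntegral (S := A) (RingHom.ker ψ)
      (by
        intro x hx
        have : x = 0 := hg (by rw [map_zero]; exact hx)
        rw [this]; exact Ideal.zero_mem _)
    let _ : Field (A ⧸ M) := Ideal.Quotient.field M
    have : Module.Finite ℚ (A ⧸ M) := finite_of_finite_type_of_isJacobsonRing _ _
    let ι : (A ⧸ M) →ₐ[ℚ] ℚᵃ := IsAlgClosed.lift
    obtain ⟨c, hc⟩ := h (ι.comp (Ideal.Quotient.mkₐ ℚ M)) (g (X ⟨0, hs⟩))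
    have h1 : (X ⟨0, hs⟩ ^ 2 - C 2 : MvPolynomial (Fin s) ℚ) ∈ RingHom.ker ψ := by
      rw [RingHom.mem_ker, map_sub, map_pow, aeval_X, hα, ← algebraMap_eq, AlgHom.commutes]
      simp
    rw [← hcomap, Ideal.mem_comap] at h1
    have h2 : g (X ⟨0, hs⟩) ^ 2 - algebraMap ℚ A 2 ∈ M := by
      have h3 : g (X ⟨0, hs⟩ ^ 2 - C 2) ∈ M := h1
      rwa [map_sub, map_pow, ← algebraMap_eq, AlgHom.commutes] at h3
    have h3 : (ι.comp (Ideal.Quotient.mkₐ ℚ M)) (g (X ⟨0, hs⟩) ^ 2 - algebraMap ℚ A 2) = 0 := by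
      rw [AlgHom.comp_apply, Ideal.Quotient.mkₐ_eq_mk, Ideal.Quotient.eq_zero_iff_mem.2 h2, map_zero]
    rw [map_sub, map_pow, hc, AlgHom.commutes, ← map_pow, sub_eq_zero] at h3
    have h4 : c ^ 2 = 2 := (algebraMap ℚ ℚᵃ).injective h3
    have h5 : IsSquare (2 : ℚ) := ⟨c, by rw [← h4, pow_two]⟩
    rw [Rat.isSquare_iff] at h5
    have h6 : IsSquare (2 : ℤ) := by simpa using h5.1
    exact Int.prime_two.not_isSquare h6

end

section

open MvPolynomial

/-! ### Common zeros of two plane curves -/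

lemma isPrime_ker_coordinates (F : Type*) [Field F] (s : Set (Fin 3)) [DecidablePred (· ∈ s)] :
    (RingHom.ker (aeval (R := F) fun i : Fin 3 =>
      if i ∈ s then (0 : ℳ F) else X i)).IsPrime :=
  RingHom.ker_isPrime _

lemma three_le_height_ker_eval_zero (F : Type*) [Field F] :
    3 ≤ (RingHom.ker (eval (0 : Fin 3 → F))).height := by
  classical
  let I : Set (Fin 3) → Ideal (ℳ F) := fun s =>
    RingHom.ker (aeval (R := F) fun i : Fin 3 =>
      if i ∈ s then (0 : ℳ F) else X i)
  have hI : ∀ s, (I s).IsPrime := fun s => isPrime_ker_coordinates F s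
  have hlt : ∀ {s t : Set (Fin 3)} (i : Fin 3), s ⊆ t → i ∈ t → i ∉ s → I s < I t := by
    intro s t i hst hit his
    refine lt_of_le_of_ne (fun a ha => ?_) fun h => ?_
    · have h1 : (aeval (R := F) fun i : Fin 3 =>
          if i ∈ t then (0 : ℳ F) else X i) =
          (aeval (R := F) fun i : Fin 3 => if i ∈ t then (0 : ℳ F) else X i).comp
          (aeval (R := F) fun i : Fin 3 =>
            if i ∈ s then (0 : ℳ F) else X i) := by
        apply MvPolynomial.algHom_ext
        intro j
        by_cases hj : j ∈ s
        · simp [hj, hst hj]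
        · simp [hj]
      rw [RingHom.mem_ker, h1, AlgHom.comp_apply, (RingHom.mem_ker).1 ha, map_zero]
    · have h1 : (X i : ℳ F) ∈ I t := by
        rw [RingHom.mem_ker, aeval_X, if_pos hit]
      rw [← h, RingHom.mem_ker, aeval_X, if_neg his] at h1
      exact X_ne_zero i h1
  have h3 : I Set.univ ≤ RingHom.ker (eval (0 : Fin 3 → F)) := by
    intro a ha
    rw [RingHom.mem_ker] at ha ⊢
    have h1 := congrArg (eval (0 : Fin 3 → F)) ha
    rw [map_zero] at h1
    have h2 : ∀ θ : Fin 3 → ℳ F, (∀ i, eval 0 (θ i) = 0) →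
        eval (0 : Fin 3 → F) a = eval 0 (aeval (R := F) θ a) := by
      intro θ hθ
      change eval (0 : Fin 3 → F) a = ((eval (0 : Fin 3 → F)).comp (aeval (R := F) θ).toRingHom) a
      congr 1
      apply MvPolynomial.ringHom_ext
      · intro c; simp
      · intro i
        change eval (0 : Fin 3 → F) (X i) = eval 0 (aeval (R := F) θ (X i))
        rw [aeval_X, hθ, eval_X]
        rfl
    exact (h2 _ (by simp)).trans h1
  have h01 := Ideal.height_add_one_le_of_lt_of_isPrime
    (hlt (s := ∅) (t := {0}) 0 (by simp) (by simp) (by simp))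
  have h12 := Ideal.height_add_one_le_of_lt_of_isPrime
    (hlt (s := {0}) (t := {0, 1}) 1 (by simp) (by simp) (by simp))
  have h23 := Ideal.height_add_one_le_of_lt_of_isPrime
    (hlt (s := {0, 1}) (t := Set.univ) 2 (by simp) (by simp) (by simp))
  refine le_trans ?_ (Ideal.height_mono h3)
  calc (3 : ℕ∞) = 0 + 1 + 1 + 1 := by norm_num
    _ ≤ (I ∅).height + 1 + 1 + 1 := by gcongr; exact zero_le
    _ ≤ (I {0}).height + 1 + 1 := by gcongr
    _ ≤ (I {0, 1}).height + 1 := by gcongr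
    _ ≤ _ := h23

lemma exists_common_zero {F : Type*} [Field F] [IsAlgClosed F] {a b : ℳ F}
    (ha : eval 0 a = 0) (hb : eval 0 b = 0) :
    ∃ v : Fin 3 → F, v ≠ 0 ∧ eval v a = 0 ∧ eval v b = 0 := by
  by_contra! hc
  have hle : RingHom.ker (eval (0 : Fin 3 → F)) ≤ (Ideal.span {a, b}).radical := by
    rw [← vanishingIdeal_zeroLocus_eq_radical (K := F)]
    intro q hq
    rw [mem_vanishingIdeal_iff]
    intro v hv
    rw [mem_zeroLocus_iff] at hv
    have h1 := hv a (Ideal.subset_span (by simp))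
    have h2 := hv b (Ideal.subset_span (by simp))
    rw [aeval_eq_eval] at h1 h2 ⊢
    by_cases hv0 : v = 0
    · rw [hv0]; exact hq
    · exact absurd h2 (hc v hv0 h1)
  have hmin : RingHom.ker (eval (0 : Fin 3 → F)) ∈ (Ideal.span {a, b}).minimalPrimes := by
    refine ⟨⟨RingHom.ker_isPrime _, ?_⟩, fun P hP _ => ?_⟩
    · rw [Ideal.span_le]
      rintro q (rfl | rfl)
      · exact ha
      · exact hb
    · exact hle.trans (hP.1.radical_le_iff.2 hP.2)
  have h2 := Ideal.height_le_card_of_mem_minimalPrimes_span (Set.toFinite _) hmin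
  have h3 := (three_le_height_ker_eval_zero F).trans h2
  have h4 : ({a, b} : Set (ℳ F)).ncard ≤ 2 := by
    have := Set.ncard_insert_le a {b}
    rwa [Set.ncard_singleton] at this
  have h5 : (3 : ℕ∞) ≤ (2 : ℕ) := h3.trans (by exact_mod_cast h4)
  exact absurd h5 (by decide)

/-! ### Geometric irreducibility of the components -/

instance : IsAlgClosure ℚ ℚᵃ := ⟨inferInstance, inferInstance⟩

instance : IsGalois ℚ ℚᵃ where
  to_normal := IsAlgClosure.normal ℚ ℚᵃ

lemma map_baseChange {R S : Type*} [CommRing R] [CommRing S] (φ : R →+* S)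
    (f : ℳ ℤ) : map φ (baseChange R f) = baseChange S f := by
  rw [baseChange, baseChange, map_map]
  rw [show φ.comp (Int.castRingHom R) = Int.castRingHom S from RingHom.ext_int _ _]

lemma hessian_mul_mul {F : Type*} [Field F] {a b q : ℳ F} {w : Fin 3 → F}
    (ha : eval w a = 0) (hb : eval w b = 0) (i j : Fin 3) :
    hessian (a * b * q) w i j = eval w q * (eval w (pderiv i a) * eval w (pderiv j b) +
      eval w (pderiv i b) * eval w (pderiv j a)) := by
  simp only [hessian, Derivation.leibniz, map_add, smul_eq_mul, map_mul, ha, hb]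
  ring

lemma pderiv_mul_eq_zero {F : Type*} [Field F] {a b : ℳ F} {w : Fin 3 → F}
    (ha : eval w a = 0) (hb : eval w b = 0) (i : Fin 3) : eval w (pderiv i (a * b)) = 0 := by
  simp [Derivation.leibniz, ha, hb]

lemma rank_le_one_of_forall {H : Matrix (Fin 3) (Fin 3) ℚ} {a : Fin 3 → ℚ}
    (h : ∀ x, dotProduct a x = 0 → H.mulVec x = 0) : H.rank ≤ 1 := by
  let ℓ : (Fin 3 → ℚ) →ₗ[ℚ] ℚ := dotProductBilin ℚ ℚ a
  have h1 := LinearMap.finrank_range_add_finrank_ker ℓ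
  have h2 := LinearMap.finrank_range_add_finrank_ker H.mulVecLin
  have h3 : LinearMap.ker ℓ ≤ LinearMap.ker H.mulVecLin := fun x hx => h x hx
  have h4 := Submodule.finrank_mono h3
  have h5 := Submodule.finrank_le (LinearMap.range ℓ)
  rw [Module.finrank_self] at h5
  rw [Module.finrank_fintype_fun_eq_card, Fintype.card_fin] at h1 h2
  rw [Matrix.rank]
  omega

/-- Conjugate factors meet in a double point whose tangent lines are conjugate; so they cannot
be rational. -/
lemma not_conjugate_factors {f : ℳ ℤ} (hsing : HasOnlyRationalODPs f)
    {h q : ℳ ℚᵃ} {k : ℕ} (hk : k ≠ 0) (hh : h.IsHomogeneous k)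
    (σ : ℚᵃ ≃ₐ[ℚ] ℚᵃ)
    (hf : baseChange ℚᵃ f = h * map (σ : ℚᵃ →+* _) h * q) :
    False := by
  set h' := map (σ : ℚᵃ →+* ℚᵃ) h with hh'
  have hhom' : h'.IsHomogeneous k := hh.map _
  have hzero : ∀ a : ℳ ℚᵃ, a.IsHomogeneous k → eval 0 a = 0 := by
    intro a ha
    have := eval_smul_of_isHomogeneous ha 0 0
    rwa [zero_smul, zero_pow hk, zero_mul] at this
  obtain ⟨v, hv0, hv, hv'⟩ := exists_common_zero (hzero h hh) (hzero h' hhom')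
  obtain ⟨c, w, hcw, ⟨-, hrank⟩, a, b, hab⟩ := hsing v ⟨hv0, by rw [hf]; simp [hv], fun i => by
    rw [hf, mul_assoc]
    exact pderiv_mul_eq_zero hv (by rw [map_mul, hv', zero_mul]) i⟩
  have hc0 : c ≠ 0 := by
    rintro rfl
    exact hv0 (by rw [hcw]; funext i; simp)
  let φ := algebraMap ℚ ℚᵃ
  let w' : Fin 3 → ℚᵃ := fun i => φ (w i)
  have hw : ∀ a : ℳ ℚᵃ, a.IsHomogeneous k → eval v a = 0 →
      eval w' a = 0 := by
    intro a ha h0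
    rw [show v = c • w' from hcw, eval_smul_of_isHomogeneous ha] at h0
    exact (mul_eq_zero.1 h0).resolve_left (pow_ne_zero _ hc0)
  have h1 := hw h hh hv
  have h2 := hw h' hhom' hv'
  let α : Fin 3 → ℚᵃ := fun i => eval w' (pderiv i h)
  let β : Fin 3 → ℚᵃ := fun i => eval w' (pderiv i h')
  have hβ : ∀ i, β i = σ (α i) := by
    intro i
    have h3 := map_eval (σ : ℚᵃ →+* ℚᵃ) w' (pderiv i h)
    have h4 : (σ : ℚᵃ →+* ℚᵃ) ∘ w' = w' := by
      funext j; exact σ.commutes (w j)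
    rw [h4, ← pderiv_map] at h3
    exact h3.symm
  have hH : ∀ i j, φ (hessian (baseChange ℚ f) w i j) = eval w' q * (α i * β j + β i * α j) := by
    intro i j
    rw [← hessian_mul_mul h1 h2, ← hf, hessian, hessian, pderiv_baseChange, pderiv_baseChange,
      map_eval_baseChange, pderiv_baseChange, pderiv_baseChange]
  have key : ∀ x, dotProduct a x = 0 → (hessian (baseChange ℚ f) w).mulVec x = 0 := by
    intro x hx
    have h3 := congrArg φ (hab x)
    rw [hx, zero_mul, map_zero] at h3
    set s := ∑ i, α i * φ (x i) with hs
    have hs' : ∑ i, β i * φ (x i) = σ s := by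
      rw [hs, map_sum]
      refine sum_congr rfl fun i _ => ?_
      rw [map_mul, hβ]
      congr 1
      exact (σ.commutes (x i)).symm
    have h4 : eval w' q * (s * σ s) = 0 := by
      have h5 : 2 * (eval w' q * (s * σ s)) = 0 := by
        rw [← h3, ← hs', hs]
        simp only [dotProduct, mulVec, map_add, map_mul, hH, Fin.sum_univ_three]
        ring
      simpa using h5
    have h5 : eval w' q * s = 0 ∧ eval w' q * σ s = 0 := by
      rcases mul_eq_zero.1 h4 with h | h
      · simp [h]
      · rcases mul_eq_zero.1 h with h | h
        · simp [h]
        · simp [(map_eq_zero σ).1 h]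
    funext i
    apply φ.injective
    have h6 : φ ((hessian (baseChange ℚ f) w).mulVec x i) =
        α i * (eval w' q * σ s) + β i * (eval w' q * s) := by
      rw [← hs', hs]
      simp only [dotProduct, mulVec, map_add, map_mul, hH, Fin.sum_univ_three]
      ring
    rw [h6, h5.1, h5.2]
    simp
  have := rank_le_one_of_forall key
  omega

theorem irreducible_geometric {f g : ℳ ℤ} {r : ℕ} (hfr : f.IsHomogeneous r)
    (hf0 : f ≠ 0) (hsing : HasOnlyRationalODPs f) (hg : Irreducible (baseChange ℚ g))
    (hgf : baseChange ℚ g ∣ baseChange ℚ f) :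
    Irreducible (baseChange ℚᵃ g) := by
  let φ := algebraMap ℚ ℚᵃ
  have hφ : Function.Injective (map (σ := Fin 3) φ) := map_injective _ φ.injective
  have hG : baseChange ℚᵃ g = map φ (baseChange ℚ g) := (map_baseChange φ g).symm
  have hF : baseChange ℚᵃ f = map φ (baseChange ℚ f) := (map_baseChange φ f).symm
  have hF0 : baseChange ℚᵃ f ≠ 0 := by
    rw [baseChange, Ne, map_eq_zero_iff _ (map_injective _ (Int.castRingHom _).injective_int)]
    exact hf0
  have hG0 : baseChange ℚᵃ g ≠ 0 := by
    rw [hG, Ne, map_eq_zero_iff _ hφ]; exact hg.ne_zero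
  have hGu : ¬ IsUnit (baseChange ℚᵃ g) := by
    intro h
    apply hg.not_isUnit
    rw [isUnit_iff_totalDegree_of_isReduced] at h ⊢
    rw [hG, coeff_map] at h
    refine ⟨isUnit_iff_ne_zero.2 fun h0 => by simp [h0] at h, ?_⟩
    have h1 := h.2
    rw [totalDegree, support_map_of_injective _ φ.injective] at h1
    exact h1
  have hGF : baseChange ℚᵃ g ∣ baseChange ℚᵃ f := by
    rw [hG, hF]; exact map_dvd _ hgf
  obtain ⟨h₀, hh₀, hdvd₀⟩ := WfDvdMonoid.exists_irreducible_factor hGu hG0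
  obtain ⟨d, hd⟩ := ne_zero_iff.1 hh₀.ne_zero
  set h := C (coeff d h₀)⁻¹ * h₀ with hh
  have hunit : IsUnit (C (σ := Fin 3) (coeff d h₀)⁻¹) := (isUnit_iff_ne_zero.2 (inv_ne_zero hd)).map C
  have hassoc : Associated h₀ h := associated_unit_mul_right h₀ _ hunit
  have hirr : Irreducible h := hassoc.irreducible hh₀
  have hdvd : h ∣ baseChange ℚᵃ g := hassoc.dvd_iff_dvd_left.1 hdvd₀
  have hcoeff : coeff d h = 1 := by rw [hh, coeff_C_mul, inv_mul_cancel₀ hd]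
  obtain ⟨k, hk⟩ := hdvd
  have hfix : ∀ σ : ℚᵃ ≃ₐ[ℚ] ℚᵃ, ∀ a,
      map (σ : ℚᵃ →+* ℚᵃ) (baseChange ℚᵃ a) =
      baseChange ℚᵃ a := fun σ a => map_baseChange _ a
  have hrat : ∀ a : ℳ ℚᵃ,
      (∀ σ : ℚᵃ ≃ₐ[ℚ] ℚᵃ,
        map (σ : ℚᵃ →+* ℚᵃ) a = a) → ∃ b, map φ b = a := by
    intro a ha
    have : a ∈ Set.range (map φ) := by
      rw [mem_range_map_iff_coeffs_subset]
      intro c hc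
      obtain ⟨e, -, rfl⟩ := mem_coeffs_iff.1 hc
      rw [InfiniteGalois.mem_range_algebraMap_iff_fixed]
      intro σ
      have h3 := congrArg (coeff e) (ha σ)
      rwa [coeff_map] at h3
    exact this
  by_cases hall : ∀ σ : ℚᵃ ≃ₐ[ℚ] ℚᵃ,
      map (σ : ℚᵃ →+* ℚᵃ) h = h
  · obtain ⟨h', hh'⟩ := hrat h hall
    obtain ⟨k', hk'⟩ := hrat k fun σ => by
      have h3 := hfix σ g
      rw [hk, map_mul, hall] at h3
      exact mul_left_cancel₀ hirr.ne_zero h3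
    have h4 : baseChange ℚ g = h' * k' := hφ (by rw [map_mul, hh', hk', ← hk, hG])
    rcases hg.isUnit_or_isUnit h4 with h5 | h5
    · exact absurd (hh' ▸ h5.map (map φ)) hirr.not_isUnit
    · have h6 : IsUnit k := hk' ▸ h5.map (map φ)
      rw [hk]
      exact (associated_mul_unit_right h k h6).irreducible hirr
  · exfalso
    push Not at hall
    obtain ⟨σ, hσ⟩ := hall
    set h' := map (σ : ℚᵃ →+* ℚᵃ) h with hh'
    have hirr' : Irreducible h' :=
      (MulEquiv.irreducible_iff (mapEquiv (Fin 3) σ.toRingEquiv)).2 hirr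
    have hnd : ¬ h' ∣ h := by
      intro hd'
      obtain ⟨u, hu⟩ := (hirr'.associated_of_dvd hirr hd')
      obtain ⟨c, -, hc⟩ := isUnit_iff_eq_C_of_isReduced.1 u.isUnit
      have h3 := congrArg (coeff d) hu
      rw [hc, mul_comm, coeff_C_mul, hcoeff, hh', coeff_map, hcoeff, map_one, mul_one] at h3
      rw [hc, h3, C_1, mul_one] at hu
      exact hσ hu
    have hdvd' : h' ∣ h * k := by
      rw [← hk, ← hfix σ g, hk, map_mul]
      exact dvd_mul_right _ _
    obtain ⟨k', hk'⟩ := (hirr'.prime.dvd_or_dvd hdvd').resolve_left hnd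
    obtain ⟨e, he⟩ := hGF
    have hfac : baseChange ℚᵃ f = h * h' * (k' * e) := by
      rw [he, hk, hk']; ring
    have hhom : h.IsHomogeneous h.totalDegree := by
      refine isHomogeneous_of_dvd (hfr.map (Int.castRingHom ℚᵃ)) hF0 ?_
      change h ∣ baseChange ℚᵃ f
      rw [hfac, mul_assoc]
      exact dvd_mul_right _ _
    refine not_conjugate_factors hsing (fun h0 => hirr.not_isUnit ?_) hhom σ hfac
    rw [isUnit_iff_totalDegree_of_isReduced]
    refine ⟨isUnit_iff_ne_zero.2 fun h1 => hirr.ne_zero ?_, h0⟩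
    rw [totalDegree_eq_zero_iff_eq_C.1 h0, h1, C_0]

end

section

open MvPolynomial

/-! ### Irreducibility modulo almost all primes -/

lemma exists_ne_zero_coeff_of_totalDegree {R : Type*} [CommRing R] {g : ℳ R}
    (h : g.totalDegree ≠ 0) : ∃ d, coeff d g ≠ 0 ∧ d.degree = g.totalDegree := by
  have hne : g.support.Nonempty := by
    rw [Finset.nonempty_iff_ne_empty, Ne, support_eq_empty]
    rintro rfl
    simp at h
  obtain ⟨d, hd, hd'⟩ := Finset.exists_mem_eq_sup g.support hne (fun s => s.sum fun _ e => e)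
  exact ⟨d, mem_support_iff.1 hd, hd'.symm⟩

lemma one_le_totalDegree {F : Type*} [Field F] {a : ℳ F} (ha : a ≠ 0)
    (hu : ¬ IsUnit a) : 1 ≤ a.totalDegree := by
  by_contra h0
  apply hu
  have h0 : a.totalDegree = 0 := by omega
  rw [isUnit_iff_totalDegree_of_isReduced]
  refine ⟨isUnit_iff_ne_zero.2 fun h1 => ha ?_, h0⟩
  rw [totalDegree_eq_zero_iff_eq_C.1 h0, h1, C_0]

lemma totalDegree_pos_of_not_isUnit {F : Type*} [Field F] {a : ℳ F}
    (hd : a.totalDegree ≠ 0) : a ≠ 0 ∧ ¬ IsUnit a := by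
  refine ⟨by rintro rfl; simp at hd, fun h => hd ?_⟩
  rw [isUnit_iff_totalDegree_of_isReduced] at h
  exact h.2

lemma totalDegree_baseChange {F : Type*} [Field F] {g : ℳ ℤ} {d : Fin 3 →₀ ℕ}
    (hd : d.degree = g.totalDegree) (hF : ((coeff d g : ℤ) : F) ≠ 0) :
    (baseChange F g).totalDegree = g.totalDegree := by
  apply le_antisymm
  · exact Finset.sup_le fun e he => le_totalDegree (support_map_subset _ _ he)
  · rw [← hd]
    refine le_totalDegree (p := baseChange F g) (s := d) ?_
    rw [mem_support_iff, baseChange, coeff_map]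
    exact hF

/-- If the product of two polynomials of degree less than the degree of `g` is never `g` over the
algebraic closure of `ℚ`, then `g` is irreducible modulo `p` for almost all `p`. -/
theorem exists_irreducible_mod {g : ℳ ℤ} (hdeg : 1 < g.totalDegree)
    (hg : Irreducible (baseChange ℚᵃ g)) :
    ∃ N : ℕ, N ≠ 0 ∧ ∀ (F : Type) [Field F], (N : F) ≠ 0 → Irreducible (baseChange F g) ∧
      (baseChange F g).totalDegree = g.totalDegree := by
  set D := g.totalDegree with hD
  let S : Finset (Fin 3 →₀ ℕ) := (Finsupp.finite_of_degree_le (σ := Fin 3) (D - 1)).toFinset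
  have hS : ∀ d, d ∈ S ↔ d.degree ≤ D - 1 := fun d => by simp [S]
  let σ := S ⊕ S
  let A : ℳ (MvPolynomial σ ℤ) := ∑ s : S, monomial s.1 (X (Sum.inl s))
  let B : ℳ (MvPolynomial σ ℤ) := ∑ s : S, monomial s.1 (X (Sum.inr s))
  let E := A * B - map C g
  let P : Set (MvPolynomial σ ℤ) := Set.range fun d => coeff d E
  have hmap : ∀ {K : Type} [CommRing K] (v : σ → K),
      map (eval₂Hom (Int.castRingHom K) v) E =
      (∑ s : S, monomial s.1 (v (Sum.inl s))) * (∑ s : S, monomial s.1 (v (Sum.inr s))) -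
        baseChange K g := by
    intro K _ v
    simp only [E, A, B, map_sub, map_mul, map_sum, map_monomial, map_map]
    have h1 : (eval₂Hom (Int.castRingHom K) v).comp C = Int.castRingHom K := RingHom.ext_int _ _
    rw [h1]
    simp only [eval₂Hom_X']
    rfl
  have hPE : ∀ {K : Type} [CommRing K] (v : σ → K), (∀ q ∈ P, eval₂Hom (Int.castRingHom K) v q = 0) ↔
      map (eval₂Hom (Int.castRingHom K) v) E = 0 := by
    intro K _ v
    rw [MvPolynomial.ext_iff]
    simp [P, coeff_map]
  have hlow : ∀ {K : Type} [Field K] (c : S → K),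
      (∑ s : S, monomial s.1 (c s)).totalDegree ≤ D - 1 := by
    intro K _ c
    refine totalDegree_finsetSum_le fun s _ => ?_
    refine (totalDegree_monomial_le _ _).trans ?_
    exact (hS s.1).1 s.2
  have hexp : ∀ {K : Type} [Field K] (a : ℳ K), a.totalDegree ≤ D - 1 →
      (∑ s : S, monomial s.1 (coeff s.1 a)) = a := by
    intro K _ a ha
    rw [Finset.sum_coe_sort S (fun d => monomial d (coeff d a))]
    conv_rhs => rw [← support_sum_monomial_coeff a]
    symm
    refine Finset.sum_subset (fun d hd => ?_) (fun d _ hd => ?_)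
    · rw [hS]; exact (le_totalDegree hd).trans ha
    · rw [notMem_support_iff.1 hd, monomial_zero]
  obtain ⟨d, hd, hdD⟩ := exists_ne_zero_coeff_of_totalDegree (g := g) (by omega)
  obtain ⟨N, hN, h⟩ := exists_no_solution P (by
    intro v
    by_contra! hc
    rw [hPE, hmap, sub_eq_zero] at hc
    have hdQ : (baseChange ℚᵃ g).totalDegree = D :=
      totalDegree_baseChange hdD (by exact_mod_cast hd)
    have h1 := hlow fun s => v (Sum.inl s)
    have h2 := hlow fun s => v (Sum.inr s)
    have hne := hg.ne_zero
    rw [← hc] at hne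
    have h3 := totalDegree_mul_of_isDomain (left_ne_zero_of_mul hne) (right_ne_zero_of_mul hne)
    rw [hc, hdQ] at h3
    rcases hg.isUnit_or_isUnit hc.symm with h4 | h4
    · have := (isUnit_iff_totalDegree_of_isReduced.1 h4).2
      omega
    · have := (isUnit_iff_totalDegree_of_isReduced.1 h4).2
      omega)
  refine ⟨N * (coeff d g).natAbs, mul_ne_zero hN (by simpa using hd), fun F _ hF => ?_⟩
  rw [Nat.cast_mul] at hF
  have hc : ((coeff d g : ℤ) : F) ≠ 0 := by
    intro h0
    apply right_ne_zero_of_mul hF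
    rcases Int.natAbs_eq (coeff d g) with h6 | h6 <;> rw [h6] at h0 <;> simpa using h0
  have hdF := totalDegree_baseChange hdD hc
  have hgF := totalDegree_pos_of_not_isUnit (a := baseChange F g) (by omega)
  refine ⟨⟨hgF.2, fun {a b} hab => ?_⟩, hdF⟩
  by_contra! hu
  have hne := hgF.1
  rw [hab] at hne
  have ha0 := left_ne_zero_of_mul hne
  have hb0 := right_ne_zero_of_mul hne
  have h1 := one_le_totalDegree ha0 hu.1
  have h2 := one_le_totalDegree hb0 hu.2
  have h3 := totalDegree_mul_of_isDomain ha0 hb0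
  rw [← hab, hdF] at h3
  obtain ⟨q, hq, hne⟩ := h F (left_ne_zero_of_mul hF)
    (Sum.elim (fun s => coeff s.1 a) fun s => coeff s.1 b)
  refine hne ((hPE _).2 ?_ q hq)
  rw [hmap, sub_eq_zero]
  simp only [Sum.elim_inl, Sum.elim_inr]
  rw [hexp a (by omega), hexp b (by omega), hab]

/-! ### The singular points modulo almost all primes -/

/-- The curve `f = 0` over the algebraic closure has finitely many singular points. -/
theorem exists_finite_singular {f : ℳ ℤ} 
    (hsing : HasOnlyRationalODPs f) (i₀ : Fin 3) :
    ∃ W : Finset (Fin 3 → ℚ), (∀ w ∈ W, IsODP (baseChange ℚ f) w ∧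
        HasRationalSlopes (baseChange ℚ f) w) ∧
      ∀ v : Fin 3 → ℚᵃ, IsSingularAt (baseChange ℚᵃ f) v →
        v i₀ = 1 → ∃ w ∈ W, ∃ c : ℚᵃ, v = fun i => c * algebraMap ℚ _ (w i) := by
  classical
  let J : Ideal (ℳ ℚ) := Ideal.span
    ({baseChange ℚ f, X i₀ - 1} ∪ Set.range fun i => pderiv i (baseChange ℚ f))
  have hpt : ∀ v : Fin 3 → ℚᵃ, (∀ a ∈ J, aeval v a = 0) ↔
      IsSingularAt (baseChange ℚᵃ f) v ∧ v i₀ = 1 := by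
    intro v
    have hev : ∀ a : ℳ ℤ, aeval v (baseChange ℚ a) =
        eval v (baseChange ℚᵃ a) := by
      intro a
      rw [← map_baseChange (algebraMap ℚ ℚᵃ), eval_map]
      rfl
    have h1 : (∀ a ∈ J, aeval v a = 0) ↔ J ≤ RingHom.ker (aeval (R := ℚ) v) := Iff.rfl
    rw [h1, Ideal.span_le]
    constructor
    · intro h
      have h2 := h (Or.inl (Or.inl rfl))
      have h3 := h (Or.inl (Or.inr rfl))
      have h4 := fun i => h (Or.inr ⟨i, rfl⟩)
      simp only [SetLike.mem_coe, RingHom.mem_ker, pderiv_baseChange, hev, map_sub, aeval_X,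
        map_one, sub_eq_zero] at h2 h3 h4
      exact ⟨⟨fun h0 => by simp [h0] at h3, h2, fun i => by rw [pderiv_baseChange]; exact h4 i⟩, h3⟩
    · rintro ⟨⟨-, h2, h3⟩, h4⟩ a ((rfl | rfl) | ⟨i, rfl⟩)
      · rw [SetLike.mem_coe, RingHom.mem_ker, hev, h2]
      · simp [h4]
      · have := h3 i
        rw [pderiv_baseChange] at this
        change aeval v (pderiv i (baseChange ℚ f)) = 0
        rw [pderiv_baseChange, hev, this]
  have hrat : ∀ v : Fin 3 → ℚᵃ, (∀ a ∈ J, aeval v a = 0) →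
      ∃ w : Fin 3 → ℚ, v = fun i => algebraMap ℚ _ (w i) := by
    intro v hv
    obtain ⟨hs, h1⟩ := (hpt v).1 hv
    obtain ⟨c, w, hcw, -, -⟩ := hsing v hs
    have h2 : c * algebraMap ℚ _ (w i₀) = 1 := by rw [← h1, hcw]
    refine ⟨fun i => (w i₀)⁻¹ * w i, ?_⟩
    rw [hcw]
    funext i
    rw [map_mul, map_inv₀, eq_inv_of_mul_eq_one_left h2]
  have hI : Algebra.IsIntegral ℚ (ℳ ℚ ⧸ J) := by
    apply isIntegral_of_rational_points
    intro φ a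
    obtain ⟨a, rfl⟩ := Ideal.Quotient.mk_surjective a
    have h1 : φ.comp (Ideal.Quotient.mkₐ ℚ J) = aeval fun i => φ (Ideal.Quotient.mk J (X i)) := by
      apply MvPolynomial.algHom_ext
      intro i
      rw [aeval_X]; rfl
    obtain ⟨w, hw⟩ := hrat (fun i => φ (Ideal.Quotient.mk J (X i))) (fun b hb => by
      rw [← h1, AlgHom.comp_apply, Ideal.Quotient.mkₐ_eq_mk, Ideal.Quotient.eq_zero_iff_mem.2 hb,
        map_zero])
    refine ⟨eval w a, ?_⟩
    have h2 := AlgHom.congr_fun h1 a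
    rw [hw] at h2
    refine h2.trans ?_
    have h3 := aeval_algebraMap_apply ℚᵃ w a
    rw [aeval_eq_eval] at h3
    exact h3
  have hfin : {v : Fin 3 → ℚᵃ |
      IsSingularAt (baseChange ℚᵃ f) v ∧ v i₀ = 1}.Finite := by
    choose P hP hPz using fun i => hI.isIntegral (Ideal.Quotient.mk J (X i))
    refine Set.Finite.subset (Set.Finite.pi fun i => ((P i).map
      (algebraMap ℚ ℚᵃ)).roots.toFinset.finite_toSet) ?_
    intro v hv i _
    rw [Finset.mem_coe, Multiset.mem_toFinset, Polynomial.mem_roots ((hP i).map _).ne_zero,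
      Polynomial.IsRoot, Polynomial.eval_map]
    let φ : (ℳ ℚ ⧸ J) →ₐ[ℚ] ℚᵃ :=
      Ideal.Quotient.liftₐ J (aeval v) ((hpt v).2 hv)
    have h1 : φ (Ideal.Quotient.mk J (X i)) = v i := by
      change aeval v (X i) = v i
      rw [aeval_X]
    have h2 := congrArg φ (hPz i)
    rw [map_zero, ← AlgHom.coe_toRingHom, Polynomial.hom_eval₂, AlgHom.coe_toRingHom, h1] at h2
    rw [← h2]
    congr 1
    exact (φ.comp_algebraMap).symm
  choose! c w hcw using hsing
  refine ⟨hfin.toFinset.image w, fun u hu => ?_, fun v hv h1 => ⟨w v, ?_, c v, (hcw v hv).1⟩⟩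
  · obtain ⟨v, hv, rfl⟩ := Finset.mem_image.1 hu
    rw [Set.Finite.mem_toFinset] at hv
    exact (hcw v hv.1).2
  · exact mem_image_of_mem _ ((Set.Finite.mem_toFinset _).2 ⟨hv, h1⟩)

end

section

open MvPolynomial

lemma IsSingularAt.smul {F : Type*} [Field F] {f : ℳ F} {r : ℕ}
    (hf : f.IsHomogeneous r) {v : Fin 3 → F} (h : IsSingularAt f v) {c : F} (hc : c ≠ 0) :
    IsSingularAt f (c • v) := by
  refine ⟨smul_ne_zero hc h.1, ?_, fun i => ?_⟩
  · rw [eval_smul_of_isHomogeneous hf, h.2.1, mul_zero]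
  · rw [eval_smul_of_isHomogeneous hf.pderiv, h.2.2, mul_zero]

lemma hessian_smul {F : Type*} [Field F] {f : ℳ F} {r : ℕ}
    (hf : f.IsHomogeneous r) (v : Fin 3 → F) (c : F) :
    hessian f (c • v) = c ^ (r - 1 - 1) • hessian f v := by
  ext i j
  rw [hessian, eval_smul_of_isHomogeneous hf.pderiv.pderiv]
  rfl

lemma rank_smul_of_ne_zero {F : Type*} [Field F] {n : ℕ} (M : Matrix (Fin n) (Fin n) F) {c : F}
    (hc : c ≠ 0) : (c • M).rank = M.rank := by
  have h : c • M = (c • (1 : Matrix (Fin n) (Fin n) F)) * M := by simp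
  rw [h, Matrix.rank_mul_eq_right_of_isUnit_det]
  rw [det_smul, det_one, mul_one]
  exact (isUnit_iff_ne_zero.2 hc).pow _

lemma IsODP.smul {F : Type*} [Field F] {f : ℳ F} {r : ℕ}
    (hf : f.IsHomogeneous r) {v : Fin 3 → F} (h : IsODP f v) {c : F} (hc : c ≠ 0) :
    IsODP f (c • v) :=
  ⟨h.1.smul hf hc, by rw [hessian_smul hf, rank_smul_of_ne_zero _ (pow_ne_zero _ hc), h.2]⟩

lemma HasRationalSlopes.smul {F : Type*} [Field F] {f : ℳ F} {r : ℕ}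
    (hf : f.IsHomogeneous r) {v : Fin 3 → F} (h : HasRationalSlopes f v) (c : F) :
    HasRationalSlopes f (c • v) := by
  obtain ⟨a, b, hab⟩ := h
  refine ⟨c ^ (r - 1 - 1) • a, b, fun w => ?_⟩
  rw [hessian_smul hf, Matrix.smul_mulVec, dotProduct_smul, hab, smul_dotProduct, smul_eq_mul,
    smul_eq_mul, mul_assoc]

lemma exists_integral_multiple {ι : Type*} [Fintype ι] [DecidableEq ι] (w : ι → ℚ) :
    ∃ (c : ℚ) (w' : ι → ℤ), c ≠ 0 ∧ (fun i => (w' i : ℚ)) = c • w := by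
  refine ⟨∏ i, ((w i).den : ℚ), fun i => (w i).num * ∏ j ∈ Finset.univ.erase i, ((w j).den : ℤ),
    prod_ne_zero_iff.2 fun i _ => by exact_mod_cast (w i).den_nz, ?_⟩
  funext i
  rw [Pi.smul_apply, smul_eq_mul, ← Finset.mul_prod_erase _ _ (mem_univ i)]
  push_cast
  have := Rat.num_div_den (w i)
  have h0 : ((w i).den : ℚ) ≠ 0 := by exact_mod_cast (w i).den_nz
  rw [div_eq_iff h0] at this
  rw [this]
  ring

/-- The vectors `w` represent rational double points with rational slopes, and every singular point
in characteristic not dividing `N` is the reduction of one of them. -/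
theorem exists_node_reduction {f : ℳ ℤ} {r : ℕ} (hfr : f.IsHomogeneous r)
    (hsing : HasOnlyRationalODPs f) :
    ∃ W : Finset (Fin 3 → ℤ),
      (∀ w ∈ W, IsODP (baseChange ℚ f) (fun i => (w i : ℚ)) ∧
        HasRationalSlopes (baseChange ℚ f) (fun i => (w i : ℚ))) ∧
      ∃ N : ℕ, N ≠ 0 ∧ ∀ (F : Type) [Field F], (N : F) ≠ 0 → ∀ v : Fin 3 → F,
        IsSingularAt (baseChange F f) v → ∃ w ∈ W, ∃ c : F, c ≠ 0 ∧ v = fun i => c * (w i : F) := by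
  classical
  have hchart : ∀ i₀ : Fin 3, ∃ W : Finset (Fin 3 → ℤ),
      (∀ w ∈ W, IsODP (baseChange ℚ f) (fun i => (w i : ℚ)) ∧
        HasRationalSlopes (baseChange ℚ f) (fun i => (w i : ℚ))) ∧
      ∃ N : ℕ, N ≠ 0 ∧ ∀ (F : Type) [Field F], (N : F) ≠ 0 → ∀ v : Fin 3 → F,
        IsSingularAt (baseChange F f) v → v i₀ = 1 → ∃ w ∈ W, ∀ k, (w i₀ : F) * v k = w k := by
    intro i₀
    obtain ⟨W₀, hW₀, hW₀'⟩ := exists_finite_singular hsing i₀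
    choose c w' hc0 hw' using exists_integral_multiple (ι := Fin 3)
    refine ⟨W₀.image w', ?_, ?_⟩
    · intro u hu
      obtain ⟨w, hw, rfl⟩ := Finset.mem_image.1 hu
      rw [hw']
      exact ⟨(hW₀ w hw).1.smul (hfr.map _) (hc0 w), (hW₀ w hw).2.smul (hfr.map _) _⟩
    set W := W₀.image w' with hW
    let σ := Fin 3 ⊕ (W × Fin 3)
    let E : W → MvPolynomial σ ℤ := fun w => ∑ k, X (Sum.inr (w, k)) *
      (C (w.1 i₀) * X (Sum.inl k) - C (w.1 k)) - 1
    let P : Set (MvPolynomial σ ℤ) := {rename Sum.inl f, X (Sum.inl i₀) - 1} ∪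
      Set.range (fun i => rename Sum.inl (pderiv i f)) ∪ Set.range E
    have hren : ∀ {K : Type} [CommRing K] (v : σ → K) (a : ℳ ℤ),
        eval₂Hom (Int.castRingHom K) v (rename Sum.inl a) =
          eval (fun i => v (Sum.inl i)) (baseChange K a) := by
      intro K _ v a
      rw [eval_baseChange, eval₂Hom_rename]
      rfl
    have hP : ∀ {K : Type} [Field K] (v : σ → K),
        (∀ q ∈ P, eval₂Hom (Int.castRingHom K) v q = 0) ↔
        IsSingularAt (baseChange K f) (fun i => v (Sum.inl i)) ∧ v (Sum.inl i₀) = 1 ∧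
          ∀ w : W, ∑ k, v (Sum.inr (w, k)) * ((w.1 i₀ : K) * v (Sum.inl k) - w.1 k) = 1 := by
      intro K _ v
      constructor
      · intro h
        have h1 := h _ (Or.inl (Or.inl (Or.inl rfl)))
        have h2 := h _ (Or.inl (Or.inl (Or.inr rfl)))
        have h3 := fun i => h _ (Or.inl (Or.inr ⟨i, rfl⟩))
        have h4 := fun w => h _ (Or.inr ⟨w, rfl⟩)
        simp only [hren, map_sub, eval₂Hom_X', map_one, sub_eq_zero, E, map_sum, map_mul, map_intCast,
          eq_intCast] at h1 h2 h3 h4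
        refine ⟨⟨fun h0 => ?_, h1, fun i => by rw [pderiv_baseChange]; exact h3 i⟩, h2, h4⟩
        have := congrFun h0 i₀
        simp [h2] at this
      · rintro ⟨⟨-, h1, h2⟩, h3, h4⟩ q (((rfl | rfl) | ⟨i, rfl⟩) | ⟨w, rfl⟩)
        · rw [hren, h1]
        · simp [h3]
        · have := h2 i
          rw [pderiv_baseChange] at this
          exact (hren v _).trans this
        · simp only [map_sub, eval₂Hom_X', map_one, sub_eq_zero, E, map_sum, map_mul, map_intCast,
            eq_intCast]
          exact h4 w
    obtain ⟨N, hN, h⟩ := exists_no_solution P (by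
      intro v
      by_contra! hc
      obtain ⟨h1, h2, h3⟩ := (hP v).1 hc
      obtain ⟨w, hw, t, ht⟩ := hW₀' _ h1 h2
      have h4 := h3 ⟨w' w, mem_image_of_mem _ hw⟩
      have h5 : ∀ k, ((w' w i₀ : ℤ) : ℚᵃ) * v (Sum.inl k) - (w' w k : ℤ) = 0 := by
        intro k
        have h6 : ∀ k, ((w' w k : ℤ) : ℚᵃ) =
            algebraMap ℚ _ (c w) * algebraMap ℚ _ (w k) := by
          intro k
          have := congrArg (algebraMap ℚ ℚᵃ) (congrFun (hw' w) k)
          simpa using this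
        have h7 := congrFun ht k
        have h8 := congrFun ht i₀
        rw [h2] at h8
        rw [h6, h6, h7]
        linear_combination (-algebraMap ℚ ℚᵃ (c w) *
          algebraMap ℚ ℚᵃ (w k)) * h8
      simp [h5] at h4)
    refine ⟨N, hN, fun F _ hF v hv hv1 => ?_⟩
    by_contra! hcon
    choose κ hκ using hcon
    obtain ⟨q, hq, hne⟩ := h F hF (Sum.elim v fun x => if x.2 = κ x.1.1 x.1.2 then
      ((x.1.1 i₀ : F) * v x.2 - x.1.1 x.2)⁻¹ else 0)
    refine hne ((hP _).2 ⟨hv, hv1, fun w => ?_⟩ q hq)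
    simp only [Sum.elim_inl, Sum.elim_inr]
    rw [sum_eq_single (κ w.1 w.2)]
    · rw [if_pos rfl, inv_mul_cancel₀ (sub_ne_zero.2 (hκ w.1 w.2))]
    · intro b _ hb
      rw [if_neg hb, zero_mul]
    · simp
  choose W hW N hN h using hchart
  have hne : ∀ i, ∀ w ∈ W i, ∃ k, w k ≠ 0 := by
    intro i w hw
    by_contra! hc
    exact (hW i w hw).1.1.1 (funext fun k => by simp [hc k])
  choose! κ hκ using hne
  refine ⟨Finset.univ.biUnion W, fun w hw => ?_,
    (∏ i, N i) * ∏ i, ∏ w ∈ W i, (w (κ i w)).natAbs, ?_, ?_⟩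
  · obtain ⟨i, -, hi⟩ := Finset.mem_biUnion.1 hw
    exact hW i w hi
  · refine mul_ne_zero (prod_ne_zero_iff.2 fun i _ => hN i) ?_
    refine prod_ne_zero_iff.2 fun i _ => prod_ne_zero_iff.2 fun w hw => ?_
    exact Int.natAbs_ne_zero.2 (hκ i w hw)
  · intro F _ hF v hv
    obtain ⟨i, hi⟩ : ∃ i, v i ≠ 0 := by
      by_contra! hc
      exact hv.1 (funext hc)
    rw [Nat.cast_mul, Nat.cast_prod, Nat.cast_prod] at hF
    have hNi : ((N i : ℕ) : F) ≠ 0 :=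
      prod_ne_zero_iff.1 (left_ne_zero_of_mul hF) i (mem_univ i)
    obtain ⟨w, hw, hwv⟩ := h i F hNi ((v i)⁻¹ • v) (hv.smul (hfr.map _) (inv_ne_zero hi))
      (by simp [hi])
    have hwk : ((w (κ i w) : ℤ) : F) ≠ 0 := by
      have h1 := prod_ne_zero_iff.1 (right_ne_zero_of_mul hF) i (mem_univ i)
      rw [Nat.cast_prod] at h1
      have h2 := prod_ne_zero_iff.1 h1 w hw
      intro h0
      apply h2
      rcases Int.natAbs_eq (w (κ i w)) with h6 | h6 <;> rw [h6] at h0 <;> simpa using h0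
    have hwi : ((w i : ℤ) : F) ≠ 0 := by
      intro h0
      apply hwk
      rw [← hwv, h0, zero_mul]
    refine ⟨w, Finset.mem_biUnion.2 ⟨i, mem_univ i, hw⟩, v i * (w i : F)⁻¹,
      mul_ne_zero hi (inv_ne_zero hwi), ?_⟩
    funext k
    rw [← hwv k, Pi.smul_apply, smul_eq_mul]
    field_simp

end

section

open MvPolynomial

/-! ### Integral models of the nodes -/

lemma eval_baseChange_intCast (R : Type*) [CommRing R] (a : ℳ ℤ) (w : Fin 3 → ℤ) :
    eval (fun i => (w i : R)) (baseChange R a) = ((eval w a : ℤ) : R) := by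
  have h := map_eval_baseChange (Int.castRingHom R) a w
  have h1 : baseChange ℤ a = a := by
    rw [baseChange, show Int.castRingHom ℤ = RingHom.id ℤ from RingHom.ext_int _ _, map_id]
  rw [h1] at h
  exact h.symm

lemma isHomogeneous_baseChange {f : ℳ ℤ} {r : ℕ} (hf : f.IsHomogeneous r)
    (R : Type*) [CommRing R] : (baseChange R f).IsHomogeneous r := hf.map _

lemma transpose_hessian {F : Type*} [Field F] (f : ℳ F) (v : Fin 3 → F) :
    (hessian f v).transpose = hessian f v := by
  ext i j
  rw [Matrix.transpose_apply, hessian, hessian, pderiv_comm]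

/-- The integral Hessian form. -/
def hessForm (f : ℳ ℤ) (w x y : Fin 3 → ℤ) : ℤ :=
  ∑ i, ∑ j, eval w (pderiv i (pderiv j f)) * x i * y j

lemma hessian_mulVec_self {F : Type*} [Field F] {f : ℳ F} {r : ℕ}
    (hf : f.IsHomogeneous r) {v : Fin 3 → F} (h : IsSingularAt f v) :
    (hessian f v).mulVec v = 0 := by
  funext i
  have h1 := congrArg (eval v) (hf.pderiv (i := i)).sum_X_mul_pderiv
  simp only [map_sum, map_mul, eval_X, map_nsmul, h.2.2, smul_zero] at h1
  rw [Pi.zero_apply, ← h1, mulVec, dotProduct]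
  refine sum_congr rfl fun j _ => ?_
  rw [hessian, pderiv_comm, mul_comm]

lemma exists_tangents {H : Matrix (Fin 3) (Fin 3) ℚ} (hH : H.transpose = H) (hr : H.rank = 2)
    {w a b : Fin 3 → ℚ} (hw : w ≠ 0) (hHw : H.mulVec w = 0)
    (hab : ∀ x, dotProduct x (H.mulVec x) = dotProduct a x * dotProduct b x) :
    ∃ ψ₁ ψ₂ : Fin 3 → ℚ, (Matrix.of ![w, ψ₁, ψ₂]).det ≠ 0 ∧ dotProduct ψ₁ (H.mulVec ψ₁) = 0 ∧
      dotProduct ψ₂ (H.mulVec ψ₂) = 0 ∧ dotProduct ψ₁ (H.mulVec ψ₂) ≠ 0 := by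
  have hsymm : ∀ x y, dotProduct x (H.mulVec y) = dotProduct y (H.mulVec x) := by
    intro x y
    rw [Matrix.dotProduct_mulVec, ← Matrix.mulVec_transpose, hH, dotProduct_comm]
  have hpol : ∀ x y, 2 * dotProduct x (H.mulVec y) =
      dotProduct a x * dotProduct b y + dotProduct b x * dotProduct a y := by
    intro x y
    have h1 := hab (x + y)
    rw [Matrix.mulVec_add, add_dotProduct, dotProduct_add, dotProduct_add, hab, hab, hsymm y x,
      dotProduct_add, dotProduct_add] at h1
    linear_combination h1
  have hex : ∀ a b : Fin 3 → ℚ, (∀ x y, 2 * dotProduct x (H.mulVec y) =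
      dotProduct a x * dotProduct b y + dotProduct b x * dotProduct a y) →
      ∃ ψ, dotProduct b ψ = 0 ∧ dotProduct a ψ ≠ 0 := by
    intro a b hpol
    by_contra! hc
    have := rank_le_one_of_forall (H := H) (a := b) fun x hx => by
      apply dotProduct_eq_zero
      intro y
      have h1 := hpol y x
      rw [hx, hc x hx] at h1
      rw [dotProduct_comm]
      linarith
    omega
  obtain ⟨ψ₁, hb1, ha1⟩ := hex a b hpol
  obtain ⟨ψ₂, ha2, hb2⟩ := hex b a fun x y => by rw [hpol x y]; ring
  have hbw : dotProduct b w = 0 := by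
    have := hpol ψ₁ w
    rw [hHw, dotProduct_zero, hb1] at this
    have h2 : dotProduct a ψ₁ * dotProduct b w = 0 := by linarith
    exact (mul_eq_zero.1 h2).resolve_left ha1
  have haw : dotProduct a w = 0 := by
    have := hpol ψ₂ w
    rw [hHw, dotProduct_zero, ha2] at this
    have h2 : dotProduct b ψ₂ * dotProduct a w = 0 := by linarith
    exact (mul_eq_zero.1 h2).resolve_left hb2
  refine ⟨ψ₁, ψ₂, fun hdet => ?_, by rw [hab, hb1, mul_zero], by rw [hab, ha2, zero_mul], fun h0 => ?_⟩
  · obtain ⟨c, hc0, hc⟩ := Matrix.exists_vecMul_eq_zero_iff.2 hdet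
    have hc' : c 0 • w + c 1 • ψ₁ + c 2 • ψ₂ = 0 := by
      rw [← hc]
      funext i
      simp [Matrix.vecMul, dotProduct, Fin.sum_univ_three]
    have h1 := congrArg (dotProduct a) hc'
    have h2 := congrArg (dotProduct b) hc'
    simp only [dotProduct_add, dotProduct_smul, haw, ha2, hbw, hb1, smul_eq_mul, mul_zero, zero_add,
      add_zero, dotProduct_zero, mul_eq_zero, ha1, hb2, or_false] at h1 h2
    rw [h1, h2, zero_smul, zero_smul, add_zero, add_zero, smul_eq_zero] at hc'
    apply hc0
    funext i
    fin_cases i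
    · exact hc'.resolve_right hw
    · exact h1
    · exact h2
  · have := hpol ψ₁ ψ₂
    rw [h0, hb1] at this
    have h2 : dotProduct a ψ₁ * dotProduct b ψ₂ = 0 := by linarith
    exact (mul_ne_zero ha1 hb2) h2

lemma exists_integral_tangents {f : ℳ ℤ} {r : ℕ} (hfr : f.IsHomogeneous r)
    {w : Fin 3 → ℤ} (hw : IsODP (baseChange ℚ f) (fun i => (w i : ℚ)))
    (hs : HasRationalSlopes (baseChange ℚ f) (fun i => (w i : ℚ))) :
    ∃ ψ₁ ψ₂ : Fin 3 → ℤ, (Matrix.of ![w, ψ₁, ψ₂]).det ≠ 0 ∧ hessForm f w ψ₁ ψ₁ = 0 ∧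
      hessForm f w ψ₂ ψ₂ = 0 ∧ hessForm f w ψ₁ ψ₂ ≠ 0 := by
  obtain ⟨a, b, hab⟩ := hs
  obtain ⟨ψ₁, ψ₂, h0, h1, h2, h3⟩ := exists_tangents (H := hessian (baseChange ℚ f) _)
    (transpose_hessian _ _) hw.2 hw.1.1 (hessian_mulVec_self (isHomogeneous_baseChange hfr ℚ) hw.1)
    hab
  obtain ⟨c₁, φ₁, hc₁, hφ₁⟩ := exists_integral_multiple ψ₁
  obtain ⟨c₂, φ₂, hc₂, hφ₂⟩ := exists_integral_multiple ψ₂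
  have hform : ∀ x y : Fin 3 → ℤ, ((hessForm f w x y : ℤ) : ℚ) =
      dotProduct (fun i => (x i : ℚ)) ((hessian (baseChange ℚ f) fun i => (w i : ℚ)).mulVec
        fun i => (y i : ℚ)) := by
    intro x y
    simp only [hessForm, dotProduct, mulVec, mul_sum, Int.cast_sum, Int.cast_mul]
    refine sum_congr rfl fun i _ => sum_congr rfl fun j _ => ?_
    rw [hessian, pderiv_baseChange, pderiv_baseChange, eval_baseChange_intCast]
    ring
  refine ⟨φ₁, φ₂, fun hd => h0 ?_, ?_, ?_, ?_⟩
  · have hd' := congrArg (Int.cast : ℤ → ℚ) hd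
    have e1 : ∀ i, (φ₁ i : ℚ) = c₁ * ψ₁ i := fun i => congrFun hφ₁ i
    have e2 : ∀ i, (φ₂ i : ℚ) = c₂ * ψ₂ i := fun i => congrFun hφ₂ i
    rw [det_fin_three] at hd' ⊢
    simp [e1, e2] at hd'
    have : c₁ * c₂ ≠ 0 := mul_ne_zero hc₁ hc₂
    apply mul_left_cancel₀ this
    rw [mul_zero, ← hd']
    simp only [Matrix.of_apply, Matrix.cons_val]
    ring
  · have := hform φ₁ φ₁
    rw [hφ₁, mulVec_smul, smul_dotProduct, dotProduct_smul, h1] at this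
    simpa using this
  · have := hform φ₂ φ₂
    rw [hφ₂, mulVec_smul, smul_dotProduct, dotProduct_smul, h2] at this
    simpa using this
  · have := hform φ₁ φ₂
    rw [hφ₁, hφ₂, mulVec_smul, smul_dotProduct, dotProduct_smul] at this
    intro h
    rw [h] at this
    simp [hc₁, hc₂, h3] at this

lemma exists_integral_adapted_basis {n : ℕ} (M : Matrix (Fin n) (Fin n) ℤ) (hM : M.transpose = -M) :
    ∃ (k d : ℕ) (e : Fin k ⊕ Fin d ≃ Fin n) (P : Matrix (Fin k ⊕ Fin d) (Fin k ⊕ Fin d) ℤ)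
      (A : Matrix (Fin k) (Fin k) ℤ), P.det ≠ 0 ∧ A.det ≠ 0 ∧
      P.transpose * M.submatrix e e * P = fromBlocks A 0 0 0 := by
  let κ := Int.castRingHom ℚ
  obtain ⟨k, d, e, P, A, hP, hA, hb, -⟩ := exists_adapted_basis (M.map κ) (by
    rw [← transpose_map, hM]; ext i j; simp)
  obtain ⟨c, P', hc, hP'⟩ := exists_integral_multiple fun x : (Fin k ⊕ Fin d) × (Fin k ⊕ Fin d) =>
    P x.1 x.2
  let Q : Matrix (Fin k ⊕ Fin d) (Fin k ⊕ Fin d) ℤ := fun i j => P' (i, j)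
  have hQ : Q.map κ = c • P := by
    ext i j
    exact congrFun hP' (i, j)
  have hdet : ∀ {ι : Type} [Fintype ι] [DecidableEq ι] (B : Matrix ι ι ℤ) (t : ℚ) (D : Matrix ι ι ℚ),
      t ≠ 0 → D.det ≠ 0 → B.map κ = t • D → B.det ≠ 0 := by
    intro ι _ _ B t D ht hD h h0
    have h1 : (B.map κ).det = 0 := by
      have := RingHom.map_det κ B
      rw [h0, map_zero] at this
      exact this.symm
    rw [h, det_smul] at h1
    exact mul_ne_zero (pow_ne_zero _ ht) hD h1
  set B := Q.transpose * M.submatrix e e * Q with hB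
  have hBκ : B.map κ = c ^ 2 • fromBlocks A 0 0 0 := by
    rw [hB, Matrix.map_mul, Matrix.map_mul, transpose_map, hQ, ← hb, ← submatrix_map]
    simp only [transpose_smul, Matrix.smul_mul, Matrix.mul_smul, smul_smul, pow_two]
  have hent : ∀ i j, (B i j : ℚ) = c ^ 2 * fromBlocks A 0 0 0 i j := fun i j =>
    congrFun (congrFun hBκ i) j
  refine ⟨k, d, e, Q, B.toBlocks₁₁, hdet Q c P hc hP hQ,
    hdet _ (c ^ 2) A (pow_ne_zero 2 hc) hA ?_, ?_⟩
  · ext i j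
    exact hent (Sum.inl i) (Sum.inl j)
  · refine (fromBlocks_toBlocks B).symm.trans ?_
    congr 1
    · ext i j
      have := hent (Sum.inl i) (Sum.inr j)
      rw [Matrix.toBlocks₁₂, Matrix.of_apply]
      simpa using this
    · ext i j
      have := hent (Sum.inr i) (Sum.inl j)
      rw [Matrix.toBlocks₂₁, Matrix.of_apply]
      simpa using this
    · ext i j
      have := hent (Sum.inr i) (Sum.inr j)
      rw [Matrix.toBlocks₂₂, Matrix.of_apply]
      simpa using this

lemma isUnit_intCast_padic {p : ℕ} [Fact p.Prime] {a : ℤ} (h : (a : ZMod p) ≠ 0) :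
    IsUnit (a : ℤ_[p]) := by
  rw [isUnit_iff_toZMod_ne_zero, map_intCast]
  exact h

theorem exists_nodeData {n : ℕ} {m : Fin 3 → Matrix (Fin n) (Fin n) ℤ}
    (hm : ∀ k, (m k).transpose = -m k) {f : ℳ ℤ} {r : ℕ} (hfr : f.IsHomogeneous r)
    {w : Fin 3 → ℤ} (hw : IsODP (baseChange ℚ f) (fun i => (w i : ℚ)))
    (hs : HasRationalSlopes (baseChange ℚ f) (fun i => (w i : ℚ))) :
    ∃ N : ℕ, N ≠ 0 ∧ ∀ (p : ℕ) [Fact p.Prime], (N : ZMod p) ≠ 0 → ∀ c : ZMod p, c ≠ 0 →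
      Nonempty (NodeData m f fun i => c * (w i : ZMod p)) := by
  obtain ⟨ψ₁, ψ₂, hdet, h11, h22, h12⟩ := exists_integral_tangents hfr hw hs
  obtain ⟨k, d, e, P, A, hP, hA, hb⟩ := exists_integral_adapted_basis (commMatrix m w)
    (transpose_commMatrix hm w)
  set z : ℤ := (Matrix.of ![w, ψ₁, ψ₂]).det * hessForm f w ψ₁ ψ₂ * P.det * A.det with hz
  have hz0 : z ≠ 0 := mul_ne_zero (mul_ne_zero (mul_ne_zero hdet h12) hP) hA
  refine ⟨z.natAbs, Int.natAbs_ne_zero.2 hz0, fun p _ hp c hc => ?_⟩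
  have hzp : (z : ZMod p) ≠ 0 := by
    intro h0
    apply hp
    rcases Int.natAbs_eq z with h6 | h6 <;> rw [h6] at h0 <;> simpa using h0
  rw [hz] at hzp
  simp only [Int.cast_mul] at hzp
  obtain ⟨u, hu⟩ : ∃ u : ℤ_[p], toZMod u = c := ⟨(c.val : ℤ_[p]), by simp⟩
  have hunit : IsUnit u := by rw [isUnit_iff_toZMod_ne_zero, hu]; exact hc
  let κ := Int.castRingHom ℤ_[p]
  let w' : Fin 3 → ℤ_[p] := fun i => (w i : ℤ_[p])
  have heval : ∀ (t : ℤ_[p]) (a : ℳ ℤ) (s : ℕ), a.IsHomogeneous s →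
      eval (t • u • w') (baseChange ℤ_[p] a) = (t * u) ^ s * ((eval w a : ℤ) : ℤ_[p]) := by
    intro t a s ha
    rw [smul_smul, eval_smul_of_isHomogeneous (isHomogeneous_baseChange ha _), ← eval_baseChange_intCast]
  have hform : ∀ (t : ℤ_[p]) (x y : Fin 3 → ℤ), ∑ i, ∑ j, eval (t • u • w')
      (pderiv i (pderiv j (baseChange ℤ_[p] f))) * (x i : ℤ_[p]) * (y j : ℤ_[p]) =
      (t * u) ^ (r - 1 - 1) * ((hessForm f w x y : ℤ) : ℤ_[p]) := by
    intro t x y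
    simp only [hessForm, Int.cast_sum, mul_sum, pderiv_baseChange,
      heval t _ _ hfr.pderiv.pderiv, Int.cast_mul]
    exact sum_congr rfl fun i _ => sum_congr rfl fun j _ => by ring
  have hf0 : eval w f = 0 := by
    have := hw.1.2.1
    rw [eval_baseChange_intCast] at this
    exact_mod_cast this
  have hf1 : ∀ i, eval w (pderiv i f) = 0 := by
    intro i
    have := hw.1.2.2 i
    rw [pderiv_baseChange, eval_baseChange_intCast] at this
    exact_mod_cast this
  have hdetmap : ∀ {ι : Type} [Fintype ι] [DecidableEq ι] (B : Matrix ι ι ℤ),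
      (B.det : ZMod p) ≠ 0 → IsUnit (B.map κ).det := by
    intro ι _ _ B hB
    have := RingHom.map_det κ B
    rw [RingHom.mapMatrix_apply] at this
    rw [← this]
    exact isUnit_intCast_padic hB
  refine ⟨{
    w := u • w'
    ψ₁ := fun i => (ψ₁ i : ℤ_[p])
    ψ₂ := fun i => (ψ₂ i : ℤ_[p])
    red := fun i => by simp [w', hu]
    unit_det := ?_
    eval_eq := fun t => by rw [heval t _ _ hfr, hf0]; simp
    pderiv_eq := fun t i => by rw [pderiv_baseChange, heval t _ _ hfr.pderiv, hf1]; simp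
    h11 := fun t => by rw [hform, h11]; simp
    h22 := fun t => by rw [hform, h22]; simp
    h12 := fun t ht => by
      rw [hform]
      exact ((ht.mul hunit).pow _).mul (isUnit_intCast_padic
        (right_ne_zero_of_mul (left_ne_zero_of_mul (left_ne_zero_of_mul hzp))))
    k := k
    d := d
    e := e
    P := P.map κ
    A := u • A.map κ
    unit_P := hdetmap P (right_ne_zero_of_mul (left_ne_zero_of_mul hzp))
    unit_A := by
      rw [det_smul]
      exact (hunit.pow _).mul (hdetmap A (right_ne_zero_of_mul hzp))
    block := ?_ }⟩
  · have h1 := hdetmap (Matrix.of ![w, ψ₁, ψ₂])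
      (left_ne_zero_of_mul (left_ne_zero_of_mul (left_ne_zero_of_mul hzp)))
    have h2 : (Matrix.of ![u • w', fun i => (ψ₁ i : ℤ_[p]), fun i => (ψ₂ i : ℤ_[p])]).det =
        u * ((Matrix.of ![w, ψ₁, ψ₂]).map κ).det := by
      rw [det_fin_three, det_fin_three]
      simp [w', κ]
      ring
    rw [h2]
    exact hunit.mul h1
  · have h1 := congrArg (fun B => B.map κ) hb
    simp only [Matrix.map_mul] at h1
    rw [fromBlocks_map, transpose_map, ← submatrix_map, map_commMatrix] at h1
    rw [commMatrix_smul, submatrix_smul, Pi.smul_apply, Pi.smul_apply, Matrix.mul_smul,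
      Matrix.smul_mul]
    have h2 : (P.map κ).transpose * (commMatrix m w').submatrix e e * P.map κ =
        fromBlocks (A.map κ) 0 0 0 := by
      refine Eq.trans h1 ?_
      simp
    rw [h2, fromBlocks_smul]
    simp

end

section

open Polynomial Polynomial.Bivariate

/-! ### Valuation rings of curves at a regular parameter -/

section Regular

variable {F K : Type*} [Field F] [Field K] [Algebra F K]

/-- Evaluation of a polynomial in two variables at `(u, t)`. -/
def biEval (F : Type*) {K : Type*} [Field F] [Field K] [Algebra F K] (u t : K) :
    F[X][Y] →+* K :=
  eval₂RingHom (aeval u : Polynomial F →ₐ[F] K).toRingHom t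

/-- The constant term of a polynomial in two variables. -/
def cst (F : Type*) [Field F] : F[X][Y] →+* F :=
  constantCoeff.comp constantCoeff

@[simp] lemma biEval_X (u t : K) : biEval F u t X = t := by simp [biEval]

@[simp] lemma biEval_CX (u t : K) : biEval F u t (C X) = u := by simp [biEval]

@[simp] lemma biEval_CC (u t : K) (a : F) :
    biEval F u t (C (C a)) = algebraMap F K a := by simp [biEval]

@[simp] lemma cst_X : cst F X = 0 := by simp [cst]

@[simp] lemma cst_CX : cst F (C X) = 0 := by simp [cst]

@[simp] lemma cst_CC (a : F) : cst F (C (C a)) = a := by simp [cst]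

lemma biPoly_decomp (P : F[X][Y]) :
    P = C (C (cst F P)) +
      C X * C (P.coeff 0).divX + X * P.divX := by
  conv_lhs => rw [← X_mul_divX_add P, ← X_mul_divX_add (P.coeff 0)]
  rw [C_add, C_mul]
  simp only [cst, RingHom.comp_apply, constantCoeff_apply]
  ring

lemma biPoly_induction {p : F[X][Y] → Prop}
    (hC : ∀ a, p (C (C a))) (hX : p (C X))
    (hY : p X) (hadd : ∀ P Q, p P → p Q → p (P + Q))
    (hmul : ∀ P Q, p P → p Q → p (P * Q)) (P : F[X][Y]) : p P := by
  have h1 : ∀ q : Polynomial F, p (C q) := by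
    intro q
    induction q using Polynomial.induction_on with
    | C a => exact hC a
    | add a b ha hb => rw [C_add]; exact hadd _ _ ha hb
    | monomial n a h =>
      rw [pow_succ, ← mul_assoc, C_mul]; exact hmul _ _ h hX
  induction P using Polynomial.induction_on with
  | C a => exact h1 a
  | add a b ha hb => exact hadd _ _ ha hb
  | monomial n a h => rw [pow_succ, ← mul_assoc]; exact hmul _ _ h hY

lemma valuation_lt_one_of_inv_notMem {V : ValuationSubring K} {z : K} (h : z⁻¹ ∉ V) :
    V.valuation z < 1 := by
  by_contra hz
  rw [not_lt] at hz
  apply h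
  rw [← V.valuation_le_one_iff, map_inv₀]
  exact inv_le_one_of_one_le₀ hz

lemma inv_notMem_of_valuation_lt_one {V : ValuationSubring K} {z : K} (hz : z ≠ 0)
    (h : V.valuation z < 1) : z⁻¹ ∉ V := by
  rw [← V.valuation_le_one_iff, map_inv₀, not_le]
  exact (one_lt_inv₀ (zero_lt_iff.2 ((V.valuation.ne_zero_iff).2 hz))).2 h

/-- The valuation rings which contain the constants and have `u` and `t` in their maximal ideal. -/
def IsCentred (F : Type*) {K : Type*} [Field F] [Field K] [Algebra F K] (V : ValuationSubring K)
    (u t : K) : Prop :=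
  (∀ a : F, algebraMap F K a ∈ V) ∧ V.valuation u < 1 ∧ V.valuation t < 1

lemma valuation_algebraMap {V : ValuationSubring K} (hV : ∀ a : F, algebraMap F K a ∈ V) {a : F}
    (ha : a ≠ 0) : V.valuation (algebraMap F K a) = 1 := by
  apply le_antisymm ((V.valuation_le_one_iff _).2 (hV a))
  have h := (V.valuation_le_one_iff _).2 (hV a⁻¹)
  rw [map_inv₀, map_inv₀] at h
  by_contra hc
  rw [not_le] at hc
  have h0 : V.valuation (algebraMap F K a) ≠ 0 :=
    (V.valuation.ne_zero_iff).2 ((_root_.map_ne_zero _).2 ha)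
  exact absurd h (not_le.2 ((one_lt_inv₀ (zero_lt_iff.2 h0)).2 hc))

lemma IsCentred.biEval_mem {V : ValuationSubring K} {u t : K} (h : IsCentred F V u t)
    (P : F[X][Y]) : biEval F u t P ∈ V := by
  induction P using biPoly_induction with
  | hC a => rw [biEval_CC]; exact h.1 a
  | hX => rw [biEval_CX, ← V.valuation_le_one_iff]; exact h.2.1.le
  | hY => rw [biEval_X, ← V.valuation_le_one_iff]; exact h.2.2.le
  | hadd P Q hP hQ => rw [map_add]; exact add_mem hP hQ
  | hmul P Q hP hQ => rw [map_mul]; exact mul_mem hP hQ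

lemma IsCentred.valuation_lt {V : ValuationSubring K} {u t : K} (h : IsCentred F V u t)
    {P : F[X][Y]} (hP : cst F P = 0) : V.valuation (biEval F u t P) < 1 := by
  rw [biPoly_decomp P, hP]
  simp only [map_zero, zero_add, map_add, map_mul, biEval_CX, biEval_X]
  refine V.valuation.map_add_lt ?_ ?_
  · rw [map_mul]
    exact mul_lt_one_of_lt_of_le h.2.1 ((V.valuation_le_one_iff _).2 (h.biEval_mem _))
  · rw [map_mul]
    exact mul_lt_one_of_lt_of_le h.2.2 ((V.valuation_le_one_iff _).2 (h.biEval_mem _))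

lemma IsCentred.valuation_eq_one {V : ValuationSubring K} {u t : K} (h : IsCentred F V u t)
    {P : F[X][Y]} (hP : cst F P ≠ 0) : V.valuation (biEval F u t P) = 1 := by
  have h1 := h.valuation_lt (P := P - C (C (cst F P))) (by simp)
  have h2 : biEval F u t P = algebraMap F K (cst F P) +
      biEval F u t (P - C (C (cst F P))) := by
    rw [map_sub, biEval_CC]; ring
  have h3 := valuation_algebraMap h.1 hP
  rw [h2, V.valuation.map_add_eq_of_lt_left (by rw [h3]; exact h1), h3]

variable {u s : K}

lemma dvd_total_of_relation (h0 : ∀ P, biEval F u s P = 0 → cst F P = 0)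
    {A B : F[X][Y]} (hB : cst F B ≠ 0)
    (hrel : s * biEval F u s B = u * biEval F u s A) (P Q : F[X][Y]) :
    ∃ P' Q', cst F Q' ≠ 0 ∧
      (biEval F u s P * biEval F u s Q' = biEval F u s Q * biEval F u s P' ∨
        biEval F u s Q * biEval F u s Q' = biEval F u s P * biEval F u s P') := by
  let φ := (biEval F u s).rangeRestrict
  have hφ : Function.Surjective φ := (biEval F u s).rangeRestrict_surjective
  have hφv : ∀ P, (φ P : K) = biEval F u s P := fun P => rfl
  let R := (biEval F u s).range
  let 𝔪 : Ideal R := Ideal.map φ (RingHom.ker (cst F))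
  have h𝔪 : 𝔪.IsPrime := by
    have : (RingHom.ker (cst F)).IsPrime := RingHom.ker_isPrime _
    refine Ideal.map_isPrime_of_surjective hφ fun P hP => ?_
    exact h0 P (congrArg Subtype.val ((RingHom.mem_ker).1 hP))
  have hmem : ∀ P, φ P ∈ 𝔪 ↔ cst F P = 0 := by
    intro P
    constructor
    · intro h
      obtain ⟨P', hP', h1⟩ := (Ideal.mem_map_iff_of_surjective φ hφ).1 h
      have h2 := h0 (P - P') (by rw [map_sub, ← hφv, ← hφv, h1, sub_self])
      rw [map_sub, (RingHom.mem_ker).1 hP', sub_zero] at h2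
      exact h2
    · exact fun h => Ideal.mem_map_of_mem _ h
  have : IsNoetherianRing R := isNoetherianRing_range _
  let L := Localization.AtPrime 𝔪
  have : IsNoetherianRing L := IsLocalization.isNoetherianRing 𝔪.primeCompl L inferInstance
  have hinj : Function.Injective (algebraMap R L) :=
    IsLocalization.injective L 𝔪.primeCompl_le_nonZeroDivisors
  have hprinc : (IsLocalRing.maximalIdeal L).IsPrincipal := by
    refine ⟨algebraMap R L (φ (C X)), ?_⟩
    apply le_antisymm
    · rw [← Localization.AtPrime.map_eq_maximalIdeal, Ideal.map_le_iff_le_comap]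
      intro x hx
      obtain ⟨P, rfl⟩ := hφ x
      have hP := (hmem P).1 hx
      have hBu : IsUnit (algebraMap R L (φ B)) :=
        IsLocalization.map_units L (⟨φ B, fun h => hB ((hmem B).1 h)⟩ : 𝔪.primeCompl)
      rw [Ideal.mem_comap, ← Ideal.mul_unit_mem_iff_mem _ hBu, ← map_mul]
      change _ ∈ Ideal.span _
      rw [Ideal.mem_span_singleton]
      have h1 : φ P * φ B = φ (C X) *
          φ (C (P.coeff 0).divX * B + A * P.divX) := by
        apply Subtype.ext
        simp only [Subring.coe_mul, hφv]
        conv_lhs => rw [biPoly_decomp P, hP]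
        simp only [map_zero, zero_add, map_add, map_mul, biEval_CX, biEval_X]
        linear_combination biEval F u s P.divX * hrel
      rw [h1, map_mul]
      exact dvd_mul_right _ _
    · change Ideal.span _ ≤ _
      rw [Ideal.span_singleton_le_iff_mem, ← Localization.AtPrime.map_eq_maximalIdeal]
      exact Ideal.mem_map_of_mem _ ((hmem _).2 (by simp))
  have hval : ValuationRing L :=
    ((tfae_of_isNoetherianRing_of_isLocalRing_of_isDomain L).out 1 4).2 hprinc
  have key : ∀ P Q, algebraMap R L (φ Q) ∣ algebraMap R L (φ P) →
      ∃ P' Q', cst F Q' ≠ 0 ∧ biEval F u s P * biEval F u s Q' =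
        biEval F u s Q * biEval F u s P' := by
    rintro P Q ⟨c, hc⟩
    obtain ⟨a, ⟨b, hb⟩, rfl⟩ := IsLocalization.exists_mk'_eq 𝔪.primeCompl c
    obtain ⟨P', rfl⟩ := hφ a
    obtain ⟨Q', rfl⟩ := hφ b
    refine ⟨P', Q', fun h => hb ((hmem Q').2 h), ?_⟩
    have h1 : algebraMap R L (φ P * φ Q') = algebraMap R L (φ Q * φ P') := by
      rw [map_mul, map_mul, hc, mul_assoc]
      congr 1
      exact IsLocalization.mk'_spec L (φ P') ⟨φ Q', hb⟩
    exact congrArg Subtype.val (hinj h1)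
  rcases ValuationRing.dvd_total (algebraMap R L (φ Q)) (algebraMap R L (φ P)) with h | h
  · obtain ⟨P', Q', h1, h2⟩ := key P Q h
    exact ⟨P', Q', h1, Or.inl h2⟩
  · obtain ⟨P', Q', h1, h2⟩ := key Q P h
    exact ⟨P', Q', h1, Or.inr h2⟩

/-- If `t` is a multiple of `u` in the local ring of a plane curve at the origin, then there is exactly
one valuation ring centred at the origin, and its residue field is the field of constants. -/
theorem exists_unique_valuationSubring (hu : u ≠ 0) (h0 : ∀ P, biEval F u s P = 0 → cst F P = 0)
    {A B : F[X][Y]} (hB : cst F B ≠ 0)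
    (hrel : s * biEval F u s B = u * biEval F u s A)
    (hfrac : ∀ z : K, ∃ P Q, biEval F u s Q ≠ 0 ∧ z * biEval F u s Q = biEval F u s P) :
    ∃ V : ValuationSubring K, (V ≠ ⊤ ∧ (∀ x ∈ V, ∃ a, V.valuation (x - algebraMap F K a) < 1)) ∧
      IsCentred F V u s ∧ ∀ V', IsCentred F V' u s → V' = V := by
  have hne : ∀ Q, cst F Q ≠ 0 → biEval F u s Q ≠ 0 := fun Q hQ h => hQ (h0 Q h)
  let V : ValuationSubring K :=
    { carrier := {z | ∃ P Q, cst F Q ≠ 0 ∧ z * biEval F u s Q = biEval F u s P}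
      mul_mem' := by
        rintro z z' ⟨P, Q, hQ, h⟩ ⟨P', Q', hQ', h'⟩
        refine ⟨P * P', Q * Q', by rw [map_mul]; exact mul_ne_zero hQ hQ', ?_⟩
        rw [map_mul, map_mul, ← h, ← h']; ring
      one_mem' := ⟨1, 1, by simp, by simp⟩
      add_mem' := by
        rintro z z' ⟨P, Q, hQ, h⟩ ⟨P', Q', hQ', h'⟩
        refine ⟨P * Q' + P' * Q, Q * Q', by rw [map_mul]; exact mul_ne_zero hQ hQ', ?_⟩
        rw [map_mul, map_add, map_mul, map_mul, ← h, ← h']; ring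
      zero_mem' := ⟨0, 1, by simp, by simp⟩
      neg_mem' := by
        rintro z ⟨P, Q, hQ, h⟩
        exact ⟨-P, Q, hQ, by rw [map_neg, ← h, neg_mul]⟩
      mem_or_inv_mem' := by
        intro z
        obtain ⟨P, Q, hQ, hz⟩ := hfrac z
        by_cases hP : biEval F u s P = 0
        · left
          exact ⟨0, 1, by simp, by
            rw [hP] at hz
            rw [(mul_eq_zero.1 hz).resolve_right hQ, zero_mul, map_zero]⟩
        obtain ⟨P', Q', hQ', h | h⟩ := dvd_total_of_relation h0 hB hrel P Q
        · left
          refine ⟨P', Q', hQ', mul_left_cancel₀ hQ ?_⟩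
          rw [← h, ← hz]; ring
        · right
          have hz0 : z ≠ 0 := by rintro rfl; rw [zero_mul] at hz; exact hP hz.symm
          refine ⟨P', Q', hQ', mul_left_cancel₀ hP ?_⟩
          rw [← h, ← hz]
          field_simp }
  have hV : ∀ z, z ∈ V ↔ ∃ P Q, cst F Q ≠ 0 ∧ z * biEval F u s Q = biEval F u s P := fun z => Iff.rfl
  have hlt : ∀ z P Q, cst F Q ≠ 0 → cst F P = 0 → z * biEval F u s Q = biEval F u s P →
      V.valuation z < 1 := by
    intro z P Q hQ hP h
    by_cases hz : z = 0
    · rw [hz, map_zero]; exact zero_lt_one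
    apply valuation_lt_one_of_inv_notMem
    rintro ⟨P', Q', hQ', h'⟩
    have h1 := h0 (Q * Q' - P * P') (by
      rw [map_sub, map_mul, map_mul, ← h, ← h']
      field_simp
      ring)
    rw [map_sub, map_mul, map_mul, hP, zero_mul, sub_zero] at h1
    exact mul_ne_zero hQ hQ' h1
  have hcent : IsCentred F V u s := by
    refine ⟨fun a => ⟨C (C a), 1, by simp, by simp⟩,
      hlt u (C X) 1 (by simp) (by simp) (by simp),
      hlt s X 1 (by simp) (by simp) (by simp)⟩
  refine ⟨V, ⟨fun htop => ?_, ?_⟩, hcent, fun V' hV' => ?_⟩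
  · exact inv_notMem_of_valuation_lt_one hu hcent.2.1 (htop ▸ ValuationSubring.mem_top _)
  · rintro x ⟨P, Q, hQ, h⟩
    refine ⟨cst F P / cst F Q, hlt _
      (P - C (C (cst F P / cst F Q)) * Q) Q hQ ?_ ?_⟩
    · rw [map_sub, map_mul, cst_CC, div_mul_cancel₀ _ hQ, sub_self]
    · rw [map_sub, map_mul, biEval_CC, sub_mul, h]
  · have hle : ∀ z ∈ V, z ∈ V' := by
      rintro z ⟨P, Q, hQ, h⟩
      have h1 := hV'.valuation_eq_one hQ
      rw [← V'.valuation_le_one_iff]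
      have h2 := congrArg V'.valuation h
      rw [map_mul, h1, mul_one] at h2
      rw [h2, V'.valuation_le_one_iff]
      exact hV'.biEval_mem P
    apply ValuationSubring.ext
    intro z
    refine ⟨fun hz => ?_, hle z⟩
    by_contra hzV
    have hz' : z⁻¹ ∈ V := (V.mem_or_inv_mem z).resolve_left hzV
    obtain ⟨P, Q, hQ, h⟩ := hz'
    have hz0 : z ≠ 0 := by rintro rfl; exact hzV V.zero_mem
    by_cases hP : cst F P = 0
    · have h1 := hV'.valuation_lt hP
      have h2 := hV'.valuation_eq_one hQ
      rw [← h, map_mul, h2, mul_one] at h1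
      have := inv_notMem_of_valuation_lt_one (inv_ne_zero hz0) h1
      rw [inv_inv] at this
      exact this hz
    · apply hzV
      refine ⟨Q, P, hP, ?_⟩
      rw [← h]
      field_simp

end Regular

end

section

open MvPolynomial
open scoped Polynomial Polynomial.Bivariate

/-! ### Coefficients of low order of polynomials in two variables -/

section LowOrder

variable {F K : Type*} [Field F] [Field K] [Algebra F K]

/-- The coefficient of `X ^ i * Y ^ j`. -/
def cf (i j : ℕ) (P : F[X][Y]) : F := (P.coeff j).coeff i

lemma cst_eq_cf (P : F[X][Y]) : cst F P = cf 0 0 P := rfl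

@[simp] lemma cf_zero (i j : ℕ) : cf i j (0 : F[X][Y]) = 0 := by simp [cf]

@[simp] lemma cf_add (i j : ℕ) (P Q : F[X][Y]) :
    cf i j (P + Q) = cf i j P + cf i j Q := by simp [cf]

lemma cf_sum {ι : Type*} (s : Finset ι) (i j : ℕ) (P : ι → F[X][Y]) :
    cf i j (∑ k ∈ s, P k) = ∑ k ∈ s, cf i j (P k) := by
  simp [cf, Polynomial.finsetSum_coeff]

lemma coeff_mul_two {R : Type*} [CommRing R] (P Q : Polynomial R) :
    (P * Q).coeff 2 = P.coeff 0 * Q.coeff 2 + P.coeff 1 * Q.coeff 1 + P.coeff 2 * Q.coeff 0 := by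
  simp [Polynomial.coeff_mul, Finset.Nat.antidiagonal_succ]
  ring

lemma coeff_mul_one' {R : Type*} [CommRing R] (P Q : Polynomial R) :
    (P * Q).coeff 1 = P.coeff 0 * Q.coeff 1 + P.coeff 1 * Q.coeff 0 := by
  simp [Polynomial.coeff_mul, Finset.Nat.antidiagonal_succ]

lemma cf_mul_00 (P Q : F[X][Y]) : cf 0 0 (P * Q) = cf 0 0 P * cf 0 0 Q := by
  simp [cf, Polynomial.mul_coeff_zero]

lemma cf_mul_10 (P Q : F[X][Y]) :
    cf 1 0 (P * Q) = cf 0 0 P * cf 1 0 Q + cf 1 0 P * cf 0 0 Q := by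
  simp [cf, Polynomial.mul_coeff_zero, coeff_mul_one']

lemma cf_mul_01 (P Q : F[X][Y]) :
    cf 0 1 (P * Q) = cf 0 0 P * cf 0 1 Q + cf 0 1 P * cf 0 0 Q := by
  simp [cf, Polynomial.mul_coeff_zero, coeff_mul_one']

lemma cf_mul_20 (P Q : F[X][Y]) :
    cf 2 0 (P * Q) = cf 0 0 P * cf 2 0 Q + cf 1 0 P * cf 1 0 Q + cf 2 0 P * cf 0 0 Q := by
  simp [cf, Polynomial.mul_coeff_zero, coeff_mul_two]

lemma cf_mul_02 (P Q : F[X][Y]) :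
    cf 0 2 (P * Q) = cf 0 0 P * cf 0 2 Q + cf 0 1 P * cf 0 1 Q + cf 0 2 P * cf 0 0 Q := by
  simp [cf, Polynomial.mul_coeff_zero, coeff_mul_two]

lemma cf_mul_11 (P Q : F[X][Y]) :
    cf 1 1 (P * Q) = cf 0 0 P * cf 1 1 Q + cf 1 0 P * cf 0 1 Q + cf 0 1 P * cf 1 0 Q +
      cf 1 1 P * cf 0 0 Q := by
  simp [cf, coeff_mul_one']
  ring

/-- Constants, as polynomials in two variables. -/
def cc (F : Type*) [Field F] : F →+* F[X][Y] := Polynomial.C.comp Polynomial.C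

lemma cf_cc_mul (i j : ℕ) (a : F) (P : F[X][Y]) :
    cf i j (cc F a * P) = a * cf i j P := by simp [cf, cc]

/-- The linear form `a X + b Y`. -/
def lin (a b : F) : F[X][Y] :=
  Polynomial.C Polynomial.X * cc F a + Polynomial.X * cc F b

/-- The point `v + X ψ₁ + Y ψ₂`. -/
def localPoint (v ψ₁ ψ₂ : Fin 3 → F) (i : Fin 3) : F[X][Y] :=
  cc F (v i) + (lin (ψ₁ i) (ψ₂ i))

/-- The polynomial `g(v + X ψ₁ + Y ψ₂)`. -/
def localEq (v ψ₁ ψ₂ : Fin 3 → F) : ℳ F →+* F[X][Y] :=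
  (eval (localPoint v ψ₁ ψ₂)).comp (map (cc F))

/-- The terms of order at most two vanish. -/
structure IsCubic (P : F[X][Y]) : Prop where
  c00 : cf 0 0 P = 0
  c10 : cf 1 0 P = 0
  c01 : cf 0 1 P = 0
  c20 : cf 2 0 P = 0
  c11 : cf 1 1 P = 0
  c02 : cf 0 2 P = 0

lemma IsCubic.zero : IsCubic (0 : F[X][Y]) := by
  constructor <;> simp

lemma IsCubic.add {P Q : F[X][Y]} (hP : IsCubic P) (hQ : IsCubic Q) :
    IsCubic (P + Q) := by
  constructor <;> simp [hP.c00, hP.c10, hP.c01, hP.c20, hP.c11, hP.c02, hQ.c00, hQ.c10, hQ.c01,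
    hQ.c20, hQ.c11, hQ.c02]

lemma IsCubic.mul_right {P : F[X][Y]} (hP : IsCubic P)
    (Q : F[X][Y]) : IsCubic (P * Q) := by
  constructor <;> simp [cf_mul_00, cf_mul_10, cf_mul_01, cf_mul_20, cf_mul_11, cf_mul_02, hP.c00,
    hP.c10, hP.c01, hP.c20, hP.c11, hP.c02]

lemma isCubic_of_factors {P₁ P₂ P₃ : F[X][Y]} (h₁ : cf 0 0 P₁ = 0)
    (h₂ : cf 0 0 P₂ = 0) (h₃ : cf 0 0 P₃ = 0) : IsCubic (P₁ * P₂ * P₃) := by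
  constructor <;> simp [cf_mul_00, cf_mul_10, cf_mul_01, cf_mul_20, cf_mul_11, cf_mul_02, h₁, h₂, h₃]

lemma isCubic_sum {ι : Type*} (s : Finset ι) {P : ι → F[X][Y]}
    (h : ∀ i ∈ s, IsCubic (P i)) : IsCubic (∑ i ∈ s, P i) := by
  classical
  induction s using Finset.induction_on with
  | empty => simpa using IsCubic.zero
  | insert a s ha ih =>
    rw [sum_insert ha]
    exact (h a (by simp)).add (ih fun i hi => h i (by simp [hi]))

lemma isCubic_taylorRem (G : ℳ (F[X][Y]))
    (c x : Fin 3 → F[X][Y]) (hx : ∀ i, cf 0 0 (x i) = 0) :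
    IsCubic (taylorRem G c x) := by
  induction G using induction_on with
  | C a => simpa [taylorRem] using IsCubic.zero
  | add G H hG hH =>
    convert hG.add hH using 1
    simp only [taylorRem, map_add, add_mul, sum_add_distrib]
    ring
  | mul_X G k hG =>
    rw [taylorRem_mul_X]
    refine IsCubic.add ?_ (hG.mul_right _)
    rw [sum_mul]
    refine isCubic_sum _ fun i _ => ?_
    rw [sum_mul]
    refine isCubic_sum _ fun j _ => ?_
    exact isCubic_of_factors (by rw [cf_mul_00, hx, mul_zero]) (hx j) (hx k)

lemma cf_lin (a b : F) :
    cf 0 0 (lin a b) = 0 ∧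
    cf 1 0 (lin a b) = a ∧
    cf 0 1 (lin a b) = b ∧
    cf 2 0 (lin a b) = 0 ∧
    cf 1 1 (lin a b) = 0 ∧
    cf 0 2 (lin a b) = 0 := by
  simp only [lin, cf_add, cf_mul_00, cf_mul_10, cf_mul_01, cf_mul_20, cf_mul_11, cf_mul_02]
  simp [cf, cc, Polynomial.coeff_X, Polynomial.coeff_C, Polynomial.coeff_one]

/-- The expansion of a polynomial at `v` up to the second order. -/
lemma exists_expansion (v ψ₁ ψ₂ : Fin 3 → F) (g : ℳ F) :
    ∃ E, IsCubic E ∧ cc F 2 * localEq v ψ₁ ψ₂ g =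
      cc F (2 * eval v g) +
      cc F 2 * ∑ i, cc F (eval v (pderiv i g)) *
        (lin (ψ₁ i) (ψ₂ i)) +
      ∑ i, ∑ j, cc F (hessian g v i j) *
        (lin (ψ₁ i) (ψ₂ i)) *
        (lin (ψ₁ j) (ψ₂ j)) + E := by
  let x : Fin 3 → F[X][Y] := fun i =>
    lin (ψ₁ i) (ψ₂ i)
  let c : Fin 3 → F[X][Y] := fun i => cc F (v i)
  have hx : ∀ i, cf 0 0 (x i) = 0 := fun i => (cf_lin _ _).1
  refine ⟨_, isCubic_taylorRem (map (cc F) g) c x hx, ?_⟩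
  have hev : ∀ a : ℳ F, eval c (map (cc F) a) =
      cc F (eval v a) := fun a => (map_eval (cc F) v a).symm
  have h1 : localEq v ψ₁ ψ₂ g = eval (c + x) (map (cc F) g) := rfl
  simp only [taylorRem, pderiv_map, hev]
  rw [← h1, map_mul]
  have h2 : cc F 2 = 2 := map_ofNat (cc F) 2
  simp only [h2, hessian, x]
  ring

lemma cf_cc (a : F) : cf 0 0 (cc F a) = a ∧ cf 1 0 (cc F a) = 0 ∧ cf 0 1 (cc F a) = 0 ∧
    cf 2 0 (cc F a) = 0 ∧ cf 1 1 (cc F a) = 0 ∧ cf 0 2 (cc F a) = 0 := by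
  simp [cf, cc, Polynomial.coeff_C]

lemma cf_localEq (h2 : (2 : F) ≠ 0) (v ψ₁ ψ₂ : Fin 3 → F) (g : ℳ F) :
    cf 0 0 (localEq v ψ₁ ψ₂ g) = eval v g ∧
    cf 1 0 (localEq v ψ₁ ψ₂ g) = ∑ i, eval v (pderiv i g) * ψ₁ i ∧
    cf 0 1 (localEq v ψ₁ ψ₂ g) = ∑ i, eval v (pderiv i g) * ψ₂ i ∧
    2 * cf 2 0 (localEq v ψ₁ ψ₂ g) = ∑ i, ∑ j, hessian g v i j * ψ₁ i * ψ₁ j ∧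
    2 * cf 1 1 (localEq v ψ₁ ψ₂ g) = 2 * ∑ i, ∑ j, hessian g v i j * ψ₁ i * ψ₂ j ∧
    2 * cf 0 2 (localEq v ψ₁ ψ₂ g) = ∑ i, ∑ j, hessian g v i j * ψ₂ i * ψ₂ j := by
  obtain ⟨E, hE, h⟩ := exists_expansion v ψ₁ ψ₂ g
  have hc : ∀ i j, 2 * cf i j (localEq v ψ₁ ψ₂ g) = cf i j (cc F 2 * localEq v ψ₁ ψ₂ g) := fun i j =>
    (cf_cc_mul i j 2 _).symm
  refine ⟨mul_left_cancel₀ h2 ?_, mul_left_cancel₀ h2 ?_, mul_left_cancel₀ h2 ?_, ?_, ?_, ?_⟩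
  · rw [hc, h]
    simp only [cf_add, cf_sum, mul_assoc (cc F (hessian g v _ _)), cf_cc_mul, cf_mul_00, cf_lin,
      cf_cc, hE.c00]
    simp
  · rw [hc, h]
    simp only [cf_add, cf_sum, mul_assoc (cc F (hessian g v _ _)), cf_cc_mul, cf_mul_10, cf_lin,
      cf_cc, hE.c10]
    simp
  · rw [hc, h]
    simp only [cf_add, cf_sum, mul_assoc (cc F (hessian g v _ _)), cf_cc_mul, cf_mul_01, cf_lin,
      cf_cc, hE.c01]
    simp
  · rw [hc, h]
    simp only [cf_add, cf_sum, mul_assoc (cc F (hessian g v _ _)), cf_cc_mul, cf_mul_20, cf_lin,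
      cf_cc, hE.c20]
    simp [mul_assoc]
  · rw [hc, h]
    simp only [cf_add, cf_sum, mul_assoc (cc F (hessian g v _ _)), cf_cc_mul, cf_mul_11, cf_lin,
      cf_cc, hE.c11]
    have hs : ∀ i j, hessian g v i j = hessian g v j i := fun i j =>
      congrFun (congrFun (transpose_hessian g v) j) i
    simp only [Fin.sum_univ_three, hs 1 0, hs 2 0, hs 2 1]
    ring
  · rw [hc, h]
    simp only [cf_add, cf_sum, mul_assoc (cc F (hessian g v _ _)), cf_cc_mul, cf_mul_02, cf_lin,
      cf_cc, hE.c02]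
    simp [mul_assoc]

end LowOrder

end

section

open Polynomial Polynomial.Bivariate

/-! ### Valuation rings centred at smooth points and at nodes -/

section Centre

variable {F K : Type*} [Field F] [Field K] [Algebra F K]

/-- The valuation rings of `K / F` with residue field `F`. -/
def IsRationalPlace (F : Type*) {K : Type*} [Field F] [Field K] [Algebra F K]
    (V : ValuationSubring K) : Prop :=
  V ≠ ⊤ ∧ (∀ a : F, algebraMap F K a ∈ V) ∧ ∀ x ∈ V, ∃ a, V.valuation (x - algebraMap F K a) < 1

/-- `G = 0` is the equation of the affine plane curve with coordinate functions `u`, `t` and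
function field `K`. -/
structure IsAffineModel (G : F[X][Y]) (u t : K) : Prop where
  ne_zero_left : u ≠ 0
  ne_zero_right : t ≠ 0
  eq_zero : biEval F u t G = 0
  dvd : ∀ P, biEval F u t P = 0 → G ∣ P
  frac : ∀ z : K, ∃ P Q, biEval F u t Q ≠ 0 ∧ z * biEval F u t Q = biEval F u t P

variable {G : F[X][Y]} {u t : K}

theorem IsAffineModel.existsUnique_of_smooth (h : IsAffineModel G u t) (h00 : cf 0 0 G = 0)
    (h01 : cf 0 1 G ≠ 0) : ∃! V : ValuationSubring K, IsRationalPlace F V ∧ IsCentred F V u t := by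
  obtain ⟨V, hV, hc, huniq⟩ := exists_unique_valuationSubring (F := F) (u := u) (s := t)
    (A := -C (G.coeff 0).divX) (B := G.divX) h.ne_zero_left
    (fun P hP => by
      obtain ⟨Q, rfl⟩ := h.dvd P hP
      rw [cst_eq_cf, cf_mul_00, h00, zero_mul])
    (by
      rw [cst_eq_cf, cf, coeff_divX]
      exact h01)
    (by
      have h1 := h.eq_zero
      rw [biPoly_decomp G, cst_eq_cf, h00] at h1
      simp only [map_zero, zero_add, map_add, map_mul, biEval_CX, biEval_X] at h1
      rw [map_neg]
      linear_combination h1)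
    h.frac
  exact ⟨V, ⟨⟨hV.1, hc.1, hV.2⟩, hc⟩, fun V' hV' => huniq V' hV'.2⟩

/-- The substitution of `X * Y` for `Y`. -/
def blowUp (F : Type*) [Field F] : F[X][Y] →+* F[X][Y] :=
  eval₂RingHom C (C X * X)

lemma biEval_blowUp (u s : K) (P : F[X][Y]) :
    biEval F u s (blowUp F P) = biEval F u (u * s) P := by
  induction P using biPoly_induction with
  | hC a => simp [blowUp]
  | hX => simp [blowUp]
  | hY => simp [blowUp]
  | hadd P Q hP hQ => simp only [map_add, hP, hQ]
  | hmul P Q hP hQ => simp only [map_mul, hP, hQ]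

lemma blowUp_scaleRoots (P : F[X][Y]) :
    blowUp F (P.scaleRoots X) = C X ^ P.natDegree * P := by
  have h := scaleRoots_eval₂_mul (p := P) (C : Polynomial F →+* _)
    (X : F[X][Y]) (X : Polynomial F)
  rw [eval₂_C_X] at h
  exact h

lemma biEval_mem_of_mem {V : ValuationSubring K} (hV : ∀ a : F, algebraMap F K a ∈ V) {u s : K}
    (hu : u ∈ V) (hs : s ∈ V) (P : F[X][Y]) : biEval F u s P ∈ V := by
  induction P using biPoly_induction with
  | hC a => rw [biEval_CC]; exact hV a
  | hX => rwa [biEval_CX]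
  | hY => rwa [biEval_X]
  | hadd P Q hP hQ => rw [map_add]; exact add_mem hP hQ
  | hmul P Q hP hQ => rw [map_mul]; exact mul_mem hP hQ

lemma X_dvd_of_coeff_zero {a : Polynomial F} (h : a.coeff 0 = 0) : a = X * a.divX := by
  conv_lhs => rw [← X_mul_divX_add a, h, map_zero, add_zero]

/-- At a node with tangents `u = 0` and `t = 0`, there is exactly one place on the branch tangent
to `t = 0`. -/
theorem IsAffineModel.exists_branch (h : IsAffineModel G u t) (h00 : cf 0 0 G = 0)
    (h10 : cf 1 0 G = 0) (h01 : cf 0 1 G = 0) (h20 : cf 2 0 G = 0) (h02 : cf 0 2 G = 0)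
    (h11 : cf 1 1 G ≠ 0) :
    ∃ V : ValuationSubring K, IsRationalPlace F V ∧ IsCentred F V u t ∧ V.valuation (t / u) < 1 ∧
      ∀ V', IsCentred F V' u t → t / u ∈ V' → V' = V := by
  have hu := h.ne_zero_left
  set s := t / u with hs
  have hus : u * s = t := by rw [hs]; field_simp
  set a := (G.coeff 0).divX.divX.divX
  set b := (G.coeff 1).divX
  set d := (G.coeff 2).divX
  set R := G.divX.divX.divX
  have hG : G = C (X ^ 3 * a) + C (X * b) * X +
      C (X * d) * X ^ 2 + X ^ 3 * R := by
    have e0 : G.coeff 0 = X ^ 3 * a := by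
      have d1 := X_dvd_of_coeff_zero (a := G.coeff 0) h00
      have d2 := X_dvd_of_coeff_zero (a := (G.coeff 0).divX)
        (by rw [coeff_divX]; exact h10)
      have d3 := X_dvd_of_coeff_zero (a := (G.coeff 0).divX.divX)
        (by rw [coeff_divX, coeff_divX]; exact h20)
      linear_combination d1 + X * d2 + X ^ 2 * d3
    have e1 : G.coeff 1 = X * b := X_dvd_of_coeff_zero h01
    have e2 : G.coeff 2 = X * d := X_dvd_of_coeff_zero h02
    rw [← e0, ← e1, ← e2]
    have g0 := X_mul_divX_add G
    have g1 := X_mul_divX_add G.divX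
    have g2 := X_mul_divX_add G.divX.divX
    rw [coeff_divX] at g1
    rw [coeff_divX, coeff_divX] at g2
    conv_lhs => rw [← g0, ← g1, ← g2]
    ring
  let A : F[X][Y] := C a + C d * X ^ 2 +
    X ^ 3 * blowUp F R
  let G₁ : F[X][Y] := C b * X + C X * A
  have hblow : blowUp F G = C X ^ 2 * G₁ := by
    conv_lhs => rw [hG]
    have hC : ∀ q : Polynomial F, blowUp F (C q) = C q := fun q => by
      simp [blowUp]
    have hX : blowUp F X = C X * X := by simp [blowUp]
    simp only [map_add, map_mul, map_pow, hC, hX, G₁, A]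
    ring
  have hb0 : b.coeff 0 ≠ 0 := by
    rw [coeff_divX]; exact h11
  have hG₁c : cst F G₁ = 0 := by simp [G₁]
  have hG₁e : biEval F u s G₁ = 0 := by
    have h1 := h.eq_zero
    rw [← hus, ← biEval_blowUp, hblow, map_mul, map_pow, biEval_CX] at h1
    exact (mul_eq_zero.1 h1).resolve_left (pow_ne_zero 2 hu)
  have hrel : s * biEval F u s (C b) = u * biEval F u s (-A) := by
    simp only [G₁, map_add, map_mul, biEval_CX, biEval_X] at hG₁e
    rw [map_neg]
    linear_combination hG₁e
  have hprime : Prime (C X : F[X][Y]) :=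
    prime_C_iff.2 prime_X
  have hnd : ¬ (C X : F[X][Y]) ∣ G₁ := by
    intro hd
    have h1 := map_dvd (mapRingHom (constantCoeff (R := F))) hd
    simp only [G₁, map_add, map_mul, coe_mapRingHom, map_C,
      constantCoeff_apply, coeff_X_zero, map_X, map_zero, zero_mul,
      add_zero, zero_dvd_iff, mul_eq_zero, C_eq_zero, X_ne_zero, or_false]
      at h1
    exact hb0 h1
  have h0 : ∀ P, biEval F u s P = 0 → cst F P = 0 := by
    intro P hP
    have h1 : biEval F u t (P.scaleRoots X) = 0 := by
      rw [← hus, ← biEval_blowUp, blowUp_scaleRoots, map_mul, hP, mul_zero]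
    obtain ⟨H, hH⟩ := h.dvd _ h1
    have h2 := congrArg (blowUp F) hH
    rw [blowUp_scaleRoots, map_mul, hblow] at h2
    have h3 : (C X : F[X][Y]) ^ P.natDegree ∣
        G₁ * (C X ^ 2 * blowUp F H) := ⟨P, by rw [h2]; ring⟩
    obtain ⟨H', hH'⟩ := hprime.pow_dvd_of_dvd_mul_left _ hnd h3
    have h4 : P = G₁ * H' := by
      apply mul_left_cancel₀ (pow_ne_zero P.natDegree hprime.ne_zero)
      rw [h2]
      linear_combination G₁ * hH'
    rw [h4, map_mul, hG₁c, zero_mul]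
  have hbc : cst F (C b) ≠ 0 := by
    rw [cst_eq_cf, cf, coeff_C_zero]; exact hb0
  obtain ⟨V, hV, hc, huniq⟩ := exists_unique_valuationSubring (F := F) (u := u) (s := s) hu h0
    hbc hrel (by
      intro z
      obtain ⟨P, Q, hQ, hz⟩ := h.frac z
      refine ⟨blowUp F P, blowUp F Q, ?_, ?_⟩
      · rwa [biEval_blowUp, hus]
      · rw [biEval_blowUp, biEval_blowUp, hus, hz])
  refine ⟨V, ⟨hV.1, hc.1, hV.2⟩, ⟨hc.1, hc.2.1, ?_⟩, hc.2.2, fun V' hV' hsV' => huniq V' ⟨hV'.1, hV'.2.1, ?_⟩⟩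
  · rw [← hus, map_mul]
    exact mul_lt_one_of_lt_of_le hc.2.1 hc.2.2.le
  · have h1 := congrArg V'.valuation hrel
    have h2 : biEval F u s (C b) = biEval F u t (C b) := by simp [biEval]
    have huV : u ∈ V' := (V'.valuation_le_one_iff _).1 hV'.2.1.le
    rw [map_mul, map_mul, h2, hV'.valuation_eq_one hbc, mul_one] at h1
    rw [h1]
    exact mul_lt_one_of_lt_of_le hV'.2.1
      ((V'.valuation_le_one_iff _).2 (biEval_mem_of_mem hV'.1 huV hsV' _))

end Centre

end

section

open MvPolynomial
open scoped Polynomial Polynomial.Bivariate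

/-! ### The places of a plane curve above a point -/

section Places

variable {F K : Type*} [Field F] [Field K] [Algebra F K]

/-- `ξ` is the generic point of the integral plane curve `g = 0` of degree `k > 1`, and `K` its
function field. -/
structure IsGenericPoint (g : ℳ F) (k : ℕ) (ξ : Fin 3 → K) : Prop where
  hom : g.IsHomogeneous k
  one_lt : 1 < k
  ne_zero : g ≠ 0
  eq_zero : aeval ξ g = 0
  dvd : ∀ (h : ℳ F) (j : ℕ), h.IsHomogeneous j → aeval ξ h = 0 → g ∣ h
  exists_one : ∃ j, ξ j = 1
  adjoin : IntermediateField.adjoin F (Set.range ξ) = ⊤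

/-- The value at `ξ` of a linear form. -/
def formAt (ξ : Fin 3 → K) (c : Fin 3 → F) : K := ∑ i, algebraMap F K (c i) * ξ i

/-- `V` is centred at the point of the plane with homogeneous coordinates `v`. -/
def CentredAt (ξ : Fin 3 → K) (V : ValuationSubring K) (v : Fin 3 → F) : Prop :=
  ∀ c d : Fin 3 → F, dotProduct c v = 0 → dotProduct d v ≠ 0 →
    V.valuation (formAt ξ c / formAt ξ d) < 1

variable {g : ℳ F} {k : ℕ} {ξ : Fin 3 → K}

lemma isHomogeneous_linear (c : Fin 3 → F) :
    (∑ i, C (c i) * X i : ℳ F).IsHomogeneous 1 := by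
  refine IsHomogeneous.sum _ _ _ fun i _ => ?_
  simpa using (isHomogeneous_C (Fin 3) (c i)).mul (isHomogeneous_X F i)

lemma aeval_linear (c : Fin 3 → F) :
    aeval ξ (∑ i, C (c i) * X i) = formAt ξ c := by
  simp [formAt]

lemma linear_eq_zero {c : Fin 3 → F}
    (h : (∑ i, C (c i) * X i : ℳ F) = 0) : c = 0 := by
  funext i
  have := congrArg (eval (Pi.single i 1)) h
  simpa [Pi.single_apply] using this

lemma IsGenericPoint.formAt_ne_zero (hξ : IsGenericPoint g k ξ) {c : Fin 3 → F} (hc : c ≠ 0) :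
    formAt ξ c ≠ 0 := by
  intro h
  have hl := isHomogeneous_linear c
  obtain ⟨q, hq⟩ := hξ.dvd _ 1 hl (by rw [aeval_linear, h])
  have hne : (∑ i, C (c i) * X i : ℳ F) ≠ 0 :=
    fun h0 => hc (linear_eq_zero h0)
  have h1 := hl.totalDegree hne
  rw [hq] at hne h1
  rw [totalDegree_mul_of_isDomain hξ.ne_zero (right_ne_zero_of_mul hne),
    hξ.hom.totalDegree hξ.ne_zero] at h1
  have := hξ.one_lt
  omega

variable {v ψ₁ ψ₂ : Fin 3 → F}

/-- The coordinate forms with respect to the basis `v, ψ₁, ψ₂`. -/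
def dualForm (v ψ₁ ψ₂ : Fin 3 → F) (k : Fin 3) : Fin 3 → F :=
  fun i => (Matrix.of ![v, ψ₁, ψ₂])⁻¹ i k

lemma dot_dualForm (h : IsUnit (Matrix.of ![v, ψ₁, ψ₂]).det) (j k : Fin 3) :
    dotProduct (![v, ψ₁, ψ₂] j) (dualForm v ψ₁ ψ₂ k) = if j = k then 1 else 0 := by
  have := congrFun (congrFun (mul_nonsing_inv _ h) j) k
  rw [Matrix.mul_apply, Matrix.one_apply] at this
  exact this

lemma sum_dualForm (h : IsUnit (Matrix.of ![v, ψ₁, ψ₂]).det) (i j : Fin 3) :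
    ∑ k, dualForm v ψ₁ ψ₂ k i * ![v, ψ₁, ψ₂] k j = if i = j then 1 else 0 := by
  have := congrFun (congrFun (nonsing_inv_mul _ h) i) j
  rw [Matrix.mul_apply, Matrix.one_apply] at this
  exact this

lemma eq_formAt (h : IsUnit (Matrix.of ![v, ψ₁, ψ₂]).det) (j : Fin 3) :
    ξ j = ∑ k, formAt ξ (dualForm v ψ₁ ψ₂ k) * algebraMap F K (![v, ψ₁, ψ₂] k j) := by
  simp only [formAt, sum_mul]
  rw [sum_comm]
  have h1 : ∀ i, ∑ k, algebraMap F K (dualForm v ψ₁ ψ₂ k i) * ξ i *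
      algebraMap F K (![v, ψ₁, ψ₂] k j) = (if i = j then 1 else 0) * ξ i := by
    intro i
    have h2 := congrArg (algebraMap F K) (sum_dualForm h i j)
    rw [map_sum] at h2
    have h3 : (if i = j then (1 : K) else 0) = algebraMap F K (if i = j then 1 else 0) := by
      split_ifs <;> simp
    rw [h3, ← h2, sum_mul]
    refine sum_congr rfl fun k _ => ?_
    rw [map_mul]
    ring
  rw [sum_congr rfl fun i _ => h1 i]
  simp

lemma dualForm_ne_zero (h : IsUnit (Matrix.of ![v, ψ₁, ψ₂]).det) (k : Fin 3) :
    dualForm v ψ₁ ψ₂ k ≠ 0 := by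
  intro h0
  have := dot_dualForm h k k
  rw [h0, dotProduct_zero, if_pos rfl] at this
  exact zero_ne_one this

/-- The affine coordinates of the generic point with respect to the basis `v, ψ₁, ψ₂`. -/
def affineCoord (ξ : Fin 3 → K) (v ψ₁ ψ₂ : Fin 3 → F) (k : Fin 3) : K :=
  formAt ξ (dualForm v ψ₁ ψ₂ k) / formAt ξ (dualForm v ψ₁ ψ₂ 0)

lemma biEval_localPoint (hξ : IsGenericPoint g k ξ) (h : IsUnit (Matrix.of ![v, ψ₁, ψ₂]).det)
    (j : Fin 3) : ξ j = formAt ξ (dualForm v ψ₁ ψ₂ 0) *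
      biEval F (affineCoord ξ v ψ₁ ψ₂ 1) (affineCoord ξ v ψ₁ ψ₂ 2) (localPoint v ψ₁ ψ₂ j) := by
  have h0 := hξ.formAt_ne_zero (dualForm_ne_zero h 0)
  rw [eq_formAt (ξ := ξ) h j, Fin.sum_univ_three, localPoint]
  simp only [cc, RingHom.comp_apply, map_add, map_mul, biEval_CC, biEval_CX, biEval_X, lin,
    affineCoord]
  simp
  field_simp
  ring

lemma aeval_eq_biEval (hξ : IsGenericPoint g k ξ) (h : IsUnit (Matrix.of ![v, ψ₁, ψ₂]).det)
    {a : ℳ F} {j : ℕ} (ha : a.IsHomogeneous j) :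
    aeval ξ a = formAt ξ (dualForm v ψ₁ ψ₂ 0) ^ j *
      biEval F (affineCoord ξ v ψ₁ ψ₂ 1) (affineCoord ξ v ψ₁ ψ₂ 2) (localEq v ψ₁ ψ₂ a) := by
  set β := biEval F (affineCoord ξ v ψ₁ ψ₂ 1) (affineCoord ξ v ψ₁ ψ₂ 2) with hβ
  have h1 : β (localEq v ψ₁ ψ₂ a) = eval (fun i => β (localPoint v ψ₁ ψ₂ i))
      (map (algebraMap F K) a) := by
    rw [localEq, RingHom.comp_apply, map_eval, map_map]
    rw [show β.comp (cc F) = algebraMap F K from RingHom.ext fun c => by simp [hβ, cc]]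
    rfl
  rw [h1, ← eval_smul_of_isHomogeneous (ha.map (algebraMap F K)), eval_map]
  have h2 : ξ = formAt ξ (dualForm v ψ₁ ψ₂ 0) • fun i => β (localPoint v ψ₁ ψ₂ i) :=
    funext fun i => biEval_localPoint hξ h i
  conv_lhs => rw [h2]
  rfl

lemma localEq_linear (h : IsUnit (Matrix.of ![v, ψ₁, ψ₂]).det) (k : Fin 3) :
    localEq v ψ₁ ψ₂ (∑ i, C (dualForm v ψ₁ ψ₂ k i) * X i) =
      ![1, Polynomial.C Polynomial.X, Polynomial.X] k := by
  have h1 : localEq v ψ₁ ψ₂ (∑ i, C (dualForm v ψ₁ ψ₂ k i) * X i) =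
      cc F (dotProduct v (dualForm v ψ₁ ψ₂ k)) +
      Polynomial.C Polynomial.X * cc F (dotProduct ψ₁ (dualForm v ψ₁ ψ₂ k)) +
      Polynomial.X * cc F (dotProduct ψ₂ (dualForm v ψ₁ ψ₂ k)) := by
    simp only [localEq, RingHom.comp_apply, map_mul, map_C, map_X,
      eval_C, eval_X, localPoint, lin, dotProduct, Fin.sum_univ_three,
      map_add]
    ring
  have e0 := dot_dualForm h 0 k
  have e1 := dot_dualForm h 1 k
  have e2 := dot_dualForm h 2 k
  simp only [Matrix.cons_val] at e0 e1 e2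
  rw [h1, e0, e1, e2]
  fin_cases k <;> simp

lemma exists_homogeneous_lift (h : IsUnit (Matrix.of ![v, ψ₁, ψ₂]).det)
    (P : F[X][Y]) :
    ∃ (a : ℳ F) (j : ℕ), a.IsHomogeneous j ∧ localEq v ψ₁ ψ₂ a = P := by
  have hl := fun k => localEq_linear h k
  induction P using biPoly_induction with
  | hC a =>
    refine ⟨C a, 0, isHomogeneous_C _ _, ?_⟩
    simp [localEq, cc]
  | hX => exact ⟨_, 1, isHomogeneous_linear _, hl 1⟩
  | hY => exact ⟨_, 1, isHomogeneous_linear _, hl 2⟩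
  | hadd P Q hP hQ =>
    obtain ⟨a, i, ha, rfl⟩ := hP
    obtain ⟨b, j, hb, rfl⟩ := hQ
    have h0 := isHomogeneous_linear (dualForm v ψ₁ ψ₂ 0)
    set ℓ : ℳ F :=
      ∑ i, C (dualForm v ψ₁ ψ₂ 0 i) * X i
    refine ⟨a * ℓ ^ j + b * ℓ ^ i, i + j, ?_, ?_⟩
    · refine IsHomogeneous.add ?_ ?_
      · simpa using ha.mul (h0.pow j)
      · have := hb.mul (h0.pow i)
        rwa [one_mul, add_comm] at this
    · have h1 : localEq v ψ₁ ψ₂ ℓ = 1 := hl 0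
      simp [h1]
  | hmul P Q hP hQ =>
    obtain ⟨a, i, ha, rfl⟩ := hP
    obtain ⟨b, j, hb, rfl⟩ := hQ
    exact ⟨a * b, i + j, ha.mul hb, map_mul _ _ _⟩

theorem IsGenericPoint.isAffineModel (hξ : IsGenericPoint g k ξ)
    (h : IsUnit (Matrix.of ![v, ψ₁, ψ₂]).det) :
    IsAffineModel (localEq v ψ₁ ψ₂ g) (affineCoord ξ v ψ₁ ψ₂ 1) (affineCoord ξ v ψ₁ ψ₂ 2) := by
  have hL := fun i => hξ.formAt_ne_zero (dualForm_ne_zero h i)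
  refine ⟨div_ne_zero (hL 1) (hL 0), div_ne_zero (hL 2) (hL 0), ?_, fun P hP => ?_, fun z => ?_⟩
  · have h1 := hξ.eq_zero
    rw [aeval_eq_biEval hξ h hξ.hom] at h1
    exact (mul_eq_zero.1 h1).resolve_left (pow_ne_zero _ (hL 0))
  · obtain ⟨a, j, ha, rfl⟩ := exists_homogeneous_lift h P
    exact map_dvd _ (hξ.dvd a j ha (by rw [aeval_eq_biEval hξ h ha, hP, mul_zero]))
  · set β := biEval F (affineCoord ξ v ψ₁ ψ₂ 1) (affineCoord ξ v ψ₁ ψ₂ 2) with hβ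
    have hz : z ∈ IntermediateField.adjoin F (Set.range ξ) := by rw [hξ.adjoin]; trivial
    induction hz using IntermediateField.adjoin_induction with
    | mem x hx =>
      obtain ⟨i, rfl⟩ := hx
      obtain ⟨j, hj⟩ := hξ.exists_one
      have h1 := biEval_localPoint hξ h j
      rw [hj] at h1
      refine ⟨localPoint v ψ₁ ψ₂ i, localPoint v ψ₁ ψ₂ j, right_ne_zero_of_mul (h1 ▸ one_ne_zero), ?_⟩
      rw [biEval_localPoint hξ h i]
      linear_combination -β (localPoint v ψ₁ ψ₂ i) * h1
    | algebraMap x => exact ⟨Polynomial.C (Polynomial.C x), 1, by simp, by simp [hβ]⟩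
    | add x y _ _ hx hy =>
      obtain ⟨P, Q, hQ, hx⟩ := hx
      obtain ⟨P', Q', hQ', hy⟩ := hy
      refine ⟨P * Q' + P' * Q, Q * Q', by rw [map_mul]; exact mul_ne_zero hQ hQ', ?_⟩
      rw [map_mul, map_add, map_mul, map_mul, ← hx, ← hy]; ring
    | inv x _ hx =>
      obtain ⟨P, Q, hQ, hx⟩ := hx
      by_cases hx0 : x = 0
      · exact ⟨0, 1, by simp, by simp [hx0]⟩
      · refine ⟨Q, P, ?_, ?_⟩
        · rw [← hx]; exact mul_ne_zero hx0 hQ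
        · rw [← hx]; field_simp
    | mul x y _ _ hx hy =>
      obtain ⟨P, Q, hQ, hx⟩ := hx
      obtain ⟨P', Q', hQ', hy⟩ := hy
      refine ⟨P * P', Q * Q', by rw [map_mul]; exact mul_ne_zero hQ hQ', ?_⟩
      rw [map_mul, map_mul, ← hx, ← hy]; ring

lemma formAt_eq_sum (h : IsUnit (Matrix.of ![v, ψ₁, ψ₂]).det) (c : Fin 3 → F) :
    formAt ξ c = ∑ k, algebraMap F K (dotProduct c (![v, ψ₁, ψ₂] k)) *
      formAt ξ (dualForm v ψ₁ ψ₂ k) := by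
  conv_lhs => rw [formAt, sum_congr rfl fun j _ => by rw [eq_formAt (ξ := ξ) h j]]
  simp only [mul_sum, dotProduct, map_sum, sum_mul]
  rw [sum_comm]
  refine sum_congr rfl fun k _ => sum_congr rfl fun i _ => ?_
  rw [map_mul]
  ring

/-- For places containing the constants, being centred at `v` is expressed in affine coordinates. -/
theorem IsGenericPoint.centredAt_iff (hξ : IsGenericPoint g k ξ)
    (h : IsUnit (Matrix.of ![v, ψ₁, ψ₂]).det) {V : ValuationSubring K}
    (hV : ∀ a : F, algebraMap F K a ∈ V) :
    CentredAt ξ V v ↔ IsCentred F V (affineCoord ξ v ψ₁ ψ₂ 1) (affineCoord ξ v ψ₁ ψ₂ 2) := by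
  have hL := fun i => hξ.formAt_ne_zero (dualForm_ne_zero h i)
  constructor
  · intro hc
    have e : ∀ k, dotProduct (dualForm v ψ₁ ψ₂ k) v = if 0 = k then 1 else 0 := fun k => by
      rw [dotProduct_comm]; exact dot_dualForm h 0 k
    refine ⟨hV, hc _ _ (by rw [e]; simp) (by rw [e]; simp), hc _ _ (by rw [e]; simp) (by rw [e]; simp)⟩
  · intro hc c d hcv hdv
    have hform : ∀ c : Fin 3 → F, formAt ξ c = formAt ξ (dualForm v ψ₁ ψ₂ 0) *
        biEval F (affineCoord ξ v ψ₁ ψ₂ 1) (affineCoord ξ v ψ₁ ψ₂ 2)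
          (cc F (dotProduct c v) + lin (dotProduct c ψ₁) (dotProduct c ψ₂)) := by
      intro c
      rw [formAt_eq_sum h c, Fin.sum_univ_three]
      simp only [cc, RingHom.comp_apply, map_add, map_mul, biEval_CC, biEval_CX, biEval_X, lin,
        affineCoord]
      have := hL 0
      simp
      field_simp
      ring
    have hcst : ∀ c : Fin 3 → F, cst F (cc F (dotProduct c v) +
        lin (dotProduct c ψ₁) (dotProduct c ψ₂)) = dotProduct c v := by
      intro c
      rw [cst_eq_cf, cf_add, (cf_lin _ _).1, (cf_cc _).1, add_zero]
    rw [hform c, hform d, mul_div_mul_left _ _ (hL 0), map_div₀,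
      hc.valuation_eq_one (P := cc F (dotProduct d v) + lin (dotProduct d ψ₁) (dotProduct d ψ₂))
        (by rw [hcst]; exact hdv), div_one]
    exact hc.valuation_lt (by rw [hcst]; exact hcv)

end Places

end

section

open Polynomial Polynomial.Bivariate

/-! ### Counting the places above a point -/

section Fibres

variable {F K : Type*} [Field F] [Field K] [Algebra F K]

lemma cf_swap (i j : ℕ) (P : F[X][Y]) :
    cf i j (Bivariate.swap P) = cf j i P := by
  induction P using Polynomial.induction_on' with
  | add P Q hP hQ => rw [map_add, cf_add, cf_add, hP, hQ]
  | monomial n a =>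
    simp only [cf, Bivariate.swap_monomial, coeff_mul_C, coeff_map,
      coeff_C_mul, coeff_X_pow, coeff_monomial]
    by_cases h : i = n
    · simp [h]
    · simp [h, Ne.symm h]

lemma biEval_swap (u t : K) (P : F[X][Y]) :
    biEval F u t (Bivariate.swap P) = biEval F t u P := by
  induction P using biPoly_induction with
  | hC a => simp [Bivariate.swap_C_C]
  | hX => rw [Bivariate.swap_X]; simp
  | hY => rw [Bivariate.swap_Y]; simp
  | hadd P Q hP hQ => simp only [map_add, hP, hQ]
  | hmul P Q hP hQ => simp only [map_mul, hP, hQ]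

variable {G : F[X][Y]} {u t : K}

lemma IsAffineModel.swap (h : IsAffineModel G u t) :
    IsAffineModel (Bivariate.swap G) t u := by
  refine ⟨h.ne_zero_right, h.ne_zero_left, by rw [biEval_swap, h.eq_zero], fun P hP => ?_,
    fun z => ?_⟩
  · rw [← biEval_swap] at hP
    have := map_dvd (Bivariate.swap (R := F)) (h.dvd _ hP)
    rwa [Bivariate.swap_swap_apply] at this
  · obtain ⟨P, Q, hQ, hz⟩ := h.frac z
    exact ⟨Bivariate.swap P, Bivariate.swap Q, by rwa [biEval_swap],
      by rwa [biEval_swap, biEval_swap]⟩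

/-- The origin does not lie on `G = 0` and `k = 0`, or it is a smooth point and `k = 1`, or it is
a node with the coordinate axes as tangents and `k = 2`. -/
def LocalType (G : F[X][Y]) (k : ℕ) : Prop :=
  (k = 0 ∧ cf 0 0 G ≠ 0) ∨ (k = 1 ∧ cf 0 0 G = 0 ∧ (cf 1 0 G ≠ 0 ∨ cf 0 1 G ≠ 0)) ∨
    (k = 2 ∧ cf 0 0 G = 0 ∧ cf 1 0 G = 0 ∧ cf 0 1 G = 0 ∧ cf 2 0 G = 0 ∧ cf 0 2 G = 0 ∧
      cf 1 1 G ≠ 0)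

lemma LocalType.of_mul {P Q : F[X][Y]} {k : ℕ} (h : LocalType (P * Q) k) :
    ∃ a b, a + b = k ∧ LocalType P a ∧ LocalType Q b := by
  simp only [LocalType, cf_mul_00, cf_mul_10, cf_mul_01, cf_mul_20, cf_mul_02, cf_mul_11] at h
  have hT : ∀ R : F[X][Y], cf 0 0 R ≠ 0 → LocalType R 0 := fun R h => Or.inl ⟨rfl, h⟩
  by_cases hP : cf 0 0 P = 0 <;> by_cases hQ : cf 0 0 Q = 0
  · simp only [hP, hQ, zero_mul, mul_zero, add_zero, zero_add] at h
    obtain ⟨-, h⟩ | ⟨-, -, h⟩ | ⟨rfl, -, -, -, -, -, h⟩ := h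
    · exact absurd rfl h
    · simp at h
    · refine ⟨1, 1, rfl, Or.inr (Or.inl ⟨rfl, hP, ?_⟩), Or.inr (Or.inl ⟨rfl, hQ, ?_⟩)⟩
      all_goals
        by_contra! hc
        simp [hc.1, hc.2] at h
  · refine ⟨k, 0, rfl, ?_, hT _ hQ⟩
    simp only [LocalType]
    grind
  · refine ⟨0, k, zero_add _, hT _ hP, ?_⟩
    simp only [LocalType]
    grind
  · refine ⟨0, 0, ?_, hT _ hP, hT _ hQ⟩
    grind

lemma LocalType.of_prod {ι : Type*} (s : Finset ι) {P : ι → F[X][Y]} {k : ℕ}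
    (h : LocalType (∏ i ∈ s, P i) k) :
    ∃ a : ι → ℕ, ∑ i ∈ s, a i = k ∧ ∀ i ∈ s, LocalType (P i) (a i) := by
  classical
  induction s using Finset.induction_on generalizing k with
  | empty =>
    refine ⟨fun _ => 0, ?_, by simp⟩
    simp [LocalType, cf, coeff_one] at h
    simpa using h.symm
  | insert i s hi ih =>
    rw [Finset.prod_insert hi] at h
    obtain ⟨a, b, rfl, h1, h2⟩ := h.of_mul
    obtain ⟨c, rfl, hc⟩ := ih h2
    refine ⟨Function.update c i a, ?_, fun j hj => ?_⟩
    · rw [sum_insert hi, Function.update_self,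
        sum_congr rfl fun j hj => Function.update_of_ne (ne_of_mem_of_not_mem hj hi) _ _]
    · obtain rfl | hj := Finset.mem_insert.1 hj
      · rwa [Function.update_self]
      · rw [Function.update_of_ne (ne_of_mem_of_not_mem hj hi)]
        exact hc j hj

theorem IsAffineModel.encard_places (h : IsAffineModel G u t) {k : ℕ} (hk : LocalType G k) :
    {V : ValuationSubring K | IsRationalPlace F V ∧ IsCentred F V u t}.encard = k := by
  have hcomm : ∀ V : ValuationSubring K, IsCentred F V t u ↔ IsCentred F V u t := fun V => by
    simp only [IsCentred, and_comm (a := V.valuation t < 1)]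
  obtain ⟨rfl, h0⟩ | ⟨rfl, h0, h1⟩ | ⟨rfl, h00, h10, h01, h20, h02, h11⟩ := hk
  · rw [Nat.cast_zero, Set.encard_eq_zero]
    refine Set.eq_empty_of_forall_notMem fun V hV => ?_
    have := hV.2.valuation_eq_one (P := G) h0
    rw [h.eq_zero, map_zero] at this
    exact zero_ne_one this
  · have h2 : ∃! V : ValuationSubring K, IsRationalPlace F V ∧ IsCentred F V u t := by
      obtain h1 | h1 := h1
      · simpa only [hcomm] using h.swap.existsUnique_of_smooth (by rwa [cf_swap]) (by rwa [cf_swap])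
      · exact h.existsUnique_of_smooth h0 h1
    obtain ⟨V, hV, huniq⟩ := h2
    rw [Nat.cast_one, Set.encard_eq_one]
    exact ⟨V, Set.ext fun V' => ⟨fun hV' => huniq V' hV', fun hV' => by rw [hV']; exact hV⟩⟩
  · obtain ⟨V, hV, hc, hlt, hu⟩ := h.exists_branch h00 h10 h01 h20 h02 h11
    obtain ⟨V', hV', hc', hlt', hu'⟩ := h.swap.exists_branch (by rwa [cf_swap]) (by rwa [cf_swap])
      (by rwa [cf_swap]) (by rwa [cf_swap]) (by rwa [cf_swap]) (by rwa [cf_swap])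
    rw [show ((2 : ℕ) : ℕ∞) = 2 from rfl, Set.encard_eq_two]
    refine ⟨V, V', ?_, Set.ext fun W => ⟨fun hW => ?_, ?_⟩⟩
    · rintro rfl
      refine inv_notMem_of_valuation_lt_one (div_ne_zero h.ne_zero_right h.ne_zero_left) hlt ?_
      rw [inv_div, ← V.valuation_le_one_iff]
      exact hlt'.le
    · obtain hm | hm := W.mem_or_inv_mem (t / u)
      · exact Or.inl (hu W hW.2 hm)
      · rw [inv_div] at hm
        exact Or.inr (hu' W ((hcomm W).2 hW.2) hm)
    · rintro (rfl | rfl)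
      · exact ⟨hV, hc⟩
      · exact ⟨hV', (hcomm _).1 hc'⟩

variable {g : ℳ F} {k : ℕ} {ξ : Fin 3 → K} {v ψ₁ ψ₂ : Fin 3 → F}

/-- The rational places centred at `v`. -/
def fibre (ξ : Fin 3 → K) (v : Fin 3 → F) : Set (ValuationSubring K) :=
  {V | IsRationalPlace F V ∧ CentredAt ξ V v}

theorem IsGenericPoint.encard_fibre (hξ : IsGenericPoint g k ξ)
    (h : IsUnit (Matrix.of ![v, ψ₁, ψ₂]).det) {a : ℕ} (ha : LocalType (localEq v ψ₁ ψ₂ g) a) :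
    (fibre ξ v).encard = a := by
  rw [← (hξ.isAffineModel h).encard_places ha]
  congr 1
  ext V
  exact and_congr_right fun hV => hξ.centredAt_iff h hV.2.1

lemma IsGenericPoint.exists_centre (hξ : IsGenericPoint g k ξ) {V : ValuationSubring K}
    (hV : IsRationalPlace F V) : ∃ v : Fin 3 → F, v ≠ 0 ∧ CentredAt ξ V v := by
  obtain ⟨j, hj⟩ := Finite.exists_max fun j => V.valuation (ξ j)
  have hj0 : ξ j ≠ 0 := by
    intro h0
    obtain ⟨i, hi⟩ := hξ.exists_one
    have := hj i
    simp [hi, h0] at this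
  have hmem : ∀ i, ξ i / ξ j ∈ V := fun i => by
    rw [← V.valuation_le_one_iff, map_div₀]
    exact div_le_one_of_le₀ (hj i) zero_le
  choose v hv using fun i => hV.2.2 _ (hmem i)
  have key : ∀ c : Fin 3 → F, V.valuation (formAt ξ c / ξ j - algebraMap F K (dotProduct c v)) < 1 := by
    intro c
    have h1 : formAt ξ c / ξ j - algebraMap F K (dotProduct c v) =
        ∑ i, algebraMap F K (c i) * (ξ i / ξ j - algebraMap F K (v i)) := by
      simp only [formAt, dotProduct, map_sum, map_mul, Finset.sum_div, mul_sub, mul_div_assoc,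
        sum_sub_distrib]
    rw [h1]
    refine V.valuation.map_sum_lt one_ne_zero fun i _ => ?_
    rw [map_mul, mul_comm]
    exact mul_lt_one_of_lt_of_le (hv i) ((V.valuation_le_one_iff _).2 (hV.2.1 _))
  refine ⟨v, fun h0 => ?_, fun c d hc hd => ?_⟩
  · have := hv j
    rw [h0, div_self hj0] at this
    simp at this
  · have hc' := key c
    rw [hc, map_zero, sub_zero] at hc'
    have h3 := valuation_algebraMap hV.2.1 hd
    have hd' : V.valuation (formAt ξ d / ξ j) = 1 := by
      rw [← sub_add_cancel (formAt ξ d / ξ j) (algebraMap F K (dotProduct d v)),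
        V.valuation.map_add_eq_of_lt_right (by rw [h3]; exact key d), h3]
    rw [← div_div_div_cancel_right₀ hj0, map_div₀, hd', div_one]
    exact hc'

lemma IsGenericPoint.centre_unique (hξ : IsGenericPoint g k ξ) {V : ValuationSubring K}
    {v w : Fin 3 → F} (hv0 : v ≠ 0) (hv : CentredAt ξ V v) (hw0 : w ≠ 0) (hw : CentredAt ξ V w) :
    ∃ c : Fˣ, w = c • v := by
  obtain ⟨j, hj⟩ := Function.ne_iff.1 hv0
  have key : ∀ c, dotProduct c v = 0 → dotProduct c w = 0 := by
    intro c hc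
    by_contra hcw
    set e : Fin 3 → F := Pi.single j 1 - (w j / dotProduct c w) • c with he
    have hev : dotProduct e v ≠ 0 := by
      rw [he, sub_dotProduct, smul_dotProduct, hc]; simpa using hj
    have hew : dotProduct e w = 0 := by
      rw [he, sub_dotProduct, smul_dotProduct, smul_eq_mul, div_mul_cancel₀ _ hcw]; simp
    have hc0 := hξ.formAt_ne_zero (c := c) (by rintro rfl; simp at hcw)
    have he0 := hξ.formAt_ne_zero (c := e) (by rintro h; rw [h] at hev; simp at hev)
    have h1 := mul_lt_one_of_lt_of_le (hv c e hc hev) (hw e c hew hcw).le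
    rw [← map_mul, div_mul_div_cancel₀ he0, div_self hc0, map_one] at h1
    exact lt_irrefl _ h1
  have h1 : w = (w j / v j) • v := by
    funext i
    have := key (v j • Pi.single i 1 - v i • Pi.single j 1) (by
      rw [sub_dotProduct, smul_dotProduct, smul_dotProduct]; simp; ring)
    rw [sub_dotProduct, smul_dotProduct, smul_dotProduct] at this
    simp only [single_dotProduct, one_mul, smul_eq_mul] at this
    have hj' : v j ≠ 0 := hj
    simp only [Pi.smul_apply, smul_eq_mul]
    field_simp
    linear_combination this
  exact ⟨Units.mk0 (w j / v j) (by intro h; rw [h, zero_smul] at h1; exact hw0 h1), h1⟩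

lemma CentredAt.smul {V : ValuationSubring K} (h : CentredAt ξ V v) (c : Fˣ) :
    CentredAt ξ V (c • v) := by
  intro a b ha hb
  rw [dotProduct_smul, Units.smul_def, smul_eq_mul] at ha hb
  exact h a b ((mul_eq_zero.1 ha).resolve_left c.ne_zero) (right_ne_zero_of_mul hb)

theorem IsGenericPoint.card_places [Fintype F] [DecidableEq F] (hξ : IsGenericPoint g k ξ)
    (hfin : ∀ v : {v : Fin 3 → F // v ≠ 0}, (fibre ξ v.1).Finite) :
    Nat.card {V : ValuationSubring K // IsRationalPlace F V} * (Fintype.card F - 1) =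
      ∑ v : {v : Fin 3 → F // v ≠ 0}, (fibre ξ v.1).ncard := by
  have := fun v : {v : Fin 3 → F // v ≠ 0} => (hfin v).to_subtype
  choose w hw0 hw using fun V : {V : ValuationSubring K // IsRationalPlace F V} =>
    hξ.exists_centre V.2
  have e : {V : ValuationSubring K // IsRationalPlace F V} × Fˣ ≃
      Σ v : {v : Fin 3 → F // v ≠ 0}, fibre ξ v.1 := by
    refine Equiv.ofBijective (fun x => ⟨⟨x.2 • w x.1, ?_⟩, x.1.1, x.1.2, (hw x.1).smul x.2⟩)
      ⟨?_, ?_⟩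
    · rw [Ne, smul_eq_zero_iff_eq]
      exact hw0 x.1
    · rintro ⟨V, c⟩ ⟨V', c'⟩ h
      have h1 : V = V' := Subtype.ext (congrArg (fun s : Σ v : {v : Fin 3 → F // v ≠ 0},
        fibre ξ v.1 => s.2.1) h)
      subst h1
      have h2 : c • w V = c' • w V := congrArg (fun s : Σ v : {v : Fin 3 → F // v ≠ 0},
        fibre ξ v.1 => s.1.1) h
      obtain ⟨j, hj⟩ := Function.ne_iff.1 (hw0 V)
      have h3 := congrFun h2 j
      simp only [Pi.smul_apply, Units.smul_def, smul_eq_mul] at h3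
      rw [Units.ext (mul_right_cancel₀ hj h3)]
    · rintro ⟨⟨v, hv⟩, V, hV, hc⟩
      obtain ⟨c, hcv⟩ := hξ.centre_unique (hw0 ⟨V, hV⟩) (hw ⟨V, hV⟩) hv hc
      refine ⟨⟨⟨V, hV⟩, c⟩, ?_⟩
      subst hcv
      rfl
  rw [← Fintype.card_units, ← Nat.card_eq_fintype_card (α := Fˣ), ← Nat.card_prod, Nat.card_congr e,
    Nat.card_sigma]
  rfl

end Fibres

end

section

open MvPolynomial

/-! ### The points of the non-singular model -/

section Model

variable {F : Type*} [Field F] {g : ℳ F} {k : ℕ}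

/-- The homogeneous coordinate functions. -/
def coordAt (g : ℳ F) [(Ideal.span {g}).IsPrime] (i : Fin 3) :
    FractionRing (CoordRing g) :=
  algebraMap (CoordRing g) _ (Ideal.Quotient.mk (Ideal.span {g}) (X i))

lemma aeval_coordAt_eq_zero [(Ideal.span {g}).IsPrime] (h : ℳ F) :
    aeval (coordAt g) h = 0 ↔ g ∣ h := by
  have h1 : aeval (coordAt g) h =
      algebraMap (CoordRing g) (FractionRing (CoordRing g)) (Ideal.Quotient.mk (Ideal.span {g}) h) := by
    have : aeval (coordAt g) = (IsScalarTower.toAlgHom F (CoordRing g)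
        (FractionRing (CoordRing g))).comp (Ideal.Quotient.mkₐ F (Ideal.span {g})) :=
      algHom_ext fun i => by rw [aeval_X]; rfl
    rw [this]
    rfl
  rw [h1, map_eq_zero_iff _ (IsFractionRing.injective (CoordRing g) (FractionRing (CoordRing g))),
    Ideal.Quotient.eq_zero_iff_mem, Ideal.mem_span_singleton]

/-- The generic point of the curve `g = 0`. -/
def genericPoint (g : ℳ F) [(Ideal.span {g}).IsPrime] (i : Fin 3) :
    FunctionField g :=
  ⟨coordAt g i / coordAt g 0, IntermediateField.subset_adjoin F _ ⟨i, 0, rfl⟩⟩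

theorem isGenericPoint_genericPoint [(Ideal.span {g}).IsPrime] (hg : g.IsHomogeneous k) (hk : 1 < k)
    (h0 : g ≠ 0) : IsGenericPoint g k (genericPoint g) := by
  have hx : ∀ i, coordAt g i ≠ 0 := by
    intro i h
    have h1 : aeval (coordAt g) (X i : ℳ F) = 0 := by
      rw [aeval_X, h]
    obtain ⟨q, hq⟩ := (aeval_coordAt_eq_zero _).1 h1
    have h2 := totalDegree_X (R := F) i
    have hne := X_ne_zero (R := F) i
    rw [hq] at h2 hne
    rw [totalDegree_mul_of_isDomain h0 (right_ne_zero_of_mul hne),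
      hg.totalDegree h0] at h2
    omega
  have key : ∀ (h : ℳ F) (j : ℕ), h.IsHomogeneous j →
      (aeval (genericPoint g) h = 0 ↔ g ∣ h) := by
    intro h j hj
    have h1 : ((aeval (genericPoint g) h : FunctionField g) :
        FractionRing (CoordRing g)) =
        (coordAt g 0)⁻¹ ^ j * aeval (coordAt g) h := by
      have h2 := eval_smul_of_isHomogeneous (hj.map (algebraMap F (FractionRing (CoordRing g))))
        (coordAt g 0)⁻¹ (coordAt g)
      rw [eval_map, eval_map] at h2
      rw [← IntermediateField.coe_val, comp_aeval_apply, aeval_def,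
        aeval_def, ← h2]
      congr 1
      funext i
      simp [genericPoint, div_eq_inv_mul]
    rw [← aeval_coordAt_eq_zero, ← ZeroMemClass.coe_eq_zero, h1, mul_eq_zero,
      or_iff_right (pow_ne_zero _ (inv_ne_zero (hx 0)))]
  refine ⟨hg, hk, h0, (key g k hg).2 dvd_rfl, fun h j hj => (key h j hj).1,
    ⟨0, Subtype.ext (div_self (hx 0))⟩, ?_⟩
  apply IntermediateField.lift_injective
  rw [IntermediateField.lift_top, IntermediateField.lift_adjoin]
  refine le_antisymm (IntermediateField.adjoin_le_iff.2 ?_) (IntermediateField.adjoin_le_iff.2 ?_)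
  · rintro _ ⟨z, -, rfl⟩
    exact z.2
  · rintro _ ⟨i, j, rfl⟩
    have h1 : ∀ i, coordAt g i / coordAt g 0 ∈ IntermediateField.adjoin F
        (Subtype.val '' Set.range (genericPoint g)) := fun i =>
      IntermediateField.subset_adjoin F _ ⟨genericPoint g i, ⟨i, rfl⟩, rfl⟩
    have := div_mem (h1 i) (h1 j)
    rwa [div_div_div_cancel_right₀ (hx 0)] at this

variable [Fintype F] [DecidableEq F]

theorem modelPointCount_mul (hg : g.IsHomogeneous k) (hk : 1 < k) (hirr : Irreducible g)
    {b : {v : Fin 3 → F // v ≠ 0} → ℕ}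
    (hb : ∀ v, ∃ ψ₁ ψ₂, IsUnit (Matrix.of ![v.1, ψ₁, ψ₂]).det ∧
      LocalType (localEq v.1 ψ₁ ψ₂ g) (b v)) :
    modelPointCount g * (Fintype.card F - 1) = ∑ v, b v := by
  have hprime : (Ideal.span {g}).IsPrime :=
    (Ideal.span_singleton_prime hirr.ne_zero).2 hirr.prime
  have hξ := isGenericPoint_genericPoint hg hk hirr.ne_zero
  have h1 : ∀ v : {v : Fin 3 → F // v ≠ 0}, (fibre (genericPoint g) v.1).encard = b v := fun v => by
    obtain ⟨ψ₁, ψ₂, h, hl⟩ := hb v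
    exact hξ.encard_fibre h hl
  have h2 := hξ.card_places fun v => Set.finite_of_encard_eq_coe (h1 v)
  rw [modelPointCount, dif_pos hprime]
  refine h2.trans (sum_congr rfl fun v _ => ?_)
  rw [Set.ncard_def, h1]
  rfl

theorem sum_modelPointCount_mul {l : ℕ} {g : Fin l → ℳ F} {d : Fin l → ℕ}
    (hg : ∀ i, (g i).IsHomogeneous (d i)) (hd : ∀ i, 1 < d i) (hirr : ∀ i, Irreducible (g i))
    {f : ℳ F} {c : F} (hc : c ≠ 0) (hf : ∏ i, g i = C c * f)
    {b : {v : Fin 3 → F // v ≠ 0} → ℕ}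
    (hb : ∀ v, ∃ ψ₁ ψ₂, IsUnit (Matrix.of ![v.1, ψ₁, ψ₂]).det ∧
      LocalType (localEq v.1 ψ₁ ψ₂ f) (b v)) :
    (∑ i, modelPointCount (g i)) * (Fintype.card F - 1) = ∑ v, b v := by
  choose ψ₁ ψ₂ h hl using hb
  have h1 : ∀ v, LocalType (∏ i, localEq v.1 (ψ₁ v) (ψ₂ v) (g i)) (b v) := by
    intro v
    rw [← map_prod, hf, map_mul, show localEq v.1 (ψ₁ v) (ψ₂ v) (C c) = cc F c by
      simp [localEq]]
    simpa only [LocalType, cf_cc_mul, mul_eq_zero, hc, false_or, Ne] using hl v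
  choose a ha hla using fun v => (h1 v).of_prod
  rw [sum_mul, sum_congr rfl fun i _ => modelPointCount_mul (hg i) (hd i) (hirr i)
    (b := fun v => a v i) fun v => ⟨ψ₁ v, ψ₂ v, h v, hla v i (mem_univ i)⟩, sum_comm]
  exact sum_congr rfl fun v _ => ha v

end Model

end

section

/-! ### The types of the points of the Pfaffian curve -/

section Types

open MvPolynomial

lemma card_projectivization {F : Type*} [Field F] [Fintype F] [DecidableEq F]
    {Q : (Fin 3 → F) → Prop} (hQ : ∀ v (c : Fˣ), Q v → Q (c • v)) :
    Nat.card {α : ℙ F (Fin 3 → F) // Q α.rep} * (Fintype.card F - 1) =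
      Nat.card {v : {v : Fin 3 → F // v ≠ 0} // Q v.1} := by
  rw [← Fintype.card_units, ← Nat.card_eq_fintype_card (α := Fˣ), ← Nat.card_prod]
  refine Nat.card_congr (Equiv.ofBijective (fun x => ⟨⟨x.2 • x.1.1.rep, ?_⟩, hQ _ _ x.1.2⟩) ⟨?_, ?_⟩)
  · rw [Ne, smul_eq_zero_iff_eq]
    exact x.1.1.rep_nonzero
  · rintro ⟨⟨α, hα⟩, c⟩ ⟨⟨β, hβ⟩, d⟩ h
    have h1 : c • α.rep = d • β.rep := congrArg (fun s => s.1.1) h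
    have h2 : α = β := by
      rw [← α.mk_rep, ← β.mk_rep, Projectivization.mk_eq_mk_iff]
      exact ⟨c⁻¹ * d, by rw [mul_smul, ← h1, inv_smul_smul]⟩
    subst h2
    obtain ⟨j, hj⟩ := Function.ne_iff.1 α.rep_nonzero
    have h3 := congrFun h1 j
    simp only [Pi.smul_apply, Units.smul_def, smul_eq_mul] at h3
    rw [Units.ext (mul_right_cancel₀ hj h3)]
  · rintro ⟨⟨v, hv⟩, hQv⟩
    obtain ⟨a, ha⟩ := Projectivization.exists_smul_eq_mk_rep F v hv
    refine ⟨⟨⟨Projectivization.mk F v hv, ha ▸ hQ v a hQv⟩, a⁻¹⟩, ?_⟩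
    simp only [← ha, inv_smul_smul]

lemma exists_basis {F : Type*} [Field F] {v : Fin 3 → F} (hv : v ≠ 0) :
    ∃ ψ₁ ψ₂ : Fin 3 → F, IsUnit (Matrix.of ![v, ψ₁, ψ₂]).det := by
  obtain ⟨j, hj⟩ := Function.ne_iff.1 hv
  simp only [isUnit_iff_ne_zero]
  fin_cases j
  · exact ⟨![0, 1, 0], ![0, 0, 1], by simpa [det_fin_three] using hj⟩
  · exact ⟨![1, 0, 0], ![0, 0, 1], by simpa [det_fin_three] using hj⟩
  · exact ⟨![1, 0, 0], ![0, 1, 0], by simpa [det_fin_three] using hj⟩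

lemma exists_localType_of_not_singular {F : Type*} [Field F] [DecidableEq F] (h2 : (2 : F) ≠ 0)
    {f : ℳ F} {r : ℕ} (hf : f.IsHomogeneous r) {v : Fin 3 → F} (hv : v ≠ 0)
    (hs : ¬ IsSingularAt f v) : ∃ ψ₁ ψ₂, IsUnit (Matrix.of ![v, ψ₁, ψ₂]).det ∧
      LocalType (localEq v ψ₁ ψ₂ f) (if eval v f = 0 then 1 else 0) := by
  obtain ⟨ψ₁, ψ₂, h⟩ := exists_basis hv
  refine ⟨ψ₁, ψ₂, h, ?_⟩
  obtain ⟨e0, e1, e2, -⟩ := cf_localEq h2 v ψ₁ ψ₂ f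
  split_ifs with h0
  · refine Or.inr (Or.inl ⟨rfl, e0.trans h0, ?_⟩)
    by_contra! hc
    have h3 : (Matrix.of ![v, ψ₁, ψ₂]).mulVec (fun i => eval v (pderiv i f)) = 0 := by
      have h1 := congrArg (eval v) hf.sum_X_mul_pderiv
      simp only [map_sum, map_mul, eval_X, map_nsmul, h0, smul_zero] at h1
      funext i
      fin_cases i
      · simpa [mulVec, dotProduct] using h1
      · rw [e1] at hc
        simpa [mulVec, dotProduct, mul_comm] using hc.1
      · rw [e2] at hc
        simpa [mulVec, dotProduct, mul_comm] using hc.2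
    exact hs ⟨hv, h0, congrFun (Matrix.eq_zero_of_mulVec_eq_zero h.ne_zero h3)⟩
  · exact Or.inl ⟨rfl, by rwa [e0]⟩

variable {p : ℕ} [hfp : Fact p.Prime] {n : ℕ} {m : Fin 3 → Matrix (Fin n) (Fin n) ℤ}
  {f : ℳ ℤ} {v : Fin 3 → ZMod p}

lemma NodeData.unit_det_zmod (D : NodeData m f v) :
    IsUnit (Matrix.of ![v, fun i => toZMod (D.ψ₁ i), fun i => toZMod (D.ψ₂ i)]).det := by
  have := D.unit_det.map (toZMod (p := p))
  rw [RingHom.map_det] at this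
  convert this using 2
  ext i j
  fin_cases i <;> simp [D.red]

lemma NodeData.ne_zero (D : NodeData m f v) : v ≠ 0 := by
  intro h
  refine D.unit_det_zmod.ne_zero (Matrix.det_eq_zero_of_row_eq_zero 0 fun j => ?_)
  simp [h]

lemma NodeData.hessian_eq (D : NodeData m f v) (i j : Fin 3) :
    hessian (baseChange (ZMod p) f) v i j =
      toZMod (eval ((1 : ℤ_[p]) • D.w) (pderiv i (pderiv j (baseChange ℤ_[p] f)))) := by
  rw [hessian, one_smul]
  simp only [pderiv_baseChange, map_eval_baseChange]
  rw [funext D.red]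

lemma NodeData.isSingularAt (D : NodeData m f v) : IsSingularAt (baseChange (ZMod p) f) v := by
  refine ⟨D.ne_zero, D.eval_zmod, fun i => ?_⟩
  have := congrArg toZMod (D.pderiv_eq 1 i)
  rwa [one_smul, pderiv_baseChange, map_eval_baseChange, funext D.red, map_zero,
    ← pderiv_baseChange] at this

lemma NodeData.hessian_form (D : NodeData m f v) (a b : Fin 3 → ℤ_[p]) :
    ∑ i, ∑ j, hessian (baseChange (ZMod p) f) v i j * toZMod (a i) * toZMod (b j) =
      toZMod (∑ i, ∑ j,
        eval ((1 : ℤ_[p]) • D.w) (pderiv i (pderiv j (baseChange ℤ_[p] f))) * a i * b j) := by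
  simp only [map_sum, map_mul, D.hessian_eq]

lemma NodeData.h12_zmod (D : NodeData m f v) :
    ∑ i, ∑ j, hessian (baseChange (ZMod p) f) v i j * toZMod (D.ψ₁ i) *
      toZMod (D.ψ₂ j) ≠ 0 := by
  rw [D.hessian_form]
  exact ((D.h12 1 isUnit_one).map toZMod).ne_zero

lemma NodeData.localType (D : NodeData m f v) (hp2 : p ≠ 2) :
    ∃ ψ₁ ψ₂, IsUnit (Matrix.of ![v, ψ₁, ψ₂]).det ∧
      LocalType (localEq v ψ₁ ψ₂ (baseChange (ZMod p) f)) 2 := by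
  have h2 := two_ne_zero_zmod hp2
  refine ⟨_, _, D.unit_det_zmod, Or.inr (Or.inr ?_)⟩
  obtain ⟨e0, e1, e2, e3, e4, e5⟩ := cf_localEq h2 v (fun i => toZMod (D.ψ₁ i))
    (fun i => toZMod (D.ψ₂ i)) (baseChange (ZMod p) f)
  rw [D.hessian_form, D.h11, map_zero] at e3
  rw [D.hessian_form, D.h22, map_zero] at e5
  refine ⟨rfl, e0.trans D.eval_zmod, ?_, ?_, (mul_eq_zero.1 e3).resolve_left h2,
    (mul_eq_zero.1 e5).resolve_left h2, ?_⟩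
  · rw [e1]; simp [D.isSingularAt.2.2]
  · rw [e2]; simp [D.isSingularAt.2.2]
  · rw [mul_left_cancel₀ h2 e4]
    exact D.h12_zmod

lemma NodeData.isODP (D : NodeData m f v) {r : ℕ} (hfr : f.IsHomogeneous r) :
    IsODP (baseChange (ZMod p) f) v := by
  refine ⟨D.isSingularAt, ?_⟩
  set H := hessian (baseChange (ZMod p) f) v with hH
  have hker := hessian_mulVec_self (isHomogeneous_baseChange hfr (ZMod p)) D.isSingularAt
  have hle : H.rank ≤ 2 := by
    have h1 := H.mulVecLin.finrank_range_add_finrank_ker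
    rw [Module.finrank_fin_fun] at h1
    have h2 : 1 ≤ Module.finrank (ZMod p) H.mulVecLin.ker :=
      Submodule.one_le_finrank_iff.2 ((Submodule.ne_bot_iff _).2 ⟨v, hker, D.ne_zero⟩)
    rw [Matrix.rank]
    omega
  have hge : 2 ≤ H.rank := by
    set x : Fin 3 → ZMod p := fun i => toZMod (D.ψ₁ i) with hx
    set y : Fin 3 → ZMod p := fun i => toZMod (D.ψ₂ i) with hy
    have hB : ∀ a b : Fin 3 → ZMod p, dotProduct a (H.mulVec b) = ∑ i, ∑ j, H i j * a i * b j := by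
      intro a b
      simp only [dotProduct, mulVec, mul_sum]
      exact sum_congr rfl fun i _ => sum_congr rfl fun j _ => by ring
    have hxx : dotProduct x (H.mulVec x) = 0 := by
      rw [hB, hH, D.hessian_form, D.h11, map_zero]
    have hyy : dotProduct y (H.mulVec y) = 0 := by
      rw [hB, hH, D.hessian_form, D.h22, map_zero]
    have hxy : dotProduct x (H.mulVec y) ≠ 0 := by rw [hB]; exact D.h12_zmod
    have hyx : dotProduct y (H.mulVec x) ≠ 0 := by
      rwa [Matrix.dotProduct_mulVec, ← Matrix.mulVec_transpose, hH, transpose_hessian,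
        dotProduct_comm]
    have hli : LinearIndependent (ZMod p) ![(⟨H.mulVec x, x, rfl⟩ : H.mulVecLin.range),
        ⟨H.mulVec y, y, rfl⟩] := by
      rw [LinearIndependent.pair_iff]
      intro s t hst
      have h0 : s • H.mulVec x + t • H.mulVec y = 0 := congrArg Subtype.val hst
      have h1 := congrArg (dotProduct x) h0
      have h2 := congrArg (dotProduct y) h0
      simp only [dotProduct_add, dotProduct_smul, hxx, hyy, dotProduct_zero, smul_eq_mul, mul_zero,
        zero_add, add_zero, mul_eq_zero, hxy, hyx, or_false] at h1 h2
      exact ⟨h2, h1⟩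
    simpa [Matrix.rank] using hli.fintype_card_le_finrank
  omega

open Classical in
/-- The type of a point: off the curve, smooth, or a double point of rank deficit two or four. -/
def pointType (m : Fin 3 → Matrix (Fin n) (Fin n) ℤ) (f : ℳ ℤ)
    (v : Fin 3 → ZMod p) : Fin 4 :=
  if IsSingularAt (baseChange (ZMod p) f) v then (if (commMatrix m v).rank + 2 = n then 2 else 3)
  else if eval v (baseChange (ZMod p) f) = 0 then 1 else 0

/-- The number of points of a given type. -/
def typeCount (m : Fin 3 → Matrix (Fin n) (Fin n) ℤ) (f : ℳ ℤ) (p : ℕ)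
    [Fact p.Prime] (t : Fin 4) : ℕ :=
  (Finset.univ.filter fun v : {v : Fin 3 → ZMod p // v ≠ 0} => pointType m f v.1 = t).card

lemma sum_pointType {M : Type*} [AddCommMonoid M] (c : Fin 4 → M) :
    ∑ v : {v : Fin 3 → ZMod p // v ≠ 0}, c (pointType m f v.1) = ∑ t, typeCount m f p t • c t := by
  rw [← Finset.sum_fiberwise Finset.univ fun v : {v : Fin 3 → ZMod p // v ≠ 0} => pointType m f v.1]
  refine sum_congr rfl fun t _ => ?_
  rw [sum_congr rfl fun v hv => by rw [(Finset.mem_filter.1 hv).2], sum_const]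
  rfl

lemma sum_typeCount : ∑ t, typeCount m f p t = p ^ 3 - 1 := by
  have h := sum_pointType (p := p) (m := m) (f := f) (M := ℕ) fun _ => 1
  simp only [sum_const, smul_eq_mul, mul_one, Finset.card_univ] at h
  rw [← h, Fintype.card_subtype_compl]
  simp [ZMod.card]

variable (hp2 : p ≠ 2) (hn : Even n) (hm : ∀ k, (m k).transpose = -m k)
  (hf : f ^ 2 = (genericCommMatrix m).det)
  (hnode : ∀ v, IsSingularAt (baseChange (ZMod p) f) v → Nonempty (NodeData m f v))
  {r : ℕ} (hfr : f.IsHomogeneous r)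
include hp2 hn hm hf hnode

lemma primSum_eq_typeCount (a : ℕ) (q : ℂ) :
    primSum m p a q = typeCount m f p 0 * (p : ℂ) ^ (3 * a) +
      typeCount m f p 1 * ((p : ℂ) ^ (2 * a) * smoothSeq p (q ^ 2) a) +
      typeCount m f p 2 * ((p : ℂ) ^ a * nodeSeq p (q ^ 2) a) +
      typeCount m f p 3 * ((p : ℂ) ^ a * degenerateNodeSeq p (q ^ 2) a) := by
  have h := sum_pointType (p := p) (m := m) (f := f) ![(p : ℂ) ^ (3 * a),
    (p : ℂ) ^ (2 * a) * smoothSeq p (q ^ 2) a, (p : ℂ) ^ a * nodeSeq p (q ^ 2) a,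
    (p : ℂ) ^ a * degenerateNodeSeq p (q ^ 2) a]
  simp only [Fin.sum_univ_four, nsmul_eq_mul, Matrix.cons_val] at h
  rw [primSum_eq_sum_classSum, ← h]
  refine sum_congr rfl fun v _ => ?_
  rw [pointType]
  split_ifs with h1 h2 h2
  · obtain ⟨D⟩ := hnode v h1
    have := D.rank_add
    rw [D.classSum_two hp2 hm hf (by omega)]
    simp
  · obtain ⟨D⟩ := hnode v h1
    have := D.rank_add
    have := D.d_eq hp2 hn hm hf
    rw [D.classSum_four hp2 hm hf (by omega)]
    simp
  · have h3 : ∃ k, eval v.1 (pderiv k (baseChange (ZMod p) f)) ≠ 0 := by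
      by_contra! hc
      exact h1 ⟨v.2, h2, hc⟩
    obtain ⟨k, hk⟩ := h3
    rw [classSum_of_smooth hp2 hn hm hf a q h2 hk]
    simp
  · rw [classSum_of_eval_ne_zero hf a q h2]
    simp

include hfr

lemma odpCountAt_mul (j : ℕ) (hj : j = 1 ∨ j = 2) :
    odpCountAt m p f j * (p - 1) = typeCount m f p (if j = 1 then 2 else 3) := by
  have hF := isHomogeneous_baseChange hfr (ZMod p)
  have h := card_projectivization (F := ZMod p)
    (Q := fun v => IsODP (baseChange (ZMod p) f) v ∧ (commMatrix m v).rank + 2 * j = n)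
    (fun v c hv => ⟨hv.1.smul hF c.ne_zero, by
      rw [Units.smul_def, commMatrix_smul, rank_smul_of_ne_zero _ c.ne_zero]; exact hv.2⟩)
  rw [ZMod.card] at h
  rw [odpCountAt, odpCount, h, typeCount, ← Fintype.card_subtype, ← Nat.card_eq_fintype_card]
  refine Nat.card_congr (Equiv.subtypeEquivRight fun v => ?_)
  rw [pointType]
  by_cases hs : IsSingularAt (baseChange (ZMod p) f) v.1
  · obtain ⟨D⟩ := hnode v hs
    have h1 := D.rank_add
    have h2 := D.d_eq hp2 hn hm hf
    have h3 := D.isODP hfr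
    rw [if_pos hs]
    obtain rfl | rfl := hj <;> obtain h2 | h2 := h2
    · simp only [if_true, h3, true_and]; rw [if_pos (by omega)]; simp; omega
    · simp only [if_true, h3, true_and]; rw [if_neg (by omega)]; simp; omega
    · simp only [h3, true_and]; rw [if_pos (by omega)]; simp; omega
    · simp only [h3, true_and]; rw [if_neg (by omega)]; simp; omega
  · rw [if_neg hs]
    refine ⟨fun h => absurd h.1.1 hs, fun h => ?_⟩
    exfalso
    revert h
    split_ifs <;> simp

omit hn hm hf in
theorem sum_modelCountAt_mul {l : ℕ} {g : Fin l → ℳ ℤ} {d : Fin l → ℕ}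
    (hg : ∀ i, (baseChange (ZMod p) (g i)).IsHomogeneous (d i)) (hd : ∀ i, 1 < d i)
    (hirr : ∀ i, Irreducible (baseChange (ZMod p) (g i))) {c : ZMod p} (hc : c ≠ 0)
    (hgf : ∏ i, baseChange (ZMod p) (g i) = C c * baseChange (ZMod p) f) :
    (∑ i, modelCountAt p (g i)) * (p - 1) =
      typeCount m f p 1 + 2 * typeCount m f p 2 + 2 * typeCount m f p 3 := by
  have h := sum_modelPointCount_mul hg hd hirr hc hgf
    (b := fun v => (![0, 1, 2, 2] : Fin 4 → ℕ) (pointType m f v.1)) fun v => ?_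
  · rw [ZMod.card, sum_pointType, Fin.sum_univ_four] at h
    simp only [Matrix.cons_val, smul_eq_mul, mul_zero, mul_one, zero_add] at h
    simp only [modelCountAt, h]
    ring
  · by_cases hs : IsSingularAt (baseChange (ZMod p) f) v.1
    · obtain ⟨D⟩ := hnode v hs
      have := D.localType hp2
      rw [pointType, if_pos hs]
      split_ifs <;> simpa using this
    · have := exists_localType_of_not_singular (two_ne_zero_zmod hp2)
        (isHomogeneous_baseChange hfr (ZMod p)) v.2 hs
      rw [pointType, if_neg hs]
      split_ifs at this ⊢ <;> simpa using this

end Types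

end

section

/-! ### The Pfaffian curve contains no line -/

section Lines

open MvPolynomial

lemma linear_dvd_of_vanishes {F : Type*} [Field F] [Fintype F] {f : ℳ F} {r : ℕ}
    (hf : f.IsHomogeneous r) (hr : r ≤ Fintype.card F) {c : Fin 3 → F} (hc : c ≠ 0)
    (h : ∀ φ, dotProduct c φ = 0 → eval φ f = 0) : (∑ i, C (c i) * X i) ∣ f := by
  obtain ⟨k, hk⟩ := Function.ne_iff.1 hc
  set ℓ : ℳ F := ∑ i, C (c i) * X i with hℓ
  set a : Fin 3 → F := Pi.single k (c k)⁻¹ with ha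
  let σ : ℳ F →ₐ[F] ℳ F := aeval fun i => X i - C (a i) * ℓ
  have hσ : σ f = 0 := by
    have h1 : (σ f).IsHomogeneous r := by
      have := hf.aeval (fun i => X i - C (a i) * ℓ) (n := 1) fun i =>
        (isHomogeneous_X F i).sub (by
          simpa using (isHomogeneous_C (Fin 3) (a i)).mul (isHomogeneous_linear c))
      rwa [one_mul] at this
    refine h1.eq_zero_of_forall_eval_eq_zero_of_le_card (fun φ => ?_) (by simpa using hr)
    have h2 : eval φ (σ f) = eval (fun i => φ i - a i * dotProduct c φ) f := by
      have : ((eval φ).comp σ.toRingHom) = eval fun i => φ i - a i * dotProduct c φ :=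
        ringHom_ext (by simp [σ]) (by simp [σ, hℓ, dotProduct])
      exact congrArg (fun g : ℳ F →+* F => g f) this
    rw [h2]
    refine h _ ?_
    have h3 : dotProduct c a = 1 := by simpa [ha] using mul_inv_cancel₀ hk
    have h4 : (fun i => φ i - a i * dotProduct c φ) = φ - dotProduct c φ • a := by
      funext i; simp [mul_comm]
    rw [h4, dotProduct_sub, dotProduct_smul, h3, smul_eq_mul, mul_one, sub_self]
  have h5 : (Ideal.Quotient.mkₐ F (Ideal.span {ℓ})).comp σ = Ideal.Quotient.mkₐ F (Ideal.span {ℓ}) :=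
    algHom_ext fun i => by
      simp only [AlgHom.comp_apply, σ, aeval_X, Ideal.Quotient.mkₐ_eq_mk]
      rw [Ideal.Quotient.eq, sub_sub_cancel_left, neg_mem_iff]
      exact Ideal.mul_mem_left _ _ (Ideal.mem_span_singleton_self ℓ)
  have h6 := DFunLike.congr_fun h5 f
  rw [AlgHom.comp_apply, hσ, map_zero, eq_comm, Ideal.Quotient.mkₐ_eq_mk,
    Ideal.Quotient.eq_zero_iff_mem, Ideal.mem_span_singleton] at h6
  exact h6

lemma not_linear_dvd_prod {F : Type*} [Field F] {l : ℕ} {g : Fin l → ℳ F}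
    (hg : ∀ i, 1 < (g i).totalDegree) (hirr : ∀ i, Irreducible (g i)) {c : Fin 3 → F} (hc : c ≠ 0) :
    ¬ (∑ i, C (c i) * X i) ∣ ∏ i, g i := by
  intro h
  have hℓ := isHomogeneous_linear c
  set ℓ : ℳ F := ∑ i, C (c i) * X i
  have h0 : ℓ ≠ 0 := fun h => hc (linear_eq_zero h)
  have h1 := hℓ.totalDegree h0
  have hu : ¬ IsUnit ℓ := fun hu => by
    rw [(isUnit_iff_totalDegree_of_isReduced.1 hu).2] at h1
    exact zero_ne_one h1
  obtain ⟨q, hq, hqℓ⟩ := WfDvdMonoid.exists_irreducible_factor hu h0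
  obtain ⟨i, -, hi⟩ := hq.prime.exists_mem_finset_dvd (hqℓ.trans h)
  obtain ⟨t, ht⟩ := ((hq.associated_of_dvd (hirr i) hi).symm.dvd).trans hqℓ
  have := hg i
  rw [ht, totalDegree_mul_of_isDomain (hirr i).ne_zero (right_ne_zero_of_mul (ht ▸ h0))] at h1
  omega

variable {p : ℕ} [hfp : Fact p.Prime] {n : ℕ} {m : Fin 3 → Matrix (Fin n) (Fin n) ℤ}
  {f : ℳ ℤ}

lemma exists_form_of_topIndex {Λ : AddSubgroup (Fin 3 → ℤ)} (h : p ^ 2 ∣ topIndex p Λ) :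
    ∃ c : Fin 3 → ZMod p, c ≠ 0 ∧ ∀ φ, dotProduct c φ = 0 → ∀ x ∈ Λ,
      ∑ k, (x k : ZMod p) * φ k = 0 := by
  have hp := hfp.out
  let ρ : (Fin 3 → ℤ) →+ (Fin 3 → ZMod p) := (Int.castAddHom (ZMod p)).compLeft (Fin 3)
  have hρ : Function.Surjective ρ := fun v =>
    ⟨fun i => (v i).cast, funext fun i => ZMod.intCast_zmod_cast (v i)⟩
  have hker : ρ.ker ≤ (mulp p 3).range ⊔ Λ := by
    refine le_trans (fun v hv => ?_) le_sup_left
    have h1 : ∀ i, (p : ℤ) ∣ v i := fun i => (ZMod.intCast_zmod_eq_zero_iff_dvd _ _).1 (congrFun hv i)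
    choose w hw using h1
    exact ⟨w, funext fun i => (hw i).symm⟩
  let U : Submodule (ZMod p) (Fin 3 → ZMod p) :=
    AddSubgroup.toZModSubmodule p (((mulp p 3).range ⊔ Λ).map ρ)
  have hU : Module.finrank (ZMod p) U ≤ 1 := by
    have h1 := AddSubgroup.card_mul_index (((mulp p 3).range ⊔ Λ).map ρ)
    rw [AddSubgroup.index_map_eq _ hρ hker] at h1
    obtain ⟨t, ht⟩ := h
    have h2 : Nat.card U * (p ^ 2 * t) = p ^ 3 := by
      rw [← ht]
      refine h1.trans ?_
      simp
    rw [Module.natCard_eq_pow_finrank (K := ZMod p), Nat.card_zmod, ← mul_assoc, ← pow_add] at h2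
    have h3 := (Nat.pow_dvd_pow_iff_le_right hp.one_lt).1 (Dvd.intro _ h2)
    omega
  obtain ⟨c, hc⟩ := finrank_le_one_iff.1 hU
  have key : ∀ d : Fin 3 → ZMod p, (∃ a : ZMod p, c.1 = a • d) → ∀ φ, dotProduct d φ = 0 → ∀ x ∈ Λ,
      ∑ k, (x k : ZMod p) * φ k = 0 := by
    rintro d ⟨a, ha⟩ φ hφ x hx
    obtain ⟨b, hb⟩ := hc ⟨ρ x, x, AddSubgroup.mem_sup_right hx, rfl⟩
    have h1 : ρ x = b • a • d := by rw [← ha]; exact (congrArg Subtype.val hb).symm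
    change dotProduct (ρ x) φ = 0
    rw [h1, smul_dotProduct, smul_dotProduct, hφ, smul_zero, smul_zero]
  by_cases h0 : c.1 = 0
  · exact ⟨Pi.single 0 1, by simp, key _ ⟨0, by rw [zero_smul, h0]⟩⟩
  · exact ⟨c.1, h0, key _ ⟨1, (one_smul _ _).symm⟩⟩

/-- If `ℤ³ / Λ` is not cyclic, then the centralizer modulo `Λ` is contained in `p ℤⁿ`. -/
theorem centralizerMod_le_of_topIndex (hf : f ^ 2 = (genericCommMatrix m).det) {r : ℕ}
    (hfr : f.IsHomogeneous r) (hr : r ≤ p) {l : ℕ} {g : Fin l → ℳ ℤ}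
    (hg : ∀ i, 1 < (baseChange (ZMod p) (g i)).totalDegree)
    (hirr : ∀ i, Irreducible (baseChange (ZMod p) (g i))) {c : ZMod p}
    (hgf : ∏ i, baseChange (ZMod p) (g i) = C c * baseChange (ZMod p) f)
    {Λ : AddSubgroup (Fin 3 → ℤ)} (hΛ : p ^ 2 ∣ topIndex p Λ) {v : Fin n → ℤ}
    (hv : v ∈ centralizerMod m Λ) : ∃ w, v = (p : ℤ) • w := by
  obtain ⟨d, hd, hφ⟩ := exists_form_of_topIndex hΛ
  by_cases h0 : (fun i => (v i : ZMod p)) = 0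
  · choose w hw using fun i => (ZMod.intCast_zmod_eq_zero_iff_dvd _ _).1 (congrFun h0 i)
    exact ⟨w, funext hw⟩
  refine absurd ?_ (not_linear_dvd_prod hg hirr hd)
  rw [hgf]
  refine Dvd.dvd.mul_left (linear_dvd_of_vanishes (isHomogeneous_baseChange hfr (ZMod p))
    (by rwa [ZMod.card]) hd fun φ h => ?_) _
  have h1 : (commMatrix m φ).mulVec (fun i => (v i : ZMod p)) = 0 := by
    funext i
    have h2 := hφ φ h _ (hv (Pi.single i 1))
    simp only [bracket, Int.cast_sum, Int.cast_mul, sum_mul] at h2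
    rw [Pi.zero_apply, ← h2]
    simp only [mulVec, dotProduct, commMatrix, sum_mul]
    rw [sum_comm]
    refine sum_congr rfl fun k _ => ?_
    symm
    rw [sum_eq_single i (fun b _ hb => by simp [hb]) (by simp)]
    exact sum_congr rfl fun j _ => by simp; ring
  have h3 := Matrix.exists_mulVec_eq_zero_iff.1 ⟨_, h0, h1⟩
  rw [det_commMatrix hf] at h3
  exact pow_eq_zero_iff two_ne_zero |>.1 h3

end Lines

end

section

/-! ### The local zeta functions at almost all primes -/

section Group

variable {G : Type*} [Group G] {n : ℕ} {x : Fin n → G} {y : Fin 3 → G}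
  (hy : ∀ k, y k ∈ Subgroup.center G)
  (hyb : ∀ z ∈ Subgroup.center G, ∃! a : Fin 3 → ℤ, z = y 0 ^ a 0 * y 1 ^ a 1 * y 2 ^ a 2)
  {m : Fin 3 → Matrix (Fin n) (Fin n) ℤ}
  (hm : ∀ i j, x i * x j * (x i)⁻¹ * (x j)⁻¹ = y 0 ^ m 0 i j * y 1 ^ m 1 i j * y 2 ^ m 2 i j)
include hy hyb hm

lemma transpose_eq_neg (k : Fin 3) : (m k).transpose = -m k := by
  ext i j
  have h1 : x j * x i * (x j)⁻¹ * (x i)⁻¹ =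
      centreHom y hy (Multiplicative.ofAdd fun k => -m k i j) := by
    rw [show (fun k => -m k i j) = -(fun k => m k i j) from rfl, ofAdd_neg, map_inv, centreHom_apply,
      ← hm]
    group
  exact congrFun ((hyb _ (centreHom_mem y hy (Multiplicative.ofAdd fun k => -m k i j))).unique
    (y₁ := fun k => m k j i) (by rw [← h1, hm]) rfl) k

lemma ne_zero_of_center_eq_commutator (hZ : Subgroup.center G = commutator G)
    (bx : Module.Basis (Fin n) ℤ (Additive (Abelianization G)))
    (hx : ∀ i, bx i = Additive.ofMul (Abelianization.of (x i))) : n ≠ 0 := by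
  rintro rfl
  have h1 : Subgroup.center G = ⊤ := by
    refine eq_top_iff.2 fun h _ => Subgroup.mem_center_iff.2 fun g => ?_
    have h2 := commutator_eq_centreHom hZ bx hx y hy m hm g h
    rw [show bracket m (abHom bx g).toAdd (abHom bx h).toAdd = 0 from
      funext fun k => by simp [bracket], ofAdd_zero, map_one, mul_inv_eq_one, mul_inv_eq_iff_eq_mul]
      at h2
    exact h2
  have h0 := hy 0
  rw [hZ, (commutator_eq_bot_iff_center_eq_top G).2 h1, Subgroup.mem_bot] at h0
  have h2 := (hyb 1 (Subgroup.one_mem _)).unique (y₁ := 0) (y₂ := ![1, 0, 0]) (by simp) (by simp [h0])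
  simpa using congrFun h2 0

end Group

open MvPolynomial

section Primes

variable {n : ℕ} {m : Fin 3 → Matrix (Fin n) (Fin n) ℤ} (hm : ∀ k, (m k).transpose = -m k)
  {f : ℳ ℤ} {r : ℕ} (hfr : f.IsHomogeneous r) (hf0 : f ≠ 0)
  {l : ℕ} {g : Fin l → ℳ ℤ}
  (hgf : Associated (∏ i, baseChange ℚ (g i)) (baseChange ℚ f))
  (hgirr : ∀ i, Irreducible (baseChange ℚ (g i))) (hgdeg : ∀ i, 1 < (g i).totalDegree)
  (hsing : HasOnlyRationalODPs f)

include hgf in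
lemma exists_integral_relation : ∃ a b : ℤ, a ≠ 0 ∧ b ≠ 0 ∧ C a * ∏ i, g i = C b * f := by
  obtain ⟨u, hu⟩ := hgf
  obtain ⟨q, hq, huq⟩ := isUnit_iff_eq_C_of_isReduced.1 u.isUnit
  refine ⟨q.num, q.den, Rat.num_ne_zero.2 hq.ne_zero, by exact_mod_cast q.den_ne_zero, ?_⟩
  apply map_injective (σ := Fin 3) (Int.castRingHom ℚ) (Int.castRingHom ℚ).injective_int
  rw [map_mul, map_mul, map_prod, map_C, map_C]
  change C ((q.num : ℤ) : ℚ) * ∏ i, baseChange ℚ (g i) = C (((q.den : ℕ) : ℤ) : ℚ) * baseChange ℚ f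
  rw [← hu, huq, mul_comm _ (C q), ← mul_assoc, ← C_mul, Int.cast_natCast, Rat.den_mul_eq_num]

include hfr hf0 hgf hgdeg in
lemma two_le_of_components (hr : r ≠ 0) : 2 ≤ r := by
  obtain ⟨a, b, ha, hb, hab⟩ := exists_integral_relation hgf
  have hb' : (C b : ℳ ℤ) ≠ 0 := by rwa [Ne, C_eq_zero]
  have h1 : (C b * f).totalDegree = r := by
    rw [totalDegree_mul_of_isDomain hb' hf0, totalDegree_C, zero_add, hfr.totalDegree hf0]
  have h0 := mul_ne_zero hb' hf0
  obtain ⟨i⟩ | hl := isEmpty_or_nonempty (Fin l)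
  · rw [← hab, Finset.univ_eq_empty, Finset.prod_empty, mul_one, totalDegree_C] at h1
    exact absurd h1.symm hr
  · obtain ⟨i⟩ := hl
    obtain ⟨t, ht⟩ := (dvd_prod_of_mem g (mem_univ i)).mul_left (C a)
    rw [hab] at ht
    rw [ht] at h0 h1
    rw [totalDegree_mul_of_isDomain (left_ne_zero_of_mul h0) (right_ne_zero_of_mul h0)] at h1
    have := hgdeg i
    omega

/-- The conditions on a prime under which the local zeta function is computed. -/
structure IsGoodPrime (m : Fin 3 → Matrix (Fin n) (Fin n) ℤ) (f : ℳ ℤ) (r : ℕ)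
    (g : Fin l → ℳ ℤ) (p : ℕ) [Fact p.Prime] : Prop where
  ne_two : p ≠ 2
  le : r ≤ p
  node : ∀ v, IsSingularAt (baseChange (ZMod p) f) v → Nonempty (NodeData m f v)
  irreducible : ∀ i, Irreducible (baseChange (ZMod p) (g i))
  one_lt : ∀ i, 1 < (baseChange (ZMod p) (g i)).totalDegree
  prod : ∃ c : ZMod p, c ≠ 0 ∧ ∏ i, baseChange (ZMod p) (g i) = C c * baseChange (ZMod p) f

include hm hfr hf0 hgf hgirr hgdeg hsing in
theorem exists_isGoodPrime :
    ∃ S : Finset ℕ, ∀ (p : ℕ) [Fact p.Prime], p ∉ S → IsGoodPrime m f r g p := by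
  obtain ⟨a, b, ha, hb, hab⟩ := exists_integral_relation hgf
  obtain ⟨W, hW, N, hN, hnode⟩ := exists_node_reduction hfr hsing
  choose A hA0 hA using fun w : W => exists_nodeData hm hfr (hW w.1 w.2).1 (hW w.1 w.2).2
  choose B hB0 hB using fun i => exists_irreducible_mod (hgdeg i)
    (irreducible_geometric hfr hf0 hsing (hgirr i)
      ((dvd_prod_of_mem (fun i => baseChange ℚ (g i)) (mem_univ i)).trans hgf.dvd))
  set M : ℕ := 2 * r.factorial * N * (∏ w, A w) * (∏ i, B i) * (a.natAbs * b.natAbs) with hM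
  have hM0 : M ≠ 0 := by
    simp only [hM, mul_ne_zero_iff, prod_ne_zero_iff]
    exact ⟨⟨⟨⟨⟨two_ne_zero, r.factorial_ne_zero⟩, hN⟩, fun w _ => hA0 w⟩, fun i _ => hB0 i⟩,
      Int.natAbs_ne_zero.2 ha, Int.natAbs_ne_zero.2 hb⟩
  refine ⟨M.primeFactors, fun p hfp hpS => ?_⟩
  have hp := hfp.out
  have hpM : (M : ZMod p) ≠ 0 := by
    rw [Ne, ZMod.natCast_eq_zero_iff]
    exact fun h => hpS (Nat.mem_primeFactors.2 ⟨hp, h, hM0⟩)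
  simp only [hM, Nat.cast_mul, Nat.cast_prod, mul_ne_zero_iff, prod_ne_zero_iff] at hpM
  obtain ⟨⟨⟨⟨⟨h2, hr⟩, hN'⟩, hA'⟩, hB'⟩, ha', hb'⟩ := hpM
  have hcast : ∀ z : ℤ, ((z.natAbs : ℕ) : ZMod p) ≠ 0 → (z : ZMod p) ≠ 0 := by
    intro z hz h
    rw [Ne, ZMod.natCast_eq_zero_iff, ← Int.natCast_dvd_natCast, Int.dvd_natAbs] at hz
    exact hz ((ZMod.intCast_zmod_eq_zero_iff_dvd _ _).1 h)
  refine ⟨?_, ?_, fun v hv => ?_, fun i => (hB i (ZMod p) (hB' i (mem_univ i))).1,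
    fun i => ?_, (a : ZMod p)⁻¹ * b, mul_ne_zero (inv_ne_zero (hcast a ha')) (hcast b hb'), ?_⟩
  · rintro rfl
    exact h2 (by exact_mod_cast ZMod.natCast_self 2)
  · rw [Ne, ZMod.natCast_eq_zero_iff, hp.dvd_factorial, not_le] at hr
    exact hr.le
  · obtain ⟨w, hw, c, hc, rfl⟩ := hnode (ZMod p) hN' v hv
    exact hA ⟨w, hw⟩ p (hA' _ (mem_univ _)) c hc
  · rw [(hB i (ZMod p) (hB' i (mem_univ i))).2]
    exact hgdeg i
  · have h1 := congrArg (baseChange (ZMod p)) hab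
    simp only [baseChange, map_mul, map_prod, map_C] at h1
    rw [C_mul, mul_assoc]
    simp only [baseChange]
    rw [show C (b : ZMod p) * _ = _ from h1.symm, ← mul_assoc, eq_intCast, ← C_mul, inv_mul_cancel₀ (hcast a ha'), C_1, one_mul]

end Primes

lemma norm_mul_pow_lt_one {p : ℕ} (hp : p.Prime) {Y : ℂ} {e i j : ℕ}
    (hY : (p : ℝ) ^ e * ‖Y‖ < 1) (hi : i ≤ e) (hj : j ≠ 0) : ‖(p : ℂ) ^ i * Y ^ j‖ < 1 := by
  have hp1 : (1 : ℝ) ≤ p := by exact_mod_cast hp.one_lt.le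
  have hY1 : ‖Y‖ ≤ 1 := le_trans (le_mul_of_one_le_left (norm_nonneg _) (one_le_pow₀ hp1)) hY.le
  rw [norm_mul, norm_pow, norm_pow, Complex.norm_natCast]
  refine lt_of_le_of_lt ?_ hY
  exact mul_le_mul (pow_le_pow_right₀ hp1 hi) (pow_le_of_le_one (norm_nonneg _) hY1 hj)
    (by positivity) (by positivity)

theorem IsGoodPrime.hasSum_latticeTerm {p r l : ℕ} [hfp : Fact p.Prime]
    {m : Fin 3 → Matrix (Fin (2 * r)) (Fin (2 * r)) ℤ} {f : ℳ ℤ}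
    {g : Fin l → ℳ ℤ} (h : IsGoodPrime m f r g p) (hr : 2 ≤ r)
    (hm : ∀ k, (m k).transpose = -m k) (hf : f ^ 2 = (genericCommMatrix m).det)
    (hfr : f.IsHomogeneous r) {Y : ℂ} (hY0 : Y ≠ 0) (hY : (p : ℝ) ^ (6 * r + 3) * ‖Y‖ < 1) :
    HasSum (fun Λ : PLattice p 3 => latticeTerm m p Y Λ.1)
      ((1 - (p : ℂ) ^ (6 * r) * Y ^ (2 * r + 3))⁻¹ * (W1 r p Y +
        (∑ i, (modelCountAt p (g i) : ℂ)) * W2 r p Y + odpCountAt m p f 1 * W3 r p Y +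
        odpCountAt m p f 2 * W4 r p Y)) := by
  have hp := hfp.out
  obtain ⟨c, hc, hprod⟩ := h.prod
  have hn : Even (2 * r) := even_two_mul r
  have hp0 : (p : ℂ) ≠ 0 := by exact_mod_cast hp.ne_zero
  have hp1 : (p : ℂ) - 1 ≠ 0 := by rw [sub_ne_zero]; exact_mod_cast hp.one_lt.ne'
  have hcast : ((p - 1 : ℕ) : ℂ) = p - 1 := Nat.cast_pred hp.pos
  have hbar : baseChange (ZMod p) f ≠ 0 := by
    intro h0
    rw [h0, mul_zero, Finset.prod_eq_zero_iff] at hprod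
    obtain ⟨i, -, hi⟩ := hprod
    exact (h.irreducible i).ne_zero hi
  have hhom : ∀ i, (baseChange (ZMod p) (g i)).IsHomogeneous
      (baseChange (ZMod p) (g i)).totalDegree := by
    intro i
    refine isHomogeneous_of_dvd (isHomogeneous_baseChange hfr (ZMod p)) hbar ?_
    have h1 := dvd_prod_of_mem (fun i => baseChange (ZMod p) (g i)) (mem_univ i)
    rw [hprod] at h1
    exact (((isUnit_iff_ne_zero.2 hc).map C).dvd_mul_left).1 h1
  have hodp := fun j hj => odpCountAt_mul h.ne_two hn hm hf h.node hfr j hj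
  have hmodel := sum_modelCountAt_mul h.ne_two h.node hfr hhom h.one_lt h.irreducible hc hprod
  have hsum := sum_typeCount (m := m) (f := f) (p := p)
  have e2 := congrArg (Nat.cast (R := ℂ)) (hodp 1 (Or.inl rfl))
  have e3 := congrArg (Nat.cast (R := ℂ)) (hodp 2 (Or.inr rfl))
  have e1 := congrArg (Nat.cast (R := ℂ)) hmodel
  have e0 := congrArg (Nat.cast (R := ℂ)) hsum
  rw [Nat.cast_sub (Nat.one_le_pow _ _ hp.pos)] at e0
  simp only [Fin.sum_univ_four, if_true, show (2 : ℕ) ≠ 1 by omega, if_false, Nat.cast_mul, hcast,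
    Nat.cast_add, Nat.cast_sum, Nat.cast_ofNat, Nat.cast_pow, Nat.cast_one] at e0 e1 e2 e3
  obtain ⟨Z₁, hZ₁, hZ⟩ := hasSum_cyclicTerm hr hp0 hY0
    (typeCount m f p 0 / (p - 1 : ℂ)) (typeCount m f p 1 / (p - 1 : ℂ))
    (typeCount m f p 2 / (p - 1 : ℂ)) (typeCount m f p 3 / (p - 1 : ℂ))
    (by rw [← add_div, ← add_div, ← add_div, e0]; field_simp; ring)
    (norm_mul_pow_lt_one hp hY (by omega) (by omega))
    (norm_mul_pow_lt_one hp hY (by omega) (by omega))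
    (norm_mul_pow_lt_one hp hY (by omega) (by omega))
    (norm_mul_pow_lt_one hp hY (by omega) (by omega))
  have hY' : (p : ℝ) ^ (2 * r + 3) * ‖Y‖ < 1 := by
    have := norm_mul_pow_lt_one hp hY (i := 2 * r + 3) (by omega) one_ne_zero
    simpa using this
  have h1 := hasSum_cyclic_lattices m hY0 hY' (Z₁ := Z₁) (hZ₁.congr_fun fun a => by
    rw [cyclicTerm, primSum_eq_typeCount h.ne_two hn hm hf h.node, inv_pow]
    field_simp
    ring)
  obtain ⟨Z₂, hZ₂, h2⟩ := hasSum_lattices_of_cyclic hp hY' (fun h0 => by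
      have := norm_mul_pow_lt_one hp hY (i := 3 * (2 * r)) (j := 2 * r + 3) (by omega) (by omega)
      rw [h0, norm_one] at this
      exact lt_irrefl _ this)
    (fun Λ _ hΛ v hv => centralizerMod_le_of_topIndex hf hfr h.le h.one_lt h.irreducible hprod hΛ hv) h1
  rw [show 2 * (2 * r) = 4 * r by ring] at hZ₂
  have h3 := hZ Z₂ hZ₂
  have E1 : (∑ i, (modelCountAt p (g i) : ℂ)) = typeCount m f p 1 / (p - 1 : ℂ) +
      2 * (typeCount m f p 2 / (p - 1 : ℂ)) + 2 * (typeCount m f p 3 / (p - 1 : ℂ)) := by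
    field_simp; linear_combination e1
  rw [h3, show 3 * (2 * r) = 6 * r by ring, ← E1, ← e2, ← e3, mul_div_cancel_right₀ _ hp1,
    mul_div_cancel_right₀ _ hp1] at h2
  exact h2

lemma invertedCount_eq {p : ℕ} (hp : p ≠ 0) {B : ℕ} {β : Fin B → ℂ} {c : ℂ}
    (hc : c = 1 + (p : ℂ) - ∑ j, β j) {τ : Equiv.Perm (Fin B)}
    (hτ : ∀ j, (p : ℂ) / β j = β (τ j)) : invertedCount p β = (p : ℂ)⁻¹ * c := by
  have hp0 : (p : ℂ) ≠ 0 := by exact_mod_cast hp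
  have h1 : ∑ j, (β j)⁻¹ = (p : ℂ)⁻¹ * ∑ j, β j := by
    rw [← Equiv.sum_comp τ β, mul_sum]
    refine sum_congr rfl fun j _ => ?_
    rw [← hτ]
    field_simp
  rw [invertedCount, h1, hc]
  field_simp
  ring

end

end PfaffianZeta

end

theorem corollary1
    (G : Type*) [Group G] (r : ℕ)
    -- `G` is a finitely generated torsion-free nilpotent group of class two with `Z(G) = G'`
    (hG : PfaffianZeta.IsT2Group G)
    (hZ : Subgroup.center G = commutator G)
    -- `x₁, …, x_{2r}` is a basis of `G / G'` and `y₁, y₂, y₃` is a basis of `G' = Z(G)`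
    (x : Fin (2 * r) → G)
    (bx : Module.Basis (Fin (2 * r)) ℤ (Additive (Abelianization G)))
    (hx : ∀ i, bx i = Additive.ofMul (Abelianization.of (x i)))
    (y : Fin 3 → G) (hy : ∀ k, y k ∈ Subgroup.center G)
    (hyb : ∀ z ∈ Subgroup.center G, ∃! a : Fin 3 → ℤ,
      z = y 0 ^ a 0 * y 1 ^ a 1 * y 2 ^ a 2)
    -- `[x_i, x_j] = M(y)_{ij}`
    (m : Fin 3 → Matrix (Fin (2 * r)) (Fin (2 * r)) ℤ)
    (hm : ∀ i j, x i * x j * (x i)⁻¹ * (x j)⁻¹ =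
      y 0 ^ m 0 i j * y 1 ^ m 1 i j * y 2 ^ m 2 i j)
    -- `f = √(det M(y))` is non-zero and square-free
    (f : MvPolynomial (Fin 3) ℤ)
    (hf : f ^ 2 = (PfaffianZeta.genericCommMatrix m).det)
    (hf0 : f ≠ 0)
    (hfsq : Squarefree (PfaffianZeta.baseChange ℚ f))
    -- the irreducible components `E_i` of the Pfaffian curve, none of which is a line
    (l : ℕ) (g : Fin l → MvPolynomial (Fin 3) ℤ)
    (hgf : Associated (∏ i, PfaffianZeta.baseChange ℚ (g i)) (PfaffianZeta.baseChange ℚ f))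
    (hgirr : ∀ i, Irreducible (PfaffianZeta.baseChange ℚ (g i)))
    (hgdeg : ∀ i, 1 < (g i).totalDegree)
    -- the singularities are rational ordinary double points with rational slopes
    (hsing : PfaffianZeta.HasOnlyRationalODPs f) :
    ∃ S : Finset ℕ, ∀ (p : ℕ) [Fact p.Prime], p ∉ S →
      -- the local normal zeta function is given by the explicit rational expression
      (∃ σ : ℝ, ∀ s : ℂ, σ < s.re →
        Summable (PfaffianZeta.localNormalZetaTerm G p s) ∧
        PfaffianZeta.localNormalZeta G p s =
          PfaffianZeta.zetaExpr r (p : ℂ) ((p : ℂ) ^ (-s))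
            (fun i => (PfaffianZeta.modelCountAt p (g i) : ℂ))
            (PfaffianZeta.odpCountAt m p f 1) (PfaffianZeta.odpCountAt m p f 2)) ∧
      -- and, for all numbers `β_{i,j}` as in the hypothesis, the expression obtained by
      -- `p → p⁻¹` satisfies the functional equation
      ∀ (B : Fin l → ℕ) (β : (i : Fin l) → Fin (B i) → ℂ),
        (∀ i j, β i j ≠ 0) →
        (∀ i, (PfaffianZeta.modelCountAt p (g i) : ℂ) = 1 + (p : ℂ) - ∑ j, β i j) →
        (∀ i, ∃ τ : Equiv.Perm (Fin (B i)), ∀ j, (p : ℂ) / β i j = β i (τ j)) →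
        (∀ i, PfaffianZeta.invertedCount p (β i) =
          (p : ℂ)⁻¹ * (PfaffianZeta.modelCountAt p (g i) : ℂ)) ∧
        ∀ s : ℂ,
          PfaffianZeta.zetaExpr r (p : ℂ)⁻¹ ((p : ℂ) ^ s)
              (fun i => PfaffianZeta.invertedCount p (β i))
              (PfaffianZeta.odpCountAt m p f 1) (PfaffianZeta.odpCountAt m p f 2) =
            -(p : ℂ) ^ ((((2 * r + 3).choose 2 : ℕ) : ℂ) - (4 * (r : ℂ) + 3) * s) *
              PfaffianZeta.zetaExpr r (p : ℂ) ((p : ℂ) ^ (-s))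
                (fun i => (PfaffianZeta.modelCountAt p (g i) : ℂ))
                (PfaffianZeta.odpCountAt m p f 1) (PfaffianZeta.odpCountAt m p f 2) := by
  have hmt := PfaffianZeta.transpose_eq_neg hy hyb hm
  have hfr := PfaffianZeta.isHomogeneous_of_sq_eq_det hf hf0
  have hr := PfaffianZeta.two_le_of_components hfr hf0 hgf hgdeg fun h =>
    PfaffianZeta.ne_zero_of_center_eq_commutator hy hyb hm hZ bx hx (by omega)
  obtain ⟨S, hS⟩ := PfaffianZeta.exists_isGoodPrime hmt hfr hf0 hgf hgirr hgdeg hsing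
  refine ⟨S, fun p hfp hpS => ⟨⟨6 * r + 3, fun s hs => ?_⟩, fun B β hβ hc hτ => ?_⟩⟩
  · have hp := hfp.out
    have hp0 : (p : ℂ) ≠ 0 := by exact_mod_cast hp.ne_zero
    have hY0 : (p : ℂ) ^ (-s) ≠ 0 := by simp [Complex.cpow_eq_zero_iff, hp0]
    have hY : (p : ℝ) ^ (6 * r + 3) * ‖(p : ℂ) ^ (-s)‖ < 1 := by
      have h1 : (1 : ℝ) < p := by exact_mod_cast hp.one_lt
      rw [Complex.norm_natCast_cpow_of_pos hp.pos, ← Real.rpow_natCast,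
        ← Real.rpow_add (by linarith)]
      refine Real.rpow_lt_one_of_one_lt_of_neg h1 ?_
      push_cast
      rw [Complex.neg_re]
      linarith
    have hY' : (p : ℝ) ^ (2 * r) * ‖(p : ℂ) ^ (-s)‖ < 1 := by
      simpa using PfaffianZeta.norm_mul_pow_lt_one hp hY (i := 2 * r) (by omega) one_ne_zero
    have h := PfaffianZeta.localNormalZeta_of_hasSum G hp s
      (PfaffianZeta.hasSum_normal_of_class_two hZ bx hx y hy hyb m hm hp hY'
        ((hS p hpS).hasSum_latticeTerm hr hmt hf hfr hY0 hY))
    exact ⟨h.1, h.2.trans (by rw [PfaffianZeta.zetaExpr, mul_assoc])⟩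
  · have hp0 : (p : ℂ) ≠ 0 := by exact_mod_cast hfp.out.ne_zero
    have hinv := fun i => (hτ i).elim fun τ h => PfaffianZeta.invertedCount_eq hfp.out.ne_zero (hc i) h
    refine ⟨hinv, fun s => ?_⟩
    have h1 := PfaffianZeta.zetaExpr_inv r hr (p : ℂ) ((p : ℂ) ^ (-s)) hp0
      (by simp [Complex.cpow_eq_zero_iff, hp0]) _ _ hinv (PfaffianZeta.odpCountAt m p f 1) (PfaffianZeta.odpCountAt m p f 2)
    rw [← Complex.cpow_neg, neg_neg] at h1
    rw [h1, Complex.cpow_sub _ _ hp0, Complex.cpow_natCast, ← Complex.cpow_nat_mul, div_eq_mul_inv,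
      ← Complex.cpow_neg]
    congr 4
    push_cast
    ring
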